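/- Let $K$ be a number field with ring of integers $\mathcal O_K$, let $n\ge 1$ and $\delta\ge 1$ be integers, and let $f\in K[T_0,\dots,T_n]$ be a non-zero homogeneous polynomial of degree $\delta$. Assume that the hypersurface $X=\mathrm{Proj}\,(K[T_0,\dots,T_n]/(f))\subset\mathbb P^n_K$ is reduced, and let $\mathscr X$ be its Zariski closure (scheme-theoretic closure) in $\mathbb P^n_{\mathcal O_K}$. For a maximal ideal $\mathfrak p$ of $\mathcal O_K$ put $\mathbb F_{\mathfrak p}=\mathcal O_K/\mathfrak p$ and $N_{\mathfrak p}=\#\mathbb F_{\mathfrak p}$. Let $$\mathcal Q(\mathscr X)=\{\mathfrak p\in\mathrm{Spm}\,\mathcal O_K \mid \mathscr X\times_{\mathrm{Spec}\,\mathcal O_K}\mathrm{Spec}\,\mathbb F_{\mathfrak p}\text{ is not reduced}\}.$$ Let $I_f=Kf\cap\mathcal O_K[T_0,\dots,T_n]$ be the largest (saturated) $\mathcal O_K$-submodule of $\mathcal O_K[T_0,\dots,T_n]$ that spans the line $Kf$ over $K$, and let $\mathcal Q(I_f)$ be the set of all $\mathfrak p\in\mathrm{Spm}\,\mathcal O_K$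 such that the line $I_f\otimes_{\mathcal O_K}\mathbb F_{\mathfrak p}\subset\mathbb F_{\mathfrak p}[T_0,\dots,T_n]$ is generated by a polynomial with a square factor (that is, one divisible by $g^2$ for some non-constant polynomial $g$). Let $$h(f)=\sum_{v\in M_K}\frac{[K_v:\mathbb Q_v]}{[K:\mathbb Q]}\log\max_{i}|a_i|_v,\qquad H_K(X)=\exp\big([K:\mathbb Q]\,h(f)\big),$$ where the $a_i$ are the coefficients of $f$ and each $|\cdot|_v$ extends the usual absolute value of $\mathbb Q_v$. Then $\mathcal Q(\mathscr X)$ and $\mathcal Q(I_f)$ are finite, and $$\prod_{\mathfrak p\in\mathcal Q(\mathscr X)}N_{\mathfrak p}\;\le\;\prod_{\mathfrak p\in\mathcal Q(I_f)}N_{\mathfrak p}\;\le\;\binom{\delta+n}{n}^{\frac{(2\delta-1)[K:\mathbb Q]}{2}}\,\delta^{[K:\mathbb Q]\delta}\,H_K(X)^{2\delta-1},$$ where an empty product is $1$. -/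

import Mathlib

open CategoryTheory CategoryTheory.Limits AlgebraicGeometry NumberField

noncomputable section

namespace ReducedHypersurface

universe u

section GradedQuotient

variable {R A : Type*} [CommRing R] [CommRing A] [Algebra R A]
  {𝒜 : ℕ → Submodule R A} [GradedAlgebra 𝒜]

/-- The grading on the quotient `A / I` of a graded algebra by a homogeneous ideal:
the piece of degree `i` is the image of `𝒜 i`. -/
def quotGrading (I : HomogeneousIdeal 𝒜) (i : ℕ) : Submodule R (A ⧸ I.toIdeal) :=
  (𝒜 i).map (Ideal.Quotient.mkₐ R I.toIdeal).toLinearMap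

theorem mk_mem_quotGrading (I : HomogeneousIdeal 𝒜) {i : ℕ} {a : A} (ha : a ∈ 𝒜 i) :
    Ideal.Quotient.mk I.toIdeal a ∈ quotGrading I i :=
  Submodule.mem_map_of_mem (f := (Ideal.Quotient.mkₐ R I.toIdeal).toLinearMap) ha

instance quotGradedMonoid (I : HomogeneousIdeal 𝒜) : SetLike.GradedMonoid (quotGrading I) where
  one_mem := by
    rw [← map_one (Ideal.Quotient.mk I.toIdeal)]
    exact mk_mem_quotGrading I (SetLike.GradedOne.one_mem (A := 𝒜))
  mul_mem := by
    rintro i j _ _ ⟨a, ha, rfl⟩ ⟨b, hb, rfl⟩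
    change Ideal.Quotient.mk I.toIdeal a * Ideal.Quotient.mk I.toIdeal b ∈ _
    rw [← map_mul]
    exact mk_mem_quotGrading I (SetLike.GradedMul.mul_mem ha hb)

/-- The reduction map `𝒜 i → (A / I) i`. -/
def quotPiece (I : HomogeneousIdeal 𝒜) (i : ℕ) : 𝒜 i →+ quotGrading I i where
  toFun a := ⟨Ideal.Quotient.mk I.toIdeal a, mk_mem_quotGrading I a.2⟩
  map_zero' := by ext; simp
  map_add' a b := by ext; simp

/-- Decompose an element of `A` and reduce its components modulo `I`. -/
def quotDecomposeAux (I : HomogeneousIdeal 𝒜) :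
    A →+ DirectSum ℕ fun i => quotGrading I i :=
  (DirectSum.map (quotPiece I)).comp (DirectSum.decomposeAddEquiv 𝒜).toAddMonoidHom

theorem quotDecomposeAux_of_mem (I : HomogeneousIdeal 𝒜) {i : ℕ} {a : A} (ha : a ∈ 𝒜 i) :
    quotDecomposeAux I a = DirectSum.of (fun i => quotGrading I i) i
      ⟨Ideal.Quotient.mk I.toIdeal a, mk_mem_quotGrading I ha⟩ := by
  simp [quotDecomposeAux, DirectSum.decompose_of_mem 𝒜 ha, DirectSum.map_of, quotPiece]

theorem quotDecomposeAux_eq_zero (I : HomogeneousIdeal 𝒜) {a : A} (ha : a ∈ I.toIdeal) :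
    quotDecomposeAux I a = 0 := by
  refine DFinsupp.ext fun i => Subtype.ext ?_
  have h := I.isHomogeneous i ha
  change Ideal.Quotient.mk I.toIdeal (DirectSum.decompose 𝒜 a i : A) = 0
  exact Ideal.Quotient.eq_zero_iff_mem.mpr h

/-- The quotient of a graded algebra by a homogeneous ideal is graded. -/
instance quotGradedRing (I : HomogeneousIdeal 𝒜) : GradedRing (quotGrading I) where
  toDecomposition := DirectSum.Decomposition.ofAddHom (quotGrading I)
    (QuotientAddGroup.lift I.toIdeal.toAddSubgroup (quotDecomposeAux I)
      fun _ ha => quotDecomposeAux_eq_zero I ha)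
    (by
      refine AddMonoidHom.ext fun x => ?_
      obtain ⟨a, rfl⟩ := Ideal.Quotient.mk_surjective x
      change DirectSum.coeAddMonoidHom (quotGrading I) (quotDecomposeAux I a)
        = Ideal.Quotient.mk I.toIdeal a
      induction a using DirectSum.Decomposition.inductionOn 𝒜 with
      | zero => simp
      | homogeneous a => rw [quotDecomposeAux_of_mem I a.2]; simp
      | add a b ha hb => simp [ha, hb])
    (by
      refine DirectSum.addHom_ext fun i y => ?_
      obtain ⟨_, a, ha, rfl⟩ := y
      refine (congrArg (QuotientAddGroup.lift I.toIdeal.toAddSubgroup (quotDecomposeAux I)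
        fun _ ha => quotDecomposeAux_eq_zero I ha)
        (DirectSum.coeAddMonoidHom_of (quotGrading I) i _)).trans ?_
      exact quotDecomposeAux_of_mem I ha)

/-- The quotient map `A → A / I` as a homomorphism of graded rings. -/
def quotGradedHom (I : HomogeneousIdeal 𝒜) : GradedRingHom 𝒜 (quotGrading I) where
  toRingHom := Ideal.Quotient.mk I.toIdeal
  map_mem ha := mk_mem_quotGrading I ha

theorem irrelevant_le_map_quot (I : HomogeneousIdeal 𝒜) :
    HomogeneousIdeal.irrelevant (quotGrading I)
      ≤ (HomogeneousIdeal.irrelevant 𝒜).map (quotGradedHom I) := by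
  rw [HomogeneousIdeal.irrelevant_le]
  rintro i hi _ ⟨a, ha, rfl⟩
  exact Ideal.mem_map_of_mem (quotGradedHom I)
    (HomogeneousIdeal.mem_irrelevant_of_mem 𝒜 hi ha)

end GradedQuotient

section Projective

attribute [local instance] MvPolynomial.gradedAlgebra

/-- The grading by degree on `R[T₀, …, Tₙ]`. -/
abbrev polyGrading (n : ℕ) (R : Type u) [CommRing R] :
    ℕ → Submodule R (MvPolynomial (Fin (n + 1)) R) :=
  MvPolynomial.homogeneousSubmodule (Fin (n + 1)) R

/-- Projective space `ℙⁿ_R = Proj R[T₀, …, Tₙ]`. -/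
def projSpace (n : ℕ) (R : Type u) [CommRing R] : Scheme.{u} :=
  Proj (polyGrading n R)

/-- The structure morphism `ℙⁿ_R → Spec R`. -/
def projSpaceStr (n : ℕ) (R : Type u) [CommRing R] : projSpace n R ⟶ Spec (.of R) :=
  Proj.toSpecZero (polyGrading n R) ≫
    Spec.map (CommRingCat.ofHom (algebraMap R (polyGrading n R 0)))

/-- Change of coefficients `R[T₀, …, Tₙ] → S[T₀, …, Tₙ]` as a homomorphism of graded rings. -/
def polyBaseChange (n : ℕ) (R S : Type u) [CommRing R] [CommRing S] [Algebra R S] :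
    GradedRingHom (polyGrading n R) (polyGrading n S) where
  toRingHom := MvPolynomial.map (algebraMap R S)
  map_mem ha := MvPolynomial.IsHomogeneous.map ha _

theorem irrelevant_le_map_polyBaseChange (n : ℕ) (R S : Type u) [CommRing R] [CommRing S]
    [Algebra R S] :
    HomogeneousIdeal.irrelevant (polyGrading n S)
      ≤ (HomogeneousIdeal.irrelevant (polyGrading n R)).map (polyBaseChange n R S) := by
  rw [HomogeneousIdeal.irrelevant_le]
  intro i hi p hp
  change p ∈ ((HomogeneousIdeal.irrelevant (polyGrading n R)).map (polyBaseChange n R S)).toIdeal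
  rw [p.as_sum]
  refine Ideal.sum_mem _ fun d hd => ?_
  have hdeg : d.degree = i := by
    have := hp (MvPolynomial.mem_support_iff.mp hd)
    rw [Finsupp.degree_eq_weight_one (R := ℕ)]
    exact this
  have h1 : MvPolynomial.monomial d (1 : S)
      = polyBaseChange n R S (MvPolynomial.monomial d (1 : R)) := by
    change _ = MvPolynomial.map (algebraMap R S) _
    rw [MvPolynomial.map_monomial, RingHom.map_one]
  rw [← mul_one (MvPolynomial.coeff d p), ← MvPolynomial.C_mul_monomial, h1]
  refine Ideal.mul_mem_left _ _ (Ideal.mem_map_of_mem (polyBaseChange n R S) ?_)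
  exact HomogeneousIdeal.mem_irrelevant_of_mem _ hi
    (MvPolynomial.isHomogeneous_monomial _ hdeg)

/-- The morphism `ℙⁿ_S → ℙⁿ_R` induced by a ring homomorphism `R → S`. -/
def projSpaceBaseChange (n : ℕ) (R S : Type u) [CommRing R] [CommRing S] [Algebra R S] :
    projSpace n S ⟶ projSpace n R :=
  Proj.map (polyBaseChange n R S) (irrelevant_le_map_polyBaseChange n R S)

variable {n δ : ℕ} {K : Type u} [Field K]

/-- The homogeneous ideal `(f)` of `K[T₀, …, Tₙ]` generated by a form `f`. -/
def formIdeal (f : MvPolynomial (Fin (n + 1)) K) (hf : f.IsHomogeneous δ) :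
    HomogeneousIdeal (polyGrading n K) :=
  ⟨Ideal.span {f}, Ideal.homogeneous_span _ _ (by rintro _ rfl; exact ⟨δ, hf⟩)⟩

/-- The hypersurface `X = Proj (K[T₀, …, Tₙ] / (f))`. -/
def hypersurface (f : MvPolynomial (Fin (n + 1)) K) (hf : f.IsHomogeneous δ) : Scheme.{u} :=
  Proj (quotGrading (formIdeal f hf))

/-- The closed embedding of the hypersurface `X` into `ℙⁿ_K`. -/
def hypersurfaceEmb (f : MvPolynomial (Fin (n + 1)) K) (hf : f.IsHomogeneous δ) :
    hypersurface f hf ⟶ projSpace n K :=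
  Proj.map (quotGradedHom (formIdeal f hf)) (irrelevant_le_map_quot (formIdeal f hf))

end Projective

section Arithmetic

variable {n δ : ℕ} {K : Type u} [Field K]

/-- The composite `X → ℙⁿ_K → ℙⁿ_{𝓞 K}`. -/
def toIntegralProjSpace (f : MvPolynomial (Fin (n + 1)) K) (hf : f.IsHomogeneous δ) :
    hypersurface f hf ⟶ projSpace n (𝓞 K) :=
  hypersurfaceEmb f hf ≫ projSpaceBaseChange n (𝓞 K) K

/-- The Zariski closure `𝒳` of `X` in `ℙⁿ_{𝓞 K}`, i.e. the scheme-theoretic image of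
`X → ℙⁿ_{𝓞 K}`. -/
def zariskiClosure (f : MvPolynomial (Fin (n + 1)) K) (hf : f.IsHomogeneous δ) : Scheme.{u} :=
  (toIntegralProjSpace f hf).image

/-- The structure morphism `𝒳 → Spec 𝓞 K`. -/
def zariskiClosureStr (f : MvPolynomial (Fin (n + 1)) K) (hf : f.IsHomogeneous δ) :
    zariskiClosure f hf ⟶ Spec (.of (𝓞 K)) :=
  (toIntegralProjSpace f hf).imageι ≫ projSpaceStr n (𝓞 K)

/-- The special fibre `Y ×_{Spec 𝓞 K} Spec 𝔽_𝔭` of an `𝓞 K`-scheme `Y`, where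
`𝔽_𝔭 = 𝓞 K / 𝔭`. -/
def specialFibre {Y : Scheme.{u}} (π : Y ⟶ Spec (.of (𝓞 K))) (𝔭 : MaximalSpectrum (𝓞 K)) :
    Scheme.{u} :=
  pullback π (Spec.map (CommRingCat.ofHom (Ideal.Quotient.mk 𝔭.asIdeal)))

/-- The set `𝒬(Y)` of non-reduced places of an `𝓞 K`-scheme `Y`. -/
def nonReducedPlaces {Y : Scheme.{u}} (π : Y ⟶ Spec (.of (𝓞 K))) :
    Set (MaximalSpectrum (𝓞 K)) :=
  {𝔭 | ¬ AlgebraicGeometry.IsReduced (specialFibre π 𝔭)}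

/-- The `𝓞 K`-module `I_f = K f ∩ 𝓞 K[T₀, …, Tₙ]`: the largest `𝓞 K`-submodule of
`𝓞 K[T₀, …, Tₙ]` that spans the line `K f` over `K`. It is saturated. -/
def formModule (f : MvPolynomial (Fin (n + 1)) K) :
    Submodule (𝓞 K) (MvPolynomial (Fin (n + 1)) (𝓞 K)) :=
  ((Submodule.span K {f}).restrictScalars (𝓞 K)).comap
    (MvPolynomial.mapAlgHom (Algebra.ofId (𝓞 K) K)).toLinearMap

/-- For an `𝓞 K`-submodule `F` of `𝓞 K[T₀, …, Tₙ]`, the image of `F ⊗ 𝔽_𝔭` in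
`𝔽_𝔭[T₀, …, Tₙ]`. (For saturated `F`, the map from `F ⊗ 𝔽_𝔭` onto it is an isomorphism.) -/
def reductionMod (F : Submodule (𝓞 K) (MvPolynomial (Fin (n + 1)) (𝓞 K)))
    (𝔭 : MaximalSpectrum (𝓞 K)) :
    Submodule (𝓞 K ⧸ 𝔭.asIdeal) (MvPolynomial (Fin (n + 1)) (𝓞 K ⧸ 𝔭.asIdeal)) :=
  Submodule.span (𝓞 K ⧸ 𝔭.asIdeal)
    (MvPolynomial.map (Ideal.Quotient.mk 𝔭.asIdeal) '' (F : Set _))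

/-- The set `𝒬(F)` of the `𝔭` for which the reduction of `F` modulo `𝔭` is generated by a
polynomial with a square factor. -/
def squareFactorPlaces (F : Submodule (𝓞 K) (MvPolynomial (Fin (n + 1)) (𝓞 K))) :
    Set (MaximalSpectrum (𝓞 K)) :=
  {𝔭 | ∃ g : MvPolynomial (Fin (n + 1)) (𝓞 K ⧸ 𝔭.asIdeal),
    reductionMod F 𝔭 = Submodule.span (𝓞 K ⧸ 𝔭.asIdeal) {g} ∧ ¬ Squarefree g}

/-- The norm `N_𝔭 = #(𝓞 K / 𝔭)`. -/
def placeNorm (𝔭 : MaximalSpectrum (𝓞 K)) : ℕ :=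
  Nat.card (𝓞 K ⧸ 𝔭.asIdeal)

/-- The classical height `h(f) = ∑_v [K_v : ℚ_v] / [K : ℚ] * log max |a|_v`, the maximum being
over the coefficients `a` of `f ≠ 0`, each `|.|_v` extending the usual absolute value on `ℚ_v`.
The absolute values in Mathlib's `logHeight` over a number field carry the local degrees
`[K_v : ℚ_v]`, and are not divided by `[K : ℚ]`. -/
def classicalHeight [NumberField K] (f : MvPolynomial (Fin (n + 1)) K) : ℝ :=
  Height.logHeight (fun d : f.support => f.coeff d) / Module.finrank ℚ K

/-- The exponential height `H_K(f) = exp ([K : ℚ] h(f))`. -/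
def expHeight [NumberField K] (f : MvPolynomial (Fin (n + 1)) K) : ℝ :=
  Real.exp (Module.finrank ℚ K * classicalHeight f)

end Arithmetic

end ReducedHypersurface

end

/-!
The theorem compares three things: reducedness of the fibres of the closure, square factors of the
primitive reductions `red v f` of the form at the finite places `v`, and the height of `f`.

*From fibres to square factors.* Since the hypersurface is reduced, `f` is squarefree
(`squarefree_of_isReduced_hypersurface`). If `red v f` is squarefree, then the special fibre at `v`
is reduced: on each affine chart the ideal of the closure together with `v` is, by Gauss's lemma,
the kernel of the map to the coordinate ring of `red v f = 0`, which is a radical ideal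
(`isRadical_ker_sup_map`, `isReduced_specialFibre`). This gives the first inequality.

*From square factors to heights.* What remains is to bound the sum of `log (normV v)` over the places
`v` at which `red v f` is divisible by a square (`sum_log_normV_le`). The irreducible factors of `f`
are grouped into blocks `F_r` according to the first variable `T_r` which they contain, leaving aside
those factors which divide the leading coefficient in `T_r` of an earlier block (`IsInitial`). Let
`L` be the product of these leading coefficients and of the factors set aside.

The discriminant of `F_r` with respect to `T_r` is a nonzero polynomial. Its height is at most
`(2 d_r - 1) h(F_r) + [K : ℚ] d_r log d_r`, where `d_r` is the degree of `F_r` in `T_r`, by Hadamard's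
inequality for the Vandermonde determinant and Jensen's formula. The height `hgt` used here takes
Mahler measures at the archimedean places, which makes it additive and nonnegative. The discriminant
vanishes modulo `v` when `red v F_r` loses degree in `T_r` or has a square factor involving `T_r`, so
that its height controls all such places (`discriminant_estimate`).

At any other place, a double factor `g` of `red v f` must be a factor of the reduction of `L`
(`IsInitial.detection`). So some irreducible factor `p` of `L` has, modulo `v`, a common component
with `f`. If `p` does not divide `f`, this contact is bounded by a form of the arithmetic Bézout
theorem: `multiplicity_estimate` applies the product formula to the determinant of multiplication by
`s` modulo the multiples of `p`, in degrees tending to infinity. A common factor of `p` and `s` modulo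
`v` forces a large power of `v` into this determinant, and its archimedean size is bounded through
volumes in Hilbert spaces of polynomials with the weight `1 / |p|²` on the torus (`norm_det_mul_le`).
If `p` divides `f`, the same estimate is applied to a derivative of `f`.

Some care is needed to reach the constant `2 δ - 1`. As `p` involves no variable before its first
one, `f` may be replaced by an iterated coefficient with respect to those variables, whose degree is
smaller (`exists_sec`, `section_estimate`, `pderiv_estimate`). The gain falls short of the sum of the
`d_r` just when the degree of some `F_r` in `T_r` drops modulo `p`; but then a power of `p` divides
the discriminant of `F_r`, and `discriminant_estimate` improves by the corresponding multiple of the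
height of `p`. The two corrections cancel.

*Comparison of heights.* A polynomial with at most `C` terms has Mahler measure at most `√C` times its
largest coefficient (`logMahler_le_log_l2`). Hence the bound
`(2 δ - 1) H + [K : ℚ] δ log δ` holds with `H = [K : ℚ] (h(f) + (log C) / 2)` and
`C = (δ + n).choose n`, and exponentiation gives the second inequality (`finprod_placeNorm_le`).
-/


noncomputable section

namespace ReducedHypersurface

/-! ### Mahler measures on the torus -/

section Torus

open MeasureTheory Polynomial

variable {σ : Type*}

/-- The point of modulus one in `ℂ` given by a point of the unit additive circle. -/
def unitPt (t : UnitAddCircle) : ℂ := Circle.coeHom (AddCircle.toCircle t)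

theorem norm_unitPt (t : UnitAddCircle) : ‖unitPt t‖ = 1 := Circle.norm_coe _

theorem unitPt_add (s t : UnitAddCircle) : unitPt (s + t) = unitPt s * unitPt t := by
  simp [unitPt, AddCircle.toCircle_add]

theorem unitPt_nsmul (n : ℕ) (t : UnitAddCircle) : unitPt (n • t) = unitPt t ^ n := by
  simp [unitPt, AddCircle.toCircle_nsmul]

theorem continuous_unitPt : Continuous unitPt :=
  continuous_induced_dom.comp AddCircle.continuous_toCircle

theorem unitPt_coe (t : ℝ) : unitPt t = circleMap 0 1 (2 * Real.pi * t) := by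
  have := AddCircle.toCircle_apply_mk (T := 1) t
  rw [unitPt, this]
  change ((Circle.exp _ : Circle) : ℂ) = _
  rw [Circle.coe_exp]
  simp [circleMap]

/-- The point of `ℂ^σ` with coordinates of modulus one given by a point of the torus. -/
def circ (x : UnitAddTorus σ) (i : σ) : ℂ := unitPt (x i)

/-- The one-parameter subgroup of the torus with weights `e`. -/
def rot (e : σ → ℕ) (t : UnitAddCircle) : UnitAddTorus σ := fun i => e i • t

/-- The substitution `T_i ↦ z_i X ^ e_i`. -/
def curve (z : σ → ℂ) (e : σ → ℕ) : MvPolynomial σ ℂ →ₐ[ℂ] ℂ[X] :=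
  MvPolynomial.aeval fun i => C (z i) * X ^ e i

/-- The logarithmic Mahler measure of a polynomial in several variables. -/
def logMahler [Fintype σ] (Q : MvPolynomial σ ℂ) : ℝ :=
  ∫ x : UnitAddTorus σ, Real.log ‖MvPolynomial.eval (circ x) Q‖

theorem norm_circ (x : UnitAddTorus σ) (i : σ) : ‖circ x i‖ = 1 := norm_unitPt _

theorem eval_curve (z : σ → ℂ) (e : σ → ℕ) (Q : MvPolynomial σ ℂ) (τ : ℂ) :
    (curve z e Q).eval τ = MvPolynomial.eval (fun i => z i * τ ^ e i) Q := by
  have : (Polynomial.evalRingHom τ).comp (curve z e).toRingHom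
      = MvPolynomial.eval (fun i => z i * τ ^ e i) := by
    apply MvPolynomial.ringHom_ext
    · intro a; simp [curve]
    · intro i; simp [curve]
  exact congrArg (fun φ => φ Q) this

theorem circ_add_rot (e : σ → ℕ) (x : UnitAddTorus σ) (t : UnitAddCircle) :
    circ (x + rot e t) = fun i => circ x i * unitPt t ^ e i := by
  funext i
  simp [circ, rot, unitPt_add, unitPt_nsmul]

theorem continuous_circ : Continuous (circ : UnitAddTorus σ → σ → ℂ) :=
  continuous_pi fun i => continuous_unitPt.comp (continuous_apply i)

theorem continuous_eval_circ (Q : MvPolynomial σ ℂ) :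
    Continuous fun x : UnitAddTorus σ => MvPolynomial.eval (circ x) Q :=
  (MvPolynomial.continuous_eval Q).comp continuous_circ

theorem continuous_rot (e : σ → ℕ) : Continuous (rot e) :=
  continuous_pi fun i => continuous_id.nsmul (e i)

instance isProbabilityMeasure_unitAddCircle :
    IsProbabilityMeasure (volume : Measure UnitAddCircle) :=
  ⟨UnitAddCircle.measure_univ⟩

theorem integrable_log_eval_circle (p : ℂ[X]) :
    Integrable (fun t : UnitAddCircle => Real.log ‖p.eval (unitPt t)‖) := by
  have hmp := UnitAddCircle.measurePreserving_mk 0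
  have hm : Measurable fun t : UnitAddCircle => Real.log ‖p.eval (unitPt t)‖ :=
    Real.measurable_log.comp (continuous_norm.comp (p.continuous.comp continuous_unitPt)).measurable
  rw [← hmp.integrable_comp hm.aestronglyMeasurable]
  have h := (intervalIntegrable_mahlerMeasure p).comp_mul_left (c := 2 * Real.pi)
  rw [zero_div, div_self (by positivity), intervalIntegrable_iff_integrableOn_Ioc_of_le
    zero_le_one] at h
  rw [zero_add]
  refine h.congr (Filter.Eventually.of_forall fun t => ?_)
  simp only [Function.comp]
  rw [unitPt_coe]

theorem integral_log_eval_circle (p : ℂ[X]) :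
    ∫ t : UnitAddCircle, Real.log ‖p.eval (unitPt t)‖ = p.logMahlerMeasure := by
  rw [← UnitAddCircle.intervalIntegral_preimage 0, zero_add, logMahlerMeasure_def,
    Real.circleAverage_def]
  have h := intervalIntegral.integral_comp_mul_left (a := 0) (b := 1)
    (fun θ => Real.log ‖p.eval (circleMap 0 1 θ)‖) (c := 2 * Real.pi) (by positivity)
  rw [mul_zero, mul_one] at h
  rw [← h]
  refine intervalIntegral.integral_congr fun t _ => ?_
  simp only [unitPt_coe]

theorem lintegral_sub_log_eval_circle (p : ℂ[X]) (B : ℝ)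
    (hB : ∀ t : UnitAddCircle, Real.log ‖p.eval (unitPt t)‖ ≤ B) :
    ∫⁻ t : UnitAddCircle, ENNReal.ofReal (B - Real.log ‖p.eval (unitPt t)‖)
      = ENNReal.ofReal (B - p.logMahlerMeasure) := by
  have h := ofReal_integral_eq_lintegral_ofReal (f := fun t => B - Real.log ‖p.eval (unitPt t)‖)
    ((integrable_const B).sub (integrable_log_eval_circle p))
    (Filter.Eventually.of_forall fun t => sub_nonneg.2 (hB t))
  rw [← h, integral_sub (integrable_const B) (integrable_log_eval_circle p),
    integral_log_eval_circle]
  simp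

variable [Fintype σ]

instance isProbabilityMeasure_unitAddTorus :
    IsProbabilityMeasure (volume : Measure (UnitAddTorus σ)) :=
  inferInstanceAs (IsProbabilityMeasure (Measure.pi fun _ : σ => (volume : Measure UnitAddCircle)))

/-- Haar measure on the torus is the average of its translates along a one-parameter subgroup. -/
theorem measurePreserving_rot (e : σ → ℕ) :
    MeasurePreserving (fun p : UnitAddCircle × UnitAddTorus σ => p.2 + rot e p.1)
      ((volume : Measure UnitAddCircle).prod (volume : Measure (UnitAddTorus σ))) volume := by
  have hc : Continuous fun p : UnitAddCircle × UnitAddTorus σ => p.2 + rot e p.1 :=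
    continuous_snd.add ((continuous_rot e).comp continuous_fst)
  have := MeasurePreserving.skew_product (μa := (volume : Measure UnitAddCircle))
    (μc := (volume : Measure (UnitAddTorus σ))) (μd := (volume : Measure (UnitAddTorus σ)))
    (MeasurePreserving.id _) (g := fun t x => x + rot e t) hc.measurable
    (Filter.Eventually.of_forall fun t => map_add_right_eq_self _ _)
  exact measurePreserving_snd.comp this

theorem lintegral_rot (e : σ → ℕ) {F : UnitAddTorus σ → ENNReal} (hF : Measurable F) :
    ∫⁻ x, F x = ∫⁻ x, ∫⁻ t : UnitAddCircle, F (x + rot e t) := by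
  rw [← (measurePreserving_rot e).lintegral_comp hF, lintegral_prod_symm]
  exact (hF.comp (measurePreserving_rot e).measurable).aemeasurable

theorem integrable_rot (e : σ → ℕ) {F : UnitAddTorus σ → ℝ} (hF : Integrable F) :
    Integrable fun x => ∫ t : UnitAddCircle, F (x + rot e t) :=
  ((measurePreserving_rot e).integrable_comp_of_integrable hF).integral_prod_right

theorem integral_rot (e : σ → ℕ) {F : UnitAddTorus σ → ℝ} (hF : Integrable F) :
    ∫ x, F x = ∫ x, ∫ t : UnitAddCircle, F (x + rot e t) := by
  have h := (measurePreserving_rot e).integrable_comp_of_integrable hF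
  have h2 := integral_prod_symm _ h
  rw [← (measurePreserving_rot e).map_eq, integral_map (measurePreserving_rot e).aemeasurable
    (by rw [(measurePreserving_rot e).map_eq]; exact hF.1)]
  rw [(measurePreserving_rot e).map_eq]
  exact h2

omit [Fintype σ] in
theorem log_norm_eval_rot (e : σ → ℕ) (Q : MvPolynomial σ ℂ) (x : UnitAddTorus σ)
    (t : UnitAddCircle) :
    Real.log ‖MvPolynomial.eval (circ (x + rot e t)) Q‖
      = Real.log ‖(curve (circ x) e Q).eval (unitPt t)‖ := by
  rw [circ_add_rot, eval_curve]

omit [Fintype σ] in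
theorem exists_log_le (Q : MvPolynomial σ ℂ) :
    ∃ B, 0 ≤ B ∧ ∀ x : UnitAddTorus σ, Real.log ‖MvPolynomial.eval (circ x) Q‖ ≤ B := by
  obtain ⟨b, hb⟩ := (isCompact_range (continuous_eval_circ Q).norm).bddAbove
  refine ⟨Real.log (max b 1), Real.log_nonneg (le_max_right _ _), fun x => ?_⟩
  rcases eq_or_ne ‖MvPolynomial.eval (circ x) Q‖ 0 with h | h
  · rw [h, Real.log_zero]; exact Real.log_nonneg (le_max_right _ _)
  · exact Real.log_le_log (lt_of_le_of_ne (norm_nonneg _) h.symm)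
      ((hb ⟨x, rfl⟩).trans (le_max_left _ _))

theorem measurable_log_eval (Q : MvPolynomial σ ℂ) :
    Measurable fun x : UnitAddTorus σ => Real.log ‖MvPolynomial.eval (circ x) Q‖ :=
  Real.measurable_log.comp (continuous_eval_circ Q).norm.measurable

/-- Jensen's inequality in several variables: if the leading coefficients along all translates of
a one-parameter subgroup are bounded below, so is the Mahler measure. -/
theorem integrable_and_log_le_logMahler (e : σ → ℕ) (Q : MvPolynomial σ ℂ) {c : ℝ} (hc : 0 < c)
    (h : ∀ x : UnitAddTorus σ, c ≤ ‖(curve (circ x) e Q).leadingCoeff‖) :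
    Integrable (fun x : UnitAddTorus σ => Real.log ‖MvPolynomial.eval (circ x) Q‖) ∧
      Real.log c ≤ logMahler Q := by
  obtain ⟨B, hB0, hB⟩ := exists_log_le Q
  have hm := measurable_log_eval Q
  have hm1 : ∀ x : UnitAddTorus σ, Real.log c ≤ (curve (circ x) e Q).logMahlerMeasure := by
    intro x
    rw [logMahlerMeasure_eq_log_MahlerMeasure]
    exact Real.log_le_log hc ((h x).trans (leadingCoeff_le_mahlerMeasure _))
  have key : ∫⁻ x : UnitAddTorus σ,
      ENNReal.ofReal (B - Real.log ‖MvPolynomial.eval (circ x) Q‖)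
        ≤ ENNReal.ofReal (B - Real.log c) := by
    rw [lintegral_rot e (by fun_prop)]
    calc _ ≤ ∫⁻ x : UnitAddTorus σ, ENNReal.ofReal (B - Real.log c) := by
          refine lintegral_mono fun x => ?_
          simp only [log_norm_eval_rot]
          rw [lintegral_sub_log_eval_circle]
          · exact ENNReal.ofReal_le_ofReal (by linarith [hm1 x])
          · intro t; rw [← log_norm_eval_rot]; exact hB _
      _ = _ := by simp
  have hnn : 0 ≤ᵐ[volume] fun x : UnitAddTorus σ =>
      B - Real.log ‖MvPolynomial.eval (circ x) Q‖ :=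
    Filter.Eventually.of_forall fun x => sub_nonneg.2 (hB x)
  have hint : Integrable fun x : UnitAddTorus σ =>
      B - Real.log ‖MvPolynomial.eval (circ x) Q‖ := by
    refine ⟨(measurable_const.sub hm).aestronglyMeasurable, ?_⟩
    rw [hasFiniteIntegral_iff_ofReal hnn]
    exact key.trans_lt ENNReal.ofReal_lt_top
  have hint2 : Integrable fun x : UnitAddTorus σ =>
      Real.log ‖MvPolynomial.eval (circ x) Q‖ := by
    have := (integrable_const B).sub hint
    refine this.congr (Filter.Eventually.of_forall fun x => ?_)
    simp
  refine ⟨hint2, ?_⟩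
  have hle : Real.log c ≤ B := by
    have h1 := hm1 0
    rw [← integral_log_eval_circle] at h1
    refine h1.trans ?_
    calc _ ≤ ∫ t : UnitAddCircle, B := by
          refine integral_mono (integrable_log_eval_circle _) (integrable_const _) fun t => ?_
          simp only [← log_norm_eval_rot]; exact hB _
      _ = B := by simp
  rw [← ofReal_integral_eq_lintegral_ofReal hint hnn,
    ENNReal.ofReal_le_ofReal_iff (by linarith), integral_sub (integrable_const B) hint2] at key
  simp only [integral_const, probReal_univ, one_smul] at key
  unfold logMahler
  linarith

/-- The logarithmic Mahler measure as an average of one-variable Mahler measures. -/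
theorem logMahler_eq_integral (e : σ → ℕ) {Q : MvPolynomial σ ℂ}
    (hQ : Integrable (fun x : UnitAddTorus σ => Real.log ‖MvPolynomial.eval (circ x) Q‖)) :
    Integrable (fun x : UnitAddTorus σ => (curve (circ x) e Q).logMahlerMeasure) ∧
    logMahler Q = ∫ x : UnitAddTorus σ, (curve (circ x) e Q).logMahlerMeasure := by
  have h1 := integrable_rot e hQ
  have h2 := integral_rot e hQ
  simp only [log_norm_eval_rot, integral_log_eval_circle] at h1 h2
  exact ⟨h1, h2⟩

end Torus

/-! ### Weights and dominant monomials -/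

section Weights

open MeasureTheory Polynomial

variable {σ : Type*} [Fintype σ]

/-- There are weights which separate the monomials of degree at most `N` and which order them
compatibly with the degree. -/
theorem exists_weight (σ : Type*) [Fintype σ] (N : ℕ) : ∃ e : σ → ℕ,
    Set.InjOn (Finsupp.weight e) {d : σ →₀ ℕ | d.degree ≤ N} ∧
    ∀ d d' : σ →₀ ℕ, d.degree < d'.degree → d'.degree ≤ N →
      Finsupp.weight e d < Finsupp.weight e d' := by
  classical
  let k := Fintype.card σ
  let v : σ ≃ Fin k := Fintype.equivFin σ
  let B := N + 1
  let e : σ → ℕ := fun i => B ^ k + B ^ (v i : ℕ)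
  have hlt : ∀ d : σ →₀ ℕ, d.degree ≤ N → ∀ i, d i < B := fun d hd i =>
    Nat.lt_succ_of_le ((Finsupp.le_degree i d).trans hd)
  let f : ∀ d : σ →₀ ℕ, d.degree ≤ N → (Fin k → Fin B) := fun d hd j =>
    ⟨d (v.symm j), hlt d hd _⟩
  have hw : ∀ d (hd : d.degree ≤ N), Finsupp.weight e d
      = d.degree * B ^ k + (finFunctionFinEquiv (f d hd) : ℕ) := by
    intro d hd
    rw [finFunctionFinEquiv_apply, Finsupp.weight_apply, Finsupp.sum_fintype _ _ (by simp),
      Finsupp.degree_eq_sum, Finset.sum_mul, ← v.symm.sum_comp]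
    simp only [e, f, smul_eq_mul, mul_add, Finset.sum_add_distrib, Equiv.apply_symm_apply]
    congr 1
    exact v.symm.sum_comp (fun i => d i * B ^ k)
  refine ⟨e, ?_, ?_⟩
  · intro d hd d' hd' h
    rw [hw d hd, hw d' hd'] at h
    have h1 := congrArg (· % B ^ k) h
    simp only [Nat.mul_add_mod_of_lt (finFunctionFinEquiv (f d hd)).2,
      Nat.mul_add_mod_of_lt (finFunctionFinEquiv (f d' hd')).2] at h1
    have h2 := finFunctionFinEquiv.injective (Fin.ext h1)
    ext i
    have := congrArg Fin.val (congrFun h2 (v i))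
    simpa [f] using this
  · intro d d' h h'
    rw [hw d (h.le.trans h'), hw d' h']
    have := (finFunctionFinEquiv (f d (h.le.trans h'))).2
    calc _ < d.degree * B ^ k + B ^ k := by omega
      _ = (d.degree + 1) * B ^ k := by ring
      _ ≤ d'.degree * B ^ k := Nat.mul_le_mul_right _ h
      _ ≤ _ := Nat.le_add_right _ _

theorem curve_monomial (z : σ → ℂ) (e : σ → ℕ) (d : σ →₀ ℕ) (a : ℂ) :
    curve z e (MvPolynomial.monomial d a)
      = Polynomial.monomial (Finsupp.weight e d) (a * ∏ i, z i ^ d i) := by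
  rw [curve, MvPolynomial.aeval_monomial, Finsupp.prod_fintype _ _ (by simp),
    Finsupp.weight_apply, Finsupp.sum_fintype _ _ (by simp)]
  simp only [mul_pow, Finset.prod_mul_distrib, ← Polynomial.C_pow, ← pow_mul,
    Finset.prod_pow_eq_pow_sum, smul_eq_mul, ← map_prod]
  rw [← Polynomial.C_mul_X_pow_eq_monomial, map_mul, mul_assoc]
  simp [mul_comm]

theorem coeff_curve (z : σ → ℂ) (e : σ → ℕ) (Q : MvPolynomial σ ℂ) (k : ℕ) :
    (curve z e Q).coeff k
      = ∑ d ∈ Q.support, if Finsupp.weight e d = k then Q.coeff d * ∏ i, z i ^ d i else 0 := by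
  conv_lhs => rw [Q.as_sum, map_sum, Polynomial.finsetSum_coeff]
  simp only [curve_monomial, Polynomial.coeff_monomial]

theorem norm_leadingCoeff_curve (x : UnitAddTorus σ) (e : σ → ℕ) {Q : MvPolynomial σ ℂ}
    {d : σ →₀ ℕ} (hd : Q.coeff d ≠ 0)
    (h : ∀ d' ∈ Q.support, d' ≠ d → Finsupp.weight e d' < Finsupp.weight e d) :
    ‖(curve (circ x) e Q).leadingCoeff‖ = ‖Q.coeff d‖ := by
  have hc : (curve (circ x) e Q).coeff (Finsupp.weight e d)
      = Q.coeff d * ∏ i, circ x i ^ d i := by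
    rw [coeff_curve, Finset.sum_eq_single d]
    · simp
    · intro d' hd' hne; rw [if_neg (h d' hd' hne).ne]
    · intro h'; exact absurd (MvPolynomial.mem_support_iff.2 hd) h'
  have hn : ‖Q.coeff d * ∏ i, circ x i ^ d i‖ = ‖Q.coeff d‖ := by
    simp [norm_prod, norm_circ]
  have hdeg : (curve (circ x) e Q).natDegree = Finsupp.weight e d := by
    apply le_antisymm
    · rw [Polynomial.natDegree_le_iff_coeff_eq_zero]
      intro k hk
      rw [coeff_curve]
      refine Finset.sum_eq_zero fun d' hd' => if_neg ?_
      rcases eq_or_ne d' d with rfl | hne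
      · exact hk.ne
      · exact ((h d' hd' hne).trans hk).ne
    · apply Polynomial.le_natDegree_of_ne_zero
      rw [hc, ← norm_ne_zero_iff, hn, norm_ne_zero_iff]
      exact hd
  rw [Polynomial.leadingCoeff, hdeg, hc, hn]

/-- Jensen's inequality for a monomial which dominates all others for a weight. -/
theorem log_norm_coeff_le_logMahler (e : σ → ℕ) {Q : MvPolynomial σ ℂ}
    {d : σ →₀ ℕ} (hd : Q.coeff d ≠ 0)
    (h : ∀ d' ∈ Q.support, d' ≠ d → Finsupp.weight e d' < Finsupp.weight e d) :
    Integrable (fun x : UnitAddTorus σ => Real.log ‖MvPolynomial.eval (circ x) Q‖) ∧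
      Real.log ‖Q.coeff d‖ ≤ logMahler Q :=
  integrable_and_log_le_logMahler e Q (norm_pos_iff.2 hd)
    fun x => (norm_leadingCoeff_curve x e hd h).ge

omit [Fintype σ] in
theorem exists_dominant {e : σ → ℕ} {Q : MvPolynomial σ ℂ} (hQ : Q ≠ 0)
    (he : Set.InjOn (Finsupp.weight e) (Q.support : Set (σ →₀ ℕ))) :
    ∃ d ∈ Q.support, ∀ d' ∈ Q.support, d' ≠ d → Finsupp.weight e d' < Finsupp.weight e d := by
  obtain ⟨d, hd, hmax⟩ := Q.support.exists_max_image (Finsupp.weight e)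
    (MvPolynomial.support_nonempty.2 hQ)
  exact ⟨d, hd, fun d' hd' hne => lt_of_le_of_ne (hmax d' hd') fun h => hne (he hd' hd h)⟩

omit [Fintype σ] in
theorem support_subset_degree {R : Type*} [CommSemiring R] (Q : MvPolynomial σ R) {N : ℕ}
    (hN : Q.totalDegree ≤ N) :
    (Q.support : Set (σ →₀ ℕ)) ⊆ {d : σ →₀ ℕ | d.degree ≤ N} := fun d hd => by
  have := MvPolynomial.le_totalDegree hd
  rw [Set.mem_ofPred_eq, Finsupp.degree_apply]
  exact this.trans hN

/-- The Mahler measure exists for a nonzero polynomial and dominates the logarithm of the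
modulus of some nonzero coefficient; the coefficient only depends on the support. -/
theorem exists_log_norm_coeff_le_logMahler (s : Finset (σ →₀ ℕ)) (hs : s.Nonempty) :
    ∃ d ∈ s, ∀ Q : MvPolynomial σ ℂ, Q.support = s →
      Real.log ‖Q.coeff d‖ ≤ logMahler Q := by
  obtain ⟨e, he, -⟩ := exists_weight σ (s.sup Finsupp.degree)
  obtain ⟨d, hd, hmax⟩ := s.exists_max_image (Finsupp.weight e) hs
  refine ⟨d, hd, fun Q hQ => (log_norm_coeff_le_logMahler e (Q := Q) (d := d) ?_ ?_).2⟩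
  · rw [← MvPolynomial.mem_support_iff, hQ]; exact hd
  · intro d' hd' hne
    rw [hQ] at hd'
    exact lt_of_le_of_ne (hmax d' hd') fun h => hne
      (he (Finset.le_sup (f := Finsupp.degree) hd') (Finset.le_sup (f := Finsupp.degree) hd) h)

theorem integrable_log_eval {Q : MvPolynomial σ ℂ} (hQ : Q ≠ 0) :
    Integrable (fun x : UnitAddTorus σ => Real.log ‖MvPolynomial.eval (circ x) Q‖) := by
  obtain ⟨e, he, -⟩ := exists_weight σ Q.totalDegree
  obtain ⟨d, hd, hmax⟩ := exists_dominant hQ (he.mono (support_subset_degree Q le_rfl))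
  exact (log_norm_coeff_le_logMahler e (MvPolynomial.mem_support_iff.1 hd) hmax).1

/-- Common weights along which no nonzero polynomial of degree at most `N` vanishes: its dominant
monomial gives the leading coefficient of its restriction to the curve. -/
theorem exists_weight_curve_ne_zero (N : ℕ) : ∃ e : σ → ℕ,
    Set.InjOn (Finsupp.weight e) {d : σ →₀ ℕ | d.degree ≤ N} ∧
    ∀ Q : MvPolynomial σ ℂ, Q ≠ 0 → Q.totalDegree ≤ N →
      ∀ x : UnitAddTorus σ, curve (circ x) e Q ≠ 0 := by
  obtain ⟨e, he, -⟩ := exists_weight σ N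
  refine ⟨e, he, fun Q hQ hN x => ?_⟩
  obtain ⟨d, hd, hmax⟩ := exists_dominant hQ (he.mono (support_subset_degree Q hN))
  have hd' := MvPolynomial.mem_support_iff.1 hd
  rw [← Polynomial.leadingCoeff_ne_zero, ← norm_ne_zero_iff, norm_leadingCoeff_curve x e hd' hmax]
  exact norm_ne_zero_iff.2 hd'

/-- Fubini along the curves of a weight reduces this to Mahler measures in one variable. -/
theorem logMahler_mul {P Q : MvPolynomial σ ℂ} (hP : P ≠ 0) (hQ : Q ≠ 0) :
    logMahler (P * Q) = logMahler P + logMahler Q := by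
  obtain ⟨e, -, he⟩ := exists_weight_curve_ne_zero (σ := σ)
    (max P.totalDegree Q.totalDegree)
  have hp := logMahler_eq_integral e (integrable_log_eval hP)
  have hq := logMahler_eq_integral e (integrable_log_eval hQ)
  have hpq := logMahler_eq_integral e (integrable_log_eval (mul_ne_zero hP hQ))
  rw [hp.2, hq.2, hpq.2, ← integral_add hp.1 hq.1]
  refine integral_congr_ae (Filter.Eventually.of_forall fun x => ?_)
  simp only [map_mul]
  exact logMahlerMeasure_mul_eq_add_logMahlerMeasure
    (mul_ne_zero (he P hP (le_max_left _ _) x) (he Q hQ (le_max_right _ _) x))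

/-- The Mahler measure is bounded by the Euclidean norm of the coefficients. -/
theorem logMahler_le_log_l2 {Q : MvPolynomial σ ℂ} (hQ : Q ≠ 0) :
    logMahler Q ≤ Real.log (√(∑ d ∈ Q.support, ‖Q.coeff d‖ ^ 2)) := by
  classical
  obtain ⟨e, he, hne⟩ := exists_weight_curve_ne_zero (σ := σ) Q.totalDegree
  replace he := he.mono (support_subset_degree Q le_rfl)
  have h := logMahler_eq_integral e (integrable_log_eval hQ)
  rw [h.2]
  calc _ ≤ ∫ x : UnitAddTorus σ, Real.log (√(∑ d ∈ Q.support, ‖Q.coeff d‖ ^ 2)) := by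
        refine integral_mono h.1 (integrable_const _) fun x => ?_
        simp only
        rw [logMahlerMeasure_eq_log_MahlerMeasure]
        refine Real.log_le_log (mahlerMeasure_pos_of_ne_zero (hne Q hQ le_rfl x))
          ((mahlerMeasure_le_sqrt_sum_sq_norm_coeff _).trans (Real.sqrt_le_sqrt ?_))
        have hsub : (curve (circ x) e Q).support ⊆ Q.support.image (Finsupp.weight e) := by
          intro k hk
          by_contra hk'
          apply Polynomial.mem_support_iff.1 hk
          rw [coeff_curve]
          refine Finset.sum_eq_zero fun d hd => if_neg fun h => hk' ?_
          exact Finset.mem_image.2 ⟨d, hd, h⟩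
        calc _ ≤ ∑ k ∈ Q.support.image (Finsupp.weight e), ‖(curve (circ x) e Q).coeff k‖ ^ 2 :=
              Finset.sum_le_sum_of_subset_of_nonneg hsub fun _ _ _ => by positivity
          _ = ∑ d ∈ Q.support, ‖(curve (circ x) e Q).coeff (Finsupp.weight e d)‖ ^ 2 :=
              Finset.sum_image he
          _ = _ := by
              refine Finset.sum_congr rfl fun d hd => ?_
              rw [coeff_curve, Finset.sum_eq_single d]
              · simp [norm_prod, norm_circ]
              · intro d' hd' hne'
                exact if_neg fun h => hne' (he hd' hd h)
              · exact fun h => absurd hd h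
    _ = _ := by simp

instance nullSingletonClass_unitAddCircle :
    NullSingletonClass (volume : Measure UnitAddCircle) := by
  refine ⟨fun t => ?_⟩
  obtain ⟨y, rfl⟩ := QuotientAddGroup.mk_surjective t
  rw [← (UnitAddCircle.measurePreserving_mk 0).measure_preimage
    (measurableSet_singleton _).nullMeasurableSet]
  refine Set.Countable.measure_zero ((Set.countable_range fun n : ℤ => y + n).mono ?_) _
  intro x hx
  have hx' : (y : UnitAddCircle) = (x : UnitAddCircle) := hx.symm
  rw [QuotientAddGroup.eq, AddSubgroup.mem_zmultiples_iff] at hx'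
  obtain ⟨n, hn⟩ := hx'
  exact ⟨n, by simp at hn; simp [hn]⟩

omit [Fintype σ] in
theorem injective_unitPt : Function.Injective unitPt := by
  intro s t h
  exact AddCircle.injective_toCircle one_ne_zero (Circle.ext h)

theorem ae_eval_ne_zero {Q : MvPolynomial σ ℂ} (hQ : Q ≠ 0) :
    ∀ᵐ x : UnitAddTorus σ, MvPolynomial.eval (circ x) Q ≠ 0 := by
  obtain ⟨e, -, hne⟩ := exists_weight_curve_ne_zero (σ := σ) Q.totalDegree
  have hmeas : MeasurableSet {x : UnitAddTorus σ | MvPolynomial.eval (circ x) Q = 0} :=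
    (isClosed_singleton.preimage (continuous_eval_circ Q)).measurableSet
  have h := lintegral_rot e (measurable_one.indicator hmeas)
  rw [lintegral_indicator_one hmeas] at h
  rw [ae_iff]
  simp only [not_not]
  rw [h]
  refine (lintegral_congr fun x => ?_).trans lintegral_zero
  have hm : MeasurableSet {t : UnitAddCircle |
      (curve (circ x) e Q).eval (unitPt t) = 0} :=
    (isClosed_singleton.preimage ((Polynomial.continuous _).comp continuous_unitPt)).measurableSet
  have h0 : volume {t : UnitAddCircle | (curve (circ x) e Q).eval (unitPt t) = 0} = 0 := by
    apply Set.Finite.measure_zero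
    have hf := Polynomial.finite_setOfPred_isRoot (hne Q hQ le_rfl x)
    exact hf.preimage injective_unitPt.injOn
  rw [← h0, ← lintegral_indicator_one hm]
  refine lintegral_congr fun t => ?_
  simp only [Set.indicator, Set.mem_ofPred_eq, circ_add_rot, eval_curve, Pi.one_apply]

end Weights

/-! ### Gram determinants and products of distances -/

section Volume

open Matrix Submodule

variable {E : Type*} [NormedAddCommGroup E] [InnerProductSpace ℂ E]

/-- The squared volume of the parallelepiped spanned by a finite family. -/
def gramVol {ι : Type*} [Fintype ι] [DecidableEq ι] (v : ι → E) : ℝ := (gram ℂ v).det.re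

/-- The product of the successive distances of the vectors `b j` to the subspace spanned by `W`
and the preceding vectors. -/
def relVol (W : Submodule ℂ E) {r : ℕ} (b : Fin r → E) : ℝ :=
  ∏ j, Metric.infDist (b j) ((W ⊔ span ℂ (b '' Set.Iio j) : Submodule ℂ E) : Set E)

theorem relVol_nonneg (W : Submodule ℂ E) {r : ℕ} (b : Fin r → E) : 0 ≤ relVol W b :=
  Finset.prod_nonneg fun _ _ => Metric.infDist_nonneg

theorem infDist_le_norm (x : E) (W : Submodule ℂ E) : Metric.infDist x (W : Set E) ≤ ‖x‖ := by
  simpa using Metric.infDist_le_dist_of_mem (x := x) W.zero_mem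

theorem relVol_le_prod_norm (W : Submodule ℂ E) {r : ℕ} (b : Fin r → E) :
    relVol W b ≤ ∏ j, ‖b j‖ :=
  Finset.prod_le_prod (fun _ _ => Metric.infDist_nonneg) fun _ _ => infDist_le_norm _ _

theorem relVol_append (W : Submodule ℂ E) {p q : ℕ} (a : Fin p → E) (b : Fin q → E) :
    relVol W (Fin.append a b) = relVol W a * relVol (W ⊔ span ℂ (Set.range a)) b := by
  unfold relVol
  rw [Fin.prod_univ_add]
  congr 1
  · refine Finset.prod_congr rfl fun j _ => ?_
    rw [Fin.append_left]
    congr 4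
    ext x
    constructor
    · rintro ⟨i, hi, rfl⟩
      obtain ⟨i', rfl⟩ : ∃ i' : Fin p, Fin.castAdd q i' = i :=
        ⟨⟨i, (show (i : ℕ) < j from hi).trans j.2⟩, rfl⟩
      exact ⟨i', hi, by rw [Fin.append_left]⟩
    · rintro ⟨i, hi, rfl⟩
      exact ⟨Fin.castAdd q i, hi, by rw [Fin.append_left]⟩
  · refine Finset.prod_congr rfl fun j _ => ?_
    rw [Fin.append_right, sup_assoc, ← span_union]
    congr 4
    ext x
    constructor
    · rintro ⟨i, hi, rfl⟩
      induction i using Fin.addCases with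
      | left i => exact Or.inl ⟨i, by rw [Fin.append_left]⟩
      | right i => exact Or.inr ⟨i, by simpa using hi, by rw [Fin.append_right]⟩
    · rintro (⟨i, rfl⟩ | ⟨i, hi, rfl⟩)
      · refine ⟨Fin.castAdd q i, ?_, by rw [Fin.append_left]⟩
        change (i : ℕ) < p + j
        omega
      · exact ⟨Fin.natAdd p i, by simpa using hi, by rw [Fin.append_right]⟩

/-- A linear correspondence `f x ↦ g x` that expands norms at most by `c` expands distances at most
by `c`. -/
theorem infDist_map_le {E' : Type*} [NormedAddCommGroup E'] [InnerProductSpace ℂ E']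
    {V : Type*} [AddCommGroup V] [Module ℂ V] (f : V →ₗ[ℂ] E) (g : V →ₗ[ℂ] E') {c : ℝ}
    (hc : ∀ x, ‖g x‖ ≤ c * ‖f x‖) (hc0 : 0 ≤ c) (x : V) (W : Submodule ℂ V) :
    Metric.infDist (g x) (W.map g : Set E') ≤ c * Metric.infDist (f x) (W.map f : Set E) := by
  have hne : (W.map f : Set E).Nonempty := ⟨0, zero_mem _⟩
  refine le_of_forall_pos_le_add fun ε hε => ?_
  have hlt : Metric.infDist (f x) (W.map f : Set E)
      < Metric.infDist (f x) (W.map f : Set E) + ε / (c + 1) := by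
    have : 0 < ε / (c + 1) := by positivity
    linarith
  obtain ⟨_, ⟨y, hy, rfl⟩, hd⟩ := (Metric.infDist_lt_iff hne).1 hlt
  have h1 : Metric.infDist (g x) (W.map g : Set E') ≤ dist (g x) (g y) :=
    Metric.infDist_le_dist_of_mem ⟨y, hy, rfl⟩
  refine h1.trans ?_
  rw [dist_eq_norm, ← map_sub]
  rw [dist_eq_norm, ← map_sub] at hd
  calc ‖g (x - y)‖ ≤ c * ‖f (x - y)‖ := hc _
    _ ≤ c * (Metric.infDist (f x) (W.map f : Set E) + ε / (c + 1)) := by gcongr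
    _ = c * Metric.infDist (f x) (W.map f : Set E) + ε * (c / (c + 1)) := by ring
    _ ≤ _ := by
      have : c / (c + 1) ≤ 1 := by rw [div_le_one (by positivity)]; linarith
      nlinarith

/-- A linear map with norm at most `c` between two images of a space multiplies relative volumes
by at most `c ^ r`. -/
theorem relVol_map_le {E' : Type*} [NormedAddCommGroup E'] [InnerProductSpace ℂ E']
    {V : Type*} [AddCommGroup V] [Module ℂ V] (f : V →ₗ[ℂ] E) (g : V →ₗ[ℂ] E') {c : ℝ}
    (hc : ∀ x, ‖g x‖ ≤ c * ‖f x‖) (hc0 : 0 ≤ c) (W : Submodule ℂ V) (W' : Submodule ℂ E')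
    (hW : W.map g ≤ W') {r : ℕ} (b : Fin r → V) :
    relVol W' (g ∘ b) ≤ c ^ r * relVol (W.map f) (f ∘ b) := by
  have h : (c ^ r : ℝ) = ∏ _j : Fin r, c := by simp
  rw [relVol, relVol, h, ← Finset.prod_mul_distrib]
  refine Finset.prod_le_prod (fun _ _ => Metric.infDist_nonneg) fun j _ => ?_
  have e1 : W.map f ⊔ span ℂ ((f ∘ b) '' Set.Iio j) = (W ⊔ span ℂ (b '' Set.Iio j)).map f := by
    rw [Submodule.map_sup, Submodule.map_span, Set.image_comp]
  have e2 : (W ⊔ span ℂ (b '' Set.Iio j)).map g ≤ W' ⊔ span ℂ ((g ∘ b) '' Set.Iio j) := by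
    rw [Submodule.map_sup, Submodule.map_span, Set.image_comp]
    exact sup_le_sup_right hW _
  rw [e1]
  refine le_trans ?_ (infDist_map_le f g hc hc0 (b j) _)
  exact Metric.infDist_le_infDist_of_subset e2 ⟨0, zero_mem _⟩

theorem gram_linear_combination {ι κ : Type*} [Fintype κ] (u : κ → E) (A : Matrix ι κ ℂ) :
    gram ℂ (fun i => ∑ j, A i j • u j) = A.map star * gram ℂ u * Aᵀ := by
  ext i j
  simp only [gram_apply, sum_inner, inner_sum, inner_smul_left, inner_smul_right, Matrix.mul_apply,
    Matrix.map_apply, Matrix.transpose_apply, Finset.sum_mul]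
  refine Finset.sum_congr rfl fun l _ => ?_
  rw [Finset.mul_sum]
  refine Finset.sum_congr rfl fun k _ => ?_
  simp only [starRingEnd_apply]
  ring

theorem gramVol_linear_combination {ι : Type*} [Fintype ι] [DecidableEq ι] (u : ι → E)
    (A : Matrix ι ι ℂ) :
    gramVol (fun i => ∑ j, A i j • u j) = ‖A.det‖ ^ 2 * gramVol u := by
  unfold gramVol
  rw [gram_linear_combination, det_mul, det_mul, det_transpose]
  have h : (A.map star).det = star A.det := by
    have := RingHom.map_det (starRingEnd ℂ) A
    simpa using this.symm
  rw [h, mul_right_comm]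
  have h2 : star A.det * A.det = ((‖A.det‖ ^ 2 : ℝ) : ℂ) := by
    have := Complex.conj_mul' A.det
    simpa using this
  rw [h2, Complex.re_ofReal_mul]

theorem gramVol_reindex {ι κ : Type*} [Fintype ι] [DecidableEq ι] [Fintype κ] [DecidableEq κ]
    (e : ι ≃ κ) (v : κ → E) : gramVol (v ∘ e) = gramVol v := by
  unfold gramVol
  congr 1
  exact det_submatrix_equiv_self e (gram ℂ v)

theorem infDist_eq_norm_of_sub_mem {x y : E} {W : Submodule ℂ E} (h : x - y ∈ W)
    (hy : ∀ w ∈ W, inner ℂ w y = 0) : Metric.infDist x (W : Set E) = ‖y‖ := by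
  apply le_antisymm
  · have := Metric.infDist_le_dist_of_mem (x := x) (s := (W : Set E)) h
    rwa [dist_eq_norm, sub_sub_cancel] at this
  · rw [Metric.le_infDist ⟨0, zero_mem _⟩]
    intro w hw
    rw [dist_eq_norm]
    have h2 : inner ℂ (x - y - w) y = 0 := hy _ (W.sub_mem h hw)
    have h3 := norm_add_sq_eq_norm_sq_add_norm_sq_of_inner_eq_zero (x - y - w) y h2
    have h4 : x - y - w + y = x - w := by abel
    rw [h4] at h3
    nlinarith [norm_nonneg y, norm_nonneg (x - w), norm_nonneg (x - y - w)]

/-- The product of the distances of Gram–Schmidt orthogonalization is the volume. -/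
theorem relVol_bot_sq {r : ℕ} (v : Fin r → E) : relVol ⊥ v ^ 2 = gramVol v := by
  let g := InnerProductSpace.gramSchmidt ℂ v
  have hdist : ∀ i, Metric.infDist (v i) ((⊥ ⊔ span ℂ (v '' Set.Iio i) : Submodule ℂ E) : Set E)
      = ‖g i‖ := by
    intro i
    rw [bot_sup_eq]
    apply infDist_eq_norm_of_sub_mem
    · have h := InnerProductSpace.gramSchmidt_def'' ℂ v i
      have h2 : v i - g i = ∑ j ∈ Finset.Iio i,
          (inner ℂ (g j) (v i) / (‖g j‖ : ℂ) ^ 2) • g j := by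
        conv_lhs => rw [h]
        exact add_sub_cancel_left _ _
      rw [h2]
      refine Submodule.sum_mem _ fun j hj => Submodule.smul_mem _ _ ?_
      rw [← InnerProductSpace.span_gramSchmidt_Iio ℂ v i]
      exact subset_span ⟨j, Finset.mem_Iio.1 hj, rfl⟩
    · rw [← InnerProductSpace.span_gramSchmidt_Iio ℂ v i]
      intro w hw
      induction hw using Submodule.span_induction with
      | mem x hx =>
        obtain ⟨j, hj, rfl⟩ := hx
        exact InnerProductSpace.gramSchmidt_orthogonal ℂ v (ne_of_lt hj)
      | zero => simp
      | add x y _ _ hx hy => rw [inner_add_left, hx, hy, add_zero]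
      | smul a x _ hx => rw [inner_smul_left, hx, mul_zero]
  let A : Matrix (Fin r) (Fin r) ℂ := fun i j =>
    if j = i then 1 else if j < i then inner ℂ (g j) (v i) / (‖g j‖ : ℂ) ^ 2 else 0
  have hv : v = fun i => ∑ j, A i j • g j := by
    funext i
    have h := InnerProductSpace.gramSchmidt_def'' ℂ v i
    conv_lhs => rw [h]
    rw [← Finset.add_sum_erase _ _ (Finset.mem_univ i)]
    congr 1
    · simp [A, g]
    · have hsub : Finset.Iio i ⊆ Finset.univ.erase i := fun j hj =>
        Finset.mem_erase.2 ⟨(Finset.mem_Iio.1 hj).ne, Finset.mem_univ _⟩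
      rw [← Finset.sum_subset hsub]
      · refine Finset.sum_congr rfl fun j hj => ?_
        have hj' := Finset.mem_Iio.1 hj
        simp [A, hj', hj'.ne, g]
      · intro j hj hj'
        have h1 := (Finset.mem_erase.1 hj).1
        have h2 : ¬ j < i := fun h => hj' (Finset.mem_Iio.2 h)
        simp [A, h1, h2]
  have hA : A.det = 1 := by
    rw [det_of_isLowerTriangular]
    · simp [A]
    · intro i j hij
      have hij' : i < j := hij
      simp [A, hij'.ne', hij'.not_gt]
  have hgram : gramVol v = gramVol g := by
    conv_lhs => rw [hv]
    rw [gramVol_linear_combination, hA]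
    simp
  have hdiag : gram ℂ g = Matrix.diagonal fun i => ((‖g i‖ ^ 2 : ℝ) : ℂ) := by
    ext i j
    rcases eq_or_ne i j with rfl | hij
    · rw [gram_apply, inner_self_eq_norm_sq_to_K]; simp
    · rw [gram_apply, Matrix.diagonal_apply_ne _ hij]
      exact InnerProductSpace.gramSchmidt_orthogonal ℂ v hij
  rw [hgram, gramVol, hdiag, det_diagonal, ← Complex.ofReal_prod, Complex.ofReal_re,
    Finset.prod_pow, relVol]
  simp only [hdist]

end Volume

/-! ### A weighted Hilbert space of functions on the torus -/

section WeightedSpace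

open MeasureTheory

variable {σ : Type*} [Fintype σ]

/-- Half the integral of `log (|P|² + ε)` over the torus, a regularisation of `logMahler P`. -/
def regMahler (P : MvPolynomial σ ℂ) (ε : ℝ) : ℝ :=
  2⁻¹ * ∫ x : UnitAddTorus σ, Real.log (‖MvPolynomial.eval (circ x) P‖ ^ 2 + ε)

/-- The continuous function on the torus given by `Q / (|P|² + ε)^(1/2)`. -/
def weightedFun (P : MvPolynomial σ ℂ) {ε : ℝ} (hε : 0 < ε) :
    MvPolynomial σ ℂ →ₗ[ℂ] C(UnitAddTorus σ, ℂ) where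
  toFun Q := ⟨fun x => MvPolynomial.eval (circ x) Q
      * ((√(‖MvPolynomial.eval (circ x) P‖ ^ 2 + ε))⁻¹ : ℝ), by
    refine (continuous_eval_circ Q).mul (Complex.continuous_ofReal.comp ?_)
    refine Continuous.inv₀ (Real.continuous_sqrt.comp
      (((continuous_eval_circ P).norm.pow 2).add continuous_const)) fun x => ?_
    have : 0 < ‖MvPolynomial.eval (circ x) P‖ ^ 2 + ε := by positivity
    positivity⟩
  map_add' Q R := by ext x; simp [add_mul]
  map_smul' a Q := by ext x; simp [mul_assoc]

/-- Polynomials as elements of the Hilbert space of square integrable functions on the torus for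
the weight `1 / (|P|² + ε)`. -/
def weightedEmb (P : MvPolynomial σ ℂ) {ε : ℝ} (hε : 0 < ε) :
    MvPolynomial σ ℂ →ₗ[ℂ] Lp ℂ 2 (volume : Measure (UnitAddTorus σ)) :=
  (ContinuousMap.toLp 2 volume ℂ).toLinearMap ∘ₗ weightedFun P hε

variable (P : MvPolynomial σ ℂ) {ε : ℝ} (hε : 0 < ε)

omit [Fintype σ] in
include hε in
theorem continuous_weighted (Q : MvPolynomial σ ℂ) :
    Continuous fun x : UnitAddTorus σ =>
      ‖MvPolynomial.eval (circ x) Q‖ ^ 2 / (‖MvPolynomial.eval (circ x) P‖ ^ 2 + ε) :=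
  ((continuous_eval_circ Q).norm.pow 2).div
    (((continuous_eval_circ P).norm.pow 2).add continuous_const) fun x => by positivity

include hε in
theorem integrable_weighted (Q : MvPolynomial σ ℂ) :
    Integrable fun x : UnitAddTorus σ =>
      ‖MvPolynomial.eval (circ x) Q‖ ^ 2 / (‖MvPolynomial.eval (circ x) P‖ ^ 2 + ε) :=
  (continuous_weighted P hε Q).integrable_of_hasCompactSupport
    (HasCompactSupport.of_compactSpace _)

include hε in
theorem integrable_log_reg : Integrable fun x : UnitAddTorus σ =>
    Real.log (‖MvPolynomial.eval (circ x) P‖ ^ 2 + ε) :=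
  (Continuous.log (((continuous_eval_circ P).norm.pow 2).add continuous_const)
    fun _ => (add_pos_of_nonneg_of_pos (sq_nonneg _) hε).ne').integrable_of_hasCompactSupport (HasCompactSupport.of_compactSpace _)

theorem norm_weightedEmb_sq (Q : MvPolynomial σ ℂ) :
    ‖weightedEmb P hε Q‖ ^ 2 = ∫ x : UnitAddTorus σ,
      ‖MvPolynomial.eval (circ x) Q‖ ^ 2 / (‖MvPolynomial.eval (circ x) P‖ ^ 2 + ε) := by
  have h := ContinuousMap.inner_toLp (𝕜 := ℂ) (volume : Measure (UnitAddTorus σ))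
    (weightedFun P hε Q) (weightedFun P hε Q)
  have h2 := inner_self_eq_norm_sq_to_K (𝕜 := ℂ) (weightedEmb P hε Q)
  have h3 : inner ℂ (weightedEmb P hε Q) (weightedEmb P hε Q) = _ := h
  rw [h3] at h2
  have h4 : ∀ x : UnitAddTorus σ, weightedFun P hε Q x * (starRingEnd ℂ) (weightedFun P hε Q x)
      = ((‖MvPolynomial.eval (circ x) Q‖ ^ 2 / (‖MvPolynomial.eval (circ x) P‖ ^ 2 + ε) : ℝ) : ℂ) := by
    intro x
    rw [Complex.mul_conj', ← Complex.ofReal_pow]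
    congr 1
    have hp : 0 < ‖MvPolynomial.eval (circ x) P‖ ^ 2 + ε := by positivity
    change ‖MvPolynomial.eval (circ x) Q
      * ((√(‖MvPolynomial.eval (circ x) P‖ ^ 2 + ε))⁻¹ : ℝ)‖ ^ 2 = _
    rw [norm_mul, mul_pow, Complex.norm_real, Real.norm_eq_abs, sq_abs, inv_pow, Real.sq_sqrt hp.le]
    rfl
  simp only [h4] at h2
  rw [integral_complex_ofReal] at h2
  refine Complex.ofReal_injective ?_
  rw [Complex.ofReal_pow]
  exact h2.symm

theorem norm_weightedEmb_mul_le (s Q : MvPolynomial σ ℂ) {B : ℝ} (hB0 : 0 ≤ B)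
    (hB : ∀ x : UnitAddTorus σ, ‖MvPolynomial.eval (circ x) s‖ ≤ B) :
    ‖weightedEmb P hε (s * Q)‖ ≤ B * ‖weightedEmb P hε Q‖ := by
  rw [← sq_le_sq₀ (norm_nonneg _) (by positivity), mul_pow, norm_weightedEmb_sq,
    norm_weightedEmb_sq, ← integral_const_mul]
  refine integral_mono (integrable_weighted P hε _) ((integrable_weighted P hε _).const_mul _)
    fun x => ?_
  simp only [map_mul, norm_mul, mul_pow]
  rw [mul_div_assoc]
  gcongr
  exact hB x

theorem norm_weightedEmb_le (Q : MvPolynomial σ ℂ) {B : ℝ} (hB0 : 0 ≤ B)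
    (hB : ∀ x : UnitAddTorus σ, ‖MvPolynomial.eval (circ x) Q‖ ≤ B) :
    ‖weightedEmb P hε Q‖ ≤ B * (√ε)⁻¹ := by
  rw [← sq_le_sq₀ (norm_nonneg _) (by positivity), norm_weightedEmb_sq, mul_pow, inv_pow,
    Real.sq_sqrt hε.le]
  calc _ ≤ ∫ x : UnitAddTorus σ, B ^ 2 * ε⁻¹ := by
        refine integral_mono (integrable_weighted P hε _) (integrable_const _) fun x => ?_
        simp only
        rw [div_eq_mul_inv]
        gcongr
        · exact hB x
        · have := sq_nonneg ‖MvPolynomial.eval (circ x) P‖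
          linarith
    _ = _ := by simp

theorem norm_eval_monomial (d : σ →₀ ℕ) (x : UnitAddTorus σ) :
    ‖MvPolynomial.eval (circ x) (MvPolynomial.monomial d (1 : ℂ))‖ = 1 := by
  rw [MvPolynomial.eval_monomial, Finsupp.prod_fintype _ _ (by simp)]
  simp [norm_prod, norm_circ]

theorem norm_weightedEmb_mul_monomial_le (d : σ →₀ ℕ) :
    ‖weightedEmb P hε (P * MvPolynomial.monomial d 1)‖ ≤ 1 := by
  rw [← sq_le_sq₀ (norm_nonneg _) zero_le_one, norm_weightedEmb_sq, one_pow]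
  calc _ ≤ ∫ x : UnitAddTorus σ, (1 : ℝ) := by
        refine integral_mono (integrable_weighted P hε _) (integrable_const _) fun x => ?_
        simp only [map_mul, norm_mul, norm_eval_monomial, mul_one]
        rw [div_le_one (by positivity)]
        linarith
    _ = 1 := by simp

/-- The distance estimate for the weighted norm: a polynomial whose dominant coefficient is one
has norm at least `exp (-regMahler P ε)`. -/
theorem exp_le_norm_weightedEmb (e : σ → ℕ) {Q : MvPolynomial σ ℂ} {d : σ →₀ ℕ}
    (hd : Q.coeff d = 1)
    (h : ∀ d' ∈ Q.support, d' ≠ d → Finsupp.weight e d' < Finsupp.weight e d) :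
    Real.exp (-regMahler P ε) ≤ ‖weightedEmb P hε Q‖ := by
  have hQ : Q ≠ 0 := by rintro rfl; simp at hd
  obtain ⟨hi, hl⟩ := log_norm_coeff_le_logMahler e (by rw [hd]; exact one_ne_zero) h
  rw [hd, norm_one, Real.log_one] at hl
  have hae : ∀ᵐ x : UnitAddTorus σ,
      Real.exp (2 * Real.log ‖MvPolynomial.eval (circ x) Q‖
        - Real.log (‖MvPolynomial.eval (circ x) P‖ ^ 2 + ε))
      = ‖MvPolynomial.eval (circ x) Q‖ ^ 2 / (‖MvPolynomial.eval (circ x) P‖ ^ 2 + ε) := by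
    filter_upwards [ae_eval_ne_zero hQ] with x hx
    have hp : 0 < ‖MvPolynomial.eval (circ x) P‖ ^ 2 + ε := by positivity
    rw [Real.exp_sub, Real.exp_log hp, two_mul, Real.exp_add, Real.exp_log (norm_pos_iff.2 hx),
      ← sq]
  have hj := ConvexOn.map_integral_le (μ := (volume : Measure (UnitAddTorus σ)))
    (f := fun x => 2 * Real.log ‖MvPolynomial.eval (circ x) Q‖
        - Real.log (‖MvPolynomial.eval (circ x) P‖ ^ 2 + ε)) convexOn_exp
    Real.continuous_exp.continuousOn isClosed_univ (by simp)
    ((hi.const_mul 2).sub (integrable_log_reg P hε))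
    ((integrable_weighted P hε Q).congr (hae.mono fun x hx => hx.symm))
  rw [integral_congr_ae hae, ← norm_weightedEmb_sq P hε,
    integral_sub (hi.const_mul 2) (integrable_log_reg P hε), integral_const_mul] at hj
  rw [← sq_le_sq₀ (Real.exp_pos _).le (norm_nonneg _), ← Real.exp_nat_mul]
  refine le_trans (Real.exp_le_exp.2 ?_) hj
  unfold regMahler
  unfold logMahler at hl
  push_cast
  linarith

end WeightedSpace

/-! ### Monomials of bounded degree -/

section Monomials

variable {σ : Type*} [Fintype σ]

/-- The exponents of degree at most `m`. -/
abbrev Mon (σ : Type*) (m : ℕ) : Type _ := {d : σ →₀ ℕ // d.degree ≤ m}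

instance (m : ℕ) : Fintype (Mon σ m) := (Finsupp.finite_of_degree_le m).fintype

/-- The monomial with exponent `d` as a polynomial. -/
def monPoly {R : Type*} [CommSemiring R] {m : ℕ} (d : Mon σ m) : MvPolynomial σ R :=
  MvPolynomial.monomial d.1 1

end Monomials

/-! ### Volumes of finite families -/

section Volume

open Submodule

variable {E : Type*} [NormedAddCommGroup E] [InnerProductSpace ℂ E]

/-- The volume of the parallelepiped spanned by a finite family. -/
def vol {ι : Type*} [Fintype ι] (v : ι → E) : ℝ := by
  classical exact √(gramVol v)

theorem vol_eq_relVol {r : ℕ} (v : Fin r → E) : vol v = relVol ⊥ v := by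
  have h : vol v = √(gramVol v) := by unfold vol; congr!
  rw [h, ← relVol_bot_sq, Real.sqrt_sq (relVol_nonneg _ _)]

theorem vol_linear_combination {ι : Type*} [Fintype ι] [DecidableEq ι] (u : ι → E)
    (A : Matrix ι ι ℂ) : vol (fun i => ∑ j, A i j • u j) = ‖A.det‖ * vol u := by
  have h : ∀ v : ι → E, vol v = √(gramVol v) := fun v => by unfold vol; congr!
  rw [h, h, gramVol_linear_combination, Real.sqrt_mul (by positivity),
    Real.sqrt_sq (norm_nonneg _)]

theorem vol_reindex {ι κ : Type*} [Fintype ι] [Fintype κ] (e : ι ≃ κ) (v : κ → E) :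
    vol (v ∘ e) = vol v := by
  classical
  have h : ∀ v : ι → E, vol v = √(gramVol v) := fun v => by unfold vol; congr!
  have h' : ∀ v : κ → E, vol v = √(gramVol v) := fun v => by unfold vol; congr!
  rw [h, h', gramVol_reindex]

theorem vol_sum_elim {p q : ℕ} (a : Fin p → E) (b : Fin q → E) :
    vol (Sum.elim a b) = relVol ⊥ a * relVol (span ℂ (Set.range a)) b := by
  rw [← Fin.append_comp_sumElim]
  have : (Sum.elim (Fin.castAdd q) (Fin.natAdd p)) = (finSumFinEquiv : Fin p ⊕ Fin q ≃ _) := by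
    funext i; rcases i with i | i <;> simp
  rw [this, vol_reindex, vol_eq_relVol, relVol_append, bot_sup_eq]

end Volume

/-! ### The archimedean estimate for determinants -/

section ArchimedeanDeterminant

open MeasureTheory Submodule

theorem vol_elim {E : Type*} [NormedAddCommGroup E] [InnerProductSpace ℂ E] {α β : Type*}
    [Fintype α] [Fintype β] (a : α → E) (b : β → E) {r : ℕ} (e : Fin r ≃ β) :
    vol (Sum.elim a b) = vol a * relVol (span ℂ (Set.range a)) (b ∘ e) := by
  let e' := (Fintype.equivFin α).symm
  rw [← vol_reindex (Equiv.sumCongr e' e), ← vol_reindex e' a, vol_eq_relVol (a ∘ e')]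
  have h : Sum.elim a b ∘ (Equiv.sumCongr e' e) = Sum.elim (a ∘ e') (b ∘ e) := by
    funext i; rcases i with i | i <;> rfl
  have h2 : Set.range a = Set.range (a ∘ e') := (e'.surjective.range_comp a).symm
  rw [h, vol_sum_elim, h2]

variable {σ : Type*} [Fintype σ]

/-- The exponents of degree at most `k` split into those of degree at most `k'` and the rest. -/
def monSplit {k' k : ℕ} (h : k' ≤ k) :
    Mon σ k' ⊕ {d : Mon σ k // ¬ d.1.degree ≤ k'} ≃ Mon σ k :=
  (Equiv.sumCongr ⟨fun d => ⟨⟨d.1, d.2.trans h⟩, d.2⟩, fun d => ⟨d.1.1, d.2⟩, fun _ => rfl,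
    fun _ => rfl⟩ (Equiv.refl _)).trans (Equiv.sumCompl fun d : Mon σ k => d.1.degree ≤ k')

theorem card_monSplit {k' k : ℕ} (h : k' ≤ k) :
    Fintype.card {d : Mon σ k // ¬ d.1.degree ≤ k'}
      = Fintype.card (Mon σ k) - Fintype.card (Mon σ k') := by
  classical
  have := Fintype.card_congr (monSplit (σ := σ) h)
  rw [Fintype.card_sum] at this
  omega

variable (P : MvPolynomial σ ℂ) {ε : ℝ} (hε : 0 < ε)

/-- Adjoining monomials in the order of increasing weight multiplies the volume by at least
`exp (-regMahler P ε)` each time. -/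
theorem exp_pow_le_relVol (e : σ → ℕ) {r : ℕ} (φ : Fin r → (σ →₀ ℕ)) (A : Set (σ →₀ ℕ))
    (hA : ∀ d ∈ A, ∀ i, Finsupp.weight e d < Finsupp.weight e (φ i))
    (hφ : ∀ i j, i < j → Finsupp.weight e (φ i) < Finsupp.weight e (φ j)) :
    Real.exp (-regMahler P ε) ^ r ≤
      relVol (span ℂ ((fun d => weightedEmb P hε (MvPolynomial.monomial d 1)) '' A))
        (fun i => weightedEmb P hε (MvPolynomial.monomial (φ i) 1)) := by
  classical
  have h : Real.exp (-regMahler P ε) ^ r = ∏ _j : Fin r, Real.exp (-regMahler P ε) := by simp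
  rw [h]
  refine Finset.prod_le_prod (fun _ _ => (Real.exp_pos _).le) fun j _ => ?_
  rw [Metric.le_infDist ⟨0, zero_mem _⟩]
  intro y hy
  let B : Set (σ →₀ ℕ) := A ∪ φ '' Set.Iio j
  have hB : ∀ d ∈ B, Finsupp.weight e d < Finsupp.weight e (φ j) := by
    rintro d (hd | ⟨i, hi, rfl⟩)
    · exact hA d hd j
    · exact hφ i j hi
  have hsp : span ℂ ((fun d => weightedEmb P hε (MvPolynomial.monomial d 1)) '' A) ⊔
      span ℂ ((fun i => weightedEmb P hε (MvPolynomial.monomial (φ i) 1)) '' Set.Iio j)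
      = (span ℂ ((fun d => MvPolynomial.monomial d (1 : ℂ)) '' B)).map (weightedEmb P hε) := by
    rw [Submodule.map_span, ← span_union, Set.image_union, Set.image_union, Set.image_image,
      Set.image_image, Set.image_image]
  rw [hsp] at hy
  obtain ⟨q, hq, rfl⟩ := hy
  have hq' : (q.support : Set (σ →₀ ℕ)) ⊆ B := by
    have hle : span ℂ ((fun d => MvPolynomial.monomial d (1 : ℂ)) '' B)
        ≤ MvPolynomial.restrictSupport ℂ B := by
      rw [span_le]
      rintro _ ⟨d, hd, rfl⟩
      rw [SetLike.mem_coe, MvPolynomial.mem_restrictSupport_iff]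
      intro d' hd'
      have := MvPolynomial.support_monomial_subset hd'
      rw [Finset.mem_singleton] at this
      rw [this]; exact hd
    exact (MvPolynomial.mem_restrictSupport_iff ℂ).1 (hle hq)
  have hcq : ∀ d, ¬ Finsupp.weight e d < Finsupp.weight e (φ j) → q.coeff d = 0 := by
    intro d hd
    by_contra hne
    exact hd (hB d (hq' (MvPolynomial.mem_support_iff.2 hne)))
  rw [dist_eq_norm, ← map_sub]
  refine exp_le_norm_weightedEmb P hε e (d := φ j) ?_ ?_
  · rw [MvPolynomial.coeff_sub, MvPolynomial.coeff_monomial, if_pos rfl, hcq _ (lt_irrefl _),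
      sub_zero]
  · intro d hd hne
    by_contra hlt
    apply MvPolynomial.mem_support_iff.1 hd
    rw [MvPolynomial.coeff_sub, MvPolynomial.coeff_monomial, if_neg (Ne.symm hne), hcq _ hlt,
      sub_zero]

/-- A finite family of exponents with distinct weights can be enumerated by increasing weight. -/
theorem exists_enumeration {α : Type*} [Fintype α] (w : α → ℕ) (hw : Function.Injective w) :
    ∃ φ : Fin (Fintype.card α) ≃ α, ∀ i j, i < j → w (φ i) < w (φ j) := by
  classical
  have hc : (Finset.univ.image w).card = Fintype.card α := Finset.card_image_of_injective _ hw
  let o := (Finset.univ.image w).orderIsoOfFin hc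
  have h : ∀ i, ∃ a, w a = o i := fun i => by
    obtain ⟨a, -, ha⟩ := Finset.mem_image.1 (o i).2
    exact ⟨a, ha⟩
  choose f hf using h
  have hinj : Function.Injective f := fun i j hij => by
    have : (o i : ℕ) = o j := by rw [← hf, ← hf, hij]
    exact o.injective (Subtype.ext this)
  refine ⟨Equiv.ofBijective f ((Fintype.bijective_iff_injective_and_card f).2 ⟨hinj, by simp⟩),
    fun i j hij => ?_⟩
  simp only [Equiv.ofBijective_apply, hf]
  exact o.strictMono hij

/-- Enlarging the degree bound from `m'` to `m` multiplies the volume of the monomials by at least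
`exp (-regMahler P ε)` for each new monomial. -/
theorem vol_mon_pos_and_le {m' m : ℕ} (h : m' ≤ m) :
    0 < vol (fun d : Mon σ m' => weightedEmb P hε (monPoly d)) ∧
    vol (fun d : Mon σ m' => weightedEmb P hε (monPoly d)) *
      Real.exp (-regMahler P ε) ^ (Fintype.card (Mon σ m) - Fintype.card (Mon σ m'))
      ≤ vol (fun d : Mon σ m => weightedEmb P hε (monPoly d)) := by
  obtain ⟨e, hinj, hdeg⟩ := exists_weight σ m
  constructor
  · obtain ⟨φ, hφ⟩ := exists_enumeration (fun d : Mon σ m' => Finsupp.weight e d.1)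
      (fun d d' hdd => Subtype.ext (hinj (d.2.trans h) (d'.2.trans h) hdd))
    rw [← vol_reindex φ, vol_eq_relVol]
    have := exp_pow_le_relVol P hε e (fun i => (φ i).1) ∅ (by simp) hφ
    rw [Set.image_empty, span_empty] at this
    exact lt_of_lt_of_le (by positivity) this
  · obtain ⟨φ, hφ⟩ := exists_enumeration
      (fun d : {d : Mon σ m // ¬ d.1.degree ≤ m'} => Finsupp.weight e d.1.1)
      (fun d d' hdd => Subtype.ext (Subtype.ext (hinj d.1.2 d'.1.2 hdd)))
    rw [← vol_reindex (monSplit h) (fun d : Mon σ m => weightedEmb P hε (monPoly d))]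
    have h1 : (fun d : Mon σ m => weightedEmb P hε (monPoly d)) ∘ (monSplit h)
        = Sum.elim (fun d : Mon σ m' => weightedEmb P hε (monPoly d))
          (fun d : {d : Mon σ m // ¬ d.1.degree ≤ m'} => weightedEmb P hε (monPoly d.1)) := by
      funext i; rcases i with i | i <;> rfl
    rw [h1, vol_elim _ _ φ]
    refine mul_le_mul_of_nonneg_left ?_ (Real.sqrt_nonneg _)
    rw [← card_monSplit h]
    have := exp_pow_le_relVol P hε e (fun i => (φ i).1.1) {d | d.degree ≤ m'}
      (fun d hd i => hdeg _ _ (lt_of_le_of_lt hd (not_le.1 (φ i).2)) (φ i).1.2) hφ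
    have hr : (Set.range fun d : Mon σ m' => weightedEmb P hε (monPoly d))
        = (fun d => weightedEmb P hε (MvPolynomial.monomial d 1)) '' {d | d.degree ≤ m'} := by
      ext x
      constructor
      · rintro ⟨d, rfl⟩; exact ⟨d.1, d.2, rfl⟩
      · rintro ⟨d, hd, rfl⟩; exact ⟨⟨d, hd⟩, rfl⟩
    rw [hr]
    exact this

omit [Fintype σ] in
theorem mem_span_monPoly {R : Type*} [CommSemiring R] {k : ℕ} {q : MvPolynomial σ R}
    (hq : q.totalDegree ≤ k) :
    q ∈ span R (Set.range (monPoly : Mon σ k → MvPolynomial σ R)) := by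
  rw [q.as_sum]
  refine Submodule.sum_mem _ fun d hd => ?_
  have h : MvPolynomial.monomial d (q.coeff d)
      = q.coeff d • monPoly (R := R) (⟨d, support_subset_degree q hq hd⟩ : Mon σ k) := by
    rw [monPoly, MvPolynomial.smul_monomial, smul_eq_mul, mul_one]
  rw [h]
  exact smul_mem _ _ (subset_span ⟨_, rfl⟩)

omit [Fintype σ] in
theorem totalDegree_monPoly_le {R : Type*} [CommSemiring R] {k : ℕ} (d : Mon σ k) :
    (monPoly d : MvPolynomial σ R).totalDegree ≤ k := by
  refine (MvPolynomial.totalDegree_monomial_le _ _).trans ?_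
  have := d.2
  rwa [Finsupp.degree_apply] at this

include hε in
/-- The archimedean estimate for the determinant of multiplication by `s` modulo multiples of `P`.
The determinant of `C` measures the choice of the complement `v` of the multiples of `P`, and the
determinant of `A` that of its image `s v`, completed by `rest`. -/
theorem norm_det_mul_le {s : MvPolynomial σ ℂ} {k' k m' m : ℕ} (hk : k' ≤ k) (hm : m' ≤ m)
    (hks : s.totalDegree + k' ≤ k) {β γ : Type*} [Fintype β] [Fintype γ]
    (v : β → MvPolynomial σ ℂ) (rest : γ → MvPolynomial σ ℂ) {B M : ℝ} (hB0 : 0 ≤ B)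
    (hB : ∀ x : UnitAddTorus σ, ‖MvPolynomial.eval (circ x) s‖ ≤ B) (hM0 : 0 ≤ M)
    (hM : ∀ i, ∀ x : UnitAddTorus σ, ‖MvPolynomial.eval (circ x) (rest i)‖ ≤ M)
    [DecidableEq (Mon σ m')] [DecidableEq (Mon σ m)]
    (e₁ : Mon σ k' ⊕ β ≃ Mon σ m') (e₂ : (Mon σ k ⊕ β) ⊕ γ ≃ Mon σ m)
    (C : Matrix (Mon σ m') (Mon σ m') ℂ) (A : Matrix (Mon σ m) (Mon σ m) ℂ)
    (hC : ∀ i, Sum.elim (fun d => P * monPoly d) v i = ∑ j, C (e₁ i) j • monPoly j)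
    (hA : ∀ i, Sum.elim (Sum.elim (fun d => P * monPoly d) (fun b => s * v b)) rest i
      = ∑ j, A (e₂ i) j • monPoly j) :
    ‖A.det‖ * Real.exp (-regMahler P ε) ^ (Fintype.card (Mon σ m) - Fintype.card (Mon σ m'))
      ≤ ‖C.det‖ * B ^ Fintype.card β * (M * (√ε)⁻¹) ^ Fintype.card γ := by
  let J := weightedEmb P hε
  let eβ := (Fintype.equivFin β).symm
  let eγ := (Fintype.equivFin γ).symm
  obtain ⟨hpos, hle⟩ := vol_mon_pos_and_le P hε hm
  have hvC : vol (Sum.elim (fun d : Mon σ k' => J (P * monPoly d)) (fun b => J (v b)))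
      = ‖C.det‖ * vol (fun d : Mon σ m' => J (monPoly d)) := by
    rw [← vol_linear_combination, ← vol_reindex e₁]
    congr 1
    funext i
    have := congrArg J (hC i)
    rw [map_sum] at this
    simp only [map_smul] at this
    simp only [Function.comp]
    rw [← this]
    rcases i with i | i <;> rfl
  have hvA : vol (Sum.elim (Sum.elim (fun d : Mon σ k => J (P * monPoly d))
      (fun b => J (s * v b))) (fun i => J (rest i)))
      = ‖A.det‖ * vol (fun d : Mon σ m => J (monPoly d)) := by
    rw [← vol_linear_combination, ← vol_reindex e₂]
    congr 1
    funext i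
    have := congrArg J (hA i)
    rw [map_sum] at this
    simp only [map_smul] at this
    simp only [Function.comp]
    rw [← this]
    rcases i with (i | i) | i <;> rfl
  rw [vol_elim _ _ eγ, vol_elim _ _ eβ] at hvA
  rw [vol_elim _ _ eβ] at hvC
  have hPspan : ∀ q ∈ span ℂ (Set.range (monPoly : Mon σ k → MvPolynomial σ ℂ)),
      J (P * q) ∈ span ℂ (Set.range (fun d : Mon σ k => J (P * monPoly d))) := by
    intro q hq
    induction hq using Submodule.span_induction with
    | mem x hx => obtain ⟨d, rfl⟩ := hx; exact subset_span ⟨d, rfl⟩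
    | zero => rw [mul_zero, map_zero]; exact zero_mem _
    | add x y _ _ hx hy => rw [mul_add, map_add]; exact add_mem hx hy
    | smul a x _ hx => rw [mul_smul_comm, map_smul]; exact smul_mem _ _ hx
  have h1 : relVol (span ℂ (Set.range (Sum.elim (fun d : Mon σ k => J (P * monPoly d))
      (fun b => J (s * v b))))) ((fun i => J (rest i)) ∘ eγ) ≤ (M * (√ε)⁻¹) ^ Fintype.card γ := by
    refine (relVol_le_prod_norm _ _).trans ?_
    refine (Finset.prod_le_prod (fun _ _ => norm_nonneg _)
      fun j _ => norm_weightedEmb_le P hε _ hM0 (hM _)).trans ?_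
    simp
  have h2 : relVol (span ℂ (Set.range (fun d : Mon σ k => J (P * monPoly d))))
      ((fun b => J (s * v b)) ∘ eβ) ≤ B ^ Fintype.card β *
      relVol (span ℂ (Set.range (fun d : Mon σ k' => J (P * monPoly d)))) ((fun b => J (v b)) ∘ eβ)
      := by
    have := relVol_map_le J (J ∘ₗ LinearMap.mulLeft ℂ s)
      (fun x => norm_weightedEmb_mul_le P hε s x hB0 hB) hB0
      (span ℂ (Set.range (fun d : Mon σ k' => P * monPoly d)))
      (span ℂ (Set.range (fun d : Mon σ k => J (P * monPoly d)))) ?_ (v ∘ eβ)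
    · rw [Submodule.map_span, ← Set.range_comp] at this
      exact this
    · rw [Submodule.map_span, span_le]
      rintro _ ⟨_, ⟨d, rfl⟩, rfl⟩
      have hmem : s * monPoly d ∈ span ℂ (Set.range (monPoly : Mon σ k → MvPolynomial σ ℂ)) :=
        mem_span_monPoly ((MvPolynomial.totalDegree_mul _ _).trans
          ((Nat.add_le_add_left (totalDegree_monPoly_le d) _).trans hks))
      have hmul := hPspan _ hmem
      rw [mul_left_comm] at hmul
      exact hmul
  have h3 : vol (fun d : Mon σ k => J (P * monPoly d))
      ≤ vol (fun d : Mon σ k' => J (P * monPoly d)) := by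
    rw [← vol_reindex (monSplit hk) (fun d : Mon σ k => J (P * monPoly d))]
    have h : (fun d : Mon σ k => J (P * monPoly d)) ∘ (monSplit hk)
        = Sum.elim (fun d : Mon σ k' => J (P * monPoly d))
          (fun d : {d : Mon σ k // ¬ d.1.degree ≤ k'} => J (P * monPoly d.1)) := by
      funext i; rcases i with i | i <;> rfl
    rw [h, vol_elim _ _ (Fintype.equivFin _).symm]
    refine mul_le_of_le_one_right (Real.sqrt_nonneg _) ?_
    refine (relVol_le_prod_norm _ _).trans ?_
    exact Finset.prod_le_one (fun _ _ => norm_nonneg _)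
      fun j _ => norm_weightedEmb_mul_monomial_le P hε _
  have hvn : ∀ {ι : Type _} [Fintype ι] (w : ι → Lp ℂ 2 (volume : Measure (UnitAddTorus σ))),
    0 ≤ vol w := fun w => Real.sqrt_nonneg _
  set V' := vol (fun d : Mon σ m' => J (monPoly d)) with hV'
  set V := vol (fun d : Mon σ m => J (monPoly d)) with hV
  set R := Real.exp (-regMahler P ε) ^ (Fintype.card (Mon σ m) - Fintype.card (Mon σ m'))
  have hfin : V' * (‖A.det‖ * R)
      ≤ V' * (‖C.det‖ * B ^ Fintype.card β * (M * (√ε)⁻¹) ^ Fintype.card γ) := by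
    calc V' * (‖A.det‖ * R) = ‖A.det‖ * (V' * R) := by ring
      _ ≤ ‖A.det‖ * V := mul_le_mul_of_nonneg_left hle (norm_nonneg _)
      _ = _ := hvA.symm
      _ ≤ (vol (fun d : Mon σ k' => J (P * monPoly d)) * (B ^ Fintype.card β *
      relVol (span ℂ (Set.range (fun d : Mon σ k' => J (P * monPoly d))))
        ((fun b => J (v b)) ∘ eβ))) * (M * (√ε)⁻¹) ^ Fintype.card γ := by
          refine mul_le_mul (mul_le_mul h3 h2 (relVol_nonneg _ _) (hvn _)) h1 (relVol_nonneg _ _) ?_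
          have := hvn (fun d : Mon σ k' => J (P * monPoly d))
          have := relVol_nonneg (span ℂ (Set.range (fun d : Mon σ k' => J (P * monPoly d))))
            ((fun b => J (v b)) ∘ eβ)
          positivity
      _ = (vol (fun d : Mon σ k' => J (P * monPoly d)) *
      relVol (span ℂ (Set.range (fun d : Mon σ k' => J (P * monPoly d))))
        ((fun b => J (v b)) ∘ eβ)) * (B ^ Fintype.card β * (M * (√ε)⁻¹) ^ Fintype.card γ) := by ring
      _ = _ := by rw [hvC]; ring
  exact le_of_mul_le_mul_left hfin hpos

end ArchimedeanDeterminant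

/-! ### Determinants of families of polynomials -/

section DeterminantFamily

open Submodule

variable {σ : Type*} [Fintype σ]

/-- The determinant of the coefficients of a family of polynomials of degree at most `m`, the
family being indexed by the monomials of degree at most `m` through `e`. -/
def detFam {R : Type*} [CommRing R] {ι : Type*} [Fintype ι] {m : ℕ} (e : ι ≃ Mon σ m)
    (F : ι → MvPolynomial σ R) : R := by
  classical exact (Matrix.of fun i j : ι => (F i).coeff (e j).1).det

omit [Fintype σ] in
theorem detFam_eq {R : Type*} [CommRing R] {ι : Type*} [Fintype ι] [DecidableEq ι] {m : ℕ}
    (e : ι ≃ Mon σ m) (F : ι → MvPolynomial σ R) :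
    detFam e F = (Matrix.of fun i j : ι => (F i).coeff (e j).1).det := by
  unfold detFam; congr!

omit [Fintype σ] in
theorem totalDegree_map_le {R R' : Type*} [CommRing R] [CommRing R'] (φ : R →+* R')
    (p : MvPolynomial σ R) : (MvPolynomial.map φ p).totalDegree ≤ p.totalDegree :=
  Finset.sup_mono (MvPolynomial.support_map_subset _ _)

omit [Fintype σ] in
@[simp]
theorem map_monPoly {R R' : Type*} [CommRing R] [CommRing R'] (φ : R →+* R') {m : ℕ}
    (d : Mon σ m) : MvPolynomial.map φ (monPoly d) = monPoly d := by
  simp [monPoly, MvPolynomial.map_monomial]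

omit [Fintype σ] in
theorem detFam_map {R R' : Type*} [CommRing R] [CommRing R'] (φ : R →+* R') {ι : Type*} [Fintype ι]
    {m : ℕ} (e : ι ≃ Mon σ m) (F : ι → MvPolynomial σ R) :
    detFam e (fun i => MvPolynomial.map φ (F i)) = φ (detFam e F) := by
  classical
  rw [detFam_eq, detFam_eq, RingHom.map_det]
  congr 1

omit [Fintype σ] in
theorem detFam_linear_combination {R : Type*} [CommRing R] {ι : Type*} [Fintype ι] [DecidableEq ι]
    {m : ℕ} (e : ι ≃ Mon σ m) (F : ι → MvPolynomial σ R) (A : Matrix ι ι R) :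
    detFam e (fun i => ∑ j, A i j • F j) = A.det * detFam e F := by
  rw [detFam_eq, detFam_eq, ← Matrix.det_mul]
  congr 1
  ext i j
  simp [Matrix.mul_apply, MvPolynomial.coeff_sum]

omit [Fintype σ] in
theorem detFam_smul {R : Type*} [CommRing R] {ι : Type*} [Fintype ι]
    {m : ℕ} (e : ι ≃ Mon σ m) (F : ι → MvPolynomial σ R) (a : ι → R) :
    detFam e (fun i => a i • F i) = (∏ i, a i) * detFam e F := by
  classical
  rw [← Matrix.det_diagonal, ← detFam_linear_combination]
  congr 1
  funext i
  simp [Matrix.diagonal_apply]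

omit [Fintype σ] in
theorem ext_of_totalDegree_le {R : Type*} [CommRing R] {ι : Type*} {m : ℕ} (e : ι ≃ Mon σ m)
    {p q : MvPolynomial σ R} (hp : p.totalDegree ≤ m) (hq : q.totalDegree ≤ m)
    (h : ∀ j, p.coeff (e j).1 = q.coeff (e j).1) : p = q := by
  ext d
  by_cases hd : d.degree ≤ m
  · have := h (e.symm ⟨d, hd⟩)
    simpa using this
  · have h0 : ∀ p : MvPolynomial σ R, p.totalDegree ≤ m → p.coeff d = 0 := fun p hp => by
      by_contra hne
      exact hd (support_subset_degree p hp (MvPolynomial.mem_support_iff.2 hne))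
    rw [h0 p hp, h0 q hq]

omit [Fintype σ] in
theorem totalDegree_sum_smul_le {R : Type*} [CommRing R] {ι : Type*} [Fintype ι] {m : ℕ}
    {F : ι → MvPolynomial σ R} (hF : ∀ i, (F i).totalDegree ≤ m) (a : ι → R) :
    (∑ i, a i • F i).totalDegree ≤ m :=
  MvPolynomial.totalDegree_finsetSum_le fun i _ =>
    (MvPolynomial.totalDegree_smul_le _ _).trans (hF i)

omit [Fintype σ] in
theorem detFam_ne_zero {k : Type*} [Field k] {ι : Type*} [Fintype ι] {m : ℕ} (e : ι ≃ Mon σ m)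
    {F : ι → MvPolynomial σ k} (hF : ∀ i, (F i).totalDegree ≤ m) (h : LinearIndependent k F) :
    detFam e F ≠ 0 := by
  classical
  rw [detFam_eq]
  intro h0
  obtain ⟨x, hx, hx0⟩ := Matrix.exists_vecMul_eq_zero_iff.2 h0
  refine hx (funext ((Fintype.linearIndependent_iff.1 h) x ?_))
  refine ext_of_totalDegree_le e (totalDegree_sum_smul_le hF x) (by simp) fun j => ?_
  have := congrFun hx0 j
  simp only [Matrix.vecMul, dotProduct, Matrix.of_apply, Pi.zero_apply] at this
  simpa [MvPolynomial.coeff_sum] using this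

omit [Fintype σ] in
theorem exists_eq_sum_of_detFam_ne_zero {k : Type*} [Field k] {ι : Type*} [Fintype ι] {m : ℕ}
    (e : ι ≃ Mon σ m) {F : ι → MvPolynomial σ k} (hF : ∀ i, (F i).totalDegree ≤ m)
    (h : detFam e F ≠ 0) {q : MvPolynomial σ k} (hq : q.totalDegree ≤ m) :
    ∃ x : ι → k, q = ∑ i, x i • F i := by
  classical
  rw [detFam_eq] at h
  set A := Matrix.of fun i j : ι => (F i).coeff (e j).1 with hA
  refine ⟨Matrix.vecMul (fun j => q.coeff (e j).1) A⁻¹,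
    ext_of_totalDegree_le e hq (totalDegree_sum_smul_le hF _) fun j => ?_⟩
  have h1 : Matrix.vecMul (Matrix.vecMul (fun j => q.coeff (e j).1) A⁻¹) A
      = fun j => q.coeff (e j).1 := by
    rw [Matrix.vecMul_vecMul, Matrix.nonsing_inv_mul _ (Ne.isUnit h), Matrix.vecMul_one]
  rw [← congrFun h1 j]
  simp only [MvPolynomial.coeff_sum, MvPolynomial.coeff_smul, smul_eq_mul]
  rfl

omit [Fintype σ] in
theorem linearIndependent_monPoly {R : Type*} [CommRing R] (m : ℕ) :
    LinearIndependent R (monPoly : Mon σ m → MvPolynomial σ R) := by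
  have := (MvPolynomial.basisMonomials σ R).linearIndependent.comp
    (fun d : Mon σ m => d.1) Subtype.val_injective
  simpa [Function.comp_def] using! this

omit [Fintype σ] in
theorem linearIndependent_mul_monPoly {k : Type*} [Field k] {P : MvPolynomial σ k} (hP : P ≠ 0)
    (m : ℕ) : LinearIndependent k (fun d : Mon σ m => P * monPoly d) :=
  (linearIndependent_monPoly m).map' (LinearMap.mulLeft k P)
    (LinearMap.ker_eq_bot.2 (mul_right_injective₀ hP))

theorem finrank_span_monPoly (k : Type*) [Field k] (m : ℕ) : Module.finrank k
    (span k (Set.range (monPoly : Mon σ m → MvPolynomial σ k))) = Fintype.card (Mon σ m) :=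
  finrank_span_eq_card (linearIndependent_monPoly m)

omit [Fintype σ] in
theorem totalDegree_le_of_mem_span {R : Type*} [CommRing R] {m : ℕ} {q : MvPolynomial σ R}
    (hq : q ∈ span R (Set.range (monPoly : Mon σ m → MvPolynomial σ R))) : q.totalDegree ≤ m := by
  rw [← MvPolynomial.mem_restrictTotalDegree]
  refine (span_le.2 ?_) hq
  rintro _ ⟨d, rfl⟩
  exact (MvPolynomial.mem_restrictTotalDegree _ _ _).2 (totalDegree_monPoly_le d)

/-- A linearly independent family of polynomials of degree at most `m` can be completed by
monomials to a basis. -/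
theorem exists_monomial_complement {k : Type*} [Field k] {α β : Type*} [Fintype α] [Fintype β]
    {m : ℕ} {u : α → MvPolynomial σ k} (hu : LinearIndependent k u)
    (hdeg : ∀ i, (u i).totalDegree ≤ m)
    (hcard : Fintype.card α + Fintype.card β = Fintype.card (Mon σ m)) :
    ∃ φ : β → Mon σ m, LinearIndependent k (Sum.elim u fun b => monPoly (φ b)) := by
  classical
  set W := span k (Set.range u)
  obtain ⟨κ, a, ha, hspan, hli⟩ := exists_linearIndependent' k
    (fun d : Mon σ m => W.mkQ (monPoly d))
  let _ : Fintype κ := Fintype.ofInjective a ha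
  have hind : LinearIndependent k (Sum.elim u fun i => monPoly (a i)) := by
    have h1 : LinearIndependent k (fun i => (⟨u i, subset_span ⟨i, rfl⟩⟩ : W)) :=
      LinearIndependent.of_comp W.subtype hu
    exact h1.sumElim_of_quotient (fun i => monPoly (a i)) hli
  have hsp : span k (Set.range (Sum.elim u fun i => monPoly (a i)))
      = span k (Set.range (monPoly : Mon σ m → MvPolynomial σ k)) := by
    refine le_antisymm (span_le.2 ?_) (span_le.2 ?_)
    · rintro _ ⟨i | i, rfl⟩
      · exact mem_span_monPoly (hdeg i)
      · exact subset_span ⟨a i, rfl⟩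
    · rintro _ ⟨d, rfl⟩
      have h1 : W.mkQ (monPoly d) ∈ span k (Set.range ((fun d : Mon σ m => W.mkQ (monPoly d)) ∘ a))
          := by rw [hspan]; exact subset_span ⟨d, rfl⟩
      have h2 : (Set.range ((fun d : Mon σ m => W.mkQ (monPoly d)) ∘ a))
          = W.mkQ '' (Set.range fun i => monPoly (a i)) := by
        rw [← Set.range_comp]; rfl
      rw [h2, ← Submodule.map_span] at h1
      obtain ⟨y, hy, hyd⟩ := h1
      have h3 : monPoly d - y ∈ W := by
        rw [← Submodule.ker_mkQ W, LinearMap.mem_ker, map_sub, hyd, sub_self]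
      rw [Set.Sum.elim_range, span_union]
      have := add_mem (mem_sup_left h3 : _ ∈ W ⊔ span k (Set.range fun i => monPoly (a i)))
        (mem_sup_right hy)
      rwa [sub_add_cancel] at this
  have hc := finrank_span_eq_card hind
  rw [hsp, finrank_span_monPoly, Fintype.card_sum] at hc
  let e : β ≃ κ := Fintype.equivOfCardEq (by omega)
  refine ⟨a ∘ e, ?_⟩
  have := hind.comp (Sum.map id e) (Function.injective_id.sumMap e.injective)
  convert this using 1
  funext i; rcases i with i | i <;> rfl

/-- Changing the complement `v` of the multiples of `P` changes the determinants before and after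
multiplication by `s` by the same factor. -/
theorem exists_detFam_eq_mul {k : Type*} [Field k] {P s : MvPolynomial σ k} {m₁ m₂ k₁ k₂ : ℕ}
    {β γ : Type*} [Fintype β] [Fintype γ] (e₁ : Mon σ k₁ ⊕ β ≃ Mon σ m₁)
    (e₂ : (Mon σ k₂ ⊕ β) ⊕ γ ≃ Mon σ m₂) (hP : P.totalDegree + k₁ ≤ m₁)
    (hs : s.totalDegree + k₁ ≤ k₂) {v v' : β → MvPolynomial σ k}
    (hv : ∀ b, (v b).totalDegree ≤ m₁) (hv' : ∀ b, (v' b).totalDegree ≤ m₁)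
    (rest : γ → MvPolynomial σ k)
    (h : detFam e₁ (Sum.elim (fun d => P * monPoly d) v') ≠ 0) :
    ∃ a : k, detFam e₁ (Sum.elim (fun d => P * monPoly d) v)
        = a * detFam e₁ (Sum.elim (fun d => P * monPoly d) v') ∧
      detFam e₂ (Sum.elim (Sum.elim (fun d => P * monPoly d) fun b => s * v b) rest)
        = a * detFam e₂ (Sum.elim (Sum.elim (fun d => P * monPoly d) fun b => s * v' b) rest) := by
  classical
  have hdeg : ∀ i, (Sum.elim (fun d : Mon σ k₁ => P * monPoly d) v' i).totalDegree ≤ m₁ := by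
    rintro (d | b)
    · exact (MvPolynomial.totalDegree_mul _ _).trans
        ((Nat.add_le_add_left (totalDegree_monPoly_le d) _).trans hP)
    · exact hv' b
  choose x hx using fun b => exists_eq_sum_of_detFam_ne_zero e₁ hdeg h (hv b)
  have hmem : ∀ b, s * ∑ d : Mon σ k₁, x b (Sum.inl d) • monPoly d
      ∈ span k (Set.range (monPoly : Mon σ k₂ → MvPolynomial σ k)) := fun b =>
    mem_span_monPoly ((MvPolynomial.totalDegree_mul _ _).trans
      ((Nat.add_le_add_left (totalDegree_sum_smul_le totalDegree_monPoly_le _) _).trans hs))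
  choose y hy using fun b => (Submodule.mem_span_range_iff_exists_fun k).1 (hmem b)
  let G : Matrix β β k := Matrix.of fun b b' => x b (Sum.inr b')
  let M₁ : Matrix (Mon σ k₁ ⊕ β) (Mon σ k₁ ⊕ β) k :=
    Matrix.fromBlocks 1 0 (Matrix.of fun b d => x b (Sum.inl d)) G
  let M₂ : Matrix ((Mon σ k₂ ⊕ β) ⊕ γ) ((Mon σ k₂ ⊕ β) ⊕ γ) k :=
    Matrix.fromBlocks (Matrix.fromBlocks 1 0 (Matrix.of y) G) 0 0 1
  have hM₁ : M₁.det = G.det := by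
    rw [Matrix.det_fromBlocks_zero₁₂, Matrix.det_one, one_mul]
  have hM₂ : M₂.det = G.det := by
    rw [Matrix.det_fromBlocks_zero₁₂, Matrix.det_fromBlocks_zero₁₂, Matrix.det_one, Matrix.det_one,
      one_mul, mul_one]
  refine ⟨G.det, ?_, ?_⟩
  · rw [← hM₁, ← detFam_linear_combination]
    congr 1
    funext i
    rcases i with d | b
    · simp [M₁, Fintype.sum_sum_type, Matrix.one_apply]
    · simp only [Sum.elim_inr, Fintype.sum_sum_type, Sum.elim_inl, M₁,
        Matrix.fromBlocks_apply₂₁, Matrix.fromBlocks_apply₂₂, Matrix.of_apply, G]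
      rw [hx b, Fintype.sum_sum_type]
      rfl
  · rw [← hM₂, ← detFam_linear_combination]
    congr 1
    funext i
    rcases i with (d | b) | c
    · simp [M₂, Fintype.sum_sum_type, Matrix.one_apply]
    · simp only [Sum.elim_inr, Fintype.sum_sum_type, Sum.elim_inl, M₂,
        Matrix.fromBlocks_apply₂₁, Matrix.fromBlocks_apply₂₂, Matrix.fromBlocks_apply₁₁,
        Matrix.fromBlocks_apply₁₂, Matrix.of_apply, G, Matrix.zero_apply, zero_smul,
        Finset.sum_const_zero, add_zero]
      conv_lhs => rw [hx b, Fintype.sum_sum_type]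
      simp only [Sum.elim_inr, Sum.elim_inl, mul_add, Finset.mul_sum, mul_smul_comm]
      congr 1
      have h1 := hy b
      have h2 := congrArg (P * ·) h1
      simp only [Finset.mul_sum, mul_smul_comm] at h2
      rw [h2]
      refine Finset.sum_congr rfl fun d _ => ?_
      rw [mul_left_comm]
    · simp [M₂, Fintype.sum_sum_type, Matrix.one_apply]

end DeterminantFamily

/-! ### The nonarchimedean estimate for determinants -/

section LocalDeterminant

open Submodule

/-- Hadamard's inequality for a nonarchimedean absolute value. -/
theorem abv_det_le {K ι : Type*} [Field K] [Fintype ι] [DecidableEq ι] (w : AbsoluteValue K ℝ)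
    (hw : IsNonarchimedean w) (M : Matrix ι ι K) (r : ι → ℝ) (h : ∀ i j, w (M i j) ≤ r i) :
    w M.det ≤ ∏ i, r i := by
  have hr : ∀ i, 0 ≤ r i := fun i => (w.nonneg _).trans (h i i)
  rw [← Matrix.det_transpose, Matrix.det_apply]
  refine (IsNonarchimedean.apply_sum_le_sup hw ⟨1, Finset.mem_univ _⟩).trans ?_
  refine Finset.sup'_le _ _ fun τ _ => ?_
  have h1 : w (Equiv.Perm.sign τ • ∏ i, M.transpose (τ i) i) = ∏ i, w (M i (τ i)) := by
    rcases Int.units_eq_one_or (Equiv.Perm.sign τ) with h | h <;> rw [h] <;> simp [map_prod]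
  rw [h1]
  exact Finset.prod_le_prod (fun _ _ => w.nonneg _) fun i _ => h i _

variable {R K k : Type*} [CommRing R] [Field K] [Field k] (w : AbsoluteValue K ℝ)
  (hw : IsNonarchimedean w) (ι : R →+* K) (ρ : R →+* k) (hρ : Function.Surjective ρ) {q : ℝ}
  (hq : q ≤ 1) (h1 : ∀ x, ρ x ≠ 0 → w (ι x) = 1) (h0 : ∀ x, ρ x = 0 → w (ι x) ≤ q)

theorem sumExtend_inl {V ι : Type*} [AddCommGroup V] [Module k V] {v : ι → V}
    (hs : LinearIndependent k v) (i : ι) : Module.Basis.sumExtend hs (Sum.inl i) = v i := by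
  simp only [Module.Basis.sumExtend]
  simp
  rfl

theorem detFam_map_elim {σ : Type*} {A : Type*} [CommRing A] (f : R →+* A) {P : MvPolynomial σ R}
    {k₁ m₁ : ℕ} {β : Type*} [Fintype σ] [Fintype β] (e₁ : Mon σ k₁ ⊕ β ≃ Mon σ m₁)
    (φ : β → Mon σ m₁) :
    detFam e₁ (Sum.elim (fun d => MvPolynomial.map f P * monPoly d) fun b => monPoly (φ b))
      = f (detFam e₁ (Sum.elim (fun d => P * monPoly d) fun b => monPoly (φ b))) := by
  rw [← detFam_map]
  congr 1
  funext i
  rcases i with d | b <;> simp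

theorem map_elim_elim {σ : Type*} {A : Type*} [CommRing A] (f : R →+* A) (P s : MvPolynomial σ R)
    {k₂ m₁ m₂ : ℕ} {β γ : Type*} (φ : β → Mon σ m₁) (τ : γ → Mon σ m₂) :
    (fun i => MvPolynomial.map f ((Sum.elim (Sum.elim (fun d : Mon σ k₂ => P * monPoly d)
      fun b => s * monPoly (φ b)) fun c => monPoly (τ c)) i)) = Sum.elim (Sum.elim
      (fun d => MvPolynomial.map f P * monPoly d) fun b => MvPolynomial.map f s * monPoly (φ b))
      fun c => monPoly (τ c) := by
  funext i
  rcases i with (d | b) | c <;> simp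

include hw hρ hq h1 h0

/-- A matrix of integers whose reduction has a left kernel of dimension at least `t` has a
determinant of absolute value at most `q ^ t`. -/
theorem abv_det_le_pow {η : Type*} [Fintype η] [DecidableEq η] (A : Matrix η η R)
    (W : Submodule k (η → k)) (hW : ∀ x ∈ W, Matrix.vecMul x (A.map ρ) = 0) {t : ℕ}
    (ht : t ≤ Module.finrank k W) : w (ι A.det) ≤ q ^ t := by
  classical
  have hle1 : ∀ x, w (ι x) ≤ 1 := fun x => by
    by_cases hx : ρ x = 0
    · exact (h0 x hx).trans hq
    · exact (h1 x hx).le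
  have hq0 : 0 ≤ q := (w.nonneg _).trans (h0 0 (map_zero _))
  let b : Fin (Module.finrank k W) → (η → k) := fun i => (Module.finBasis k W i : η → k)
  have hb : LinearIndependent k b :=
    (Module.finBasis k W).linearIndependent.map' W.subtype (Submodule.ker_subtype W)
  let Bs := Module.Basis.sumExtend hb
  let e := (Pi.basisFun k η).indexEquiv Bs
  have hBs : ∀ i, Bs (Sum.inl i) = b i := fun i => sumExtend_inl hb i
  choose L hL using hρ
  let B : Matrix η η R := Matrix.of fun i j => L (Bs (e i) j)
  have hBρ : ∀ i, (B.map ρ) i = Bs (e i) := fun i => by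
    funext j; simp [B, hL]
  have hdet : ρ B.det ≠ 0 := by
    rw [RingHom.map_det]
    have : LinearIndependent k (fun i => (B.map ρ) i) := by
      rw [funext hBρ]
      exact Bs.linearIndependent.comp e e.injective
    have h2 := (Matrix.linearIndependent_rows_iff_isUnit).1 this
    rw [Matrix.isUnit_iff_isUnit_det] at h2
    exact h2.ne_zero
  let r : η → ℝ := fun i => Sum.elim (fun _ => q) (fun _ => 1) (e i)
  have hmain : w (ι (B * A).det) ≤ ∏ i, r i := by
    rw [RingHom.map_det]
    refine abv_det_le w hw _ r fun i j => ?_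
    simp only [RingHom.mapMatrix_apply, Matrix.map_apply, r]
    rcases he : e i with a | a
    · simp only [Sum.elim_inl]
      apply h0
      have h3 := congrFun (hW (b a) (Module.finBasis k W a).2) j
      have h4 : ρ ((B * A) i j) = Matrix.vecMul ((B.map ρ) i) (A.map ρ) j := by
        simp [Matrix.mul_apply, Matrix.vecMul, dotProduct]
      rw [h4, hBρ, he, hBs]
      exact h3
    · exact hle1 _
  rw [Matrix.det_mul, map_mul, map_mul, h1 _ hdet, one_mul] at hmain
  refine hmain.trans ?_
  have : Finite (Module.Basis.sumExtendIndex hb) :=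
    Finite.of_injective (fun x => e.symm (Sum.inr x)) fun x y h => Sum.inr_injective (e.symm.injective h)
  let _ : Fintype (Module.Basis.sumExtendIndex hb) := Fintype.ofFinite _
  have : ∏ i, r i = q ^ Module.finrank k W := by
    rw [e.prod_comp (Sum.elim (fun _ => q) (fun _ => (1 : ℝ))), Fintype.prod_sum_type]
    simp
  rw [this]
  exact pow_le_pow_of_le_one hq0 hq ht

/-- If the reductions of `P` and `s` have the common factor `g ^ μ`, then multiplication by `s`
modulo the multiples of `P` degenerates. It kills the products of `P / g ^ μ` with the polynomials
`p` of degree at most `k₁ + μ`, and such a product is itself a multiple of `P` only if `g ^ μ`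
divides `p`, which leaves at most the polynomials of degree `k₁` as cofactors. The determinant
therefore gains the power of `q` given by the difference of the two dimensions. -/
theorem abv_detFam_le {σ : Type*} [Fintype σ] {P s : MvPolynomial σ R} {g : MvPolynomial σ k}
    {D D₁ μ k₁ m₁ k₂ m₂ : ℕ} (hm₁ : m₁ = k₁ + D) (hk₂ : k₂ = k₁ + D₁) (hm₂ : m₂ = k₁ + D + D₁)
    (hP0 : MvPolynomial.map ρ P ≠ 0)
    (hP : P.totalDegree ≤ D) (hs : s.totalDegree ≤ D₁) (hg : μ ≤ (g ^ μ).totalDegree)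
    (hgP : g ^ μ ∣ MvPolynomial.map ρ P) (hgs : g ^ μ ∣ MvPolynomial.map ρ s)
    {β γ : Type*} [Fintype β] [Fintype γ] (e₁ : Mon σ k₁ ⊕ β ≃ Mon σ m₁)
    (e₂ : (Mon σ k₂ ⊕ β) ⊕ γ ≃ Mon σ m₂) {v : β → MvPolynomial σ K}
    (hv : ∀ b, (v b).totalDegree ≤ m₁) (τ : γ → Mon σ m₂) :
    w (detFam e₂ (Sum.elim (Sum.elim (fun d => MvPolynomial.map ι P * monPoly d)
        fun b => MvPolynomial.map ι s * v b) fun c => monPoly (τ c)))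
      ≤ w (detFam e₁ (Sum.elim (fun d => MvPolynomial.map ι P * monPoly d) v)) *
        q ^ (Fintype.card (Mon σ (k₁ + μ)) - Fintype.card (Mon σ k₁)) := by
  classical
  subst hm₁ hk₂ hm₂
  set P' := MvPolynomial.map ρ P with hP'
  set s' := MvPolynomial.map ρ s with hs'
  have hP'd : P'.totalDegree ≤ D := (totalDegree_map_le _ _).trans hP
  have hs'd : s'.totalDegree ≤ D₁ := (totalDegree_map_le _ _).trans hs
  have hdegP : ∀ d : Mon σ k₁, (P' * monPoly d).totalDegree ≤ k₁ + D := fun d =>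
    (MvPolynomial.totalDegree_mul _ _).trans
      ((Nat.add_le_add hP'd (totalDegree_monPoly_le d)).trans (by omega))
  -- A complement by monomials chosen modulo the maximal ideal has a unit as determinant, and the
  -- general case differs from it by a common factor.
  obtain ⟨φ, hφ⟩ := exists_monomial_complement (β := β) (linearIndependent_mul_monPoly hP0 k₁) hdegP
    (by rw [← Fintype.card_sum]; exact Fintype.card_congr e₁)
  have hFdeg : ∀ i, (Sum.elim (fun d : Mon σ k₁ => P' * monPoly d)
      (fun b => monPoly (φ b)) i).totalDegree ≤ k₁ + D := by
    rintro (d | b)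
    · exact hdegP d
    · exact totalDegree_monPoly_le _
  have hc := detFam_ne_zero e₁ hFdeg hφ
  rw [detFam_map_elim ρ] at hc
  have hc1 := h1 _ hc
  rw [← detFam_map_elim ι] at hc1
  obtain ⟨a, ha₁, ha₂⟩ := exists_detFam_eq_mul (P := MvPolynomial.map ι P)
    (s := MvPolynomial.map ι s) e₁ e₂
    (by have := (totalDegree_map_le ι P).trans hP; omega)
    (by have := (totalDegree_map_le ι s).trans hs; omega) hv
    (v' := fun b => monPoly (φ b)) (fun b => totalDegree_monPoly_le _)
    (fun c => monPoly (τ c)) (by intro h; rw [h, map_zero] at hc1; exact zero_ne_one hc1)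
  rw [ha₁, ha₂, map_mul, map_mul, hc1, mul_one]
  refine mul_le_mul_of_nonneg_left ?_ (w.nonneg _)
  let F : (Mon σ (k₁ + D₁) ⊕ β) ⊕ γ → MvPolynomial σ R := Sum.elim (Sum.elim
    (fun d => P * monPoly d) fun b => s * monPoly (φ b)) fun c => monPoly (τ c)
  rw [← map_elim_elim ι, detFam_map, detFam_eq]
  obtain ⟨P'', hP''⟩ := hgP
  obtain ⟨s'', hs''⟩ := hgs
  have hG0 : g ^ μ ≠ 0 := fun h => hP0 (by rw [hP'', h, zero_mul])
  have hP''0 : P'' ≠ 0 := fun h => hP0 (by rw [hP'', h, mul_zero])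
  have hdP : P''.totalDegree + μ ≤ D := by
    have := MvPolynomial.totalDegree_mul_of_isDomain hG0 hP''0
    rw [← hP''] at this
    omega
  have hds : s''.totalDegree + μ ≤ D₁ ∨ s'' = 0 := by
    by_cases h0 : s'' = 0
    · exact Or.inr h0
    · left
      have := MvPolynomial.totalDegree_mul_of_isDomain hG0 h0
      rw [← hs''] at this
      omega
  have hSk : ∀ p : span k (Set.range (monPoly : Mon σ (k₁ + μ) → MvPolynomial σ k)),
      (P'' * p.1).totalDegree ≤ k₁ + D := fun p => by
    have := totalDegree_le_of_mem_span p.2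
    have h2 := MvPolynomial.totalDegree_mul P'' p.1
    omega
  have hbasis : span k (Set.range (Sum.elim (fun d : Mon σ k₁ => P' * monPoly d)
      fun b => monPoly (φ b))) = span k (Set.range (monPoly : Mon σ (k₁ + D) → MvPolynomial σ k)) := by
    refine le_antisymm (span_le.2 ?_) (span_le.2 ?_)
    · rintro _ ⟨i, rfl⟩
      exact mem_span_monPoly (hFdeg i)
    · rintro _ ⟨d, rfl⟩
      obtain ⟨x, hx⟩ := exists_eq_sum_of_detFam_ne_zero e₁ hFdeg
        (detFam_ne_zero e₁ hFdeg hφ) (totalDegree_monPoly_le d)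
      rw [SetLike.mem_coe, hx]
      exact sum_mem fun i _ => smul_mem _ _ (subset_span ⟨i, rfl⟩)
  have hfin : ∀ m, Module.Finite k (span k (Set.range (monPoly : Mon σ m → MvPolynomial σ k))) :=
    fun m => FiniteDimensional.span_of_finite k (Set.finite_range _)
  have := hfin (k₁ + μ)
  have := hfin k₁
  let S := span k (Set.range (monPoly : Mon σ (k₁ + μ) → MvPolynomial σ k))
  let T := span k (Set.range (Sum.elim (fun d : Mon σ k₁ => P' * monPoly d)
      fun b => monPoly (φ b)))
  let mulS : S →ₗ[k] T := ((LinearMap.mulLeft k P'').domRestrict S).codRestrict T fun p => by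
    have := mem_span_monPoly (hSk p)
    rw [← hbasis] at this
    exact this
  -- the coordinates of `P'' p` along the complement of the multiples of `P'`
  let Lb : S →ₗ[k] (β → k) := LinearMap.pi fun b =>
    ((Finsupp.lapply (Sum.inr b)).comp hφ.repr).comp mulS
  have hLb : ∀ p : S, P'' * p.1 = P' * (∑ d, (hφ.repr (mulS p)) (Sum.inl d) • monPoly d)
      + ∑ b, Lb p b • monPoly (φ b) := by
    intro p
    have := hφ.linearCombination_repr (mulS p)
    rw [Finsupp.linearCombination_apply, Finsupp.sum_fintype (hφ.repr (mulS p)) (fun i a => a •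
      (Sum.elim (fun d : Mon σ k₁ => P' * monPoly d) (fun b => monPoly (φ b)) i)) (by simp),
      Fintype.sum_sum_type] at this
    simp only [Sum.elim_inl, Sum.elim_inr] at this
    rw [Finset.mul_sum]
    simp only [mul_smul_comm]
    exact this.symm
  have hLb0 : ∀ p : S, Lb p = 0 → p.1 ∈ (span k (Set.range
      (monPoly : Mon σ k₁ → MvPolynomial σ k))).map (LinearMap.mulLeft k (g ^ μ)) := by
    intro p hp
    have h := (hLb p).trans (congrArg (· * _ + _) hP'')
    rw [hp, mul_assoc, mul_left_comm] at h
    simp only [Pi.zero_apply, zero_smul, Finset.sum_const_zero, add_zero] at h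
    exact ⟨_, sum_mem fun d _ => smul_mem _ _ (subset_span ⟨d, rfl⟩),
      (mul_left_cancel₀ hP''0 h).symm⟩
  let W : Submodule k (((Mon σ (k₁ + D₁) ⊕ β) ⊕ γ) → k) := LinearMap.ker (Matrix.vecMulLinear
    ((Matrix.of fun i j => (F i).coeff (e₂ j).1).map ρ))
  -- With `P' = g ^ μ P''` and `s' = g ^ μ s''`, the identity `s' P'' p = P' s'' p` is a relation
  -- among the rows of the reduced matrix.
  have hrel : ∀ p : S, ∃ y : Mon σ (k₁ + D₁) → k,
      (Sum.elim (Sum.elim y (Lb p)) 0 : ((Mon σ (k₁ + D₁) ⊕ β) ⊕ γ) → k) ∈ W := by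
    intro p
    set a := ∑ d, (hφ.repr (mulS p)) (Sum.inl d) • (monPoly d : MvPolynomial σ k) with ha
    have hdeg : (s' * a - s'' * p.1).totalDegree ≤ k₁ + D₁ := by
      refine (MvPolynomial.totalDegree_sub _ _).trans (max_le ?_ ?_)
      · have h2 := MvPolynomial.totalDegree_mul s' a
        have h3 := totalDegree_sum_smul_le (F := fun d : Mon σ k₁ => (monPoly d : MvPolynomial σ k))
          totalDegree_monPoly_le (fun d => (hφ.repr (mulS p)) (Sum.inl d))
        rw [← ha] at h3
        omega
      · rcases hds with h | h
        · have := totalDegree_le_of_mem_span p.2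
          have h2 := MvPolynomial.totalDegree_mul s'' p.1
          omega
        · rw [h, zero_mul]; simp
    obtain ⟨y, hy⟩ := (Submodule.mem_span_range_iff_exists_fun k).1 (mem_span_monPoly hdeg)
    refine ⟨y, ?_⟩
    rw [LinearMap.mem_ker, Matrix.vecMulLinear_apply]
    funext j
    have hz : P' * (∑ d, y d • monPoly d) + s' * ∑ b, Lb p b • monPoly (φ b) = 0 := by
      have h2 : ∑ b, Lb p b • monPoly (φ b) = P'' * p.1 - P' * a := by rw [hLb p]; ring
      rw [hy, h2, hP'', hs'']; ring
    have h3 := congrArg (MvPolynomial.coeff (e₂ j).1) hz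
    have h4 : ∀ i, ((Matrix.of fun i j => (F i).coeff (e₂ j).1).map ρ) i j
        = (MvPolynomial.map ρ (F i)).coeff (e₂ j).1 := fun i => by
      simp [MvPolynomial.coeff_map]
    simp only [Matrix.vecMul, dotProduct, h4, Pi.zero_apply]
    have h5 : ∀ i, MvPolynomial.map ρ (F i) = _ :=
      congrFun (map_elim_elim (k₂ := k₁ + D₁) ρ P s φ τ)
    simp only [h5, Fintype.sum_sum_type, Sum.elim_inl, Sum.elim_inr, Pi.zero_apply, zero_mul,
      Finset.sum_const_zero, add_zero]
    rw [MvPolynomial.coeff_zero, MvPolynomial.coeff_add, Finset.mul_sum, Finset.mul_sum,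
      MvPolynomial.coeff_sum, MvPolynomial.coeff_sum] at h3
    simpa only [mul_smul_comm, MvPolynomial.coeff_smul, smul_eq_mul] using h3
  refine abv_det_le_pow w hw ι ρ hρ hq h1 h0 _ W (fun x hx => LinearMap.mem_ker.1 hx) ?_
  -- The kernel of `Lb` consists of multiples of `g ^ μ`, which gives the lower bound for the rank.
  let pr : W →ₗ[k] (β → k) := (LinearMap.funLeft k k (fun b => Sum.inl (Sum.inr b))).comp W.subtype
  have hrange : LinearMap.range Lb ≤ LinearMap.range pr := by
    rintro _ ⟨p, rfl⟩
    obtain ⟨y, hy⟩ := hrel p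
    exact ⟨⟨_, hy⟩, rfl⟩
  have hS : Module.Finite k S := hfin _
  have hr1 := Submodule.finrank_mono hrange
  have hr2 := LinearMap.finrank_range_le pr
  have hr3 := LinearMap.finrank_range_add_finrank_ker Lb
  have hr4 : Module.finrank k S = Fintype.card (Mon σ (k₁ + μ)) := finrank_span_monPoly k _
  have hr5 : Module.finrank k (LinearMap.ker Lb) ≤ Fintype.card (Mon σ k₁) := by
    rw [← finrank_span_monPoly (σ := σ) k k₁]
    have h2 : (LinearMap.ker Lb).map S.subtype ≤ (span k (Set.range
      (monPoly : Mon σ k₁ → MvPolynomial σ k))).map (LinearMap.mulLeft k (g ^ μ)) := by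
      rintro _ ⟨p, hp, rfl⟩
      exact hLb0 p hp
    have h3 := Submodule.finrank_mono h2
    rw [← (Submodule.equivMapOfInjective S.subtype S.subtype_injective _).finrank_eq] at h3
    exact h3.trans (Submodule.finrank_map_le _ _)
  omega

end LocalDeterminant

/-! ### Finite places, primitive reductions and heights -/

section FinitePlaces

open IsDedekindDomain

variable {K : Type*} [Field K] [NumberField K] (v : HeightOneSpectrum (𝓞 K))

/-- The normalised absolute value of `K` at a maximal ideal of `𝓞 K`. -/
def absV : AbsoluteValue K ℝ := NumberField.HeightOneSpectrum.adicAbv K v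

/-- The residue field at a maximal ideal of `𝓞 K`. -/
abbrev ResV : Type _ := 𝓞 K ⧸ v.asIdeal

instance instFieldResV : Field (ResV v) :=
  letI := v.isMaximal
  Ideal.Quotient.field v.asIdeal

/-- The number of elements of the residue field. -/
def normV : ℝ := Nat.card (𝓞 K ⧸ v.asIdeal)

theorem normV_eq : normV v = (Ideal.absNorm v.asIdeal : ℝ) := by
  rw [normV, Ideal.absNorm_apply, Submodule.cardQuot_apply]

theorem one_lt_normV : 1 < normV v := by
  rw [normV_eq]
  exact_mod_cast NumberField.HeightOneSpectrum.one_lt_absNorm v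

theorem isNonarchimedean_absV : IsNonarchimedean (absV v) :=
  NumberField.HeightOneSpectrum.isNonarchimedean_adicAbv K v

theorem absV_coe_le_one (x : 𝓞 K) : absV v (algebraMap (𝓞 K) K x) ≤ 1 := by
  rw [absV, ← FinitePlace.norm_embedding]
  exact FinitePlace.norm_le_one K v x

theorem absV_coe_eq_one (x : 𝓞 K) (hx : Ideal.Quotient.mk v.asIdeal x ≠ 0) :
    absV v (algebraMap (𝓞 K) K x) = 1 := by
  rw [absV, ← FinitePlace.norm_embedding]
  exact (FinitePlace.norm_eq_one_iff_notMem K v x).2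
    fun h => hx (Ideal.Quotient.eq_zero_iff_mem.2 h)

theorem absV_coe_le_inv (x : 𝓞 K) (hx : Ideal.Quotient.mk v.asIdeal x = 0) :
    absV v (algebraMap (𝓞 K) K x) ≤ (normV v)⁻¹ := by
  rw [Ideal.Quotient.eq_zero_iff_mem] at hx
  have hN := one_lt_normV v
  by_cases hx0 : x = 0
  · rw [hx0, map_zero, map_zero]; positivity
  have h := NumberField.HeightOneSpectrum.embedding_mul_absNorm K v hx0
  rw [FinitePlace.norm_embedding, HeightOneSpectrum.maxPowDividing, map_pow] at h
  set n := (Associates.mk v.asIdeal).count (Associates.mk (Ideal.span {x})).factors with hn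
  have hn1 : 1 ≤ n := by
    have := (HeightOneSpectrum.intValuation_le_pow_iff_mem v x 1).2 (by simpa using hx)
    rw [HeightOneSpectrum.intValuation_if_neg v hx0, ← hn, WithZero.exp_le_exp] at this
    push_cast at this
    omega
  push_cast at h
  rw [← normV_eq] at h
  have h2 : absV v (algebraMap (𝓞 K) K x) = (normV v ^ n)⁻¹ := eq_inv_of_mul_eq_one_left h
  rw [h2]
  exact inv_anti₀ (by linarith) (le_self_pow₀ hN.le (by omega))

theorem exists_den (x : K) (hx : absV v x ≤ 1) : ∃ d n : 𝓞 K, d ∉ v.asIdeal ∧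
    algebraMap (𝓞 K) K d * x = algebraMap (𝓞 K) K n := by
  have h : v.valuation K x ≤ 1 := by
    rw [absV, NumberField.HeightOneSpectrum.adicAbv_def] at hx
    exact (WithZeroMulInt.toNNReal_le_one_iff
      (NumberField.HeightOneSpectrum.one_lt_absNorm_nnreal v)).1 (by exact_mod_cast hx)
  obtain ⟨n, d, hnd⟩ := HeightOneSpectrum.exists_primeCompl_mul_eq_of_integer v x h
  exact ⟨d.1, n, d.2, by rw [mul_comm, hnd]⟩

theorem exists_common_den (F : Finset K) (hF : ∀ x ∈ F, absV v x ≤ 1) : ∃ d : 𝓞 K,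
    d ∉ v.asIdeal ∧ ∀ x ∈ F, ∃ n : 𝓞 K, algebraMap (𝓞 K) K d * x = algebraMap (𝓞 K) K n := by
  classical
  induction F using Finset.induction with
  | empty => exact ⟨1, v.asIdeal.ne_top_iff_one.1 v.isPrime.ne_top, by simp⟩
  | insert x F _ ih =>
    obtain ⟨d, hd, hdF⟩ := ih fun y hy => hF y (Finset.mem_insert_of_mem hy)
    obtain ⟨d', n', hd', hn'⟩ := exists_den v x (hF x (Finset.mem_insert_self _ _))
    refine ⟨d * d', fun h => (v.isPrime.mem_or_mem h).elim hd hd', fun y hy => ?_⟩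
    rcases Finset.mem_insert.1 hy with rfl | hy
    · exact ⟨d * n', by rw [map_mul, mul_assoc, hn', map_mul]⟩
    · obtain ⟨n, hn⟩ := hdF y hy
      exact ⟨d' * n, by rw [map_mul, mul_right_comm, hn, map_mul, mul_comm]⟩

theorem finite_absV_ne_one {x : K} (hx : x ≠ 0) : {v | absV v x ≠ 1}.Finite := by
  have h := FinitePlace.hasFiniteMulSupport hx
  refine (h.image FinitePlace.equivHeightOneSpectrum).subset fun v hv => ?_
  refine ⟨FinitePlace.mk v, ?_, FinitePlace.maximalIdeal_mk v⟩
  rw [Function.mem_mulSupport, FinitePlace.mk_apply, FinitePlace.norm_embedding]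
  exact hv

/-- The product formula, in logarithmic form. -/
theorem sum_log_eq_zero {x : K} (hx : x ≠ 0) :
    (∑ φ : K →+* ℂ, Real.log ‖φ x‖) + ∑ᶠ v : HeightOneSpectrum (𝓞 K), Real.log (absV v x) = 0 := by
  classical
  have h := NumberField.prod_abs_eq_one hx
  have h1 : ∏ w : InfinitePlace K, w x ^ w.mult = ∏ φ : K →+* ℂ, ‖φ x‖ := by
    rw [NumberField.InfinitePlace.prod_eq_abs_norm]
    have h2 := congrArg norm (Algebra.norm_eq_prod_embeddings ℚ ℂ x)
    rw [norm_prod, ← Fintype.prod_equiv (RingHom.equivRatAlgHom (R := K) (S := ℂ))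
      (fun f => ‖f x‖) (fun φ => ‖φ x‖) fun _ => by simp [RingHom.equivRatAlgHom_apply]] at h2
    rw [← h2]
    simp
  have h3 : ∏ᶠ w : FinitePlace K, w x = ∏ᶠ v : HeightOneSpectrum (𝓞 K), absV v x := by
    rw [← finprod_comp_equiv FinitePlace.equivHeightOneSpectrum.symm]
    refine finprod_congr fun v => ?_
    rw [FinitePlace.equivHeightOneSpectrum_symm_apply, FinitePlace.norm_embedding]
    rfl
  rw [h1, h3] at h
  have hfin := finite_absV_ne_one hx
  rw [finprod_eq_prod_of_mulSupport_subset (s := hfin.toFinset) _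
    (fun v hv => by simpa using hv)] at h
  rw [finsum_eq_sum_of_support_subset (s := hfin.toFinset) _ (fun v hv => by
    rw [Set.Finite.coe_toFinset]
    intro h1
    exact hv (by simp only [h1, Real.log_one]))]
  have hφ : ∀ φ : K →+* ℂ, ‖φ x‖ ≠ 0 := fun φ => by simpa using hx
  have hv : ∀ v : HeightOneSpectrum (𝓞 K), absV v x ≠ 0 := fun v => (absV v).ne_zero hx
  rw [← Real.log_prod fun φ _ => hφ φ, ← Real.log_prod fun v _ => hv v, ← Real.log_mul
    (Finset.prod_ne_zero_iff.2 fun φ _ => hφ φ) (Finset.prod_ne_zero_iff.2 fun v _ => hv v), h,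
    Real.log_one]

variable {σ : Type*}

/-- The Gauss norm of a polynomial at a maximal ideal. -/
def gaussV (Q : MvPolynomial σ K) : ℝ := ⨆ d : Q.support, absV v (Q.coeff d)

theorem absV_coeff_le_gaussV (Q : MvPolynomial σ K) (d : σ →₀ ℕ) :
    absV v (Q.coeff d) ≤ gaussV v Q := by
  by_cases hd : d ∈ Q.support
  · exact le_ciSup (f := fun d : Q.support => absV v (Q.coeff d)) (Set.finite_range _).bddAbove
      ⟨d, hd⟩
  · rw [MvPolynomial.notMem_support_iff.1 hd, map_zero]
    exact Real.iSup_nonneg fun d => (absV v).nonneg _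

theorem exists_gaussV_eq {Q : MvPolynomial σ K} (hQ : Q ≠ 0) :
    ∃ d ∈ Q.support, gaussV v Q = absV v (Q.coeff d) := by
  have : Nonempty Q.support := (MvPolynomial.support_nonempty.2 hQ).to_subtype
  obtain ⟨d, hd⟩ := exists_eq_ciSup_of_finite (f := fun d : Q.support => absV v (Q.coeff d))
  exact ⟨d, d.2, hd.symm⟩

theorem gaussV_pos {Q : MvPolynomial σ K} (hQ : Q ≠ 0) : 0 < gaussV v Q := by
  obtain ⟨d, hd, h⟩ := exists_gaussV_eq v hQ
  rw [h]
  exact (absV v).pos (MvPolynomial.mem_support_iff.1 hd)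

theorem finite_gaussV_ne_one {Q : MvPolynomial σ K} (hQ : Q ≠ 0) :
    {v | gaussV v Q ≠ 1}.Finite := by
  have h : (⋃ d ∈ Q.support, {v : HeightOneSpectrum (𝓞 K) | absV v (Q.coeff d) ≠ 1}).Finite :=
    Set.Finite.biUnion Q.support.finite_toSet fun d hd =>
      finite_absV_ne_one (MvPolynomial.mem_support_iff.1 hd)
  refine h.subset fun v hv => ?_
  obtain ⟨d, hd, hd'⟩ := exists_gaussV_eq v hQ
  simp only [Set.mem_iUnion]
  refine ⟨d, hd, ?_⟩
  simp only [Set.mem_ofPred_eq] at hv ⊢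
  rwa [← hd']

/-- Reduction modulo a maximal ideal of polynomials with integral coefficients. -/
abbrev redMap : MvPolynomial σ (𝓞 K) →+* MvPolynomial σ (ResV v) :=
  MvPolynomial.map (Ideal.Quotient.mk v.asIdeal)

/-- Extension of scalars from `𝓞 K` to `K`. -/
abbrev intMap : MvPolynomial σ (𝓞 K) →+* MvPolynomial σ K :=
  MvPolynomial.map (algebraMap (𝓞 K) K)

omit v [NumberField K] in
theorem injective_intMap : Function.Injective (intMap : MvPolynomial σ (𝓞 K) →+* MvPolynomial σ K) :=
  MvPolynomial.map_injective _ (FaithfulSMul.algebraMap_injective _ _)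

/-- A polynomial whose coefficients are integral at `v` becomes integral after multiplication by
an integer prime to `v`. -/
theorem exists_intMap_eq (Q : MvPolynomial σ K) (h : ∀ d, absV v (Q.coeff d) ≤ 1) :
    ∃ s : 𝓞 K, s ∉ v.asIdeal ∧ ∃ Q' : MvPolynomial σ (𝓞 K),
      intMap Q' = MvPolynomial.C (algebraMap (𝓞 K) K s) * Q := by
  classical
  obtain ⟨s, hs, hsF⟩ := exists_common_den v (Q.support.image fun d => Q.coeff d) (by simp [h])
  refine ⟨s, hs, ?_⟩
  have hn : ∀ d, ∃ n : 𝓞 K, algebraMap (𝓞 K) K s * Q.coeff d = algebraMap (𝓞 K) K n := fun d => by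
    by_cases hd : d ∈ Q.support
    · exact hsF _ (Finset.mem_image_of_mem _ hd)
    · exact ⟨0, by rw [MvPolynomial.notMem_support_iff.1 hd, mul_zero, map_zero]⟩
  choose n hn using hn
  refine ⟨∑ d ∈ Q.support, MvPolynomial.monomial d (n d), ?_⟩
  rw [map_sum]
  conv_rhs => rw [Q.as_sum, Finset.mul_sum]
  refine Finset.sum_congr rfl fun d _ => ?_
  rw [MvPolynomial.map_monomial, MvPolynomial.C_mul_monomial, hn]

/-- A scaling of `Q` which is integral and has a nonzero reduction modulo `v` (or `1` if
`Q = 0`), together with the scaled polynomial. -/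
theorem exists_primitive (Q : MvPolynomial σ K) : ∃ a : K, a ≠ 0 ∧ (Q ≠ 0 →
    ∃ Q' : MvPolynomial σ (𝓞 K), intMap Q' = MvPolynomial.C a * Q ∧ redMap v Q' ≠ 0) := by
  by_cases hQ : Q = 0
  · exact ⟨1, one_ne_zero, fun h => absurd hQ h⟩
  obtain ⟨d, hd, hdQ⟩ := exists_gaussV_eq v hQ
  have hd0 := MvPolynomial.mem_support_iff.1 hd
  have hle : ∀ d', absV v ((MvPolynomial.C (Q.coeff d)⁻¹ * Q).coeff d') ≤ 1 := fun d' => by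
    rw [MvPolynomial.coeff_C_mul, map_mul, map_inv₀, ← hdQ, inv_mul_le_iff₀ (gaussV_pos v hQ),
      mul_one]
    exact absV_coeff_le_gaussV v Q d'
  obtain ⟨s, hs, Q', hQ'⟩ := exists_intMap_eq v _ hle
  have hs0 : s ≠ 0 := fun h => hs (h ▸ zero_mem _)
  refine ⟨algebraMap (𝓞 K) K s * (Q.coeff d)⁻¹, mul_ne_zero (by simpa using hs0)
    (inv_ne_zero hd0), fun _ => ⟨Q', by rw [hQ', MvPolynomial.C_mul, mul_assoc], fun h0 => hs ?_⟩⟩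
  have h1 := congrArg (MvPolynomial.coeff d) hQ'
  rw [MvPolynomial.coeff_C_mul, MvPolynomial.coeff_C_mul, inv_mul_cancel₀ hd0, mul_one,
    MvPolynomial.coeff_map] at h1
  have h2 := FaithfulSMul.algebraMap_injective _ _ h1
  have h3 := congrArg (MvPolynomial.coeff d) h0
  rw [MvPolynomial.coeff_map, h2, MvPolynomial.coeff_zero] at h3
  exact Ideal.Quotient.eq_zero_iff_mem.1 h3

/-- The scaling factor making `Q` primitive at `v`. -/
def primScale (Q : MvPolynomial σ K) : K := (exists_primitive v Q).choose

theorem primScale_ne_zero (Q : MvPolynomial σ K) : primScale v Q ≠ 0 :=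
  (exists_primitive v Q).choose_spec.1

/-- A multiple of `Q` with integral coefficients, not all divisible by `v`. -/
def primLift (Q : MvPolynomial σ K) : MvPolynomial σ (𝓞 K) := by
  classical exact if h : Q ≠ 0 then ((exists_primitive v Q).choose_spec.2 h).choose else 0

theorem intMap_primLift (Q : MvPolynomial σ K) :
    intMap (primLift v Q) = MvPolynomial.C (primScale v Q) * Q := by
  unfold primLift
  split_ifs with h
  · exact ((exists_primitive v Q).choose_spec.2 h).choose_spec.1
  · rw [not_not.1 h, mul_zero, map_zero]

/-- The reduction of `Q` modulo `v`, after a scaling which makes it nonzero. -/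
def red (Q : MvPolynomial σ K) : MvPolynomial σ (ResV v) := redMap v (primLift v Q)

theorem red_ne_zero {Q : MvPolynomial σ K} (hQ : Q ≠ 0) : red v Q ≠ 0 := by
  unfold red primLift
  rw [dif_pos hQ]
  exact ((exists_primitive v Q).choose_spec.2 hQ).choose_spec.2

theorem gaussV_eq_inv {Q : MvPolynomial σ K} {a : K} (ha : a ≠ 0) {Q' : MvPolynomial σ (𝓞 K)}
    (h : intMap Q' = MvPolynomial.C a * Q) (h' : redMap v Q' ≠ 0) :
    gaussV v Q = (absV v a)⁻¹ := by
  have hQ : Q ≠ 0 := by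
    rintro rfl
    rw [mul_zero, ← map_zero (intMap (σ := σ) (K := K))] at h
    exact h' (by rw [injective_intMap h, map_zero])
  have hc : ∀ d, absV v (Q.coeff d)
      = (absV v a)⁻¹ * absV v (algebraMap (𝓞 K) K (Q'.coeff d)) := fun d => by
    have := congrArg (MvPolynomial.coeff d) h
    rw [MvPolynomial.coeff_C_mul, MvPolynomial.coeff_map] at this
    rw [this, map_mul, inv_mul_cancel_left₀ ((absV v).ne_zero ha)]
  have hpos := (absV v).pos ha
  apply le_antisymm
  · obtain ⟨d, -, hd⟩ := exists_gaussV_eq v hQ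
    rw [hd, hc]
    exact mul_le_of_le_one_right (by positivity) (absV_coe_le_one v _)
  · obtain ⟨d, hd⟩ := MvPolynomial.ne_zero_iff.1 h'
    rw [MvPolynomial.coeff_map] at hd
    have := absV_coeff_le_gaussV v Q d
    rwa [hc, absV_coe_eq_one v _ hd, mul_one] at this

theorem gaussV_eq_primScale {Q : MvPolynomial σ K} (hQ : Q ≠ 0) :
    gaussV v Q = (absV v (primScale v Q))⁻¹ :=
  gaussV_eq_inv v (primScale_ne_zero v Q) (intMap_primLift v Q) (red_ne_zero v hQ)

/-- Gauss's lemma: the product of two primitive polynomials is primitive. -/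
theorem gaussV_mul {P Q : MvPolynomial σ K} (hP : P ≠ 0) (hQ : Q ≠ 0) :
    gaussV v (P * Q) = gaussV v P * gaussV v Q := by
  rw [gaussV_eq_primScale v hP, gaussV_eq_primScale v hQ, ← mul_inv, ← map_mul]
  refine gaussV_eq_inv v (Q' := primLift v P * primLift v Q)
    (mul_ne_zero (primScale_ne_zero v P) (primScale_ne_zero v Q)) ?_ ?_
  · rw [map_mul, intMap_primLift, intMap_primLift, MvPolynomial.C_mul]; ring
  · rw [map_mul]; exact mul_ne_zero (red_ne_zero v hP) (red_ne_zero v hQ)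

/-- The reduction of an integral multiple of `Q` is a constant multiple of `red v Q`. -/
theorem exists_redMap_eq {Q : MvPolynomial σ K} {a : K} {Q' : MvPolynomial σ (𝓞 K)}
    (h : intMap Q' = MvPolynomial.C a * Q) : ∃ c, redMap v Q' = MvPolynomial.C c * red v Q := by
  by_cases hQ : Q = 0
  · rw [hQ, mul_zero, ← map_zero (intMap (σ := σ) (K := K))] at h
    exact ⟨0, by rw [injective_intMap h]; simp⟩
  set p := primScale v Q
  have hp : p ≠ 0 := primScale_ne_zero v Q
  have h1 : absV v (a * p⁻¹) ≤ 1 := by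
    obtain ⟨d, -, hd⟩ := exists_gaussV_eq v hQ
    have h2 := congrArg (MvPolynomial.coeff d) h
    rw [MvPolynomial.coeff_C_mul, MvPolynomial.coeff_map] at h2
    rw [map_mul, map_inv₀, ← gaussV_eq_primScale v hQ, hd, ← map_mul, ← h2]
    exact absV_coe_le_one v _
  obtain ⟨s, n, hs, hn⟩ := exists_den v _ h1
  have h3 : MvPolynomial.C s * Q' = MvPolynomial.C n * primLift v Q := by
    apply injective_intMap
    rw [map_mul, map_mul, h, intMap_primLift, MvPolynomial.map_C, MvPolynomial.map_C, ← hn,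
      ← mul_assoc, ← mul_assoc, ← MvPolynomial.C_mul, ← MvPolynomial.C_mul]
    congr 2
    change _ = _ * p
    field_simp
  have h4 := congrArg (redMap v) h3
  rw [map_mul, map_mul, MvPolynomial.map_C, MvPolynomial.map_C] at h4
  have hs' : Ideal.Quotient.mk v.asIdeal s ≠ 0 := fun h => hs (Ideal.Quotient.eq_zero_iff_mem.1 h)
  refine ⟨(Ideal.Quotient.mk v.asIdeal s)⁻¹ * Ideal.Quotient.mk v.asIdeal n, ?_⟩
  change _ = _ * redMap v (primLift v Q)
  rw [MvPolynomial.C_mul, mul_assoc, ← h4, ← mul_assoc, ← MvPolynomial.C_mul,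
    inv_mul_cancel₀ hs', MvPolynomial.C_1, one_mul]

theorem red_mul_associated (P Q : MvPolynomial σ K) :
    Associated (red v (P * Q)) (red v P * red v Q) := by
  by_cases hP : P = 0
  · simp [red, primLift, hP]
  by_cases hQ : Q = 0
  · simp [red, primLift, hQ]
  have h1 : intMap (primLift v P * primLift v Q)
      = MvPolynomial.C (primScale v P * primScale v Q) * (P * Q) := by
    rw [map_mul, intMap_primLift, intMap_primLift, MvPolynomial.C_mul]; ring
  obtain ⟨c, hc⟩ := exists_redMap_eq v h1
  rw [map_mul] at hc
  have hc0 : c ≠ 0 := by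
    rintro rfl
    rw [MvPolynomial.C_0, zero_mul] at hc
    exact mul_ne_zero (red_ne_zero v hP) (red_ne_zero v hQ) hc
  change Associated _ (redMap v (primLift v P) * redMap v (primLift v Q))
  rw [hc]
  exact (associated_unit_mul_left _ _ ((Ne.isUnit hc0).map MvPolynomial.C)).symm

theorem totalDegree_primLift {Q : MvPolynomial σ K} :
    (primLift v Q).totalDegree ≤ Q.totalDegree := by
  have h : (primLift v Q).totalDegree = (intMap (primLift v Q)).totalDegree := by
    rw [MvPolynomial.totalDegree, MvPolynomial.totalDegree,
      MvPolynomial.support_map_of_injective _ (FaithfulSMul.algebraMap_injective _ _)]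
  rw [h, intMap_primLift]
  refine (MvPolynomial.totalDegree_mul _ _).trans ?_
  rw [MvPolynomial.totalDegree_C, zero_add]

/-- The height of a polynomial, with Mahler measures at the archimedean places. -/
def hgt [Fintype σ] (Q : MvPolynomial σ K) : ℝ :=
  (∑ φ : K →+* ℂ, logMahler (MvPolynomial.map φ Q)) +
    ∑ᶠ v : HeightOneSpectrum (𝓞 K), Real.log (gaussV v Q)

omit v in
theorem finite_log_gaussV {Q : MvPolynomial σ K} (hQ : Q ≠ 0) :
    (Function.support fun v : HeightOneSpectrum (𝓞 K) => Real.log (gaussV v Q)).Finite :=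
  (finite_gaussV_ne_one hQ).subset fun v hv h => hv (by
    simp only [h, Real.log_one])

omit v in
theorem finite_log_absV {x : K} (hx : x ≠ 0) :
    (Function.support fun v : HeightOneSpectrum (𝓞 K) => Real.log (absV v x)).Finite :=
  (finite_absV_ne_one hx).subset fun v hv h => hv (by simp only [h, Real.log_one])

omit [NumberField K] v in
theorem map_embedding_ne_zero (φ : K →+* ℂ) {Q : MvPolynomial σ K} (hQ : Q ≠ 0) :
    MvPolynomial.map φ Q ≠ 0 := fun h => hQ (by
  rw [← map_zero (MvPolynomial.map φ)] at h
  exact MvPolynomial.map_injective φ φ.injective h)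

omit v in
theorem hgt_mul [Fintype σ] {P Q : MvPolynomial σ K} (hP : P ≠ 0) (hQ : Q ≠ 0) :
    hgt (P * Q) = hgt P + hgt Q := by
  unfold hgt
  have h1 : ∀ v : HeightOneSpectrum (𝓞 K), Real.log (gaussV v (P * Q))
      = Real.log (gaussV v P) + Real.log (gaussV v Q) := fun v => by
    rw [gaussV_mul v hP hQ, Real.log_mul (gaussV_pos v hP).ne' (gaussV_pos v hQ).ne']
  simp only [h1, map_mul]
  rw [finsum_add_distrib (finite_log_gaussV hP) (finite_log_gaussV hQ)]
  simp only [logMahler_mul (map_embedding_ne_zero _ hP) (map_embedding_ne_zero _ hQ),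
    Finset.sum_add_distrib]
  ring

omit v in
theorem hgt_nonneg [Fintype σ] {Q : MvPolynomial σ K} (hQ : Q ≠ 0) : 0 ≤ hgt Q := by
  obtain ⟨d, hd, h⟩ := exists_log_norm_coeff_le_logMahler Q.support
    (MvPolynomial.support_nonempty.2 hQ)
  have hd0 := MvPolynomial.mem_support_iff.1 hd
  rw [← sum_log_eq_zero hd0]
  unfold hgt
  refine add_le_add (Finset.sum_le_sum fun φ _ => ?_) (finsum_le_finsum'
    (finite_log_absV hd0) (finite_log_gaussV hQ) fun v => ?_)
  · have := h (MvPolynomial.map φ Q) (MvPolynomial.support_map_of_injective _ φ.injective)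
    rwa [MvPolynomial.coeff_map] at this
  · exact Real.log_le_log ((absV v).pos hd0) (absV_coeff_le_gaussV v Q d)

end FinitePlaces

/-! ### Counting monomials -/

section Counting

open Filter Topology

variable (σ : Type*) [Fintype σ]

/-- The number of monomials of degree at most `m`, as a real number. -/
def numMon (m : ℕ) : ℝ := Fintype.card (Mon σ m)

theorem card_mon_succ (m : ℕ) : Fintype.card (Mon σ (m + 1))
    = Fintype.card (Mon σ m) + (Fintype.card σ + (m + 1) - 1).choose (m + 1) := by
  classical
  rw [← Finset.card_univ (α := σ), ← Finset.card_finsuppAntidiag_nat_eq_choose,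
    ← Fintype.card_coe, ← Fintype.card_congr (monSplit (σ := σ) (Nat.le_succ m)), Fintype.card_sum]
  congr 1
  refine Fintype.card_congr ⟨fun d => ⟨d.1.1, ?_⟩, fun d => ⟨⟨d.1, ?_⟩, ?_⟩, fun _ => rfl,
    fun _ => rfl⟩
  · have h1 := d.1.2
    have h2 := d.2
    rw [Finset.mem_finsuppAntidiag]
    refine ⟨?_, Finset.subset_univ _⟩
    rw [← Finsupp.degree_eq_sum]
    omega
  · have := (Finset.mem_finsuppAntidiag.1 d.2).1
    rw [← Finsupp.degree_eq_sum] at this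
    exact this.le
  · have := (Finset.mem_finsuppAntidiag.1 d.2).1
    rw [← Finsupp.degree_eq_sum] at this
    simp only [this]
    omega

theorem numMon_mono {a b : ℕ} (h : a ≤ b) : Fintype.card (Mon σ a) ≤ Fintype.card (Mon σ b) := by
  rw [← Fintype.card_congr (monSplit (σ := σ) h), Fintype.card_sum]
  exact Nat.le_add_right _ _

variable [Nonempty σ]

theorem numMon_layer_pos (m : ℕ) : 0 < numMon σ (m + 1) - numMon σ m := by
  have h : 0 < Fintype.card σ := Fintype.card_pos
  have h2 : 0 < (Fintype.card σ + (m + 1) - 1).choose (m + 1) := Nat.choose_pos (by omega)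
  rw [numMon, numMon, card_mon_succ]
  push_cast
  have : (0 : ℝ) < ((Fintype.card σ + (m + 1) - 1).choose (m + 1) : ℕ) := by exact_mod_cast h2
  linarith

theorem numMon_layer_succ (m : ℕ) : (numMon σ (m + 2) - numMon σ (m + 1)) * (m + 2)
    = (numMon σ (m + 1) - numMon σ m) * (Fintype.card σ + m + 1) := by
  have h : 0 < Fintype.card σ := Fintype.card_pos
  obtain ⟨q, hq⟩ : ∃ q, Fintype.card σ = q + 1 := ⟨_, (Nat.succ_pred_eq_of_pos h).symm⟩
  have h1 : numMon σ (m + 2) - numMon σ (m + 1) = ((q + m + 2).choose (m + 2) : ℕ) := by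
    rw [numMon, numMon, card_mon_succ, hq]
    have : q + 1 + (m + 1 + 1) - 1 = q + m + 2 := by omega
    rw [this]; push_cast; ring
  have h2 : numMon σ (m + 1) - numMon σ m = ((q + m + 1).choose (m + 1) : ℕ) := by
    rw [numMon, numMon, card_mon_succ, hq]
    have : q + 1 + (m + 1) - 1 = q + m + 1 := by omega
    rw [this]; push_cast; ring
  have h3 := Nat.add_one_mul_choose_eq (q + m + 1) (m + 1)
  rw [h1, h2, hq]
  have h4 := congrArg (Nat.cast : ℕ → ℝ) h3
  push_cast at h4 ⊢
  linarith

theorem tendsto_layer_ratio (a : ℕ) : Tendsto (fun m : ℕ =>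
    (numMon σ (m + a + 1) - numMon σ (m + a)) / (numMon σ (m + 1) - numMon σ m)) atTop (𝓝 1) := by
  induction a with
  | zero =>
    refine tendsto_const_nhds.congr fun m => ?_
    rw [add_zero, div_self (numMon_layer_pos σ m).ne']
  | succ a ih =>
    have h1 : Tendsto (fun m : ℕ => (1 : ℝ) + (Fintype.card σ - 1) * (1 / ((m + a + 2 : ℕ) : ℝ)))
        atTop (𝓝 (1 + (Fintype.card σ - 1) * 0)) := by
      refine (Tendsto.const_mul _ ?_).const_add _
      have := (tendsto_one_div_atTop_nhds_zero_nat (𝕜 := ℝ)).comp (tendsto_add_atTop_nat (a + 2))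
      refine this.congr fun m => ?_
      simp [add_assoc]
    have h2 := h1.mul ih
    rw [mul_zero, add_zero, one_mul] at h2
    refine h2.congr fun m => ?_
    have h3 := numMon_layer_succ σ (m + a)
    have h4 : ((m + a + 2 : ℕ) : ℝ) ≠ 0 := by positivity
    have h5 := (numMon_layer_pos σ m).ne'
    rw [show m + (a + 1) + 1 = m + a + 2 by ring, show m + (a + 1) = m + a + 1 by ring]
    push_cast at h3 h4 ⊢
    field_simp
    linear_combination -h3

theorem tendsto_numMon_sub_base (a : ℕ) : Tendsto (fun m : ℕ =>
    (numMon σ (m + a) - numMon σ m) / (numMon σ (m + 1) - numMon σ m)) atTop (𝓝 a) := by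
  induction a with
  | zero => simp
  | succ a ih =>
    have := ih.add (tendsto_layer_ratio σ a)
    push_cast
    refine this.congr fun m => ?_
    rw [← add_div, ← add_assoc]
    congr 1
    ring

/-- The number of monomials is a polynomial in the degree, so differences of its values grow like the
difference of the arguments times the number of monomials of one degree. -/
theorem tendsto_numMon_sub (a b : ℕ) : Tendsto (fun m : ℕ =>
    (numMon σ (m + a) - numMon σ (m + b)) / (numMon σ (m + 1) - numMon σ m)) atTop
    (𝓝 (a - b)) := by
  refine ((tendsto_numMon_sub_base σ a).sub (tendsto_numMon_sub_base σ b)).congr fun m => ?_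
  rw [← sub_div]; congr 1; ring

end Counting

/-! ### The limit of the regularised Mahler measure -/

section RegularisedMahler

open MeasureTheory Filter Topology

theorem tendsto_regMahler {σ : Type*} [Fintype σ] {P : MvPolynomial σ ℂ} (hP : P ≠ 0) :
    Tendsto (fun ε => regMahler P ε) (𝓝[>] 0) (𝓝 (logMahler P)) := by
  have hae := ae_eval_ne_zero hP
  have hI := integrable_log_eval hP
  have hI1 := integrable_log_reg P (ε := 1) one_pos
  have key : Tendsto (fun ε => ∫ x : UnitAddTorus σ,
      Real.log (‖MvPolynomial.eval (circ x) P‖ ^ 2 + ε)) (𝓝[>] 0)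
      (𝓝 (∫ x : UnitAddTorus σ, 2 * Real.log ‖MvPolynomial.eval (circ x) P‖)) := by
    refine tendsto_integral_filter_of_dominated_convergence
      (fun x => |2 * Real.log ‖MvPolynomial.eval (circ x) P‖|
        + |Real.log (‖MvPolynomial.eval (circ x) P‖ ^ 2 + 1)|) ?_ ?_
      ((hI.const_mul 2).abs.add hI1.abs) ?_
    · filter_upwards [self_mem_nhdsWithin] with ε hε
      exact (integrable_log_reg P hε).aestronglyMeasurable
    · filter_upwards [Ioc_mem_nhdsGT (zero_lt_one' ℝ)] with ε hε
      filter_upwards [hae] with x hx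
      have h0 : 0 < ‖MvPolynomial.eval (circ x) P‖ ^ 2 := by positivity
      have hl : 2 * Real.log ‖MvPolynomial.eval (circ x) P‖
          ≤ Real.log (‖MvPolynomial.eval (circ x) P‖ ^ 2 + ε) := by
        have : 2 * Real.log ‖MvPolynomial.eval (circ x) P‖
          = Real.log (‖MvPolynomial.eval (circ x) P‖ ^ 2) := by rw [Real.log_pow]; norm_num
        rw [this]
        exact Real.log_le_log h0 (by linarith [hε.1])
      have hu : Real.log (‖MvPolynomial.eval (circ x) P‖ ^ 2 + ε)
          ≤ Real.log (‖MvPolynomial.eval (circ x) P‖ ^ 2 + 1) :=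
        Real.log_le_log (by linarith [hε.1]) (by linarith [hε.2])
      rw [Real.norm_eq_abs, abs_le]
      constructor
      · have := neg_abs_le (2 * Real.log ‖MvPolynomial.eval (circ x) P‖)
        have := abs_nonneg (Real.log (‖MvPolynomial.eval (circ x) P‖ ^ 2 + 1))
        linarith
      · have := le_abs_self (Real.log (‖MvPolynomial.eval (circ x) P‖ ^ 2 + 1))
        have := abs_nonneg (2 * Real.log ‖MvPolynomial.eval (circ x) P‖)
        linarith
    · filter_upwards [hae] with x hx
      have h0 : 0 < ‖MvPolynomial.eval (circ x) P‖ ^ 2 := by positivity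
      have h1 : 2 * Real.log ‖MvPolynomial.eval (circ x) P‖
          = Real.log (‖MvPolynomial.eval (circ x) P‖ ^ 2 + 0) := by
        rw [add_zero, Real.log_pow]; norm_num
      rw [h1]
      refine Tendsto.log ?_ (by simpa using h0.ne')
      exact (tendsto_id.mono_left nhdsWithin_le_nhds).const_add _
  have := key.const_mul (2⁻¹ : ℝ)
  rw [integral_const_mul, ← mul_assoc, inv_mul_cancel₀ (two_ne_zero), one_mul] at this
  exact this

end RegularisedMahler

/-! ### The local estimate at a finite place -/

section LocalFactor

open IsDedekindDomain

variable {K : Type*} [Field K] [NumberField K] (v : HeightOneSpectrum (𝓞 K)) {σ : Type*}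

/-- The reductions modulo `v` of `P` and of the integral polynomial `a s` have a common divisor
`g ^ μ` of degree at least `μ`. -/
def HasDrop (P s : MvPolynomial σ K) (a : K) (μ : ℕ) : Prop :=
  ∃ (g : MvPolynomial σ (ResV v)) (s' : MvPolynomial σ (𝓞 K)),
    intMap s' = MvPolynomial.C a * s ∧ μ ≤ (g ^ μ).totalDegree ∧ g ^ μ ∣ red v P ∧
      g ^ μ ∣ redMap v s'

omit v [NumberField K] in
theorem totalDegree_le_of_intMap_eq {Q : MvPolynomial σ K} {a : K} {Q' : MvPolynomial σ (𝓞 K)}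
    (h : intMap Q' = MvPolynomial.C a * Q) : Q'.totalDegree ≤ Q.totalDegree := by
  have h1 : Q'.totalDegree = (intMap Q').totalDegree := by
    rw [MvPolynomial.totalDegree, MvPolynomial.totalDegree,
      MvPolynomial.support_map_of_injective _ (FaithfulSMul.algebraMap_injective _ _)]
  rw [h1, h]
  refine (MvPolynomial.totalDegree_mul _ _).trans ?_
  rw [MvPolynomial.totalDegree_C, zero_add]

/-- The local estimate at a finite place for the determinant of multiplication by `s` modulo the
multiples of `P`. -/
theorem absV_detFam_le [Fintype σ] {P s : MvPolynomial σ K} (hP0 : P ≠ 0) {a : K} (ha : a ≠ 0)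
    {D D₁ μ k₁ m₁ k₂ m₂ : ℕ} (hd : HasDrop v P s a μ)
    (hm₁ : m₁ = k₁ + D) (hk₂ : k₂ = k₁ + D₁) (hm₂ : m₂ = k₁ + D + D₁)
    (hP : P.totalDegree ≤ D) (hs : s.totalDegree ≤ D₁)
    {β γ : Type*} [Fintype β] [Fintype γ] (e₁ : Mon σ k₁ ⊕ β ≃ Mon σ m₁)
    (e₂ : (Mon σ k₂ ⊕ β) ⊕ γ ≃ Mon σ m₂) {w : β → MvPolynomial σ K}
    (hw : ∀ b, (w b).totalDegree ≤ m₁) (τ : γ → Mon σ m₂) :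
    absV v (detFam e₂ (Sum.elim (Sum.elim (fun d => P * monPoly d)
        fun b => s * w b) fun c => monPoly (τ c)))
      ≤ absV v (detFam e₁ (Sum.elim (fun d => P * monPoly d) w)) *
        (gaussV v P ^ (Fintype.card (Mon σ k₂) - Fintype.card (Mon σ k₁)) *
        (absV v a)⁻¹ ^ Fintype.card β *
        (normV v)⁻¹ ^ (Fintype.card (Mon σ (k₁ + μ)) - Fintype.card (Mon σ k₁))) := by
  classical
  obtain ⟨g, s', hs', hg, hgP, hgs⟩ := hd
  set p := primScale v P with hp
  have hp0 : p ≠ 0 := primScale_ne_zero v P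
  have hN := one_lt_normV v
  have hlem := abv_detFam_le (absV v) (isNonarchimedean_absV v) (algebraMap (𝓞 K) K)
    (Ideal.Quotient.mk v.asIdeal) Ideal.Quotient.mk_surjective (inv_le_one_of_one_le₀ hN.le)
    (absV_coe_eq_one v) (absV_coe_le_inv v) hm₁ hk₂ hm₂ (P := primLift v P) (s := s')
    (red_ne_zero v hP0) ((totalDegree_primLift v).trans hP)
    ((totalDegree_le_of_intMap_eq hs').trans hs) hg hgP hgs e₁ e₂ hw τ
  change absV v (detFam e₂ (Sum.elim (Sum.elim (fun d => intMap (primLift v P) * monPoly d)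
        fun b => intMap s' * w b) fun c => monPoly (τ c)))
      ≤ absV v (detFam e₁ (Sum.elim (fun d => intMap (primLift v P) * monPoly d) w)) * _ at hlem
  rw [intMap_primLift, hs'] at hlem
  have h1 : (Sum.elim (Sum.elim (fun d : Mon σ k₂ => MvPolynomial.C p * P * monPoly d)
      fun b => MvPolynomial.C a * s * w b) fun c => monPoly (τ c)) = fun i =>
      (Sum.elim (Sum.elim (fun _ => p) (fun _ => a)) (fun _ => 1) i : K) •
      (Sum.elim (Sum.elim (fun d => P * monPoly d) fun b => s * w b)
        (fun c => monPoly (τ c)) i) := by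
    funext i
    rcases i with (d | b) | c <;> simp [MvPolynomial.smul_eq_C_mul, mul_assoc]
  have h2 : (Sum.elim (fun d : Mon σ k₁ => MvPolynomial.C p * P * monPoly d) w) = fun i =>
      (Sum.elim (fun _ => p) (fun _ => 1) i : K) •
      (Sum.elim (fun d => P * monPoly d) w i) := by
    funext i
    rcases i with d | b <;> simp [MvPolynomial.smul_eq_C_mul, mul_assoc]
  rw [h1, h2, detFam_smul, detFam_smul] at hlem
  simp only [Fintype.prod_sum_type, Sum.elim_inl, Sum.elim_inr, Finset.prod_const, Finset.card_univ,
    one_pow, mul_one, map_mul, map_pow] at hlem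
  rw [gaussV_eq_primScale v hP0]
  have hpp := (absV v).pos hp0
  have hap := (absV v).pos ha
  have hcard : Fintype.card (Mon σ k₁) ≤ Fintype.card (Mon σ k₂) :=
    numMon_mono σ (by omega)
  obtain ⟨j, hj⟩ := Nat.exists_eq_add_of_le hcard
  rw [hj, pow_add] at hlem
  rw [hj, Nat.add_sub_cancel_left]
  set X := absV v (detFam e₂ (Sum.elim (Sum.elim (fun d => P * monPoly d)
        fun b => s * w b) fun c => monPoly (τ c)))
  set Y := absV v (detFam e₁ (Sum.elim (fun d => P * monPoly d) w))
  set Z := (normV v)⁻¹ ^ (Fintype.card (Mon σ (k₁ + μ)) - Fintype.card (Mon σ k₁))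
  rw [← hp]
  have hq : 0 < absV v p ^ Fintype.card (Mon σ k₁) * absV v p ^ j * absV v a ^ Fintype.card β := by
    positivity
  refine le_of_mul_le_mul_left (hlem.trans (le_of_eq ?_)) hq
  rw [inv_pow, inv_pow]
  field_simp

end LocalFactor

/-! ### Complements of the multiples of a polynomial -/

section Complement

open Submodule

variable {σ : Type*} [Fintype σ] {k : Type*} [Field k]

theorem card_le_of_linearIndependent {α : Type*} [Fintype α] {m : ℕ} {u : α → MvPolynomial σ k}
    (hu : LinearIndependent k u) (hdeg : ∀ i, (u i).totalDegree ≤ m) :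
    Fintype.card α ≤ Fintype.card (Mon σ m) := by
  have : Module.Finite k (span k (Set.range (monPoly : Mon σ m → MvPolynomial σ k))) :=
    FiniteDimensional.span_of_finite k (Set.finite_range _)
  rw [← finrank_span_monPoly k m, ← finrank_span_eq_card hu]
  refine Submodule.finrank_mono (span_le.2 ?_)
  rintro _ ⟨i, rfl⟩
  exact mem_span_monPoly (hdeg i)

/-- Multiplication by a polynomial prime to `P` preserves independence modulo the multiples of
`P`. -/
theorem linearIndependent_mul_complement {P s : MvPolynomial σ k} (hP : Prime P) (hs : ¬ P ∣ s)
    {k₁ : ℕ} {β : Type*} [Fintype β] {w : β → MvPolynomial σ k}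
    (hw : ∀ b, (w b).totalDegree ≤ k₁ + P.totalDegree)
    (h : LinearIndependent k (Sum.elim (fun d : Mon σ k₁ => P * monPoly d) w)) (k₂ : ℕ) :
    LinearIndependent k (Sum.elim (fun d : Mon σ k₂ => P * monPoly d) fun b => s * w b) := by
  rw [Fintype.linearIndependent_iff] at h ⊢
  intro x hx
  rw [Fintype.sum_sum_type] at hx
  simp only [Sum.elim_inl, Sum.elim_inr] at hx
  simp only [← mul_smul_comm, ← Finset.mul_sum] at hx
  set V := ∑ b, x (Sum.inr b) • w b with hV
  have hdvd : P ∣ s * V := ⟨-∑ d, x (Sum.inl d) • monPoly d, by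
    rw [mul_neg]
    exact eq_neg_of_add_eq_zero_right hx⟩
  obtain ⟨q, hq⟩ := (hP.dvd_or_dvd hdvd).resolve_left hs
  have hqd : q.totalDegree ≤ k₁ := by
    by_cases hq0 : q = 0
    · rw [hq0]; simp
    · have h1 := MvPolynomial.totalDegree_mul_of_isDomain hP.ne_zero hq0
      have h2 := totalDegree_sum_smul_le hw (fun b => x (Sum.inr b))
      rw [← hV, hq, h1] at h2
      omega
  obtain ⟨y, hy⟩ := (Submodule.mem_span_range_iff_exists_fun k).1 (mem_span_monPoly hqd)
  have hb := h (Sum.elim (-y) fun b => x (Sum.inr b)) (by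
    rw [Fintype.sum_sum_type]
    simp only [Sum.elim_inl, Sum.elim_inr, ← mul_smul_comm, ← Finset.mul_sum, Pi.neg_apply,
      neg_smul, Finset.sum_neg_distrib]
    rw [hy, ← hV, hq]; ring)
  have hb' : ∀ b, x (Sum.inr b) = 0 := fun b => hb (Sum.inr b)
  have hV0 : V = 0 := by rw [hV]; simp [hb']
  rw [hV0, mul_zero, add_zero] at hx
  have hx' := (mul_eq_zero.1 hx).resolve_left hP.ne_zero
  have ha := (Fintype.linearIndependent_iff.1 (linearIndependent_monPoly (R := k) k₂)) _ hx'
  rintro (d | b)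
  · exact ha d
  · exact hb' b

omit [Fintype σ] in
theorem detFam_reindex {R : Type*} [CommRing R] {ι κ : Type*} [Fintype ι] [Fintype κ] {m : ℕ}
    (f : κ ≃ ι) (e : ι ≃ Mon σ m) (F : ι → MvPolynomial σ R) :
    detFam (f.trans e) (F ∘ f) = detFam e F := by
  classical
  rw [detFam_eq, detFam_eq, ← Matrix.det_submatrix_equiv_self f]
  rfl

theorem det_coeff_eq_detFam {R : Type*} [CommRing R] {ι : Type*} [Fintype ι] {m : ℕ}
    [DecidableEq (Mon σ m)] (e : ι ≃ Mon σ m) (F : ι → MvPolynomial σ R) :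
    (Matrix.of fun a j : Mon σ m => (F (e.symm a)).coeff j.1).det = detFam e F := by
  classical
  rw [detFam_eq, ← Matrix.det_submatrix_equiv_self e]
  congr 1
  ext i j
  simp

theorem eq_sum_coeff_monPoly {R : Type*} [CommRing R] {m : ℕ} {q : MvPolynomial σ R}
    (hq : q.totalDegree ≤ m) : q = ∑ j : Mon σ m, q.coeff j.1 • monPoly j := by
  classical
  refine ext_of_totalDegree_le (Equiv.refl (Mon σ m)) hq
    (totalDegree_sum_smul_le totalDegree_monPoly_le _) fun j => ?_
  simp [MvPolynomial.coeff_sum, monPoly, MvPolynomial.coeff_monomial, ← Subtype.ext_iff]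

end Complement

/-! ### The multiplicity estimate -/

section MultiplicityEstimate

open IsDedekindDomain Filter Topology

variable {K : Type*} [Field K] [NumberField K] {σ : Type*} [Fintype σ]

theorem log_le_of_mul_pow_le {x y B M reg : ℝ} {n b g : ℕ} (hx : 0 < x) (hy : 0 < y) (hB : 0 < B)
    (hM : 0 < M) (h : x * Real.exp (-reg) ^ n ≤ y * B ^ b * M ^ g) :
    Real.log x - Real.log y ≤ n * reg + b * Real.log B + g * Real.log M := by
  have h1 := Real.log_le_log (by positivity) h
  rw [Real.log_mul hx.ne' (by positivity), Real.log_mul (by positivity) (by positivity),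
    Real.log_mul hy.ne' (by positivity), Real.log_pow, Real.log_pow, Real.log_pow,
    Real.log_exp] at h1
  linarith

theorem exists_complement_equiv {k : Type*} [Field k] {α : Type*} [Fintype α] {m : ℕ}
    {u : α → MvPolynomial σ k} (hu : LinearIndependent k u) (hdeg : ∀ i, (u i).totalDegree ≤ m) :
    ∃ (r : ℕ) (τ : Fin r → Mon σ m) (_ : α ⊕ Fin r ≃ Mon σ m),
      Fintype.card α + r = Fintype.card (Mon σ m) ∧
      LinearIndependent k (Sum.elim u fun b => monPoly (τ b)) := by
  classical
  have hc := card_le_of_linearIndependent hu hdeg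
  obtain ⟨r, hr⟩ := Nat.exists_eq_add_of_le hc
  obtain ⟨τ, hτ⟩ := exists_monomial_complement (β := Fin r) hu hdeg (by simp [hr])
  exact ⟨r, τ, Fintype.equivOfCardEq (by simp [hr]), hr.symm, hτ⟩

/-- The product formula for the ratio of two determinants: that of the multiples of `P` of degree at
most `k + D` with a complement, and that of the image of this complement under multiplication by
`s₁` and then by `s₂`. -/
theorem multiplicity_level {P s₁ s₂ : MvPolynomial σ K} (hP : Prime P) (h₁ : ¬ P ∣ s₁)
    (h₂ : ¬ P ∣ s₂) {D₁ D₂ : ℕ} (hs₁ : s₁.totalDegree ≤ D₁) (hs₂ : s₂.totalDegree ≤ D₂)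
    {a₁ a₂ : HeightOneSpectrum (𝓞 K) → K} (ha₁ : ∀ v, a₁ v ≠ 0) (ha₂ : ∀ v, a₂ v ≠ 0)
    {μ₁ μ₂ : HeightOneSpectrum (𝓞 K) → ℕ} (hd₁ : ∀ v, HasDrop v P s₁ (a₁ v) (μ₁ v))
    (hd₂ : ∀ v, HasDrop v P s₂ (a₂ v) (μ₂ v)) (S : Finset (HeightOneSpectrum (𝓞 K)))
    (hS : ∀ v ∉ S, gaussV v P = 1 ∧ absV v (a₁ v) = 1 ∧ absV v (a₂ v) = 1)
    {B M : (K →+* ℂ) → ℝ} (hB0 : ∀ φ, 0 < B φ)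
    (hB : ∀ φ, ∀ x, ‖MvPolynomial.eval (circ x) (MvPolynomial.map φ (s₁ * s₂))‖ ≤ B φ)
    (hM1 : ∀ φ, 1 ≤ M φ) (hM : ∀ φ, ∀ x, ‖MvPolynomial.eval (circ x) (MvPolynomial.map φ s₂)‖ ≤ M φ)
    {ε : ℝ} (hε : 0 < ε) (k : ℕ) {D : ℕ} (hD : P.totalDegree = D) :
    0 ≤ (∑ φ : K →+* ℂ, ((numMon σ (k + (D₁ + D₂ + D)) - numMon σ (k + D))
          * regMahler (MvPolynomial.map φ P) ε
        + (numMon σ (k + D) - numMon σ (k + 0)) * Real.log (B φ)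
        + ((numMon σ (k + (D₁ + D₂ + D)) - numMon σ (k + (D₁ + D₂)))
          - (numMon σ (k + D) - numMon σ (k + 0))) * Real.log (M φ * (√ε)⁻¹)))
      + ∑ v ∈ S, ((numMon σ (k + (D₁ + D₂)) - numMon σ (k + 0)) * Real.log (gaussV v P)
        - (numMon σ (k + D) - numMon σ (k + 0)) * Real.log (absV v (a₁ v))
        - (numMon σ (k + (D₁ + D)) - numMon σ (k + D₁)) * Real.log (absV v (a₂ v))
        - ((numMon σ (k + μ₁ v) - numMon σ (k + 0))
          + (numMon σ (k + (D₁ + μ₂ v)) - numMon σ (k + D₁))) * Real.log (normV v)) := by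
  classical
  have hdegP : ∀ k m, k + D ≤ m → ∀ d : Mon σ k, (P * monPoly d).totalDegree ≤ m :=
    fun k m hkm d => (MvPolynomial.totalDegree_mul _ _).trans
      ((Nat.add_le_add hD.le (totalDegree_monPoly_le d)).trans (by omega))
  have hdegS : ∀ {ι : Type} {s : MvPolynomial σ K} {w : ι → MvPolynomial σ K} {d m : ℕ},
      s.totalDegree ≤ d → (∀ b, (w b).totalDegree ≤ m) → ∀ b, (s * w b).totalDegree ≤ m + d :=
    fun hs hw b => (MvPolynomial.totalDegree_mul _ _).trans
      ((Nat.add_le_add hs (hw b)).trans (by omega))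
  -- a complement of the multiples of `P` in degree at most `k + D`
  obtain ⟨r, τ₀, e₁, hr, hli₁⟩ := exists_complement_equiv
    (linearIndependent_mul_monPoly hP.ne_zero k) (hdegP k (k + D) le_rfl)
  set w₀ : Fin r → MvPolynomial σ K := fun b => monPoly (τ₀ b) with hw₀
  have hw₀d : ∀ b, (w₀ b).totalDegree ≤ k + D := fun b => totalDegree_monPoly_le _
  -- its product with `s₁`, completed to a complement in degree at most `k + D + D₁`
  have hli₂ := linearIndependent_mul_complement hP h₁ (hD ▸ hw₀d) hli₁ (k + D₁)
  obtain ⟨ρ₁, τ₁, e₂, hρ₁, hli₂'⟩ := exists_complement_equiv (m := k + D + D₁) hli₂ (by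
    rintro (d | b)
    · exact hdegP _ _ (by omega) d
    · exact hdegS hs₁ hw₀d b)
  set w₁ : Fin r ⊕ Fin ρ₁ → MvPolynomial σ K :=
    Sum.elim (fun b => s₁ * w₀ b) (fun b => monPoly (τ₁ b)) with hw₁
  have hw₁d : ∀ b, (w₁ b).totalDegree ≤ k + D₁ + D := by
    rintro (b | b)
    · exact (hdegS hs₁ hw₀d b).trans (by omega)
    · exact (totalDegree_monPoly_le _).trans (by omega)
  have hassoc : (Sum.elim (fun d : Mon σ (k + D₁) => P * monPoly d) w₁)
      ∘ Equiv.sumAssoc _ _ _ = Sum.elim (Sum.elim (fun d : Mon σ (k + D₁) => P * monPoly d)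
        fun b => s₁ * w₀ b) fun b => monPoly (τ₁ b) := by
    funext i
    rcases i with (i | i) | i <;> rfl
  have hli₂'' : LinearIndependent K (Sum.elim (fun d : Mon σ (k + D₁) => P * monPoly d) w₁) := by
    rw [← hassoc] at hli₂'
    exact (linearIndependent_equiv _).1 hli₂'
  -- the product with `s₂`, completed in degree at most `k + D + D₁ + D₂`
  have hli₃ := linearIndependent_mul_complement hP h₂ (hD ▸ hw₁d) hli₂'' (k + D₁ + D₂)
  obtain ⟨ρ₂, τ₂, e₃, hρ₂, hli₃'⟩ := exists_complement_equiv (m := k + D₁ + D + D₂) hli₃ (by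
    rintro (d | b)
    · exact hdegP _ _ (by omega) d
    · exact (hdegS hs₂ hw₁d b).trans (by omega))
  set c := detFam e₁ (Sum.elim (fun d : Mon σ k => P * monPoly d) w₀) with hc
  set Δ₁ := detFam e₂ (Sum.elim (Sum.elim (fun d : Mon σ (k + D₁) => P * monPoly d)
        fun b => s₁ * w₀ b) fun b => monPoly (τ₁ b)) with hΔ₁
  set Δ₂ := detFam e₃ (Sum.elim (Sum.elim (fun d : Mon σ (k + D₁ + D₂) => P * monPoly d)
        fun b => s₂ * w₁ b) fun b => monPoly (τ₂ b)) with hΔ₂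
  have hc0 : c ≠ 0 := detFam_ne_zero e₁ (by
    rintro (d | b)
    · exact hdegP _ _ le_rfl d
    · exact hw₀d b) hli₁
  have hΔ₁0 : Δ₁ ≠ 0 := detFam_ne_zero e₂ (by
    rintro ((d | b) | b)
    · exact hdegP _ _ (by omega) d
    · exact hdegS hs₁ hw₀d b
    · exact totalDegree_monPoly_le _) hli₂'
  have hdeg₃ : ∀ i, (Sum.elim (Sum.elim (fun d : Mon σ (k + D₁ + D₂) => P * monPoly d)
        fun b => s₂ * w₁ b) (fun b => monPoly (τ₂ b)) i).totalDegree ≤ k + D₁ + D + D₂ := by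
    rintro ((d | b) | b)
    · exact hdegP _ _ (by omega) d
    · exact (hdegS hs₂ hw₁d b).trans (by omega)
    · exact totalDegree_monPoly_le _
  have hΔ₂0 : Δ₂ ≠ 0 := detFam_ne_zero e₃ hdeg₃ hli₃'
  have hΔ₁' : detFam ((Equiv.sumAssoc _ _ _).symm.trans e₂)
      (Sum.elim (fun d : Mon σ (k + D₁) => P * monPoly d) w₁) = Δ₁ := by
    rw [hΔ₁, ← hassoc, ← detFam_reindex (Equiv.sumAssoc _ _ _).symm e₂]
    congr 1
    funext i
    simp
  -- the sizes of the complements in terms of numbers of monomials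
  have n₁ : numMon σ (k + D) - numMon σ (k + 0) = r := by
    rw [numMon, numMon, ← hr]; push_cast; rw [add_zero]; ring
  have n₂ : numMon σ (k + (D₁ + D)) - numMon σ (k + D₁) = r + ρ₁ := by
    rw [numMon, numMon, show k + (D₁ + D) = k + D + D₁ by ring, ← hρ₁, Fintype.card_sum,
      Fintype.card_fin]
    push_cast; ring
  have n₃ : numMon σ (k + (D₁ + D₂ + D)) - numMon σ (k + (D₁ + D₂)) = r + ρ₁ + ρ₂ := by
    rw [numMon, numMon, show k + (D₁ + D₂ + D) = k + D₁ + D + D₂ by ring, ← hρ₂, Fintype.card_sum,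
      Fintype.card_sum, Fintype.card_fin, Fintype.card_fin, ← add_assoc k]
    push_cast; ring
  have hsub : ∀ {a b : ℕ}, a ≤ b → ((Fintype.card (Mon σ b) - Fintype.card (Mon σ a) : ℕ) : ℝ)
      = numMon σ b - numMon σ a := fun h => by
    rw [Nat.cast_sub (numMon_mono σ h)]; rfl
  -- At an archimedean place the two multiplications are treated as one, by `s₁ s₂`.
  have harch : ∀ φ : K →+* ℂ, Real.log ‖φ Δ₂‖ - Real.log ‖φ c‖
      ≤ (numMon σ (k + (D₁ + D₂ + D)) - numMon σ (k + D)) * regMahler (MvPolynomial.map φ P) ε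
        + (numMon σ (k + D) - numMon σ (k + 0)) * Real.log (B φ)
        + ((numMon σ (k + (D₁ + D₂ + D)) - numMon σ (k + (D₁ + D₂)))
          - (numMon σ (k + D) - numMon σ (k + 0))) * Real.log (M φ * (√ε)⁻¹) := by
    intro φ
    let f : (Mon σ (k + D₁ + D₂) ⊕ Fin r) ⊕ (Fin ρ₁ ⊕ Fin ρ₂)
        ≃ (Mon σ (k + D₁ + D₂) ⊕ (Fin r ⊕ Fin ρ₁)) ⊕ Fin ρ₂ :=
      (Equiv.sumAssoc _ _ _).symm.trans (Equiv.sumCongr (Equiv.sumAssoc _ _ _) (Equiv.refl _))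
    let F₁ : Mon σ k ⊕ Fin r → MvPolynomial σ ℂ :=
      Sum.elim (fun d => MvPolynomial.map φ P * monPoly d) fun b => MvPolynomial.map φ (w₀ b)
    let F₂ : (Mon σ (k + D₁ + D₂) ⊕ Fin r) ⊕ (Fin ρ₁ ⊕ Fin ρ₂) → MvPolynomial σ ℂ :=
      Sum.elim (Sum.elim (fun d => MvPolynomial.map φ P * monPoly d)
        fun b => MvPolynomial.map φ (s₁ * s₂) * MvPolynomial.map φ (w₀ b))
        (Sum.elim (fun b => MvPolynomial.map φ s₂ * monPoly (τ₁ b)) fun b => monPoly (τ₂ b))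
    have hF₁ : F₁ = fun i => MvPolynomial.map φ
        (Sum.elim (fun d : Mon σ k => P * monPoly d) w₀ i) := by
      funext i
      rcases i with d | b <;> simp [F₁]
    have hF₂ : F₂ = (fun i => MvPolynomial.map φ
        (Sum.elim (Sum.elim (fun d : Mon σ (k + D₁ + D₂) => P * monPoly d)
        fun b => s₂ * w₁ b) (fun b => monPoly (τ₂ b)) i)) ∘ f := by
      funext i
      rcases i with (d | b) | (b | b)
      · simp [F₂, f]
      · simp [F₂, f, hw₁, mul_assoc, mul_left_comm]
      · simp [F₂, f, hw₁]
      · simp [F₂, f]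
    have hdet₁ : detFam e₁ F₁ = φ c := by rw [hF₁, detFam_map]
    have hdet₂ : detFam (f.trans e₃) F₂ = φ Δ₂ := by rw [hF₂, detFam_reindex, detFam_map]
    have hM0 : 0 < M φ := one_pos.trans_le (hM1 φ)
    have hkey := norm_det_mul_le (MvPolynomial.map φ P) hε (s := MvPolynomial.map φ (s₁ * s₂))
      (k' := k) (k := k + D₁ + D₂) (m' := k + D) (m := k + D₁ + D + D₂) (by omega) (by omega)
      ((Nat.add_le_add_right ((totalDegree_map_le _ _).trans ((MvPolynomial.totalDegree_mul _ _).trans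
        (Nat.add_le_add hs₁ hs₂))) _).trans (by omega))
      (fun b => MvPolynomial.map φ (w₀ b))
      (Sum.elim (fun b => MvPolynomial.map φ s₂ * monPoly (τ₁ b)) fun b => monPoly (τ₂ b))
      (hB0 φ).le (hB φ) hM0.le (by
        rintro (b | b) x
        · simp only [Sum.elim_inl, map_mul, norm_mul, monPoly]
          rw [norm_eval_monomial, mul_one]
          exact hM φ x
        · simp only [Sum.elim_inr, monPoly]
          rw [norm_eval_monomial]
          exact hM1 φ) e₁ (f.trans e₃)
      (Matrix.of fun a j => (F₁ (e₁.symm a)).coeff j.1)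
      (Matrix.of fun a j => (F₂ ((f.trans e₃).symm a)).coeff j.1)
      (by
        intro i
        simp only [Matrix.of_apply, Equiv.symm_apply_apply]
        refine eq_sum_coeff_monPoly (q := F₁ i) ?_
        rw [hF₁]
        refine (totalDegree_map_le _ _).trans ?_
        rcases i with d | b
        · exact hdegP _ _ le_rfl d
        · exact hw₀d b)
      (by
        intro i
        simp only [Matrix.of_apply, Equiv.symm_apply_apply]
        refine eq_sum_coeff_monPoly (q := F₂ i) ?_
        rw [hF₂]
        exact (totalDegree_map_le _ _).trans (hdeg₃ _))
    rw [det_coeff_eq_detFam, det_coeff_eq_detFam, hdet₁, hdet₂] at hkey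
    have hφ0 : ∀ {x : K}, x ≠ 0 → 0 < ‖φ x‖ := fun hx => by simpa using hx
    have hres := log_le_of_mul_pow_le (hφ0 hΔ₂0) (hφ0 hc0) (hB0 φ)
      (M := M φ * (√ε)⁻¹) (by positivity) hkey
    refine hres.trans (le_of_eq ?_)
    rw [n₃, n₁, hsub (by omega), Fintype.card_sum, Fintype.card_fin, Fintype.card_fin,
      Fintype.card_fin, show k + D₁ + D + D₂ = k + (D₁ + D₂ + D) by ring]
    push_cast
    ring
  -- At a finite place the two multiplications contribute separately.
  have hfin : ∀ v, Real.log (absV v Δ₂) - Real.log (absV v c)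
      ≤ (numMon σ (k + (D₁ + D₂)) - numMon σ (k + 0)) * Real.log (gaussV v P)
        - (numMon σ (k + D) - numMon σ (k + 0)) * Real.log (absV v (a₁ v))
        - (numMon σ (k + (D₁ + D)) - numMon σ (k + D₁)) * Real.log (absV v (a₂ v))
        - ((numMon σ (k + μ₁ v) - numMon σ (k + 0))
          + (numMon σ (k + (D₁ + μ₂ v)) - numMon σ (k + D₁))) * Real.log (normV v) := by
    intro v
    have hl₁ := absV_detFam_le v hP.ne_zero (ha₁ v) (hd₁ v) rfl rfl rfl hD.le hs₁ e₁ e₂ hw₀d τ₁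
    have hl₂ := absV_detFam_le v hP.ne_zero (ha₂ v) (hd₂ v) (k₁ := k + D₁)
      (m₁ := k + D + D₁) (k₂ := k + D₁ + D₂) (by ring) rfl rfl hD.le hs₂
      ((Equiv.sumAssoc _ _ _).symm.trans e₂) e₃ (fun b => (hw₁d b).trans (by omega)) τ₂
    rw [hΔ₁'] at hl₂
    have hg := gaussV_pos v hP.ne_zero
    have hp₁ := (absV v).pos (ha₁ v)
    have hp₂ := (absV v).pos (ha₂ v)
    have hN : 0 < normV v := one_pos.trans (one_lt_normV v)
    have hlog : ∀ {x y : K} {n b t : ℕ} {A : ℝ}, 0 < A → x ≠ 0 → y ≠ 0 →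
        absV v x ≤ absV v y * (gaussV v P ^ n * A⁻¹ ^ b * (normV v)⁻¹ ^ t) →
        Real.log (absV v x) - Real.log (absV v y) ≤ n * Real.log (gaussV v P) - b * Real.log A
          - t * Real.log (normV v) := by
      intro x y n b t A hA hx hy h
      have h1 := Real.log_le_log ((absV v).pos hx) h
      have hy' := (absV v).pos hy
      rw [Real.log_mul hy'.ne' (by positivity), Real.log_mul (by positivity) (by positivity),
        Real.log_mul (by positivity) (by positivity), Real.log_pow, Real.log_pow, Real.log_pow,
        Real.log_inv, Real.log_inv] at h1
      linarith
    have hr₁ := hlog hp₁ hΔ₁0 hc0 hl₁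
    have hr₂ := hlog hp₂ hΔ₂0 hΔ₁0 hl₂
    have := add_le_add hr₁ hr₂
    rw [hsub (by omega), hsub (by omega), hsub (by omega), hsub (by omega), Fintype.card_sum,
      Fintype.card_fin, Fintype.card_fin] at this
    rw [n₁, n₂, add_zero]
    rw [show k + D₁ + D₂ = k + (D₁ + D₂) by ring, show k + D₁ + μ₂ v = k + (D₁ + μ₂ v) by ring]
      at this
    push_cast at this
    linarith
  -- The product formula; the places outside `S` contribute nonpositive terms.
  have hx0 : Δ₂ / c ≠ 0 := div_ne_zero hΔ₂0 hc0
  have hpf := sum_log_eq_zero hx0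
  have hxv : ∀ v, Real.log (absV v (Δ₂ / c)) = Real.log (absV v Δ₂) - Real.log (absV v c) :=
    fun v => by
      rw [map_div₀, Real.log_div ((absV v).ne_zero hΔ₂0) ((absV v).ne_zero hc0)]
  have hxφ : ∀ φ : K →+* ℂ, Real.log ‖φ (Δ₂ / c)‖ = Real.log ‖φ Δ₂‖ - Real.log ‖φ c‖ :=
    fun φ => by
      rw [map_div₀, norm_div, Real.log_div (by simpa using hΔ₂0) (by simpa using hc0)]
  have hle0 : ∀ v ∉ S, Real.log (absV v (Δ₂ / c)) ≤ 0 := by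
    intro v hv
    obtain ⟨h1, h2, h3⟩ := hS v hv
    rw [hxv]
    refine (hfin v).trans ?_
    rw [h1, h2, h3, Real.log_one, mul_zero, mul_zero, mul_zero, sub_zero, sub_zero, zero_sub,
      neg_nonpos, ← hsub (by omega), ← hsub (by omega)]
    exact mul_nonneg (by positivity) (Real.log_nonneg (one_lt_normV v).le)
  have hfs : ∑ᶠ v, Real.log (absV v (Δ₂ / c)) ≤ ∑ v ∈ S, Real.log (absV v (Δ₂ / c)) := by
    have hf := finite_log_absV hx0
    rw [finsum_eq_sum_of_support_subset (s := S ∪ hf.toFinset) _ (by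
      intro v hv
      rw [Finset.coe_union, Set.Finite.coe_toFinset]
      exact Or.inr hv), ← Finset.union_sdiff_self_eq_union, Finset.sum_union Finset.disjoint_sdiff]
    refine add_le_of_nonpos_right (Finset.sum_nonpos fun v hv => hle0 v (Finset.mem_sdiff.1 hv).2)
  rw [← hpf]
  refine add_le_add (Finset.sum_le_sum fun φ _ => ?_) (hfs.trans (Finset.sum_le_sum fun v _ => ?_))
  · rw [hxφ]; exact harch φ
  · rw [hxv]; exact hfin v

theorem norm_eval_circ_le (Q : MvPolynomial σ ℂ) (x : UnitAddTorus σ) :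
    ‖MvPolynomial.eval (circ x) Q‖ ≤ ∑ d ∈ Q.support, ‖Q.coeff d‖ := by
  conv_lhs => rw [Q.as_sum, map_sum]
  refine (norm_sum_le _ _).trans (Finset.sum_le_sum fun d _ => ?_)
  rw [← mul_one (Q.coeff d), ← MvPolynomial.C_mul_monomial, map_mul, norm_mul,
    norm_eval_monomial, MvPolynomial.eval_C, mul_one, mul_one]

theorem hgt_eq_sum {Q : MvPolynomial σ K} (S : Finset (HeightOneSpectrum (𝓞 K)))
    (hS : ∀ v ∉ S, gaussV v Q = 1) :
    hgt Q = (∑ φ : K →+* ℂ, logMahler (MvPolynomial.map φ Q)) + ∑ v ∈ S, Real.log (gaussV v Q) := by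
  rw [hgt, finsum_eq_sum_of_support_subset (s := S)]
  intro v hv
  by_contra h
  exact hv (by simp only [hS v h, Real.log_one])

/-- If the reductions of `P` and of `s₁`, `s₂` modulo many primes have common factors then the
heights of `P`, `s₁` and `s₂` are large: the inequalities at finite level `k` are divided by the
number of monomials of degree `k + 1`, and `k` tends to infinity, then `ε` to `0`. -/
theorem multiplicity_estimate [Nonempty σ] {P s₁ s₂ : MvPolynomial σ K} (hP : Prime P)
    (h₁ : ¬ P ∣ s₁) (h₂ : ¬ P ∣ s₂) {D₁ D₂ : ℕ} (hs₁ : s₁.totalDegree ≤ D₁)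
    (hs₂ : s₂.totalDegree ≤ D₂)
    {a₁ a₂ : HeightOneSpectrum (𝓞 K) → K} (ha₁ : ∀ v, a₁ v ≠ 0) (ha₂ : ∀ v, a₂ v ≠ 0)
    {μ₁ μ₂ : HeightOneSpectrum (𝓞 K) → ℕ} (hd₁ : ∀ v, HasDrop v P s₁ (a₁ v) (μ₁ v))
    (hd₂ : ∀ v, HasDrop v P s₂ (a₂ v) (μ₂ v)) (S : Finset (HeightOneSpectrum (𝓞 K)))
    (hS : ∀ v ∉ S, gaussV v P = 1 ∧ absV v (a₁ v) = 1 ∧ absV v (a₂ v) = 1)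
    {B : (K →+* ℂ) → ℝ} (hB0 : ∀ φ, 0 < B φ)
    (hB : ∀ φ, ∀ x, ‖MvPolynomial.eval (circ x) (MvPolynomial.map φ (s₁ * s₂))‖ ≤ B φ) :
    ∑ v ∈ S, ((μ₁ v : ℝ) + μ₂ v) * Real.log (normV v) ≤ (D₁ + D₂) * hgt P
      + P.totalDegree * ((∑ φ, Real.log (B φ))
        + ∑ v ∈ S, (-Real.log (absV v (a₁ v)) - Real.log (absV v (a₂ v)))) := by
  set D := P.totalDegree with hD
  let M : (K →+* ℂ) → ℝ := fun φ => max 1 (∑ d ∈ (MvPolynomial.map φ s₂).support,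
    ‖(MvPolynomial.map φ s₂).coeff d‖)
  have hM1 : ∀ φ, 1 ≤ M φ := fun φ => le_max_left _ _
  have hM : ∀ φ, ∀ x, ‖MvPolynomial.eval (circ x) (MvPolynomial.map φ s₂)‖ ≤ M φ := fun φ x =>
    (norm_eval_circ_le _ x).trans (le_max_right _ _)
  have hreg : ∀ ε : ℝ, 0 < ε → 0 ≤ (∑ φ : K →+* ℂ, (((D₁ + D₂ : ℕ) : ℝ)
        * regMahler (MvPolynomial.map φ P) ε + D * Real.log (B φ)))
      + ∑ v ∈ S, (((D₁ + D₂ : ℕ) : ℝ) * Real.log (gaussV v P) - D * Real.log (absV v (a₁ v))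
        - D * Real.log (absV v (a₂ v)) - ((μ₁ v : ℝ) + μ₂ v) * Real.log (normV v)) := by
    intro ε hε
    have hlev := fun k => div_nonneg (multiplicity_level hP h₁ h₂ hs₁ hs₂ ha₁ ha₂ hd₁ hd₂ S hS hB0 hB
      hM1 hM hε k hD.symm) (numMon_layer_pos σ k).le
    refine ge_of_tendsto' (x := atTop) ?_ hlev
    have hT : ∀ a b : ℕ, ∀ c : ℝ, Tendsto (fun m : ℕ =>
        (numMon σ (m + a) - numMon σ (m + b)) / (numMon σ (m + 1) - numMon σ m) * c) atTop
        (𝓝 (((a : ℝ) - b) * c)) := fun a b c => (tendsto_numMon_sub σ a b).mul_const c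
    have hlim := (tendsto_finsetSum (Finset.univ : Finset (K →+* ℂ)) fun φ _ =>
      (((hT (D₁ + D₂ + D) D (regMahler (MvPolynomial.map φ P) ε)).add
        (hT D 0 (Real.log (B φ)))).add
        ((hT (D₁ + D₂ + D) (D₁ + D₂) (Real.log (M φ * (√ε)⁻¹))).sub
          (hT D 0 (Real.log (M φ * (√ε)⁻¹)))))).add
      (tendsto_finsetSum S fun v _ =>
      (((hT (D₁ + D₂) 0 (Real.log (gaussV v P))).sub (hT D 0 (Real.log (absV v (a₁ v))))).sub
        (hT (D₁ + D) D₁ (Real.log (absV v (a₂ v))))).sub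
        ((hT (μ₁ v) 0 (Real.log (normV v))).add (hT (D₁ + μ₂ v) D₁ (Real.log (normV v)))))
    refine (Tendsto.congr (fun k => ?_) hlim).trans (le_of_eq ?_)
    · rw [add_div, Finset.sum_div, Finset.sum_div]
      congr 1
      · refine Finset.sum_congr rfl fun φ _ => ?_
        ring
      · refine Finset.sum_congr rfl fun v _ => ?_
        ring
    · congr 2
      · refine Finset.sum_congr rfl fun φ _ => ?_
        push_cast; ring
      · refine Finset.sum_congr rfl fun v _ => ?_
        push_cast; ring
  have hfin : 0 ≤ (∑ φ : K →+* ℂ, (((D₁ + D₂ : ℕ) : ℝ)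
        * logMahler (MvPolynomial.map φ P) + D * Real.log (B φ)))
      + ∑ v ∈ S, (((D₁ + D₂ : ℕ) : ℝ) * Real.log (gaussV v P) - D * Real.log (absV v (a₁ v))
        - D * Real.log (absV v (a₂ v)) - ((μ₁ v : ℝ) + μ₂ v) * Real.log (normV v)) := by
    refine ge_of_tendsto (x := 𝓝[>] 0) ?_ (f := fun ε => (∑ φ : K →+* ℂ, (((D₁ + D₂ : ℕ) : ℝ)
        * regMahler (MvPolynomial.map φ P) ε + D * Real.log (B φ))) + _)
      (eventually_nhdsWithin_of_forall hreg)
    refine (tendsto_finsetSum _ fun φ _ => ?_).add_const _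
    exact ((tendsto_regMahler (map_embedding_ne_zero φ hP.ne_zero)).const_mul _).add_const _
  rw [hgt_eq_sum S fun v hv => (hS v hv).1]
  simp only [Finset.sum_add_distrib, Finset.sum_sub_distrib, ← Finset.mul_sum, Finset.sum_neg_distrib]
    at hfin ⊢
  push_cast at hfin
  linarith

end MultiplicityEstimate

/-! ### Polynomials in one distinguished variable -/

section Coefficients

variable {σ R S : Type*} [DecidableEq σ] [CommRing R] [CommRing S]

/-- A polynomial regarded as a polynomial in the single variable `T_r`. The coefficients remain in
the full polynomial ring, where they have degree `0` in `T_r`. -/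
def phi (r : σ) : MvPolynomial σ R →ₐ[R] Polynomial (MvPolynomial σ R) :=
  MvPolynomial.aeval fun i => if i = r then Polynomial.X else Polynomial.C (MvPolynomial.X i)

theorem phi_C (r : σ) (a : R) :
    phi r (MvPolynomial.C a : MvPolynomial σ R) = Polynomial.C (MvPolynomial.C a) :=
  MvPolynomial.aeval_C _ _

theorem phi_monomial (r : σ) (d : σ →₀ ℕ) (a : R) :
    phi r (MvPolynomial.monomial d a)
      = Polynomial.monomial (d r) (MvPolynomial.monomial (d.erase r) a) := by
  have h : ∀ k : σ →₀ ℕ, k r = 0 →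
      (k.prod fun i j => (if i = r then (Polynomial.X : Polynomial (MvPolynomial σ R))
        else Polynomial.C (MvPolynomial.X i)) ^ j)
      = Polynomial.C (MvPolynomial.monomial k 1) := by
    intro k hk
    rw [MvPolynomial.monomial_eq, map_mul, map_one, map_one, one_mul, Finsupp.prod, Finsupp.prod,
      map_prod]
    refine Finset.prod_congr rfl fun i hi => ?_
    rw [if_neg (by rintro rfl; exact Finsupp.mem_support_iff.mp hi hk), map_pow]
  rw [phi, MvPolynomial.aeval_monomial,
    ← Finsupp.mul_prod_erase' d r _ (fun i => pow_zero _), h _ (by simp), if_pos rfl,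
    ← Polynomial.C_mul_X_pow_eq_monomial]
  have h1 : (MvPolynomial.monomial (d.erase r) a : MvPolynomial σ R)
      = MvPolynomial.C a * MvPolynomial.monomial (d.erase r) 1 := by
    rw [MvPolynomial.C_mul_monomial, mul_one]
  have h2 : algebraMap R (Polynomial (MvPolynomial σ R)) a = Polynomial.C (MvPolynomial.C a) := rfl
  rw [h1, map_mul, h2]
  ring

theorem coeff_phi (r : σ) (F : MvPolynomial σ R) (j : ℕ) (d : σ →₀ ℕ) :
    ((phi r F).coeff j).coeff d
      = if d r = 0 then F.coeff (d + Finsupp.single r j) else 0 := by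
  induction F using MvPolynomial.induction_on' with
  | monomial e a =>
    rw [phi_monomial, Polynomial.coeff_monomial]
    by_cases hj : e r = j
    · rw [if_pos hj, MvPolynomial.coeff_monomial, MvPolynomial.coeff_monomial]
      have key : Finsupp.erase r e = d ↔ d r = 0 ∧ e = d + Finsupp.single r j := by
        constructor
        · rintro rfl
          refine ⟨by simp, ?_⟩
          rw [← hj, Finsupp.erase_add_single]
        · rintro ⟨h, rfl⟩
          ext i
          by_cases hi : i = r
          · subst hi; simp [h]
          · simp [Finsupp.erase_ne hi]
      by_cases h0 : d r = 0
      · simp [key, h0]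
      · rw [if_neg (fun h => h0 (key.mp h).1), if_neg h0]
    · rw [if_neg hj, MvPolynomial.coeff_zero]
      split_ifs with h0
      · rw [MvPolynomial.coeff_monomial, if_neg]
        rintro rfl
        simp [h0] at hj
      · rfl
  | add p q hp hq =>
    rw [map_add, Polynomial.coeff_add, MvPolynomial.coeff_add, hp, hq]
    split_ifs
    · rw [MvPolynomial.coeff_add]
    · simp

theorem coeff_phi_coeff_eq_zero_or (r : σ) (F : MvPolynomial σ R) (j : ℕ) (d : σ →₀ ℕ) :
    ((phi r F).coeff j).coeff d = 0 ∨
      d r = 0 ∧ ((phi r F).coeff j).coeff d = F.coeff (d + Finsupp.single r j) := by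
  rw [coeff_phi]
  split_ifs with h <;> simp [h]

theorem eval_phi (r : σ) (F : MvPolynomial σ R) :
    (phi r F).eval (MvPolynomial.X r) = F := by
  have : ((Polynomial.evalRingHom (MvPolynomial.X r)).comp (phi r : MvPolynomial σ R →ₐ[R] _).toRingHom)
      = RingHom.id (MvPolynomial σ R) := by
    refine MvPolynomial.ringHom_ext (fun a => ?_) fun i => ?_
    · change Polynomial.eval _ (phi r (MvPolynomial.C a)) = _
      rw [phi_C, Polynomial.eval_C]; rfl
    · change Polynomial.eval _ (phi r (MvPolynomial.X i)) = _
      rw [phi, MvPolynomial.aeval_X]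
      split_ifs with h <;> simp [h]
  exact DFunLike.congr_fun this F

theorem phi_injective (r : σ) : Function.Injective (phi r : MvPolynomial σ R → _) := fun F G h => by
  rw [← eval_phi r F, h, eval_phi]

theorem phi_ne_zero (r : σ) {F : MvPolynomial σ R} (hF : F ≠ 0) : phi r F ≠ 0 := fun h =>
  hF (phi_injective r (h.trans (map_zero _).symm))

theorem phi_map (r : σ) (φ : R →+* S) (F : MvPolynomial σ R) :
    phi r (MvPolynomial.map φ F) = (phi r F).map (MvPolynomial.map φ) := by
  have : ((phi r : MvPolynomial σ S →ₐ[S] _).toRingHom.comp (MvPolynomial.map φ))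
      = (Polynomial.mapRingHom (MvPolynomial.map φ)).comp
        (phi r : MvPolynomial σ R →ₐ[R] _).toRingHom := by
    refine MvPolynomial.ringHom_ext (fun a => ?_) fun i => ?_
    · change phi r (MvPolynomial.map φ (MvPolynomial.C a))
        = Polynomial.map _ (phi r (MvPolynomial.C a))
      rw [MvPolynomial.map_C, phi_C, phi_C, Polynomial.map_C, MvPolynomial.map_C]
    · change phi r (MvPolynomial.map φ (MvPolynomial.X i))
        = Polynomial.map _ (phi r (MvPolynomial.X i))
      rw [MvPolynomial.map_X, phi, phi, MvPolynomial.aeval_X, MvPolynomial.aeval_X]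
      split_ifs <;> simp
  exact DFunLike.congr_fun this F

/-- Evaluation may be done first in the coefficients and then in `T_r`. -/
theorem eval_eq_eval_map_phi (r : σ) {z z' : σ → R} (h : ∀ i ≠ r, z i = z' i)
    (F : MvPolynomial σ R) :
    MvPolynomial.eval z F = ((phi r F).map (MvPolynomial.eval z')).eval (z r) := by
  have : MvPolynomial.eval z = ((Polynomial.evalRingHom (z r)).comp
      (Polynomial.mapRingHom (MvPolynomial.eval z'))).comp
        (phi r : MvPolynomial σ R →ₐ[R] _).toRingHom := by
    refine MvPolynomial.ringHom_ext (fun a => ?_) fun i => ?_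
    · change _ = Polynomial.eval _ (Polynomial.map _ (phi r (MvPolynomial.C a)))
      rw [phi_C]; simp
    · change _ = Polynomial.eval _ (Polynomial.map _ (phi r (MvPolynomial.X i)))
      rw [phi, MvPolynomial.aeval_X]
      split_ifs with hi
      · simp [hi]
      · simp [h i hi]
  exact DFunLike.congr_fun this F

theorem natDegree_phi (r : σ) (F : MvPolynomial σ R) :
    (phi r F).natDegree = MvPolynomial.degreeOf r F := by
  apply le_antisymm
  · rw [Polynomial.natDegree_le_iff_coeff_eq_zero]
    intro j hj
    ext d
    rw [coeff_phi, MvPolynomial.coeff_zero]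
    split_ifs
    · by_contra h
      have := MvPolynomial.monomial_le_degreeOf r (MvPolynomial.mem_support_iff.mpr h)
      simp at this
      omega
    · rfl
  · rw [MvPolynomial.degreeOf_le_iff]
    intro m hm
    apply Polynomial.le_natDegree_of_ne_zero
    intro h
    have := coeff_phi r F (m r) (m.erase r)
    rw [h, if_pos (by simp), Finsupp.erase_add_single] at this
    exact MvPolynomial.mem_support_iff.mp hm (by simpa using this.symm)

theorem phi_eq_C (r : σ) {F : MvPolynomial σ R} (h : MvPolynomial.degreeOf r F = 0) :
    phi r F = Polynomial.C F := by
  rw [← natDegree_phi, Polynomial.natDegree_eq_zero] at h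
  obtain ⟨c, hc⟩ := h
  have := eval_phi r F
  rw [← hc, Polynomial.eval_C] at this
  rw [← hc, this]

theorem mem_support_coeff_phi {r : σ} {F : MvPolynomial σ R} {j : ℕ} {d : σ →₀ ℕ}
    (h : d ∈ ((phi r F).coeff j).support) : d r = 0 ∧ d + Finsupp.single r j ∈ F.support := by
  rw [MvPolynomial.mem_support_iff] at h
  rcases coeff_phi_coeff_eq_zero_or r F j d with h' | ⟨h0, h'⟩
  · exact absurd h' h
  · exact ⟨h0, MvPolynomial.mem_support_iff.mpr (h' ▸ h)⟩

theorem degreeOf_coeff_phi_self (r : σ) (F : MvPolynomial σ R) (j : ℕ) :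
    MvPolynomial.degreeOf r ((phi r F).coeff j) = 0 :=
  Nat.le_zero.mp <| MvPolynomial.degreeOf_le_iff.mpr fun _ hm => (mem_support_coeff_phi hm).1.le

theorem degreeOf_coeff_phi_le (r i : σ) (F : MvPolynomial σ R) (j : ℕ) :
    MvPolynomial.degreeOf i ((phi r F).coeff j) ≤ MvPolynomial.degreeOf i F :=
  MvPolynomial.degreeOf_le_iff.mpr fun _ hm =>
    le_trans (by simp) (MvPolynomial.monomial_le_degreeOf i (mem_support_coeff_phi hm).2)

theorem totalDegree_coeff_phi_add_le (r : σ) {F : MvPolynomial σ R} {j : ℕ}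
    (h : (phi r F).coeff j ≠ 0) : ((phi r F).coeff j).totalDegree + j ≤ F.totalDegree := by
  obtain ⟨d, hd, h'⟩ := Finset.exists_mem_eq_sup _ (MvPolynomial.support_nonempty.mpr h)
    fun d : σ →₀ ℕ => d.sum fun _ e => e
  change ((phi r F).coeff j).totalDegree = _ at h'
  rw [h']
  have := MvPolynomial.le_totalDegree (mem_support_coeff_phi hd).2
  rwa [Finsupp.sum_add_index' (fun _ => rfl) (fun _ _ _ => rfl),
    Finsupp.sum_single_index rfl] at this

theorem degreeOf_map_le (r : σ) (φ : R →+* S) (F : MvPolynomial σ R) :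
    MvPolynomial.degreeOf r (MvPolynomial.map φ F) ≤ MvPolynomial.degreeOf r F := by
  rw [← natDegree_phi, ← natDegree_phi, phi_map]
  exact Polynomial.natDegree_map_le

omit [DecidableEq σ] in
theorem degreeOf_eq_zero_of_dvd [IsDomain R] {r : σ} {F G : MvPolynomial σ R} (hF : F ≠ 0)
    (h : G ∣ F) (h0 : MvPolynomial.degreeOf r F = 0) : MvPolynomial.degreeOf r G = 0 := by
  obtain ⟨H, rfl⟩ := h
  rw [MvPolynomial.degreeOf_mul_eq (left_ne_zero_of_mul hF) (right_ne_zero_of_mul hF)] at h0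
  omega

/-- The leading coefficient of a polynomial with respect to `T_r`. -/
def lead (r : σ) (F : MvPolynomial σ R) : MvPolynomial σ R := (phi r F).leadingCoeff

theorem lead_ne_zero (r : σ) {F : MvPolynomial σ R} (hF : F ≠ 0) : lead r F ≠ 0 :=
  Polynomial.leadingCoeff_ne_zero.mpr (phi_ne_zero r hF)

theorem lead_mul [IsDomain R] (r : σ) (F G : MvPolynomial σ R) :
    lead r (F * G) = lead r F * lead r G := by
  rw [lead, map_mul, Polynomial.leadingCoeff_mul]; rfl

theorem lead_one (r : σ) : lead r (1 : MvPolynomial σ R) = 1 := by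
  rw [lead, map_one, Polynomial.leadingCoeff_one]

/-- The resultant of `F` and `∂F/∂T_r` with respect to `T_r`, formed as if `F` had degree `d`. -/
def disc (r : σ) (d : ℕ) (F : MvPolynomial σ R) : MvPolynomial σ R :=
  Polynomial.resultant (phi r F) (Polynomial.derivative (phi r F)) d (d - 1)

theorem disc_map (r : σ) (d : ℕ) (φ : R →+* S) (F : MvPolynomial σ R) :
    disc r d (MvPolynomial.map φ F) = MvPolynomial.map φ (disc r d F) := by
  rw [disc, phi_map, Polynomial.derivative_map, Polynomial.resultant_map_map]; rfl

theorem disc_C_mul (r : σ) {d : ℕ} (hd : 1 ≤ d) (a : R) (F : MvPolynomial σ R) :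
    disc r d (MvPolynomial.C a * F) = MvPolynomial.C (a ^ (2 * d - 1)) * disc r d F := by
  rw [disc, map_mul, phi_C, Polynomial.derivative_C_mul, Polynomial.resultant_C_mul_left,
    Polynomial.resultant_C_mul_right, ← mul_assoc, ← pow_add, ← map_pow]
  congr 3
  omega

theorem natDegree_derivative_le' {A : Type*} [CommRing A] {p : Polynomial A} {d : ℕ}
    (h : p.natDegree ≤ d) : p.derivative.natDegree ≤ d - 1 :=
  (Polynomial.natDegree_derivative_le p).trans (Nat.sub_le_sub_right h 1)

/-- The discriminant vanishes if `F` has a square factor involving `T_r`. -/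
theorem disc_eq_zero_of_sq_dvd [IsDomain R] (r : σ) {d : ℕ} (hd : 1 ≤ d) {F g : MvPolynomial σ R}
    (hF : MvPolynomial.degreeOf r F ≤ d) (hg : MvPolynomial.degreeOf r g ≠ 0)
    (h : g ^ 2 ∣ F) : disc r d F = 0 := by
  rw [← natDegree_phi] at hF hg
  obtain ⟨p, q, -, -, hpq⟩ := Polynomial.exists_mul_add_mul_eq_C_resultant (phi r F)
    (Polynomial.derivative (phi r F)) hF (natDegree_derivative_le' hF) (Or.inl (by omega))
  obtain ⟨w, rfl⟩ := h
  by_contra hne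
  have hdvd : phi r g ∣ Polynomial.C (disc r d (g ^ 2 * w)) := by
    rw [disc, ← hpq]
    refine dvd_add (Dvd.dvd.mul_right ?_ _) (Dvd.dvd.mul_right ?_ _)
    · rw [map_mul, map_pow, sq]
      exact (dvd_mul_right _ _).mul_right _
    · rw [map_mul, map_pow, sq, mul_assoc, Polynomial.derivative_mul, Polynomial.derivative_mul]
      exact dvd_add ((dvd_mul_right _ _).mul_left _) (dvd_mul_right _ _)
  have := Polynomial.natDegree_le_of_dvd hdvd (by simpa using hne)
  rw [Polynomial.natDegree_C] at this
  omega

/-- The discriminant vanishes if the degree in `T_r` is smaller than expected. -/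
theorem disc_eq_zero_of_degreeOf_lt [IsDomain R] (r : σ) {d : ℕ} {F : MvPolynomial σ R}
    (hF : MvPolynomial.degreeOf r F < d) : disc r d F = 0 := by
  rw [← natDegree_phi] at hF
  have hder := natDegree_derivative_le' (Nat.le_sub_one_of_lt hF)
  by_cases hd : d = 1
  · subst hd
    obtain ⟨p, q, hp, -, hpq⟩ := Polynomial.exists_mul_add_mul_eq_C_resultant (phi r F)
      (Polynomial.derivative (phi r F)) hF.le (natDegree_derivative_le' hF.le) (Or.inl one_ne_zero)
    have h0 : Polynomial.derivative (phi r F) = 0 := by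
      rw [Polynomial.eq_C_of_natDegree_le_zero (Nat.lt_one_iff.mp hF).le, Polynomial.derivative_C]
    have hp0 : p = 0 := Polynomial.degree_eq_bot.mp (by simpa using hp)
    rw [hp0, mul_zero, h0, zero_mul, add_zero] at hpq
    rw [disc, h0]
    exact Polynomial.C_eq_zero.mp hpq.symm
  · exact Polynomial.resultant_eq_zero_of_lt_lt _ _ _ _ hF (by omega)

theorem pow_dvd_det {ι A : Type*} [Fintype ι] [DecidableEq ι] [CommRing A] {p : A}
    (M : Matrix ι ι A) (s : Finset ι) (h : ∀ i ∈ s, ∀ j, p ∣ M i j) : p ^ s.card ∣ M.det := by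
  rw [Matrix.det_apply]
  refine Finset.dvd_sum fun τ _ => ?_
  rw [Units.smul_def, zsmul_eq_mul]
  refine Dvd.dvd.mul_left ?_ _
  rw [← Equiv.prod_comp τ.symm, ← Finset.prod_const]
  simp only [Equiv.apply_symm_apply]
  exact (Finset.prod_dvd_prod_of_dvd _ _ fun i hi => h i hi _).trans
    (Finset.prod_dvd_prod_of_subset _ _ _ (Finset.subset_univ s))

/-- If modulo `p` the degree of `f` drops by `z`, then `z` rows of the Sylvester matrix of `f` and
its derivative are divisible by `p`. -/
theorem pow_dvd_resultant_derivative {A : Type*} [CommRing A] {p : A} {f : Polynomial A}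
    {d z : ℕ} (hz : z ≤ d) (h : ∀ k, d - z < k → p ∣ f.coeff k) :
    p ^ z ∣ f.resultant f.derivative d (d - 1) := by
  rcases Nat.eq_zero_or_pos d with rfl | hd
  · obtain rfl : z = 0 := by omega
    simp
  let e : Fin z ↪ Fin (d + (d - 1)) :=
    ⟨fun i => ⟨d + (d - 1) - z + i, by omega⟩, fun i j h => by
      have := congrArg Fin.val h
      simp only at this
      exact Fin.ext (by omega)⟩
  have hd' : ∀ k, d - z ≤ k → p ∣ f.derivative.coeff k := fun k hk => by
    rw [Polynomial.coeff_derivative]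
    exact (h _ (by omega)).mul_right _
  have hs := (Finset.card_map e (s := Finset.univ)).trans (Finset.card_fin z)
  rw [← hs]
  refine pow_dvd_det _ _ fun i hi j => ?_
  have hi' : d + (d - 1) - z ≤ (i : ℕ) := by
    obtain ⟨k, -, rfl⟩ := Finset.mem_map.mp hi
    exact Nat.le_add_right _ _
  rw [Polynomial.sylvester, Matrix.of_apply]
  induction j using Fin.addCases with
  | left j =>
    rw [Fin.addCases_left]
    split_ifs
    · exact hd' _ (by omega)
    · exact dvd_zero _
  | right j =>
    rw [Fin.addCases_right]
    split_ifs
    · exact h _ (by omega)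
    · exact dvd_zero _

end Coefficients

/-! ### Discriminants: non-vanishing and archimedean size -/

section NonVanishing

open Polynomial

/-- A squarefree primitive polynomial over a factorial ring stays squarefree over the field of
fractions. -/
theorem squarefree_map_fractionRing {A L : Type*} [CommRing A] [IsDomain A]
    [UniqueFactorizationMonoid A] [Field L] [Algebra A L] [IsFractionRing A L] {f : A[X]}
    (hp : f.IsPrimitive) (hf : Squarefree f) : Squarefree (f.map (algebraMap A L)) := by
  classical
  obtain ⟨_⟩ : Nonempty (NormalizedGCDMonoid A) := inferInstance
  intro g hg
  have hf0 : f.map (algebraMap A L) ≠ 0 :=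
    (Polynomial.map_ne_zero_iff (IsFractionRing.injective A L)).mpr hp.ne_zero
  have hg0 : g ≠ 0 := by
    rintro rfl
    exact hf0 (by simpa using hg)
  obtain ⟨b, hb, hN⟩ := IsLocalization.integerNormalization_spec (nonZeroDivisors A) g
  generalize IsLocalization.integerNormalization (nonZeroDivisors A) g = N at hN
  have hb0 : algebraMap A L b ≠ 0 := by
    simpa using nonZeroDivisors.ne_zero hb
  have hN' : N.map (algebraMap A L) = Polynomial.C (algebraMap A L b) * g := by
    rw [hN, ← Polynomial.smul_eq_C_mul, algebraMap_smul]
  have hN0 : N ≠ 0 := by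
    intro h
    rw [h, Polynomial.map_zero] at hN'
    exact mul_ne_zero (by simpa using hb0) hg0 hN'.symm
  have hc0 : algebraMap A L N.content ≠ 0 := by
    simpa using Polynomial.content_eq_zero_iff.not.mpr hN0
  have hass : Associated (N.primPart.map (algebraMap A L)) g := by
    have h1 : Associated (N.map (algebraMap A L)) g := by
      rw [hN']
      exact associated_unit_mul_left _ _ (Polynomial.isUnit_C.mpr hb0.isUnit)
    refine Associated.trans ?_ h1
    conv_rhs => rw [N.eq_C_content_mul_primPart, Polynomial.map_mul, Polynomial.map_C]
    exact (associated_unit_mul_left _ _ (Polynomial.isUnit_C.mpr hc0.isUnit)).symm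
  have hPP : N.primPart * N.primPart ∣ f := by
    refine Polynomial.IsPrimitive.dvd_of_fraction_map_dvd_fraction_map (K := L)
      (N.isPrimitive_primPart.mul N.isPrimitive_primPart) ?_
    rw [Polynomial.map_mul]
    exact (hass.mul_mul hass).dvd.trans hg
  have hu := hf _ hPP
  exact hass.isUnit (hu.map (Polynomial.mapRingHom (algebraMap A L)))

theorem resultant_derivative_ne_zero {A : Type*} [CommRing A] [IsDomain A] [CharZero A]
    [UniqueFactorizationMonoid A] {f : A[X]} (hp : f.IsPrimitive) (hf : Squarefree f) :
    f.resultant f.derivative f.natDegree (f.natDegree - 1) ≠ 0 := by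
  intro h
  let L := FractionRing A
  have : CharZero L := IsFractionRing.charZero_of_isFractionRing A
  have hinj := IsFractionRing.injective A L
  have h1 := (Polynomial.resultant_map_map f f.derivative f.natDegree (f.natDegree - 1)
    (algebraMap A L)).trans (by rw [h, map_zero])
  have hn : (f.map (algebraMap A L)).natDegree = f.natDegree :=
    Polynomial.natDegree_map_eq_of_injective hinj f
  rw [← Polynomial.derivative_map, ← hn, ← Polynomial.natDegree_derivative,
    Polynomial.resultant_eq_zero_iff] at h1
  exact h1.2 (PerfectField.separable_iff_squarefree.mpr (squarefree_map_fractionRing hp hf))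

variable {σ K : Type*} [DecidableEq σ] [Field K]

/-- The isomorphism of `K[T]` with the polynomials in `T_r` over the ring of polynomials in the
other variables. -/
def splitVar (r : σ) : MvPolynomial σ K ≃ₐ[K] (MvPolynomial {b : σ // b ≠ r} K)[X] :=
  (MvPolynomial.renameEquiv K (Equiv.optionSubtypeNe r).symm).trans
    (MvPolynomial.optionEquivLeft K _)

theorem phi_eq_map_splitVar (r : σ) (F : MvPolynomial σ K) :
    phi r F = (splitVar r F).map
      (MvPolynomial.rename (R := K) ((↑) : {b : σ // b ≠ r} → σ)).toRingHom := by
  have : (phi r : MvPolynomial σ K →ₐ[K] _)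
      = (Polynomial.mapAlgHom (MvPolynomial.rename ((↑) : {b : σ // b ≠ r} → σ))).comp
        (splitVar r : MvPolynomial σ K ≃ₐ[K] _).toAlgHom := by
    refine MvPolynomial.algHom_ext fun i => ?_
    change phi r (MvPolynomial.X i) = Polynomial.map _ (MvPolynomial.optionEquivLeft K _
      (MvPolynomial.rename _ (MvPolynomial.X i)))
    rw [phi, MvPolynomial.aeval_X, MvPolynomial.rename_X]
    by_cases h : i = r
    · subst h
      rw [if_pos rfl, Equiv.optionSubtypeNe_symm_self, MvPolynomial.optionEquivLeft_X_none,
        Polynomial.map_X]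
    · rw [if_neg h, Equiv.optionSubtypeNe_symm_of_ne h, MvPolynomial.optionEquivLeft_X_some,
        Polynomial.map_C]
      simp
  exact DFunLike.congr_fun this F

theorem natDegree_splitVar (r : σ) (F : MvPolynomial σ K) :
    (splitVar r F).natDegree = MvPolynomial.degreeOf r F := by
  rw [← natDegree_phi, phi_eq_map_splitVar]
  exact (Polynomial.natDegree_map_eq_of_injective
    (MvPolynomial.rename_injective _ Subtype.val_injective) _).symm

theorem disc_ne_zero [CharZero K] (r : σ) {F : MvPolynomial σ K} (hF : Squarefree F)
    (hF0 : F ≠ 0) (h : ∀ q, Irreducible q → q ∣ F → MvPolynomial.degreeOf r q ≠ 0) :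
    disc r (MvPolynomial.degreeOf r F) F ≠ 0 := by
  have hsq : Squarefree (splitVar r F) := fun g hg => by
    have h1 : (splitVar r).symm g * (splitVar r).symm g ∣ F := by
      rw [← map_mul]
      obtain ⟨w, hw⟩ := hg
      exact ⟨(splitVar r).symm w, by rw [← map_mul, ← hw, AlgEquiv.symm_apply_apply]⟩
    simpa using (hF _ h1).map (splitVar r)
  have hprim : (splitVar r F).IsPrimitive := by
    intro c hc
    by_contra hu
    have hc0 : c ≠ 0 := by
      rintro rfl
      rw [map_zero, zero_dvd_iff] at hc
      exact hF0 (by simpa using hc)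
    obtain ⟨q, hq, hqc⟩ := WfDvdMonoid.exists_irreducible_factor hu hc0
    have hqC : Irreducible (Polynomial.C q) := (Polynomial.prime_C_iff.mpr hq.prime).irreducible
    refine h ((splitVar r).symm (Polynomial.C q)) ?_ ?_ ?_
    · exact (MulEquiv.irreducible_iff (splitVar r).symm).mpr hqC
    · obtain ⟨w, hw⟩ := (map_dvd Polynomial.C hqc).trans hc
      exact ⟨(splitVar r).symm w, by rw [← map_mul, ← hw, AlgEquiv.symm_apply_apply]⟩
    · rw [← natDegree_splitVar, AlgEquiv.apply_symm_apply, Polynomial.natDegree_C]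
  have := resultant_derivative_ne_zero hprim hsq
  rw [natDegree_splitVar] at this
  rw [disc, phi_eq_map_splitVar, Polynomial.derivative_map, Polynomial.resultant_map_map]
  exact fun h0 => this (MvPolynomial.rename_injective _ Subtype.val_injective
    (h0.trans (map_zero _).symm))

theorem pow_dvd_disc (r : σ) {d e : ℕ} {p F : MvPolynomial σ K}
    (h : ∀ k, e < k → p ∣ (phi r F).coeff k) : p ^ (d - e) ∣ disc r d F :=
  (le_or_gt e d).elim
    (fun he => pow_dvd_resultant_derivative (Nat.sub_le d e) fun k hk => h k (by omega))
    (fun he => by rw [Nat.sub_eq_zero_of_le he.le]; simp)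

end NonVanishing

section OneVariable

open Polynomial

/-- Hadamard's inequality. -/
theorem norm_det_sq_le_prod {d : ℕ} (A : Matrix (Fin d) (Fin d) ℂ) :
    ‖A.det‖ ^ 2 ≤ ∏ i, ∑ j, ‖A i j‖ ^ 2 := by
  let u : Fin d → EuclideanSpace ℂ (Fin d) := EuclideanSpace.basisFun (Fin d) ℂ
  have hu : gramVol u = 1 := by
    have : Matrix.gram ℂ u = 1 := by
      ext i j
      rw [Matrix.gram_apply, Matrix.one_apply]
      exact orthonormal_iff_ite.mp (EuclideanSpace.basisFun (Fin d) ℂ).orthonormal i j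
    rw [gramVol, this, Matrix.det_one, Complex.one_re]
  have h := gramVol_linear_combination u A
  rw [hu, mul_one, ← relVol_bot_sq] at h
  rw [← h]
  have h2 := relVol_le_prod_norm ⊥ fun i => ∑ j, A i j • u j
  refine (pow_le_pow_left₀ (relVol_nonneg _ _) h2 2).trans_eq ?_
  rw [← Finset.prod_pow]
  refine Finset.prod_congr rfl fun i _ => ?_
  have : ∑ j, A i j • u j = WithLp.toLp 2 (A i) := by
    ext k
    simp [u, Finset.sum_apply, Pi.single_apply]
  rw [this, EuclideanSpace.norm_sq_eq]

theorem prod_max_le_mahler (c : ℂ) {d : ℕ} (α : Fin d → ℂ) :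
    (Polynomial.C c * ∏ i, (X - C (α i))).mahlerMeasure = ‖c‖ * ∏ i, max 1 ‖α i‖ := by
  by_cases hc : c = 0
  · simp [hc]
  · rw [mahlerMeasure_eq_leadingCoeff_mul_prod_roots]
    have h0 : (∏ i, (X - C (α i))) ≠ 0 := (monic_prod_X_sub_C α Finset.univ).ne_zero
    rw [leadingCoeff_mul, leadingCoeff_C, (monic_prod_X_sub_C α Finset.univ).leadingCoeff, mul_one,
      roots_C_mul _ hc, roots_prod _ _ h0]
    simp only [roots_X_sub_C, Multiset.bind_singleton, Multiset.map_map]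
    rfl

/-- Mahler's bound for the discriminant of a complex polynomial. -/
theorem norm_resultant_derivative_le {d : ℕ} (hd : 1 ≤ d) {p : ℂ[X]} (hp : p.natDegree = d) :
    ‖p.resultant p.derivative d (d - 1)‖ ≤ (d : ℝ) ^ d * p.mahlerMeasure ^ (2 * d - 1) := by
  have hsp : p.Splits := IsAlgClosed.splits p
  have hcard : p.roots.card = d := by rw [← hp]; exact hsp.natDegree_eq_card_roots.symm
  obtain ⟨α, hα⟩ : ∃ α : Fin d → ℂ, p.roots = Finset.univ.val.map α := by
    obtain ⟨l, hl⟩ := Quot.exists_rep p.roots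
    have hlen : l.length = d := by rw [← hcard, ← hl]; rfl
    subst hlen
    exact ⟨l.get, by rw [Fin.univ_val_map, List.ofFn_get, ← hl]; rfl⟩
  have hpr : p = C p.leadingCoeff * ∏ i, (X - C (α i)) := by
    conv_lhs => rw [hsp.eq_prod_roots, hα, Multiset.map_map]
    rfl
  set c := p.leadingCoeff with hc
  have hder : ∀ i, p.derivative.eval (α i) = c * ∏ j ∈ ({i}ᶜ : Finset (Fin d)), (α i - α j) := by
    intro i
    rw [hpr, derivative_C_mul, eval_mul, eval_C, ← Finset.mul_prod_erase _ _ (Finset.mem_univ i),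
      derivative_mul, eval_add, eval_mul, eval_mul]
    simp [eval_prod, Finset.compl_singleton]
  have h1 : p.resultant p.derivative d (d - 1)
      = c ^ (2 * d - 1) * ∏ i, ∏ j ∈ ({i}ᶜ : Finset (Fin d)), (α i - α j) := by
    have := resultant_eq_prod_eval p p.derivative (d - 1)
      (by rw [← hp]; exact natDegree_derivative_le p) hsp
    rw [hp, hα, Multiset.map_map] at this
    rw [this]
    change _ * ∏ i, p.derivative.eval (α i) = _
    simp only [hder]
    rw [Finset.prod_mul_distrib, Finset.prod_const, Finset.card_univ, Fintype.card_fin, ← mul_assoc,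
      ← pow_add]
    congr 2
    omega
  have h2 : ‖∏ i, ∏ j ∈ ({i}ᶜ : Finset (Fin d)), (α i - α j)‖
      = ‖(Matrix.vandermonde α).det‖ ^ 2 := by
    have e := Finset.prod_prod_Ioi_mul_eq_prod_prod_off_diag fun i j : Fin d => ‖α j - α i‖
    rw [norm_prod]
    simp only [norm_prod]
    rw [← e, Matrix.det_vandermonde, norm_prod, ← Finset.prod_pow]
    refine Finset.prod_congr rfl fun i _ => ?_
    rw [norm_prod, ← Finset.prod_pow]
    refine Finset.prod_congr rfl fun j _ => ?_
    rw [norm_sub_rev (α i), sq]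
  have h3 : ‖(Matrix.vandermonde α).det‖ ^ 2 ≤ (d : ℝ) ^ d * (∏ i, max 1 ‖α i‖) ^ (2 * (d - 1)) := by
    refine (norm_det_sq_le_prod _).trans ?_
    have : ∀ i, ∑ j, ‖Matrix.vandermonde α i j‖ ^ 2 ≤ d * (max 1 ‖α i‖) ^ (2 * (d - 1)) := by
      intro i
      refine (Finset.sum_le_card_nsmul _ _ ((max 1 ‖α i‖) ^ (2 * (d - 1))) fun j _ => ?_).trans_eq
        (by simp)
      rw [Matrix.vandermonde_apply, norm_pow, ← pow_mul]
      refine (pow_le_pow_left₀ (norm_nonneg _) (le_max_right _ _) _).trans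
        (pow_le_pow_right₀ (le_max_left _ _) ?_)
      have := j.2
      omega
    refine (Finset.prod_le_prod (fun i _ => by positivity) fun i _ => this i).trans_eq ?_
    rw [Finset.prod_mul_distrib, Finset.prod_pow]
    simp
  have hM : p.mahlerMeasure = ‖c‖ * ∏ i, max 1 ‖α i‖ := by
    conv_lhs => rw [hpr]
    exact prod_max_le_mahler c α
  have hP1 : 1 ≤ ∏ i, max 1 ‖α i‖ :=
    Finset.prod_induction _ (fun x : ℝ => 1 ≤ x) (fun _ _ => one_le_mul_of_one_le_of_one_le) le_rfl
      fun i _ => le_max_left _ _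
  rw [h1, norm_mul, norm_pow, h2, hM, mul_pow]
  calc ‖c‖ ^ (2 * d - 1) * ‖(Matrix.vandermonde α).det‖ ^ 2
      ≤ ‖c‖ ^ (2 * d - 1) * ((d : ℝ) ^ d * (∏ i, max 1 ‖α i‖) ^ (2 * d - 1)) := by
        gcongr
        refine h3.trans ?_
        gcongr
        omega
    _ = _ := by ring

end OneVariable

section Archimedean

open MeasureTheory

variable {σ : Type*} [Fintype σ] [DecidableEq σ]

omit [Fintype σ] in
theorem logMahlerMeasure_map_phi (r : σ) (F : MvPolynomial σ ℂ) (x : UnitAddTorus σ) :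
    (curve (circ x) (Pi.single r 1) F).logMahlerMeasure
      = ((phi r F).map (MvPolynomial.eval (circ x))).logMahlerMeasure := by
  rw [← integral_log_eval_circle, ← integral_log_eval_circle,
    ← integral_add_left_eq_self (μ := (volume : Measure UnitAddCircle))
      (fun t => Real.log ‖((phi r F).map (MvPolynomial.eval (circ x))).eval (unitPt t)‖) (x r)]
  refine integral_congr_ae (Filter.Eventually.of_forall fun t => ?_)
  simp only
  rw [eval_curve, unitPt_add, eval_eq_eval_map_phi r (z' := circ x) (fun i hi => ?_)]
  · simp [circ]
  · simp [hi]

theorem logMahler_eq_integral_phi (r : σ) {F : MvPolynomial σ ℂ} (hF : F ≠ 0) :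
    Integrable (fun x : UnitAddTorus σ =>
      ((phi r F).map (MvPolynomial.eval (circ x))).logMahlerMeasure) ∧
    logMahler F = ∫ x : UnitAddTorus σ,
      ((phi r F).map (MvPolynomial.eval (circ x))).logMahlerMeasure := by
  simp only [← logMahlerMeasure_map_phi]
  exact logMahler_eq_integral _ (integrable_log_eval hF)

theorem logMahler_lead_le (r : σ) {F : MvPolynomial σ ℂ} (hF : F ≠ 0) :
    logMahler (lead r F) ≤ logMahler F := by
  obtain ⟨hi, h⟩ := logMahler_eq_integral_phi r hF
  rw [h, logMahler]
  refine integral_mono_ae (integrable_log_eval (lead_ne_zero r hF)) hi ?_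
  filter_upwards [ae_eval_ne_zero (lead_ne_zero r hF)] with x hx
  have hx' : ((phi r F).map (MvPolynomial.eval (circ x))).leadingCoeff
      = MvPolynomial.eval (circ x) (lead r F) :=
    Polynomial.leadingCoeff_map_of_leadingCoeff_ne_zero _ hx
  rw [← hx', Polynomial.logMahlerMeasure_eq_log_MahlerMeasure]
  exact Real.log_le_log (by rw [hx']; exact norm_pos_iff.mpr hx)
    (Polynomial.leadingCoeff_le_mahlerMeasure _)

theorem logMahler_disc_le (r : σ) {F : MvPolynomial σ ℂ} {d : ℕ} (hd : 1 ≤ d)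
    (hF : MvPolynomial.degreeOf r F = d) (hdisc : disc r d F ≠ 0) :
    logMahler (disc r d F) ≤ (2 * d - 1) * logMahler F + d * Real.log d := by
  have hF0 : F ≠ 0 := by
    rintro rfl
    rw [MvPolynomial.degreeOf_zero] at hF
    omega
  obtain ⟨hi, h⟩ := logMahler_eq_integral_phi r hF0
  have : (2 * d - 1) * logMahler F + d * Real.log d = ∫ x : UnitAddTorus σ,
      ((2 * d - 1) * ((phi r F).map (MvPolynomial.eval (circ x))).logMahlerMeasure
        + d * Real.log d) := by
    rw [integral_add (hi.const_mul _) (integrable_const _), integral_const_mul, ← h]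
    simp
  rw [this, logMahler]
  refine integral_mono_ae (integrable_log_eval hdisc) ((hi.const_mul _).add (integrable_const _)) ?_
  filter_upwards [ae_eval_ne_zero (lead_ne_zero r hF0), ae_eval_ne_zero hdisc] with x hx hx2
  set p := (phi r F).map (MvPolynomial.eval (circ x)) with hpdef
  have hdeg : p.natDegree = d := by
    rw [← hF, ← natDegree_phi]
    exact Polynomial.natDegree_map_of_leadingCoeff_ne_zero _ hx
  have hp0 : p ≠ 0 := by
    rintro h0
    rw [h0, Polynomial.natDegree_zero] at hdeg
    omega
  have he : MvPolynomial.eval (circ x) (disc r d F) = p.resultant p.derivative d (d - 1) := by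
    rw [hpdef, Polynomial.derivative_map, Polynomial.resultant_map_map]; rfl
  have hM : 0 < p.mahlerMeasure := Polynomial.mahlerMeasure_pos_of_ne_zero hp0
  have hd0 : (0 : ℝ) < d := by exact_mod_cast hd
  have := Real.log_le_log (norm_pos_iff.mpr hx2) (he ▸ norm_resultant_derivative_le hd hdeg)
  rw [Real.log_mul (by positivity) (by positivity), Real.log_pow, Real.log_pow,
    ← Polynomial.logMahlerMeasure_eq_log_MahlerMeasure, Nat.cast_sub (by omega)] at this
  push_cast at this
  linarith

end Archimedean

/-! ### Heights of leading coefficients and of discriminants -/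

section DiscriminantHeight

open IsDedekindDomain

variable {K : Type*} [Field K] [NumberField K] {σ : Type*} [DecidableEq σ]

theorem gaussV_lead_le (v : HeightOneSpectrum (𝓞 K)) (r : σ) {F : MvPolynomial σ K}
    (hF : F ≠ 0) : gaussV v (lead r F) ≤ gaussV v F := by
  obtain ⟨d, hd, h⟩ := exists_gaussV_eq v (lead_ne_zero r hF)
  rw [h]
  rcases coeff_phi_coeff_eq_zero_or r F (phi r F).natDegree d with h0 | ⟨-, h0⟩
  · exact absurd h0 (MvPolynomial.mem_support_iff.mp hd)
  · exact (congrArg (absV v) h0).trans_le (absV_coeff_le_gaussV v F _)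

omit [NumberField K] in
theorem lead_map {L : Type*} [Field L] (φ : K →+* L) (r : σ) (F : MvPolynomial σ K) :
    lead r (MvPolynomial.map φ F) = MvPolynomial.map φ (lead r F) := by
  rw [lead, phi_map, Polynomial.leadingCoeff_map_of_injective
    (MvPolynomial.map_injective φ φ.injective)]; rfl

variable [Fintype σ]

omit [DecidableEq σ] [Fintype σ] in
theorem exists_finset_gaussV_eq_one {Q : MvPolynomial σ K} (hQ : Q ≠ 0) :
    ∃ S : Finset (HeightOneSpectrum (𝓞 K)), ∀ v ∉ S, gaussV v Q = 1 :=
  ⟨(finite_gaussV_ne_one hQ).toFinset, fun v hv => by simpa using hv⟩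

theorem hgt_lead_le (r : σ) {F : MvPolynomial σ K} (hF : F ≠ 0) : hgt (lead r F) ≤ hgt F := by
  classical
  obtain ⟨S₁, h₁⟩ := exists_finset_gaussV_eq_one hF
  obtain ⟨S₂, h₂⟩ := exists_finset_gaussV_eq_one (lead_ne_zero r hF)
  rw [hgt_eq_sum (S₁ ∪ S₂) fun v hv => h₁ v fun h => hv (Finset.mem_union_left _ h),
    hgt_eq_sum (S₁ ∪ S₂) fun v hv => h₂ v fun h => hv (Finset.mem_union_right _ h)]
  refine add_le_add (Finset.sum_le_sum fun φ _ => ?_) (Finset.sum_le_sum fun v _ => ?_)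
  · rw [← lead_map]
    exact logMahler_lead_le r (map_embedding_ne_zero φ hF)
  · exact Real.log_le_log (gaussV_pos v (lead_ne_zero r hF)) (gaussV_lead_le v r hF)

omit [DecidableEq σ] in
theorem hgt_one : hgt (1 : MvPolynomial σ K) = 0 := by
  have := hgt_mul (one_ne_zero (α := MvPolynomial σ K)) one_ne_zero
  rw [mul_one] at this
  linarith

omit [DecidableEq σ] in
theorem hgt_prod {ι : Type*} (I : Finset ι) (p : ι → MvPolynomial σ K) (hp : ∀ i ∈ I, p i ≠ 0) :
    hgt (∏ i ∈ I, p i) = ∑ i ∈ I, hgt (p i) := by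
  classical
  induction I using Finset.induction_on with
  | empty => simp [hgt_one]
  | insert i I hi ih =>
    have h := fun j hj => hp j (Finset.mem_insert_of_mem hj)
    rw [Finset.prod_insert hi, Finset.sum_insert hi,
      hgt_mul (hp i (Finset.mem_insert_self i I)) (Finset.prod_ne_zero_iff.mpr h), ih h]

omit [DecidableEq σ] in
theorem hgt_pow {p : MvPolynomial σ K} (hp : p ≠ 0) (z : ℕ) : hgt (p ^ z) = z * hgt p := by
  rw [← Finset.card_range z, ← Finset.prod_const, hgt_prod _ _ fun _ _ => hp, Finset.sum_const,
    nsmul_eq_mul]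

omit [Fintype σ] in
open scoped Classical in
/-- The discriminant of `F` is small at every finite place; it is smaller still where the
discriminant of the reduction of `F` vanishes. -/
theorem log_gaussV_disc_le (v : HeightOneSpectrum (𝓞 K)) (r : σ) {d : ℕ} (hd : 1 ≤ d)
    {F : MvPolynomial σ K} (hF : F ≠ 0) (hdisc : disc r d F ≠ 0) :
    Real.log (gaussV v (disc r d F)) ≤ (2 * d - 1) * Real.log (gaussV v F)
      - if disc r d (red v F) = 0 then Real.log (normV v) else 0 := by
  have hint : intMap (disc r d (primLift v F))
      = MvPolynomial.C (primScale v F ^ (2 * d - 1)) * disc r d F := by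
    rw [← disc_map, intMap_primLift, disc_C_mul r hd]
  have hred : disc r d (red v F) = redMap v (disc r d (primLift v F)) := disc_map _ _ _ _
  have ha := (absV v).pos (primScale_ne_zero v F)
  obtain ⟨e, he, h⟩ := exists_gaussV_eq v hdisc
  have hcoeff : algebraMap (𝓞 K) K ((disc r d (primLift v F)).coeff e)
      = primScale v F ^ (2 * d - 1) * (disc r d F).coeff e := by
    rw [← MvPolynomial.coeff_C_mul, ← hint, MvPolynomial.coeff_map]
  have hpos : 0 < absV v ((disc r d F).coeff e) :=
    (absV v).pos (MvPolynomial.mem_support_iff.mp he)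
  have hlog : Real.log (absV v (algebraMap (𝓞 K) K ((disc r d (primLift v F)).coeff e)))
      = (2 * d - 1) * Real.log (absV v (primScale v F)) + Real.log (gaussV v (disc r d F)) := by
    rw [hcoeff, map_mul, map_pow, Real.log_mul (by positivity) hpos.ne', Real.log_pow, h,
      Nat.cast_sub (by omega)]
    push_cast
    ring
  rw [gaussV_eq_primScale v hF, Real.log_inv]
  have h0 : 0 < absV v (algebraMap (𝓞 K) K ((disc r d (primLift v F)).coeff e)) := by
    rw [hcoeff, map_mul, map_pow]
    positivity
  split_ifs with hz
  · have hm : Ideal.Quotient.mk v.asIdeal ((disc r d (primLift v F)).coeff e) = 0 := by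
      rw [← MvPolynomial.coeff_map, ← hred, hz, MvPolynomial.coeff_zero]
    have := Real.log_le_log h0 (absV_coe_le_inv v _ hm)
    rw [Real.log_inv] at this
    linarith
  · have := Real.log_le_log h0 (absV_coe_le_one v _)
    rw [Real.log_one] at this
    linarith

/-- The discriminant with respect to `T_r` controls at once the places where it vanishes and the
polynomials that divide it. -/
theorem discriminant_estimate {ι : Type*} (r : σ) {d : ℕ} (hd : 1 ≤ d) {F : MvPolynomial σ K}
    (hF : MvPolynomial.degreeOf r F = d) (hdisc : disc r d F ≠ 0)
    (A : Finset (HeightOneSpectrum (𝓞 K))) (hA : ∀ v ∈ A, disc r d (red v F) = 0)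
    (I : Finset ι) (p : ι → MvPolynomial σ K) (z : ι → ℕ)
    (hp0 : ∀ i ∈ I, p i ≠ 0) (hp : (I : Set ι).Pairwise (Function.onFun IsRelPrime p))
    (hz : ∀ i ∈ I, p i ^ z i ∣ disc r d F) :
    ∑ v ∈ A, Real.log (normV v) + ∑ i ∈ I, z i * hgt (p i)
      ≤ (2 * d - 1) * hgt F + Fintype.card (K →+* ℂ) * (d * Real.log d) := by
  classical
  have hF0 : F ≠ 0 := by
    rintro rfl
    rw [MvPolynomial.degreeOf_zero] at hF
    omega
  have hdvd : ∏ i ∈ I, p i ^ z i ∣ disc r d F :=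
    Finset.prod_dvd_of_isRelPrime (fun i hi j hj hij => (hp hi hj hij).pow) hz
  have h1 : ∑ i ∈ I, z i * hgt (p i) ≤ hgt (disc r d F) := by
    have hn := fun i hi => pow_ne_zero (z i) (hp0 i hi)
    obtain ⟨w, hw⟩ := hdvd
    have hw0 : w ≠ 0 := by
      rintro rfl
      exact hdisc (hw.trans (mul_zero _))
    rw [hw, hgt_mul (Finset.prod_ne_zero_iff.mpr hn) hw0, hgt_prod _ _ hn]
    refine le_add_of_le_of_nonneg (Finset.sum_le_sum fun i hi => ?_) (hgt_nonneg hw0)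
    rw [hgt_pow (hp0 i hi)]
  obtain ⟨S₁, h₁⟩ := exists_finset_gaussV_eq_one hF0
  obtain ⟨S₂, h₂⟩ := exists_finset_gaussV_eq_one hdisc
  have h2 : hgt (disc r d F) ≤ (2 * d - 1) * hgt F + Fintype.card (K →+* ℂ) * (d * Real.log d)
      - ∑ v ∈ A, Real.log (normV v) := by
    set S := A ∪ (S₁ ∪ S₂) with hS
    rw [hgt_eq_sum S fun v hv => h₁ v fun h => hv (by simp [hS, h]),
      hgt_eq_sum S fun v hv => h₂ v fun h => hv (by simp [hS, h])]
    have ha : ∑ φ : K →+* ℂ, logMahler (MvPolynomial.map φ (disc r d F))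
        ≤ ∑ φ : K →+* ℂ, ((2 * d - 1) * logMahler (MvPolynomial.map φ F) + d * Real.log d) := by
      refine Finset.sum_le_sum fun φ _ => ?_
      have hn := map_embedding_ne_zero φ hdisc
      rw [← disc_map] at hn ⊢
      refine logMahler_disc_le r hd ?_ hn
      rw [← hF, ← natDegree_phi, ← natDegree_phi, phi_map]
      exact Polynomial.natDegree_map_eq_of_injective (MvPolynomial.map_injective φ φ.injective) _
    have hf : ∑ v ∈ S, Real.log (gaussV v (disc r d F))
        ≤ ∑ v ∈ S, ((2 * d - 1) * Real.log (gaussV v F)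
          - if v ∈ A then Real.log (normV v) else 0) := by
      refine Finset.sum_le_sum fun v _ => ?_
      have := log_gaussV_disc_le v r hd hF0 hdisc
      have hN := Real.log_pos (one_lt_normV v)
      by_cases hv : v ∈ A
      · rw [if_pos (hA v hv)] at this
        rwa [if_pos hv]
      · rw [if_neg hv]
        split_ifs at this <;> linarith
    rw [Finset.sum_add_distrib, ← Finset.mul_sum, Finset.sum_const, Finset.card_univ,
      nsmul_eq_mul] at ha
    rw [Finset.sum_sub_distrib, ← Finset.mul_sum, Finset.sum_ite_mem,
      Finset.inter_eq_right.mpr Finset.subset_union_left] at hf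
    linarith
  linarith

end DiscriminantHeight

/-! ### Iterated coefficients -/

section Sections

variable {σ R S : Type*} [DecidableEq σ] [CommRing R] [CommRing S]

/-- For a list of pairs `(r, k)`, take successively the coefficients of `T_r ^ k`. -/
def sec : List (σ × ℕ) → MvPolynomial σ R → MvPolynomial σ R
  | [], F => F
  | p :: J, F => sec J ((phi p.1 F).coeff p.2)

theorem coeff_phi_mul {r : σ} {c : MvPolynomial σ R} (hc : MvPolynomial.degreeOf r c = 0)
    (F : MvPolynomial σ R) (k : ℕ) : (phi r (c * F)).coeff k = c * (phi r F).coeff k := by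
  rw [map_mul, phi_eq_C r hc, Polynomial.coeff_C_mul]

theorem sec_mul {J : List (σ × ℕ)} {c : MvPolynomial σ R}
    (hc : ∀ p ∈ J, MvPolynomial.degreeOf p.1 c = 0) (F : MvPolynomial σ R) :
    sec J (c * F) = c * sec J F := by
  induction J generalizing F with
  | nil => rfl
  | cons p J ih =>
    rw [sec, sec, coeff_phi_mul (hc p List.mem_cons_self),
      ih fun q hq => hc q (List.mem_cons_of_mem p hq)]

theorem sec_C_mul (J : List (σ × ℕ)) (a : R) (F : MvPolynomial σ R) :
    sec J (MvPolynomial.C a * F) = MvPolynomial.C a * sec J F :=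
  sec_mul (fun _ _ => MvPolynomial.degreeOf_C _ _) F

theorem sec_dvd {J : List (σ × ℕ)} {c F : MvPolynomial σ R}
    (hc : ∀ p ∈ J, MvPolynomial.degreeOf p.1 c = 0) (h : c ∣ F) : c ∣ sec J F := by
  obtain ⟨w, rfl⟩ := h
  rw [sec_mul hc]
  exact dvd_mul_right _ _

theorem sec_map (J : List (σ × ℕ)) (φ : R →+* S) (F : MvPolynomial σ R) :
    sec J (MvPolynomial.map φ F) = MvPolynomial.map φ (sec J F) := by
  induction J generalizing F with
  | nil => rfl
  | cons p J ih => rw [sec, sec, phi_map, Polynomial.coeff_map, ih]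

theorem sec_zero (J : List (σ × ℕ)) : sec J (0 : MvPolynomial σ R) = 0 := by
  induction J with
  | nil => rfl
  | cons p J ih => rw [sec, map_zero, Polynomial.coeff_zero, ih]

theorem totalDegree_sec_add_le {J : List (σ × ℕ)} {F : MvPolynomial σ R} (h : sec J F ≠ 0) :
    (sec J F).totalDegree + (J.map Prod.snd).sum ≤ F.totalDegree := by
  induction J generalizing F with
  | nil => simp [sec]
  | cons p J ih =>
    rw [sec] at h ⊢
    have h0 : (phi p.1 F).coeff p.2 ≠ 0 := fun h0 => h (by rw [h0, sec_zero])
    have h1 := ih h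
    have h2 := totalDegree_coeff_phi_add_le p.1 h0
    rw [List.map_cons, List.sum_cons]
    omega

/-- The sum of the absolute values of the coefficients. -/
def l1 (F : MvPolynomial σ ℂ) : ℝ := ∑ d ∈ F.support, ‖F.coeff d‖

theorem l1_sec_le (J : List (σ × ℕ)) (F : MvPolynomial σ ℂ) : l1 (sec J F) ≤ l1 F := by
  induction J generalizing F with
  | nil => rfl
  | cons p J ih =>
    refine (ih _).trans ?_
    let e : (σ →₀ ℕ) ↪ (σ →₀ ℕ) := addRightEmbedding (Finsupp.single p.1 p.2)
    have hsub : ((phi p.1 F).coeff p.2).support.map e ⊆ F.support := by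
      intro d hd
      obtain ⟨d', hd', rfl⟩ := Finset.mem_map.mp hd
      exact (mem_support_coeff_phi hd').2
    refine le_trans ?_ (Finset.sum_le_sum_of_subset_of_nonneg hsub fun _ _ _ => norm_nonneg _)
    rw [Finset.sum_map]
    refine Finset.sum_le_sum fun d hd => ?_
    rw [coeff_phi, if_pos (mem_support_coeff_phi hd).1]
    rfl

omit [DecidableEq σ] in
theorem l1_pderiv_le (i : σ) {F : MvPolynomial σ ℂ} {n : ℕ} (hn : MvPolynomial.degreeOf i F ≤ n) :
    l1 (MvPolynomial.pderiv i F) ≤ n * l1 F := by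
  let e : (σ →₀ ℕ) ↪ (σ →₀ ℕ) := addRightEmbedding (Finsupp.single i 1)
  have hc : ∀ d, (MvPolynomial.pderiv i F).coeff d
      = F.coeff (d + Finsupp.single i 1) * (d i + 1) := by
    intro d
    rw [MvPolynomial.coeff_pderiv]
  have hsub : (MvPolynomial.pderiv i F).support.map e ⊆ F.support := by
    intro d hd
    obtain ⟨d', hd', rfl⟩ := Finset.mem_map.mp hd
    rw [MvPolynomial.mem_support_iff, hc] at hd'
    exact MvPolynomial.mem_support_iff.mpr (left_ne_zero_of_mul hd')
  rw [l1, l1, Finset.mul_sum]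
  refine le_trans ?_ (Finset.sum_le_sum_of_subset_of_nonneg hsub fun _ _ _ => by positivity)
  rw [Finset.sum_map]
  refine Finset.sum_le_sum fun d hd => ?_
  have hd' := hsub (Finset.mem_map_of_mem e hd)
  have hle := (MvPolynomial.monomial_le_degreeOf i hd').trans hn
  have he : e d = d + Finsupp.single i 1 := rfl
  rw [he, Finsupp.add_apply, Finsupp.single_eq_same] at hle
  rw [hc, norm_mul, mul_comm, he]
  gcongr
  have : ((d i : ℂ) + 1) = ((d i + 1 : ℕ) : ℂ) := by push_cast; rfl
  rw [this, Complex.norm_natCast]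
  exact_mod_cast hle

theorem phi_pderiv (r : σ) (F : MvPolynomial σ R) :
    phi r (MvPolynomial.pderiv r F) = Polynomial.derivative (phi r F) := by
  induction F using MvPolynomial.induction_on with
  | C a => simp
  | add p q hp hq => simp [hp, hq]
  | mul_X p i hp =>
    rw [Derivation.leibniz, smul_eq_mul, smul_eq_mul, map_add, map_mul, map_mul, hp, map_mul,
      Polynomial.derivative_mul, MvPolynomial.pderiv_X]
    have hX : phi r (MvPolynomial.X i : MvPolynomial σ R)
        = if i = r then Polynomial.X else Polynomial.C (MvPolynomial.X i) :=
      MvPolynomial.aeval_X _ _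
    rw [hX]
    by_cases h : i = r
    · subst h
      simp
      ring
    · simp [h]
      ring

theorem not_dvd_pderiv [IsDomain R] [CharZero R] {r : σ} {p : MvPolynomial σ R}
    (hp : MvPolynomial.degreeOf r p ≠ 0) : ¬ p ∣ MvPolynomial.pderiv r p := by
  rw [← natDegree_phi] at hp
  intro h
  have h1 : phi r p ∣ Polynomial.derivative (phi r p) := by
    rw [← phi_pderiv]
    exact map_dvd (phi r) h
  have h2 : Polynomial.derivative (phi r p) ≠ 0 := fun h0 =>
    hp (Polynomial.derivative_eq_zero.mp h0)
  have := Polynomial.natDegree_le_of_dvd h1 h2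
  have := Polynomial.natDegree_derivative_lt hp
  omega

/-- The degree in `T_r` of the reduction of `F` modulo `p`. -/
def degMod (p : MvPolynomial σ R) (r : σ) (F : MvPolynomial σ R) : ℕ :=
  ((phi r F).map (Ideal.Quotient.mk (Ideal.span {p}))).natDegree

theorem degMod_le (p : MvPolynomial σ R) (r : σ) (F : MvPolynomial σ R) :
    degMod p r F ≤ MvPolynomial.degreeOf r F := by
  rw [← natDegree_phi]
  exact Polynomial.natDegree_map_le

theorem dvd_coeff_phi_of_degMod_lt {p : MvPolynomial σ R} {r : σ} {F : MvPolynomial σ R} {k : ℕ}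
    (h : degMod p r F < k) : p ∣ (phi r F).coeff k := by
  have := Polynomial.coeff_eq_zero_of_natDegree_lt h
  rwa [Polynomial.coeff_map, Ideal.Quotient.eq_zero_iff_mem, Ideal.mem_span_singleton] at this

end Sections

section MainVariable

variable {σ R : Type*} [LinearOrder σ] [CommRing R]

/-- Let `p` be a prime not involving the variables in `s`. A polynomial which modulo `p` is a
multiple of a product of polynomials `G r`, where `G r` involves no variable in `s` before `r`, has
an iterated coefficient not divisible by `p` of order at least the sum of the degrees of the `G r`
modulo `p`: the first coefficient in the lexicographic order will do. -/
theorem exists_sec [IsDomain R] {p : MvPolynomial σ R} (hp : Prime p)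
    (G : σ → MvPolynomial σ R) (s : Finset σ) (hs : ∀ r ∈ s, MvPolynomial.degreeOf r p = 0)
    (hG : ∀ r ∈ s, ∀ i ∈ s, i < r → MvPolynomial.degreeOf i (G r) = 0)
    (F H : MvPolynomial σ R) (hF : ¬ p ∣ F) (hFG : p ∣ F - (∏ r ∈ s, G r) * H) :
    ∃ J : List (σ × ℕ), (∀ j ∈ J, j.1 ∈ s) ∧ ¬ p ∣ sec J F ∧
      ∑ r ∈ s, degMod p r (G r) ≤ (J.map Prod.snd).sum := by
  set I : Ideal (MvPolynomial σ R) := Ideal.span {p} with hI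
  have hIp : I.IsPrime := (Ideal.span_singleton_prime hp.ne_zero).mpr hp
  have hmk : ∀ x, Ideal.Quotient.mk I x = 0 ↔ p ∣ x := fun x => by
    rw [Ideal.Quotient.eq_zero_iff_mem, Ideal.mem_span_singleton]
  induction s using Finset.induction_on_min generalizing F H with
  | empty => exact ⟨[], by simp, hF, by simp⟩
  | insert a s ha ih =>
    have has : a ∉ s := fun h => lt_irrefl a (ha a h)
    let Φ : MvPolynomial σ R →+* Polynomial (MvPolynomial σ R ⧸ I) :=
      (Polynomial.mapRingHom (Ideal.Quotient.mk I)).comp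
        (phi a : MvPolynomial σ R →ₐ[R] _).toRingHom
    have hΦC : ∀ x, MvPolynomial.degreeOf a x = 0 → Φ x = Polynomial.C (Ideal.Quotient.mk I x) := by
      intro x hx
      change (phi a x).map _ = _
      rw [phi_eq_C a hx, Polynomial.map_C]
    have hΦp : Φ p = 0 := by
      rw [hΦC p (hs a (Finset.mem_insert_self a s)), (hmk p).mpr dvd_rfl, map_zero]
    have hΦF : Φ F = Φ (G a) * Φ H * Polynomial.C (Ideal.Quotient.mk I (∏ r ∈ s, G r)) := by
      obtain ⟨w, hw⟩ := hFG
      have h1 := congrArg Φ (sub_eq_iff_eq_add.mp hw)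
      rw [map_add, map_mul, hΦp, zero_mul, zero_add, map_mul, Finset.prod_insert has, map_mul,
        hΦC (∏ r ∈ s, G r)] at h1
      · rw [h1]
        ring
      · refine Finset.prod_induction _ (fun x => MvPolynomial.degreeOf a x = 0) (fun x y hx hy => ?_)
          (by rw [← MvPolynomial.C_1, MvPolynomial.degreeOf_C]) fun r hr =>
            hG r (Finset.mem_insert_of_mem hr) a (Finset.mem_insert_self a s) (ha r hr)
        have := MvPolynomial.degreeOf_mul_le a x y
        omega
    have hΦ0 : Φ F ≠ 0 := by
      intro h0
      apply hF
      rw [← eval_phi a F, Polynomial.eval_eq_sum_range]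
      refine Finset.dvd_sum fun k _ => Dvd.dvd.mul_right ((hmk _).mp ?_) _
      rw [← Polynomial.coeff_map]
      exact (congrArg (fun q => Polynomial.coeff q k) h0).trans (Polynomial.coeff_zero k)
    set k := degMod p a F with hk
    set F' := (phi a F).coeff k with hF'
    have hlc : Ideal.Quotient.mk I F' = (Φ F).leadingCoeff := by
      rw [hF', ← Polynomial.coeff_map]; rfl
    obtain ⟨H', hH'⟩ := Ideal.Quotient.mk_surjective (I := I) (Φ (G a) * Φ H).leadingCoeff
    obtain ⟨J, hJ, hJF, hJsum⟩ := ih (fun r hr => hs r (Finset.mem_insert_of_mem hr))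
      (fun r hr i hi => hG r (Finset.mem_insert_of_mem hr) i (Finset.mem_insert_of_mem hi)) F' H'
      (by rw [← hmk, hlc]; exact Polynomial.leadingCoeff_ne_zero.mpr hΦ0)
      (by
        rw [← hmk, map_sub, map_mul, hlc, hΦF, Polynomial.leadingCoeff_mul,
          Polynomial.leadingCoeff_C, hH', mul_comm, sub_self])
    refine ⟨(a, k) :: J, ?_, hJF, ?_⟩
    · intro j hj
      rcases List.mem_cons.mp hj with rfl | hj
      · exact Finset.mem_insert_self _ _
      · exact Finset.mem_insert_of_mem (hJ j hj)
    · rw [Finset.sum_insert has, List.map_cons, List.sum_cons]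
      refine add_le_add ?_ hJsum
      change (Φ (G a)).natDegree ≤ (Φ F).natDegree
      rw [hΦF, mul_assoc] at hΦ0 ⊢
      rw [Polynomial.natDegree_mul (left_ne_zero_of_mul hΦ0) (right_ne_zero_of_mul hΦ0)]
      exact Nat.le_add_right _ _

variable [Fintype σ] [Nonempty σ]

open scoped Classical in
/-- The first variable occurring in a polynomial (an arbitrary one for a constant). -/
def mainVar (F : MvPolynomial σ R) : σ :=
  if h : (Finset.univ.filter fun i => MvPolynomial.degreeOf i F ≠ 0).Nonempty then
    Finset.min' _ h else Classical.arbitrary σ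

omit [Nonempty σ] [Fintype σ] in
theorem eq_C_of_degreeOf_eq_zero {F : MvPolynomial σ R} (h : ∀ i, MvPolynomial.degreeOf i F = 0) :
    F = MvPolynomial.C (F.coeff 0) := by
  ext d
  rw [MvPolynomial.coeff_C]
  split_ifs with hd
  · rw [hd]
  · by_contra hne
    apply hd
    ext i
    have := MvPolynomial.monomial_le_degreeOf i (MvPolynomial.mem_support_iff.mpr hne)
    rw [h i] at this
    exact (Nat.le_zero.mp this).symm

theorem mainVar_spec {F : MvPolynomial σ R} {i : σ} (h : MvPolynomial.degreeOf i F ≠ 0) :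
    MvPolynomial.degreeOf (mainVar F) F ≠ 0 ∧
      ∀ j < mainVar F, MvPolynomial.degreeOf j F = 0 := by
  classical
  have hne : (Finset.univ.filter fun i => MvPolynomial.degreeOf i F ≠ 0).Nonempty :=
    ⟨i, by simp [h]⟩
  have e : mainVar F = Finset.min' _ hne := dif_pos hne
  constructor
  · have := Finset.min'_mem _ hne
    rw [← e] at this
    exact (Finset.mem_filter.mp this).2
  · intro j hj
    by_contra hj0
    exact absurd (Finset.min'_le _ j (by simp [hj0])) (not_le.mpr (e ▸ hj))

theorem mainVar_spec_of_irreducible {k : Type*} [Field k] {F : MvPolynomial σ k}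
    (h : Irreducible F) : MvPolynomial.degreeOf (mainVar F) F ≠ 0 ∧
      ∀ j < mainVar F, MvPolynomial.degreeOf j F = 0 := by
  by_cases h0 : ∀ i, MvPolynomial.degreeOf i F = 0
  · have h1 := eq_C_of_degreeOf_eq_zero h0
    refine absurd ?_ h.not_isUnit
    rw [h1]
    refine (Ne.isUnit fun h2 => h.ne_zero ?_).map MvPolynomial.C
    rw [h1, h2, map_zero]
  · push Not at h0
    exact mainVar_spec h0.choose_spec

end MainVariable

/-! ### Multiplicity estimates for iterated coefficients -/

section Estimates

open IsDedekindDomain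

variable {K : Type*} [Field K] [NumberField K] {σ : Type*}

theorem totalDegree_pos_of_irreducible {k : Type*} [Field k] {g : MvPolynomial σ k}
    (hg : Irreducible g) : 0 < g.totalDegree := by
  by_contra h
  have h1 := MvPolynomial.totalDegree_eq_zero_iff_eq_C.mp (Nat.eq_zero_of_not_pos h)
  refine hg.not_isUnit ?_
  rw [h1]
  refine (Ne.isUnit fun h2 => hg.ne_zero ?_).map MvPolynomial.C
  rw [h1, h2, map_zero]

theorem le_totalDegree_pow {k : Type*} [Field k] {g : MvPolynomial σ k}
    (hg : Irreducible g) (n : ℕ) : n ≤ (g ^ n).totalDegree := by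
  induction n with
  | zero => exact Nat.zero_le _
  | succ n ih =>
    rw [pow_succ, MvPolynomial.totalDegree_mul_of_isDomain (pow_ne_zero n hg.ne_zero) hg.ne_zero]
    have := totalDegree_pos_of_irreducible hg
    omega

theorem degreeOf_map_of_injective {R S : Type*} [CommRing R] [CommRing S] (r : σ) {φ : R →+* S}
    (hφ : Function.Injective φ) (F : MvPolynomial σ R) :
    MvPolynomial.degreeOf r (MvPolynomial.map φ F) = MvPolynomial.degreeOf r F := by
  classical
  rw [← natDegree_phi, ← natDegree_phi, phi_map]
  exact Polynomial.natDegree_map_eq_of_injective (MvPolynomial.map_injective φ hφ) _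

variable (v : HeightOneSpectrum (𝓞 K))

theorem degreeOf_primLift_le (r : σ) (Q : MvPolynomial σ K) :
    MvPolynomial.degreeOf r (primLift v Q) ≤ MvPolynomial.degreeOf r Q := by
  rw [← degreeOf_map_of_injective r (FaithfulSMul.algebraMap_injective (𝓞 K) K)]
  change MvPolynomial.degreeOf r (intMap (primLift v Q)) ≤ _
  rw [intMap_primLift]
  exact MvPolynomial.degreeOf_C_mul_le _ _ _

theorem degreeOf_red_le (r : σ) (Q : MvPolynomial σ K) :
    MvPolynomial.degreeOf r (red v Q) ≤ MvPolynomial.degreeOf r Q := by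
  classical
  exact (degreeOf_map_le r _ _).trans (degreeOf_primLift_le v r Q)

theorem hasDrop_zero (P Q : MvPolynomial σ K) : HasDrop v P Q (primScale v Q) 0 :=
  ⟨1, primLift v Q, intMap_primLift v Q, Nat.zero_le _, by simp, by simp⟩

theorem hasDrop_zero_one (P : MvPolynomial σ K) : HasDrop v P 1 1 0 :=
  ⟨1, 1, by simp, Nat.zero_le _, by simp, by simp⟩

variable [DecidableEq σ]

theorem hasDrop_sec {P Q : MvPolynomial σ K} (hP : P ≠ 0) {J : List (σ × ℕ)}
    (hJ : ∀ j ∈ J, MvPolynomial.degreeOf j.1 P = 0) {g : MvPolynomial σ (ResV v)}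
    (hg : Irreducible g) {μ : ℕ} (h₁ : g ^ μ ∣ red v P) (h₂ : g ^ μ ∣ red v Q) :
    HasDrop v P (sec J Q) (primScale v Q) μ := by
  refine ⟨g, sec J (primLift v Q), ?_, le_totalDegree_pow hg μ, h₁, ?_⟩
  · rw [intMap, ← sec_map, ← sec_C_mul, ← intMap_primLift]
  · rw [redMap, ← sec_map]
    refine sec_dvd (fun j hj => ?_) h₂
    exact degreeOf_eq_zero_of_dvd (red_ne_zero v hP) h₁
      (Nat.le_zero.mp ((degreeOf_red_le v j.1 P).trans (hJ j hj).le))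

theorem hasDrop_sec_zero (P Q : MvPolynomial σ K) (J : List (σ × ℕ)) :
    HasDrop v P (sec J Q) (primScale v Q) 0 := by
  refine ⟨1, sec J (primLift v Q), ?_, Nat.zero_le _, by simp, by simp⟩
  rw [intMap, ← sec_map, ← sec_C_mul, ← intMap_primLift]

theorem hasDrop_pderiv {P Q : MvPolynomial σ K} (hP : P ≠ 0) (t : σ) {J : List (σ × ℕ)}
    (hJ : ∀ j ∈ J, MvPolynomial.degreeOf j.1 P = 0) {g : MvPolynomial σ (ResV v)}
    (hg : Irreducible g) (h₁ : g ∣ red v P) (h₂ : g ^ 2 ∣ red v Q) :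
    HasDrop v P (MvPolynomial.pderiv t (sec J Q)) (primScale v Q) 1 := by
  refine ⟨g, MvPolynomial.pderiv t (sec J (primLift v Q)), ?_, le_totalDegree_pow hg 1,
    by rwa [pow_one], ?_⟩
  · rw [intMap, ← MvPolynomial.pderiv_map, ← sec_map]
    change MvPolynomial.pderiv t (sec J (intMap (primLift v Q))) = _
    rw [intMap_primLift, sec_C_mul, MvPolynomial.pderiv_C_mul]
  · rw [redMap, ← MvPolynomial.pderiv_map, ← sec_map, pow_one]
    change g ∣ MvPolynomial.pderiv t (sec J (red v Q))
    have hgJ : ∀ j ∈ J, MvPolynomial.degreeOf j.1 (g ^ 2) = 0 := fun j hj => by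
      have h0 := degreeOf_eq_zero_of_dvd (red_ne_zero v hP) h₁
        (Nat.le_zero.mp ((degreeOf_red_le v j.1 P).trans (hJ j hj).le))
      rw [sq, MvPolynomial.degreeOf_mul_eq hg.ne_zero hg.ne_zero, h0]
    obtain ⟨w, hw⟩ := sec_dvd hgJ h₂
    rw [hw, sq, mul_assoc, Derivation.leibniz, smul_eq_mul, smul_eq_mul, mul_assoc]
    exact dvd_add (dvd_mul_right _ _) (dvd_mul_right _ _)

theorem hasDrop_pderiv_zero (P Q : MvPolynomial σ K) (t : σ) (J : List (σ × ℕ)) :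
    HasDrop v P (MvPolynomial.pderiv t (sec J Q)) (primScale v Q) 0 := by
  refine ⟨1, MvPolynomial.pderiv t (sec J (primLift v Q)), ?_, Nat.zero_le _, by simp, by simp⟩
  rw [intMap, ← MvPolynomial.pderiv_map, ← sec_map]
  change MvPolynomial.pderiv t (sec J (intMap (primLift v Q))) = _
  rw [intMap_primLift, sec_C_mul, MvPolynomial.pderiv_C_mul]

omit v [DecidableEq σ] in
/-- The height in which the archimedean size of a polynomial is the sum of the absolute values of
its coefficients. -/
def hgtL (Q : MvPolynomial σ K) : ℝ :=
  (∑ φ : K →+* ℂ, Real.log (l1 (MvPolynomial.map φ Q))) +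
    ∑ᶠ v : HeightOneSpectrum (𝓞 K), Real.log (gaussV v Q)

omit v [DecidableEq σ] in
theorem hgtL_eq_sum {Q : MvPolynomial σ K} (S : Finset (HeightOneSpectrum (𝓞 K)))
    (hS : ∀ v ∉ S, gaussV v Q = 1) :
    hgtL Q = (∑ φ : K →+* ℂ, Real.log (l1 (MvPolynomial.map φ Q)))
      + ∑ v ∈ S, Real.log (gaussV v Q) := by
  rw [hgtL, finsum_eq_sum_of_support_subset (s := S)]
  intro v hv
  by_contra h
  exact hv (by simp only [hS v h, Real.log_one])

omit [NumberField K] v [DecidableEq σ] in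
theorem l1_pos {Q : MvPolynomial σ ℂ} (hQ : Q ≠ 0) : 0 < l1 Q :=
  Finset.sum_pos (fun _ hd => norm_pos_iff.mpr (MvPolynomial.mem_support_iff.mp hd))
    (MvPolynomial.support_nonempty.mpr hQ)

omit v [DecidableEq σ] in
theorem totalDegree_pderiv_le {R : Type*} [CommRing R] (i : σ) (Q : MvPolynomial σ R) :
    (MvPolynomial.pderiv i Q).totalDegree ≤ Q.totalDegree := by
  refine Finset.sup_le fun d hd => ?_
  rw [MvPolynomial.mem_support_iff, MvPolynomial.coeff_pderiv] at hd
  have := MvPolynomial.le_totalDegree (MvPolynomial.mem_support_iff.mpr (left_ne_zero_of_mul hd))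
  rw [Finsupp.sum_add_index' (fun _ => rfl) (fun _ _ _ => rfl)] at this
  omega

variable [Fintype σ] [Nonempty σ]

omit v in
/-- The multiplicity estimate for `P` with an iterated coefficient of `F` and with `c`. The powers of
the variables in `J`, which occur neither in `P` nor in `c`, lower the degree. -/
theorem section_estimate {P c F : MvPolynomial σ K} (hP : Prime P) (hc : ¬ P ∣ c)
    {J : List (σ × ℕ)} (hJP : ∀ j ∈ J, MvPolynomial.degreeOf j.1 P = 0)
    (hJc : ∀ j ∈ J, MvPolynomial.degreeOf j.1 c = 0) (hF : ¬ P ∣ sec J F)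
    (S₀ : Finset (HeightOneSpectrum (𝓞 K))) (μ₁ μ₂ : HeightOneSpectrum (𝓞 K) → ℕ)
    (hμ : ∀ v ∈ S₀, ∃ g : MvPolynomial σ (ResV v), Irreducible g ∧ g ^ μ₁ v ∣ red v P ∧
      g ^ μ₂ v ∣ red v P ∧ g ^ μ₁ v ∣ red v F ∧ g ^ μ₂ v ∣ red v c) :
    ∑ v ∈ S₀, ((μ₁ v : ℝ) + μ₂ v) * Real.log (normV v)
      ≤ ((c * F).totalDegree - (J.map Prod.snd).sum) * hgt P + P.totalDegree * hgtL (c * F) := by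
  classical
  have hs0 : sec J F ≠ 0 := fun h => hF (h ▸ dvd_zero P)
  have hF0 : F ≠ 0 := fun h => hs0 (by rw [h, sec_zero])
  have hc0 : c ≠ 0 := fun h => hc (h ▸ dvd_zero P)
  obtain ⟨S₁, h₁⟩ := exists_finset_gaussV_eq_one hP.ne_zero
  obtain ⟨S₂, h₂⟩ := exists_finset_gaussV_eq_one hF0
  obtain ⟨S₃, h₃⟩ := exists_finset_gaussV_eq_one hc0
  set S := S₀ ∪ (S₁ ∪ (S₂ ∪ S₃)) with hS
  have hscale : ∀ {Q : MvPolynomial σ K}, Q ≠ 0 → ∀ v, gaussV v Q = 1 →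
      absV v (primScale v Q) = 1 := fun {Q} hQ v h => by
    rw [gaussV_eq_primScale v hQ] at h
    rw [← inv_inv (absV v _), h, inv_one]
  have hD := totalDegree_sec_add_le hs0
  have main := multiplicity_estimate (D₁ := F.totalDegree - (J.map Prod.snd).sum)
    (D₂ := c.totalDegree) hP hF hc (by omega) le_rfl
    (a₁ := fun v => primScale v F) (a₂ := fun v => primScale v c)
    (fun v => primScale_ne_zero v F) (fun v => primScale_ne_zero v c)
    (μ₁ := fun v => if v ∈ S₀ then μ₁ v else 0) (μ₂ := fun v => if v ∈ S₀ then μ₂ v else 0)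
    (fun v => by
      by_cases hv : v ∈ S₀
      · obtain ⟨g, hg, g₁, -, g₃, -⟩ := hμ v hv
        simp only [if_pos hv]
        exact hasDrop_sec v hP.ne_zero hJP hg g₁ g₃
      · simp only [if_neg hv]
        exact hasDrop_sec_zero v P F J)
    (fun v => by
      by_cases hv : v ∈ S₀
      · obtain ⟨g, hg, -, g₂, -, g₄⟩ := hμ v hv
        simp only [if_pos hv]
        exact hasDrop_sec (J := []) v hP.ne_zero (by simp) hg g₂ g₄
      · simp only [if_neg hv]
        exact hasDrop_zero v P c) S
    (fun v hv => ⟨h₁ v fun h => hv (by simp [hS, h]),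
      hscale hF0 v (h₂ v fun h => hv (by simp [hS, h])),
      hscale hc0 v (h₃ v fun h => hv (by simp [hS, h]))⟩)
    (B := fun φ => l1 (MvPolynomial.map φ (c * F)))
    (fun φ => l1_pos (map_embedding_ne_zero φ (mul_ne_zero hc0 hF0)))
    (fun φ x => by
      rw [mul_comm, ← sec_mul hJc, ← sec_map]
      exact (norm_eval_circ_le _ x).trans (l1_sec_le J _))
  have hL : (∑ v ∈ S, (-Real.log (absV v (primScale v F)) - Real.log (absV v (primScale v c))))
      = ∑ v ∈ S, Real.log (gaussV v (c * F)) := Finset.sum_congr rfl fun v _ => by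
    rw [gaussV_mul v hc0 hF0, Real.log_mul (gaussV_pos v hc0).ne' (gaussV_pos v hF0).ne',
      gaussV_eq_primScale v hc0, gaussV_eq_primScale v hF0, Real.log_inv, Real.log_inv]
    ring
  rw [hL, ← hgtL_eq_sum S fun v hv => by
    rw [gaussV_mul v hc0 hF0, h₂ v fun h => hv (by simp [hS, h]),
      h₃ v fun h => hv (by simp [hS, h]), one_mul]] at main
  have hsub : ∑ v ∈ S₀, ((μ₁ v : ℝ) + μ₂ v) * Real.log (normV v)
      = ∑ v ∈ S, (((if v ∈ S₀ then μ₁ v else 0 : ℕ) : ℝ) + ((if v ∈ S₀ then μ₂ v else 0 : ℕ) : ℝ))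
        * Real.log (normV v) := by
    rw [← Finset.sum_subset (Finset.subset_union_left : S₀ ⊆ S) fun v _ hv => by simp [hv]]
    exact Finset.sum_congr rfl fun v hv => by simp [hv]
  rw [hsub]
  refine main.trans_eq ?_
  rw [MvPolynomial.totalDegree_mul_of_isDomain hc0 hF0, Nat.cast_sub (by omega)]
  push_cast
  ring

omit v in
/-- The multiplicity estimate for `P` with a derivative of an iterated coefficient of `P F`. Where the
reduction of `P F` has a double factor dividing that of `P`, this factor also divides the
derivative; but `P` does not divide it, as `P` is a simple factor of the iterated coefficient. -/
theorem pderiv_estimate {P F : MvPolynomial σ K} (hP : Prime P) {t : σ}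
    (ht : MvPolynomial.degreeOf t P ≠ 0)
    {J : List (σ × ℕ)} (hJP : ∀ j ∈ J, MvPolynomial.degreeOf j.1 P = 0) (hF : ¬ P ∣ sec J F)
    {D : ℕ} (hD : (P * F).totalDegree ≤ D) (S₀ : Finset (HeightOneSpectrum (𝓞 K)))
    (hg : ∀ v ∈ S₀, ∃ g : MvPolynomial σ (ResV v), Irreducible g ∧ g ∣ red v P ∧
      g ^ 2 ∣ red v (P * F)) :
    ∑ v ∈ S₀, Real.log (normV v)
      ≤ ((P * F).totalDegree - (J.map Prod.snd).sum) * hgt P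
        + P.totalDegree * (hgtL (P * F) + Fintype.card (K →+* ℂ) * Real.log D) := by
  classical
  have hP0 := hP.ne_zero
  have hs0 : sec J F ≠ 0 := fun h => hF (h ▸ dvd_zero P)
  have hF0 : F ≠ 0 := fun h => hs0 (by rw [h, sec_zero])
  have hPF0 : P * F ≠ 0 := mul_ne_zero hP0 hF0
  have hsec : sec J (P * F) = P * sec J F := sec_mul hJP F
  have hsec0 : sec J (P * F) ≠ 0 := hsec ▸ mul_ne_zero hP0 hs0
  have hnd : ¬ P ∣ MvPolynomial.pderiv t (sec J (P * F)) := by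
    rw [hsec, Derivation.leibniz, smul_eq_mul, smul_eq_mul, dvd_add_right (dvd_mul_right _ _)]
    exact fun h => (hP.dvd_or_dvd h).elim hF (not_dvd_pderiv ht)
  obtain ⟨S₁, h₁⟩ := exists_finset_gaussV_eq_one hP.ne_zero
  obtain ⟨S₂, h₂⟩ := exists_finset_gaussV_eq_one hPF0
  set S := S₀ ∪ (S₁ ∪ S₂) with hS
  have hDpos : 0 < D := lt_of_lt_of_le (by
    rw [MvPolynomial.totalDegree_mul_of_isDomain hP0 hF0]
    exact Nat.add_pos_left (totalDegree_pos_of_irreducible hP.irreducible) _) hD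
  have hdeg := totalDegree_sec_add_le hsec0
  have main := multiplicity_estimate (D₁ := (P * F).totalDegree - (J.map Prod.snd).sum)
    (D₂ := 0) hP hnd (hP.not_dvd_one)
    ((totalDegree_pderiv_le _ _).trans (by omega)) (by simp)
    (a₁ := fun v => primScale v (P * F)) (a₂ := fun v => 1)
    (fun v => primScale_ne_zero v _) (fun v => one_ne_zero)
    (μ₁ := fun v => if v ∈ S₀ then 1 else 0) (μ₂ := fun v => 0)
    (fun v => by
      by_cases hv : v ∈ S₀
      · obtain ⟨g, hg, g₁, g₂⟩ := hg v hv
        simp only [if_pos hv]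
        exact hasDrop_pderiv v hP.ne_zero t hJP hg g₁ g₂
      · simp only [if_neg hv]
        exact hasDrop_pderiv_zero v P _ t J)
    (fun v => hasDrop_zero_one v P) S
    (fun v hv => ⟨h₁ v fun h => hv (by simp [hS, h]), by
      have h := h₂ v fun h => hv (by simp [hS, h])
      rw [gaussV_eq_primScale v hPF0] at h
      rw [← inv_inv (absV v _), h, inv_one], map_one _⟩)
    (B := fun φ => D * l1 (MvPolynomial.map φ (P * F)))
    (fun φ => mul_pos (by exact_mod_cast hDpos) (l1_pos (map_embedding_ne_zero φ hPF0)))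
    (fun φ x => by
      rw [mul_one, ← MvPolynomial.pderiv_map, ← sec_map]
      refine (norm_eval_circ_le _ x).trans ((l1_pderiv_le t (n := D) ?_).trans
        (mul_le_mul_of_nonneg_left (l1_sec_le J _) (Nat.cast_nonneg _)))
      rw [sec_map]
      refine (degreeOf_map_le t φ _).trans ((MvPolynomial.degreeOf_le_totalDegree _ t).trans ?_)
      omega)
  have hL : (∑ v ∈ S, (-Real.log (absV v (primScale v (P * F))) - Real.log (absV v (1 : K))))
      = ∑ v ∈ S, Real.log (gaussV v (P * F)) := Finset.sum_congr rfl fun v _ => by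
    rw [gaussV_eq_primScale v hPF0, Real.log_inv, map_one, Real.log_one, sub_zero]
  have hB : ∑ φ : K →+* ℂ, Real.log (D * l1 (MvPolynomial.map φ (P * F)))
      = Fintype.card (K →+* ℂ) * Real.log D
        + ∑ φ : K →+* ℂ, Real.log (l1 (MvPolynomial.map φ (P * F))) := by
    rw [Finset.sum_congr rfl fun φ _ => Real.log_mul (Nat.cast_ne_zero.mpr hDpos.ne')
      (l1_pos (map_embedding_ne_zero φ hPF0)).ne', Finset.sum_add_distrib, Finset.sum_const,
      Finset.card_univ, nsmul_eq_mul]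
  rw [hL, hB] at main
  have hsub : ∑ v ∈ S₀, Real.log (normV v)
      = ∑ v ∈ S, (((if v ∈ S₀ then 1 else 0 : ℕ) : ℝ) + ((0 : ℕ) : ℝ)) * Real.log (normV v) := by
    rw [← Finset.sum_subset (Finset.subset_union_left : S₀ ⊆ S) fun v _ hv => by simp [hv]]
    exact Finset.sum_congr rfl fun v hv => by simp [hv]
  rw [hsub, hgtL_eq_sum S fun v hv => h₂ v fun h => hv (by simp [hS, h])]
  refine main.trans_eq ?_
  rw [Nat.cast_sub (by omega)]
  push_cast
  ring

end Estimates

/-! ### Orders of vanishing of reductions -/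

section Orders

open IsDedekindDomain

variable {K : Type*} [Field K] [NumberField K] {σ : Type*} (v : HeightOneSpectrum (𝓞 K))

/-- The multiplicity of `g` in the reduction of `Q`. -/
def ordV (g : MvPolynomial σ (ResV v)) (Q : MvPolynomial σ K) : ℕ := multiplicity g (red v Q)

theorem pow_ordV_dvd (g : MvPolynomial σ (ResV v)) (Q : MvPolynomial σ K) :
    g ^ ordV v g Q ∣ red v Q := pow_multiplicity_dvd _ _

variable {v} {g : MvPolynomial σ (ResV v)}

theorem pow_dvd_iff_le_ordV (hg : Irreducible g) {Q : MvPolynomial σ K} (hQ : Q ≠ 0) {n : ℕ} :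
    g ^ n ∣ red v Q ↔ n ≤ ordV v g Q :=
  (FiniteMultiplicity.of_prime_left hg.prime (red_ne_zero v hQ)).pow_dvd_iff_le_multiplicity

theorem dvd_iff_ordV_pos (hg : Irreducible g) {Q : MvPolynomial σ K} (hQ : Q ≠ 0) :
    g ∣ red v Q ↔ 1 ≤ ordV v g Q := by
  rw [← pow_dvd_iff_le_ordV hg hQ, pow_one]

theorem ordV_mul (hg : Irreducible g) {P Q : MvPolynomial σ K} (hP : P ≠ 0) (hQ : Q ≠ 0) :
    ordV v g (P * Q) = ordV v g P + ordV v g Q := by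
  rw [ordV, multiplicity_eq_of_associated_right (red_mul_associated v P Q),
    multiplicity_mul hg.prime (FiniteMultiplicity.of_prime_left hg.prime
      (mul_ne_zero (red_ne_zero v hP) (red_ne_zero v hQ)))]
  rfl

theorem ordV_one (hg : Irreducible g) : ordV v g (1 : MvPolynomial σ K) = 0 := by
  have := ordV_mul hg (one_ne_zero (α := MvPolynomial σ K)) one_ne_zero
  rw [mul_one] at this
  omega

theorem ordV_prod (hg : Irreducible g) {ι : Type*} (I : Finset ι) {p : ι → MvPolynomial σ K}
    (hp : ∀ i ∈ I, p i ≠ 0) : ordV v g (∏ i ∈ I, p i) = ∑ i ∈ I, ordV v g (p i) := by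
  classical
  induction I using Finset.induction_on with
  | empty => simp [ordV_one hg]
  | insert i I hi ih =>
    have h := fun j hj => hp j (Finset.mem_insert_of_mem hj)
    rw [Finset.prod_insert hi, Finset.sum_insert hi,
      ordV_mul hg (hp i (Finset.mem_insert_self i I)) (Finset.prod_ne_zero_iff.mpr h), ih h]

theorem ordV_le_of_dvd (hg : Irreducible g) {P Q : MvPolynomial σ K} (hQ : Q ≠ 0) (h : P ∣ Q) :
    ordV v g P ≤ ordV v g Q := by
  obtain ⟨w, rfl⟩ := h
  rw [ordV_mul hg (left_ne_zero_of_mul hQ) (right_ne_zero_of_mul hQ)]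
  exact Nat.le_add_right _ _

theorem ordV_eq_of_associated (hg : Irreducible g) {P Q : MvPolynomial σ K} (hQ : Q ≠ 0)
    (h : Associated P Q) : ordV v g P = ordV v g Q :=
  le_antisymm (ordV_le_of_dvd hg hQ h.dvd)
    (ordV_le_of_dvd hg (fun h0 => hQ (h.eq_zero_iff.mp h0)) h.symm.dvd)

theorem ordV_eq_zero_of_degreeOf (hg : Irreducible g) {Q : MvPolynomial σ K} (hQ : Q ≠ 0) {r : σ}
    (hr : MvPolynomial.degreeOf r g ≠ 0) (h : MvPolynomial.degreeOf r Q = 0) : ordV v g Q = 0 := by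
  by_contra h0
  exact hr (degreeOf_eq_zero_of_dvd (red_ne_zero v hQ)
    ((dvd_iff_ordV_pos hg hQ).mpr (Nat.one_le_iff_ne_zero.mpr h0))
    (Nat.le_zero.mp ((degreeOf_red_le v r Q).trans h.le)))

/-- If the reduction of `Q` keeps its degree in `T_r`, then a factor of it that does not involve
`T_r` divides the reduction of the leading coefficient. -/
theorem ordV_le_ordV_lead [DecidableEq σ] (hg : Irreducible g) {Q : MvPolynomial σ K} (hQ : Q ≠ 0)
    {r : σ} (hr : MvPolynomial.degreeOf r g = 0)
    (h : MvPolynomial.degreeOf r (red v Q) = MvPolynomial.degreeOf r Q) :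
    ordV v g Q ≤ ordV v g (lead r Q) := by
  rw [← pow_dvd_iff_le_ordV hg (lead_ne_zero r hQ)]
  set d := MvPolynomial.degreeOf r Q with hd
  have hint : intMap ((phi r (primLift v Q)).coeff d) = MvPolynomial.C (primScale v Q) * lead r Q := by
    rw [intMap, ← Polynomial.coeff_map, ← phi_map]
    change (phi r (intMap (primLift v Q))).coeff d = _
    rw [intMap_primLift, coeff_phi_mul (MvPolynomial.degreeOf_C _ _), hd, ← natDegree_phi]
    rfl
  obtain ⟨c, hc⟩ := exists_redMap_eq v hint
  have hlead : redMap v ((phi r (primLift v Q)).coeff d) = lead r (red v Q) := by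
    rw [redMap, ← Polynomial.coeff_map, ← phi_map, lead, Polynomial.leadingCoeff, natDegree_phi, h]
    rfl
  rw [hlead] at hc
  have hc0 : c ≠ 0 := by
    rintro rfl
    rw [map_zero, zero_mul] at hc
    exact lead_ne_zero r (red_ne_zero v hQ) hc
  have hdvd : g ^ ordV v g Q ∣ lead r (red v Q) := by
    obtain ⟨w, hw⟩ := pow_ordV_dvd v g Q
    rw [lead, hw, Polynomial.leadingCoeff, coeff_phi_mul]
    · exact dvd_mul_right _ _
    · rcases Nat.eq_zero_or_pos (ordV v g Q) with h0 | h0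
      · rw [h0, pow_zero, ← MvPolynomial.C_1, MvPolynomial.degreeOf_C]
      · have := MvPolynomial.degreeOf_pow_le r g (ordV v g Q)
        rw [hr] at this
        omega
  rw [hc] at hdvd
  exact ((hc0.isUnit.map MvPolynomial.C).dvd_mul_left).mp hdvd

end Orders

/-! ### The factors of the form and of its leading coefficients -/

section Kernel

/-- A relation that decreases a rank has a kernel: a set `N` such that an element is outside `N` if
and only if it is related to an element of `N`. -/
theorem exists_kernel {α : Type*} (m : α → ℕ) (R : α → α → Prop)
    (hR : ∀ a b, R a b → m a < m b) : ∃ N : Set α, ∀ b, b ∉ N ↔ ∃ a ∈ N, R a b := by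
  let C : α → Prop := (measure m).wf.fix fun b ih => ∃ a, ∃ h : R a b, ¬ ih a (hR a b h)
  refine ⟨{a | ¬ C a}, fun b => ?_⟩
  have : C b ↔ ∃ a, ∃ h : R a b, ¬ C a := by
    conv_lhs => rw [show C b = _ from (measure m).wf.fix_eq _ b]
  rw [Set.mem_ofPred_eq, not_not, this]
  exact ⟨fun ⟨a, h, h'⟩ => ⟨a, h', h⟩, fun ⟨a, h', h⟩ => ⟨a, h, h'⟩⟩

end Kernel

section Factors

open IsDedekindDomain UniqueFactorizationMonoid
open scoped Classical

variable {K : Type*} [Field K] {σ : Type*} [NormalizationMonoid (MvPolynomial σ K)]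

/-- The normalized irreducible factors of a polynomial. -/
def irr (f : MvPolynomial σ K) : Finset (MvPolynomial σ K) := (normalizedFactors f).toFinset

theorem mem_irr {f q : MvPolynomial σ K} (hf : f ≠ 0) :
    q ∈ irr f ↔ Irreducible q ∧ normalize q = q ∧ q ∣ f := by
  rw [irr, Multiset.mem_toFinset, mem_normalizedFactors_iff' hf]

theorem irreducible_of_mem_irr {f q : MvPolynomial σ K} (h : q ∈ irr f) : Irreducible q :=
  irreducible_of_normalized_factor q (Multiset.mem_toFinset.mp h)

theorem normalize_of_mem_irr {f q : MvPolynomial σ K} (h : q ∈ irr f) : normalize q = q :=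
  normalize_normalized_factor q (Multiset.mem_toFinset.mp h)

theorem eq_of_mem_irr_of_dvd {f f' q q' : MvPolynomial σ K} (h : q ∈ irr f) (h' : q' ∈ irr f')
    (hd : q ∣ q') : q = q' := by
  have hass := (irreducible_of_mem_irr h).associated_of_dvd (irreducible_of_mem_irr h') hd
  rw [← normalize_of_mem_irr h, ← normalize_of_mem_irr h']
  exact normalize_eq_normalize_iff_associated.mpr hass

theorem isRelPrime_of_mem_irr {f f' q q' : MvPolynomial σ K} (h : q ∈ irr f) (h' : q' ∈ irr f')
    (hne : q ≠ q') : IsRelPrime q q' :=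
  (irreducible_of_mem_irr h).isRelPrime_iff_not_dvd.mpr
    fun hd => hne (eq_of_mem_irr_of_dvd h h' hd)

theorem prod_irr_associated {f : MvPolynomial σ K} (hf : f ≠ 0) (hsq : Squarefree f) :
    Associated (∏ q ∈ irr f, q) f := by
  refine Associated.trans ?_ (prod_normalizedFactors hf)
  rw [irr, Finset.prod, Multiset.toFinset_val,
    ((squarefree_iff_nodup_normalizedFactors hf).mp hsq).dedup, Multiset.map_id']

/-- The sum of `w` over the irreducible factors of `Q`, counted with multiplicity. -/
def factorSum {M : Type*} [AddCommMonoid M] (w : MvPolynomial σ K → M) (Q : MvPolynomial σ K) : M :=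
  ((normalizedFactors Q).map w).sum

/-- The multiplicity of the normalized irreducible factor `p` in `Q`. -/
def mult (Q p : MvPolynomial σ K) : ℕ := (normalizedFactors Q).count p

theorem factorSum_eq_sum {M : Type*} [AddCommMonoid M] (w : MvPolynomial σ K → M)
    (Q : MvPolynomial σ K) :
    factorSum w Q = ∑ q ∈ irr Q, mult Q q • w q :=
  Finset.sum_multiset_map_count _ _

theorem one_le_mult {Q p : MvPolynomial σ K} (hp : p ∈ irr Q) : 1 ≤ mult Q p :=
  Multiset.one_le_count_iff_mem.mpr (Multiset.mem_toFinset.mp hp)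

theorem two_le_mult {Q p : MvPolynomial σ K} (hQ : Q ≠ 0) (hp : p ∈ irr Q) (h : p * p ∣ Q) :
    2 ≤ mult Q p := by
  have hirr := irreducible_of_mem_irr hp
  rw [dvd_iff_normalizedFactors_le_normalizedFactors (mul_ne_zero hirr.ne_zero hirr.ne_zero)
    hQ, normalizedFactors_mul hirr.ne_zero hirr.ne_zero,
    normalizedFactors_irreducible hirr, normalize_of_mem_irr hp] at h
  exact (by simp : 2 ≤ Multiset.count p ({p} + {p})).trans (Multiset.count_le_of_le p h)

theorem factorSum_mul {M : Type*} [AddCommMonoid M] (w : MvPolynomial σ K → M)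
    {P Q : MvPolynomial σ K} (hP : P ≠ 0) (hQ : Q ≠ 0) :
    factorSum w (P * Q) = factorSum w P + factorSum w Q := by
  rw [factorSum, normalizedFactors_mul hP hQ, Multiset.map_add, Multiset.sum_add]; rfl

theorem factorSum_prod {M : Type*} [AddCommMonoid M] (w : MvPolynomial σ K → M) {ι : Type*}
    (I : Finset ι) {p : ι → MvPolynomial σ K} (hp : ∀ i ∈ I, p i ≠ 0) :
    factorSum w (∏ i ∈ I, p i) = ∑ i ∈ I, factorSum w (p i) := by
  induction I using Finset.induction_on with
  | empty => simp [factorSum]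
  | insert i I hi ih =>
    have h := fun j hj => hp j (Finset.mem_insert_of_mem hj)
    rw [Finset.prod_insert hi, Finset.sum_insert hi,
      factorSum_mul w (hp i (Finset.mem_insert_self i I)) (Finset.prod_ne_zero_iff.mpr h), ih h]

theorem factorSum_le {w w' : MvPolynomial σ K → ℝ} {Q : MvPolynomial σ K}
    (h : ∀ q ∈ irr Q, w q ≤ w' q) : factorSum w Q ≤ factorSum w' Q :=
  Multiset.sum_map_le_sum_map _ _ fun q hq => h q (Multiset.mem_toFinset.mpr hq)

/-- An additive function of the polynomial is the sum of its values at the factors. -/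
theorem factorSum_eq {M : Type*} [AddCommMonoid M] (w : MvPolynomial σ K → M) (h1 : w 1 = 0)
    (hmul : ∀ P Q, P ≠ 0 → Q ≠ 0 → w (P * Q) = w P + w Q)
    (hass : ∀ P Q, Q ≠ 0 → Associated P Q → w P = w Q) {Q : MvPolynomial σ K} (hQ : Q ≠ 0) :
    factorSum w Q = w Q := by
  rw [← hass _ _ hQ (prod_normalizedFactors hQ), factorSum]
  have h0 : ∀ q ∈ normalizedFactors Q, q ≠ 0 := fun q hq =>
    (irreducible_of_normalized_factor q hq).ne_zero
  generalize normalizedFactors Q = m at h0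
  induction m using Multiset.induction_on with
  | empty => simp [h1]
  | cons q s ih =>
    have hs : ∀ x ∈ s, x ≠ 0 := fun x hx => h0 x (Multiset.mem_cons_of_mem hx)
    rw [Multiset.map_cons, Multiset.sum_cons, Multiset.prod_cons,
      hmul _ _ (h0 q (Multiset.mem_cons_self q s))
        (Multiset.prod_ne_zero fun h => hs 0 h rfl), ih hs]

omit [NormalizationMonoid (MvPolynomial σ K)] in
theorem totalDegree_eq_of_associated {P Q : MvPolynomial σ K} (hQ : Q ≠ 0) (h : Associated P Q) :
    P.totalDegree = Q.totalDegree := by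
  obtain ⟨u, rfl⟩ := h
  have hP := left_ne_zero_of_mul hQ
  have h1 := MvPolynomial.totalDegree_mul_of_isDomain u.ne_zero (u⁻¹).ne_zero
  rw [Units.mul_inv, MvPolynomial.totalDegree_one] at h1
  rw [MvPolynomial.totalDegree_mul_of_isDomain hP u.ne_zero]
  omega

theorem factorSum_totalDegree {Q : MvPolynomial σ K} (hQ : Q ≠ 0) :
    factorSum MvPolynomial.totalDegree Q = Q.totalDegree :=
  factorSum_eq _ MvPolynomial.totalDegree_one
    (fun _ _ hP hQ => MvPolynomial.totalDegree_mul_of_isDomain hP hQ)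
    (fun _ _ hQ h => totalDegree_eq_of_associated hQ h) hQ

omit [NormalizationMonoid (MvPolynomial σ K)] in
theorem hgt_eq_of_associated [NumberField K] [Fintype σ] {P Q : MvPolynomial σ K} (hQ : Q ≠ 0)
    (h : Associated P Q) : hgt P = hgt Q := by
  obtain ⟨u, rfl⟩ := h
  have hP := left_ne_zero_of_mul hQ
  have h1 := hgt_mul u.ne_zero (u⁻¹).ne_zero
  rw [Units.mul_inv, hgt_one] at h1
  have h2 := hgt_nonneg u.ne_zero
  have h3 := hgt_nonneg (u⁻¹).ne_zero
  rw [hgt_mul hP u.ne_zero]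
  linarith

theorem factorSum_hgt [NumberField K] [Fintype σ] {Q : MvPolynomial σ K} (hQ : Q ≠ 0) :
    factorSum hgt Q = hgt Q :=
  factorSum_eq _ hgt_one (fun _ _ hP hQ => hgt_mul hP hQ)
    (fun _ _ hQ h => hgt_eq_of_associated hQ h) hQ

theorem factorSum_ordV [NumberField K] {v : HeightOneSpectrum (𝓞 K)}
    {g : MvPolynomial σ (ResV v)} (hg : Irreducible g) {Q : MvPolynomial σ K} (hQ : Q ≠ 0) :
    factorSum (ordV v g) Q = ordV v g Q :=
  factorSum_eq _ (ordV_one hg) (fun _ _ hP hQ => ordV_mul hg hP hQ)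
    (fun _ _ hQ h => ordV_eq_of_associated hg hQ h) hQ

end Factors

section Initial

open IsDedekindDomain UniqueFactorizationMonoid
open scoped Classical

variable {K : Type*} [Field K] {σ : Type*} [NormalizationMonoid (MvPolynomial σ K)]
  [LinearOrder σ] [Fintype σ] [Nonempty σ]

/-- `N` is a set of irreducible factors of `f` such that the other irreducible factors are those
which divide the leading coefficient (with respect to its first variable) of an element of `N`, and
involve only later variables. -/
structure IsInitial (f : MvPolynomial σ K) (N : Finset (MvPolynomial σ K)) : Prop where
  subset : N ⊆ irr f
  notMem_iff : ∀ q ∈ irr f, q ∉ N ↔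
    ∃ q' ∈ N, mainVar q' < mainVar q ∧ q ∣ lead (mainVar q') q'

theorem exists_isInitial (f : MvPolynomial σ K) : ∃ N, IsInitial f N := by
  let m : MvPolynomial σ K → ℕ := fun q => (Finset.univ.filter (· < mainVar q)).card
  obtain ⟨N, hN⟩ := exists_kernel m
    (fun q' q => q' ∈ irr f ∧ mainVar q' < mainVar q ∧ q ∣ lead (mainVar q') q')
    (fun q' q h => Finset.card_lt_card (by
      refine Finset.ssubset_iff_of_subset (fun i hi => ?_) |>.mpr ⟨mainVar q', ?_, ?_⟩
      · exact Finset.mem_filter.mpr ⟨Finset.mem_univ _, (Finset.mem_filter.mp hi).2.trans h.2.1⟩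
      · exact Finset.mem_filter.mpr ⟨Finset.mem_univ _, h.2.1⟩
      · simp))
  refine ⟨(irr f).filter (· ∈ N), Finset.filter_subset _ _, fun q hq => ?_⟩
  rw [Finset.mem_filter, not_and]
  constructor
  · intro h
    obtain ⟨q', hq', h1, h2, h3⟩ := (hN q).mp (h hq)
    exact ⟨q', Finset.mem_filter.mpr ⟨h1, hq'⟩, h2, h3⟩
  · rintro ⟨q', hq', h2, h3⟩ -
    exact (hN q).mpr ⟨q', (Finset.mem_filter.mp hq').2, (Finset.mem_filter.mp hq').1, h2, h3⟩

/-- The product of the elements of `N` with first variable `T_r`. -/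
def block (N : Finset (MvPolynomial σ K)) (r : σ) : MvPolynomial σ K :=
  ∏ q ∈ N.filter fun q => mainVar q = r, q

/-- The product of the irreducible factors of `f` outside `N`. -/
def rest (f : MvPolynomial σ K) (N : Finset (MvPolynomial σ K)) : MvPolynomial σ K :=
  ∏ q ∈ irr f \ N, q

/-- The product of the leading coefficients of the blocks and of the remaining factors. -/
def leads (f : MvPolynomial σ K) (N : Finset (MvPolynomial σ K)) : MvPolynomial σ K :=
  rest f N * ∏ r, lead r (block N r)

variable {f : MvPolynomial σ K} {N : Finset (MvPolynomial σ K)}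

section

variable (hN : IsInitial f N)
include hN

theorem IsInitial.irreducible {q : MvPolynomial σ K} (hq : q ∈ N) : Irreducible q :=
  irreducible_of_mem_irr (hN.subset hq)

theorem IsInitial.block_ne_zero (r : σ) : block N r ≠ 0 :=
  Finset.prod_ne_zero_iff.mpr fun _ hq => (hN.irreducible (Finset.mem_filter.mp hq).1).ne_zero

omit [Fintype σ] [Nonempty σ] hN in
theorem rest_ne_zero : rest f N ≠ 0 :=
  Finset.prod_ne_zero_iff.mpr fun _ hq =>
    (irreducible_of_mem_irr (Finset.mem_sdiff.mp hq).1).ne_zero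

theorem IsInitial.lead_block_ne_zero (r : σ) : lead r (block N r) ≠ 0 :=
  lead_ne_zero r (hN.block_ne_zero r)

theorem IsInitial.leads_ne_zero : leads f N ≠ 0 :=
  mul_ne_zero rest_ne_zero (Finset.prod_ne_zero_iff.mpr fun r _ => hN.lead_block_ne_zero r)

theorem IsInitial.degreeOf_block {i r : σ} (h : i < r) : MvPolynomial.degreeOf i (block N r) = 0 := by
  rw [block, MvPolynomial.degreeOf_prod_eq _ _ fun q hq =>
    (hN.irreducible (Finset.mem_filter.mp hq).1).ne_zero]
  refine Finset.sum_eq_zero fun q hq => ?_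
  obtain ⟨h1, h2⟩ := Finset.mem_filter.mp hq
  exact (mainVar_spec_of_irreducible (hN.irreducible h1)).2 i (h2 ▸ h)

theorem IsInitial.degreeOf_lead_block {i r : σ} (h : i ≤ r) :
    MvPolynomial.degreeOf i (lead r (block N r)) = 0 := by
  rcases h.eq_or_lt with rfl | h
  · exact degreeOf_coeff_phi_self _ _ _
  · exact Nat.le_zero.mp ((degreeOf_coeff_phi_le _ _ _ _).trans (hN.degreeOf_block h).le)

theorem IsInitial.degreeOf_ne_zero_of_dvd_block {r : σ} {q : MvPolynomial σ K} (hq : Irreducible q)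
    (h : q ∣ block N r) : MvPolynomial.degreeOf r q ≠ 0 := by
  obtain ⟨q', hq', hd⟩ := (hq.prime.dvd_finsetProd_iff _).mp h
  obtain ⟨h1, h2⟩ := Finset.mem_filter.mp hq'
  have hass := hq.associated_of_dvd (hN.irreducible h1) hd
  intro h0
  refine (mainVar_spec_of_irreducible (hN.irreducible h1)).1 ?_
  rw [h2]
  exact degreeOf_eq_zero_of_dvd hq.ne_zero hass.symm.dvd h0

theorem IsInitial.block_eq_one {r : σ} (h : MvPolynomial.degreeOf r (block N r) = 0) :
    block N r = 1 := by
  refine Finset.prod_eq_one fun q hq => ?_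
  refine absurd ?_ (hN.degreeOf_ne_zero_of_dvd_block (r := r)
    (hN.irreducible (Finset.mem_filter.mp hq).1) (Finset.dvd_prod_of_mem _ hq))
  exact degreeOf_eq_zero_of_dvd (hN.block_ne_zero r) (Finset.dvd_prod_of_mem _ hq) h

theorem IsInitial.lt_mainVar {r : σ} {p : MvPolynomial σ K} (hp : Irreducible p)
    (h : p ∣ lead r (block N r)) : r < mainVar p := by
  by_contra hlt
  exact (mainVar_spec_of_irreducible hp).1 (degreeOf_eq_zero_of_dvd (hN.lead_block_ne_zero r) h
    (hN.degreeOf_lead_block (not_lt.mp hlt)))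

omit [NormalizationMonoid (MvPolynomial σ K)] [Fintype σ] [Nonempty σ] hN in
theorem lead_dvd_lead {r : σ} {p q : MvPolynomial σ K} (h : p ∣ q) : lead r p ∣ lead r q := by
  obtain ⟨w, rfl⟩ := h
  rw [lead_mul]
  exact dvd_mul_right _ _

omit [NormalizationMonoid (MvPolynomial σ K)] [Fintype σ] [Nonempty σ] hN in
theorem lead_prod {ι : Type*} (r : σ) (I : Finset ι) (p : ι → MvPolynomial σ K) :
    lead r (∏ i ∈ I, p i) = ∏ i ∈ I, lead r (p i) := by
  induction I using Finset.induction_on with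
  | empty => simp [lead_one]
  | insert i I hi ih => rw [Finset.prod_insert hi, Finset.prod_insert hi, lead_mul, ih]

omit [NormalizationMonoid (MvPolynomial σ K)] hN in
theorem prod_block (s : Finset σ) :
    ∏ r ∈ s, block N r = ∏ q ∈ N.filter fun q => mainVar q ∈ s, q := by
  rw [← Finset.prod_fiberwise_of_maps_to (s := N.filter fun q => mainVar q ∈ s) (t := s)
    (g := mainVar) fun q hq => (Finset.mem_filter.mp hq).2]
  refine Finset.prod_congr rfl fun r hr => Finset.prod_congr ?_ fun _ _ => rfl
  ext q
  simp only [Finset.mem_filter]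
  exact ⟨fun h => ⟨⟨h.1, h.2 ▸ hr⟩, h.2⟩, fun h => ⟨h.1.1, h.2⟩⟩

theorem IsInitial.prod_mul_prod_block_dvd (hf0 : f ≠ 0) (hf : Squarefree f)
    {A : Finset (MvPolynomial σ K)} (hA : A ⊆ irr f) {s : Finset σ}
    (hAs : ∀ q ∈ A, q ∈ N → mainVar q ∉ s) : (∏ q ∈ A, q) * ∏ r ∈ s, block N r ∣ f := by
  rw [prod_block, ← Finset.prod_union]
  · refine (Finset.prod_dvd_prod_of_subset _ _ _ (Finset.union_subset hA ?_)).trans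
      (prod_irr_associated hf0 hf).dvd
    exact (Finset.filter_subset _ _).trans hN.subset
  · rw [Finset.disjoint_left]
    intro q hq hq'
    obtain ⟨h1, h2⟩ := Finset.mem_filter.mp hq'
    exact hAs q hq h1 h2

theorem IsInitial.rest_mul_prod_block (hf0 : f ≠ 0) (hf : Squarefree f) :
    Associated (rest f N * ∏ r, block N r) f := by
  refine Associated.trans ?_ (prod_irr_associated hf0 hf)
  rw [prod_block, rest]
  have : (N.filter fun q => mainVar q ∈ Finset.univ) = N := by simp
  rw [this, Finset.prod_sdiff hN.subset]

theorem IsInitial.disc_block_ne_zero [CharZero K] (hf0 : f ≠ 0) (hf : Squarefree f) (r : σ) :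
    disc r (MvPolynomial.degreeOf r (block N r)) (block N r) ≠ 0 := by
  refine disc_ne_zero r (hf.squarefree_of_dvd ?_) (hN.block_ne_zero r)
    fun q hq h => hN.degreeOf_ne_zero_of_dvd_block hq h
  have := hN.prod_mul_prod_block_dvd hf0 hf (A := ∅) (s := {r}) (by simp) (by simp)
  simpa using this

theorem IsInitial.mem_irr_leads_of_mem_sdiff {q : MvPolynomial σ K}
    (hq : q ∈ irr f \ N) : q ∈ irr (leads f N) := by
  have h1 := (Finset.mem_sdiff.mp hq).1
  rw [mem_irr hN.leads_ne_zero]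
  exact ⟨irreducible_of_mem_irr h1, normalize_of_mem_irr h1,
    (Finset.dvd_prod_of_mem _ hq).trans (dvd_mul_right _ _)⟩

/-- A common factor of `f` and `leads f N` lies outside `N` and divides `leads f N` at least
twice. -/
theorem IsInitial.two_le_count (hf0 : f ≠ 0) {p : MvPolynomial σ K} (hp : p ∈ irr (leads f N))
    (hpf : p ∣ f) : p ∈ irr f \ N ∧ 2 ≤ mult (leads f N) p := by
  have hirr := irreducible_of_mem_irr hp
  have hpI : p ∈ irr f := (mem_irr hf0).mpr ⟨hirr, normalize_of_mem_irr hp, hpf⟩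
  have hpN : p ∉ N := by
    intro hpN
    rcases hirr.prime.dvd_or_dvd ((mem_irr hN.leads_ne_zero).mp hp).2.2 with h | h
    · obtain ⟨q, hq, hd⟩ := (hirr.prime.dvd_finsetProd_iff _).mp h
      obtain ⟨h1, h2⟩ := Finset.mem_sdiff.mp hq
      exact h2 (eq_of_mem_irr_of_dvd hp h1 hd ▸ hpN)
    · obtain ⟨r, -, hr⟩ := (hirr.prime.dvd_finsetProd_iff _).mp h
      have hlt := hN.lt_mainVar hirr hr
      rw [block, lead_prod] at hr
      obtain ⟨q, hq, hd⟩ := (hirr.prime.dvd_finsetProd_iff _).mp hr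
      obtain ⟨h1, rfl⟩ := Finset.mem_filter.mp hq
      exact (hN.notMem_iff p hpI).mpr ⟨q, h1, hlt, hd⟩ hpN
  refine ⟨Finset.mem_sdiff.mpr ⟨hpI, hpN⟩, ?_⟩
  obtain ⟨q, hq, -, hd⟩ := (hN.notMem_iff p hpI).mp hpN
  have h1 : p ∣ rest f N := Finset.dvd_prod_of_mem _ (Finset.mem_sdiff.mpr ⟨hpI, hpN⟩)
  have h2 : p ∣ ∏ r, lead r (block N r) :=
    (hd.trans (lead_dvd_lead (Finset.dvd_prod_of_mem _ (by simp [hq])))).trans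
      (Finset.dvd_prod_of_mem (fun r => lead r (block N r)) (Finset.mem_univ (mainVar q)))
  exact two_le_mult hN.leads_ne_zero hp (mul_dvd_mul h1 h2)

theorem IsInitial.mem_irr_leads_of_mem_irr_lead {r : σ} {p : MvPolynomial σ K}
    (hp : p ∈ irr (lead r (block N r))) : p ∈ irr (leads f N) := by
  rw [mem_irr (hN.lead_block_ne_zero r)] at hp
  rw [mem_irr hN.leads_ne_zero]
  exact ⟨hp.1, hp.2.1, hp.2.2.trans ((Finset.dvd_prod_of_mem (fun r => lead r (block N r))
    (Finset.mem_univ r)).trans (dvd_mul_left _ _))⟩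

end

end Initial

/-! ### Places with a square factor -/

section SquareFactors

open IsDedekindDomain UniqueFactorizationMonoid
open scoped Classical

variable {K : Type*} [Field K] [NumberField K] {σ : Type*}
  [NormalizationMonoid (MvPolynomial σ K)] [LinearOrder σ] [Fintype σ] [Nonempty σ]
  {f : MvPolynomial σ K} {N : Finset (MvPolynomial σ K)}

omit [NumberField K] in
/-- An iterated coefficient of the cofactor `F`, not divisible by `p`, of large order. -/
theorem IsInitial.exists_sec (hN : IsInitial f N) {p F : MvPolynomial σ K} (hp : Irreducible p)
    (hpF : ¬ p ∣ F) (hF : ∏ r ∈ Finset.univ.filter (· < mainVar p), block N r ∣ F) :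
    ∃ J : List (σ × ℕ), (∀ j ∈ J, j.1 < mainVar p) ∧ ¬ p ∣ sec J F ∧
      ∑ r ∈ Finset.univ.filter (· < mainVar p), degMod p r (block N r) ≤ (J.map Prod.snd).sum := by
  obtain ⟨H, hH⟩ := hF
  obtain ⟨J, h1, h2, h3⟩ := ReducedHypersurface.exists_sec hp.prime (block N)
    (Finset.univ.filter (· < mainVar p))
    (fun r hr => (mainVar_spec_of_irreducible hp).2 r (Finset.mem_filter.mp hr).2)
    (fun r _ i _ h => hN.degreeOf_block h) F H hpF (by rw [hH, sub_self]; exact dvd_zero _)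
  exact ⟨J, fun j hj => (Finset.mem_filter.mp (h1 j hj)).2, h2, h3⟩

/-- The multiplicity estimate for a factor `p` of the leading coefficients. The numbers `m v`
measure the contact of the reductions of `p` and `f` along a double factor `g v` of the reduction
of `f`. If `p` divides `f`, the estimate is applied to a derivative; otherwise to the product `c` of the
factors of `f` without variables before the first variable of `p`, and to an iterated coefficient of
the cofactor `F`. -/
theorem IsInitial.exists_contact (hN : IsInitial f N) (hf0 : f ≠ 0) (hf : Squarefree f)
    {p : MvPolynomial σ K} (hp : p ∈ irr (leads f N))
    (S₀ : Finset (HeightOneSpectrum (𝓞 K))) (g : ∀ v, MvPolynomial σ (ResV v))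
    (hg : ∀ v ∈ S₀, Irreducible (g v) ∧ 2 ≤ ordV v (g v) f) :
    ∃ m : HeightOneSpectrum (𝓞 K) → ℕ,
      (p ∣ f → ∀ v ∈ S₀, 1 ≤ ordV v (g v) p → 1 ≤ m v) ∧
      (¬ p ∣ f → ∀ v ∈ S₀, min (ordV v (g v) p) 2 ≤ m v) ∧
      (¬ p ∣ f → ∀ v ∈ S₀, 1 ≤ ordV v (g v) p → (∃ r r', r < mainVar p ∧ mainVar p ≤ r' ∧
        1 ≤ ordV v (g v) (block N r) ∧ 1 ≤ ordV v (g v) (block N r')) → 2 ≤ m v) ∧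
      ∑ v ∈ S₀, (m v : ℝ) * Real.log (normV v) ≤
        ((f.totalDegree : ℝ) - ∑ r ∈ Finset.univ.filter (· < mainVar p),
          (degMod p r (block N r) : ℝ)) * hgt p
        + p.totalDegree * (hgtL f + Fintype.card (K →+* ℂ) * Real.log f.totalDegree) := by
  have hirr := irreducible_of_mem_irr hp
  obtain ⟨ht, hfree⟩ := mainVar_spec_of_irreducible hirr
  have hh := hgt_nonneg hirr.ne_zero
  set s := Finset.univ.filter (· < mainVar p) with hs
  by_cases hpf : p ∣ f
  · have hmem := (hN.two_le_count hf0 hp hpf).1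
    obtain ⟨F, rfl⟩ := hpf
    have hF0 := right_ne_zero_of_mul hf0
    have hdvd : ∏ r ∈ s, block N r ∣ F := by
      have := hN.prod_mul_prod_block_dvd hf0 hf (A := {p}) (s := s)
        (Finset.singleton_subset_iff.mpr (Finset.mem_sdiff.mp hmem).1)
        (fun q hq hqN => by
          rw [Finset.mem_singleton.mp hq] at hqN
          exact absurd hqN (Finset.mem_sdiff.mp hmem).2)
      rw [Finset.prod_singleton] at this
      exact (mul_dvd_mul_iff_left hirr.ne_zero).mp this
    have hpF : ¬ p ∣ F := fun h => hirr.not_isUnit (hf p (mul_dvd_mul_left p h))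
    obtain ⟨J, hJ, hJF, hJsum⟩ := hN.exists_sec hirr hpF hdvd
    refine ⟨fun v => if v ∈ S₀ ∧ 1 ≤ ordV v (g v) p then 1 else 0, fun _ v hv h => by simp [hv, h],
      fun h => absurd (dvd_mul_right _ _) h, fun h => absurd (dvd_mul_right _ _) h, ?_⟩
    have main := pderiv_estimate hirr.prime ht (fun j hj => hfree j.1 (hJ j hj)) hJF le_rfl
      (S₀.filter fun v => 1 ≤ ordV v (g v) p) (fun v hv => by
        obtain ⟨h1, h2⟩ := Finset.mem_filter.mp hv
        obtain ⟨h3, h4⟩ := hg v h1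
        exact ⟨g v, h3, (dvd_iff_ordV_pos h3 hirr.ne_zero).mpr h2,
          (pow_dvd_iff_le_ordV h3 hf0).mpr h4⟩)
    have hsum : ∑ v ∈ S₀, ((if v ∈ S₀ ∧ 1 ≤ ordV v (g v) p then 1 else 0 : ℕ) : ℝ)
        * Real.log (normV v) = ∑ v ∈ S₀.filter (fun v => 1 ≤ ordV v (g v) p), Real.log (normV v) := by
      rw [Finset.sum_filter]
      refine Finset.sum_congr rfl fun v hv => ?_
      by_cases h : 1 ≤ ordV v (g v) p <;> simp [hv, h]
    rw [hsum]
    refine main.trans ?_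
    gcongr
    exact_mod_cast hJsum
  · set c := ∏ q ∈ (irr f).filter (fun q => ∀ i < mainVar p, MvPolynomial.degreeOf i q = 0), q
      with hc
    have hcirr : ∀ q ∈ (irr f).filter (fun q => ∀ i < mainVar p, MvPolynomial.degreeOf i q = 0),
        q ≠ 0 := fun q hq => (irreducible_of_mem_irr (Finset.mem_filter.mp hq).1).ne_zero
    have hc0 : c ≠ 0 := Finset.prod_ne_zero_iff.mpr hcirr
    have hdvd : c * ∏ r ∈ s, block N r ∣ f := by
      refine hN.prod_mul_prod_block_dvd hf0 hf (Finset.filter_subset _ _) fun q hq hqN hqs => ?_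
      exact (mainVar_spec_of_irreducible (hN.irreducible hqN)).1
        ((Finset.mem_filter.mp hq).2 _ (Finset.mem_filter.mp hqs).2)
    obtain ⟨F, hF⟩ := (dvd_mul_right c _).trans hdvd
    have hF0 : F ≠ 0 := by
      rintro rfl
      exact hf0 (by rw [hF, mul_zero])
    have hdvdF : ∏ r ∈ s, block N r ∣ F := by
      rw [hF] at hdvd
      exact (mul_dvd_mul_iff_left hc0).mp hdvd
    have hpc : ¬ p ∣ c := fun h => hpf (hF ▸ h.mul_right F)
    have hpF : ¬ p ∣ F := fun h => hpf (hF ▸ h.mul_left c)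
    obtain ⟨J, hJ, hJF, hJsum⟩ := hN.exists_sec hirr hpF hdvdF
    refine ⟨fun v => min (ordV v (g v) p) (ordV v (g v) F) + min (ordV v (g v) p) (ordV v (g v) c),
      fun h => absurd h hpf, fun _ v hv => ?_, ?_, ?_⟩
    · obtain ⟨h1, h2⟩ := hg v hv
      rw [hF, ordV_mul h1 hc0 hF0] at h2
      simp only
      omega
    · rintro - v hv ho ⟨r, r', hr, hr', h1, h2⟩
      obtain ⟨h3, -⟩ := hg v hv
      have h4 : ordV v (g v) (block N r) ≤ ordV v (g v) F :=
        ordV_le_of_dvd h3 hF0 ((Finset.dvd_prod_of_mem _ (by simp [hs, hr])).trans hdvdF)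
      have h5 : ordV v (g v) (block N r') ≤ ordV v (g v) c := by
        refine ordV_le_of_dvd h3 hc0 (Finset.prod_dvd_prod_of_subset _ _ _ fun q hq => ?_)
        obtain ⟨hq1, hq2⟩ := Finset.mem_filter.mp hq
        refine Finset.mem_filter.mpr ⟨hN.subset hq1, fun i hi => ?_⟩
        exact (mainVar_spec_of_irreducible (hN.irreducible hq1)).2 i
          (hi.trans_le (hq2 ▸ hr'))
      simp only
      omega
    · have hJc : ∀ j ∈ J, MvPolynomial.degreeOf j.1 c = 0 := fun j hj => by
        rw [hc, MvPolynomial.degreeOf_prod_eq _ _ hcirr]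
        exact Finset.sum_eq_zero fun q hq => (Finset.mem_filter.mp hq).2 _ (hJ j hj)
      have main := section_estimate hirr.prime hpc (fun j hj => hfree j.1 (hJ j hj)) hJc hJF S₀
        (fun v => min (ordV v (g v) p) (ordV v (g v) F))
        (fun v => min (ordV v (g v) p) (ordV v (g v) c)) (fun v hv => by
          obtain ⟨h1, -⟩ := hg v hv
          refine ⟨g v, h1, ?_, ?_, ?_, ?_⟩
          · exact (pow_dvd_iff_le_ordV h1 hirr.ne_zero).mpr (min_le_left _ _)
          · exact (pow_dvd_iff_le_ordV h1 hirr.ne_zero).mpr (min_le_left _ _)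
          · exact (pow_dvd_iff_le_ordV h1 hF0).mpr (min_le_right _ _)
          · exact (pow_dvd_iff_le_ordV h1 hc0).mpr (min_le_right _ _))
      rw [← hF] at main
      push_cast
      push_cast at main
      refine main.trans ?_
      have hlog : 0 ≤ Fintype.card (K →+* ℂ) * Real.log f.totalDegree :=
        mul_nonneg (Nat.cast_nonneg _) (Real.log_natCast_nonneg _)
      have hsum : (∑ r ∈ s, (degMod p r (block N r) : ℝ)) ≤ ((J.map Prod.snd).sum : ℝ) := by
        exact_mod_cast hJsum
      push_cast at hsum
      gcongr
      linarith

/-- If the reduction of `f` has a double factor `g` which the discriminants of the blocks do not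
see, then `g` is a factor of the reduction of `leads f N` in one of three ways. Only the block whose
variable is the first variable of `g` can contain `g` without its leading coefficient doing so, and
it contains `g` at most once. -/
theorem IsInitial.detection (hN : IsInitial f N) (hf0 : f ≠ 0) (hf : Squarefree f)
    {v : HeightOneSpectrum (𝓞 K)} {g : MvPolynomial σ (ResV v)} (hg : Irreducible g)
    (h2 : 2 ≤ ordV v g f)
    (hdisc : ∀ r, MvPolynomial.degreeOf r (block N r) ≠ 0 →
      disc r (MvPolynomial.degreeOf r (block N r)) (red v (block N r)) ≠ 0) :
    (∃ p ∈ irr f \ N, 1 ≤ ordV v g p) ∨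
    (∃ p ∈ irr (leads f N), ¬ p ∣ f ∧ 1 ≤ ordV v g p ∧ ∃ r r', r < mainVar p ∧ mainVar p ≤ r' ∧
      1 ≤ ordV v g (block N r) ∧ 1 ≤ ordV v g (block N r')) ∨
    ((∀ p ∈ irr (leads f N), 1 ≤ ordV v g p → ¬ p ∣ f) ∧ 2 ≤ ordV v g (leads f N)) := by
  by_cases hB : ∃ p ∈ irr f \ N, 1 ≤ ordV v g p
  · exact Or.inl hB
  right
  push Not at hB
  have hnot : ∀ p ∈ irr (leads f N), 1 ≤ ordV v g p → ¬ p ∣ f := fun p hp h hpf =>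
    absurd (hB p (hN.two_le_count hf0 hp hpf).1) (not_lt.mpr h)
  obtain ⟨hr₀, hbelow⟩ := mainVar_spec_of_irreducible hg
  set r₀ := mainVar g with hr₀def
  have hblock : ∀ r, ordV v g (block N r) ≤ if r = r₀ then 1 else
      ordV v g (lead r (block N r)) := by
    intro r
    by_cases hd : MvPolynomial.degreeOf r (block N r) = 0
    · rw [hN.block_eq_one hd, ordV_one hg]
      exact Nat.zero_le _
    · have hdeg : MvPolynomial.degreeOf r (red v (block N r))
          = MvPolynomial.degreeOf r (block N r) := by
        refine le_antisymm (degreeOf_red_le v r _) ?_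
        by_contra hlt
        exact hdisc r hd (disc_eq_zero_of_degreeOf_lt r (not_le.mp hlt))
      split_ifs with hr
      · subst hr
        by_contra hlt
        refine hdisc _ hd (disc_eq_zero_of_sq_dvd _ (Nat.one_le_iff_ne_zero.mpr hd)
          (degreeOf_red_le v _ _) hr₀ ((pow_dvd_iff_le_ordV hg (hN.block_ne_zero _)).mpr ?_))
        omega
      · rcases lt_or_gt_of_ne hr with hlt | hgt
        · exact ordV_le_ordV_lead hg (hN.block_ne_zero r) (hbelow r hlt) hdeg
        · rw [ordV_eq_zero_of_degreeOf hg (hN.block_ne_zero r) hr₀ (hN.degreeOf_block hgt)]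
          exact Nat.zero_le _
  have hsum : ordV v g f = ∑ r, ordV v g (block N r) := by
    rw [← ordV_eq_of_associated hg hf0 (hN.rest_mul_prod_block hf0 hf),
      ordV_mul hg rest_ne_zero (Finset.prod_ne_zero_iff.mpr fun r _ => hN.block_ne_zero r),
      ordV_prod hg _ fun r _ => hN.block_ne_zero r, rest, ordV_prod hg _ fun q hq =>
        (irreducible_of_mem_irr (Finset.mem_sdiff.mp hq).1).ne_zero,
      Finset.sum_eq_zero fun q hq => Nat.lt_one_iff.mp (hB q hq), zero_add]
  rw [hsum] at h2
  rcases Nat.eq_zero_or_pos (ordV v g (block N r₀)) with h0 | h0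
  · refine Or.inr ⟨hnot, h2.trans ?_⟩
    rw [leads, ordV_mul hg rest_ne_zero
      (Finset.prod_ne_zero_iff.mpr fun r _ => hN.lead_block_ne_zero r),
      ordV_prod hg _ fun r _ => hN.lead_block_ne_zero r]
    refine le_trans (Finset.sum_le_sum fun r _ => ?_) (Nat.le_add_left _ _)
    by_cases hr : r = r₀
    · rw [hr, h0]; exact Nat.zero_le _
    · have := hblock r
      rwa [if_neg hr] at this
  · left
    have h1 : ordV v g (block N r₀) ≤ 1 := by simpa using hblock r₀
    rw [← Finset.add_sum_erase _ _ (Finset.mem_univ r₀)] at h2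
    obtain ⟨r, hr, hne⟩ := Finset.exists_ne_zero_of_sum_ne_zero
      (show ∑ r ∈ Finset.univ.erase r₀, ordV v g (block N r) ≠ 0 by omega)
    have hrr₀ := Finset.ne_of_mem_erase hr
    have h3 := hblock r
    rw [if_neg hrr₀, ← factorSum_ordV hg (hN.lead_block_ne_zero r), factorSum_eq_sum] at h3
    obtain ⟨p, hp, hpne⟩ := Finset.exists_ne_zero_of_sum_ne_zero
      (show ∑ q ∈ irr (lead r (block N r)),
        mult (lead r (block N r)) q • ordV v g q ≠ 0 by omega)
    have hpo : 1 ≤ ordV v g p := Nat.one_le_iff_ne_zero.mpr fun h => hpne (by rw [h, smul_zero])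
    have hpL := hN.mem_irr_leads_of_mem_irr_lead hp
    have hpirr := irreducible_of_mem_irr hp
    have hlt := hN.lt_mainVar hpirr ((mem_irr (hN.lead_block_ne_zero r)).mp hp).2.2
    refine ⟨p, hpL, hnot p hpL hpo, hpo, r, r₀, hlt, ?_, Nat.one_le_iff_ne_zero.mpr hne, h0⟩
    by_contra hgt
    have := ordV_eq_zero_of_degreeOf hg hpirr.ne_zero hr₀
      ((mainVar_spec_of_irreducible hpirr).2 r₀ (not_le.mp hgt))
    omega

/-- Truncating both the weights and the orders at two keeps a weighted sum at least two. -/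
theorem min_two_le_sum {ι : Type*} (I : Finset ι) (k o m : ι → ℕ)
    (h : ∀ i ∈ I, 1 ≤ o i → min (o i) 2 ≤ m i) (h2 : 2 ≤ ∑ i ∈ I, k i * o i) :
    2 ≤ ∑ i ∈ I, min (k i) 2 * m i := by
  have hstep : ∀ i ∈ I, min (k i * o i) 2 ≤ min (k i) 2 * m i := by
    intro i hi
    rcases Nat.eq_zero_or_pos (o i) with h0 | h0
    · simp [h0]
    · refine le_trans ?_ (Nat.mul_le_mul_left _ (h i hi h0))
      rcases Nat.eq_zero_or_pos (k i) with hk | hk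
      · simp [hk]
      · rcases Nat.lt_or_ge (k i) 2 with hk2 | hk2
        · obtain h1 : k i = 1 := by omega
          simp [h1]
        · rw [min_eq_right hk2]
          have : 1 ≤ min (o i) 2 := by omega
          omega
  refine le_trans ?_ (Finset.sum_le_sum hstep)
  have hmin : ∀ J : Finset ι, min (∑ i ∈ J, k i * o i) 2 ≤ ∑ i ∈ J, min (k i * o i) 2 := fun J => by
    induction J using Finset.induction_on with
    | empty => simp
    | insert i J hi ih =>
      rw [Finset.sum_insert hi, Finset.sum_insert hi]
      omega
  exact (le_min h2 le_rfl).trans (hmin I)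

/-- A place which the discriminants of the blocks do not see has total weighted contact at
least two. -/
theorem IsInitial.two_le_contact (hN : IsInitial f N) (hf0 : f ≠ 0) (hf : Squarefree f)
    {v : HeightOneSpectrum (𝓞 K)} {g : MvPolynomial σ (ResV v)} (hg : Irreducible g)
    (h2 : 2 ≤ ordV v g f)
    (hdisc : ∀ r, MvPolynomial.degreeOf r (block N r) ≠ 0 →
      disc r (MvPolynomial.degreeOf r (block N r)) (red v (block N r)) ≠ 0)
    (m : MvPolynomial σ K → ℕ)
    (hm₁ : ∀ p ∈ irr (leads f N), p ∣ f → 1 ≤ ordV v g p → 1 ≤ m p)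
    (hm₂ : ∀ p ∈ irr (leads f N), ¬ p ∣ f → min (ordV v g p) 2 ≤ m p)
    (hm₃ : ∀ p ∈ irr (leads f N), ¬ p ∣ f → 1 ≤ ordV v g p →
      (∃ r r', r < mainVar p ∧ mainVar p ≤ r' ∧
        1 ≤ ordV v g (block N r) ∧ 1 ≤ ordV v g (block N r')) → 2 ≤ m p) :
    2 ≤ ∑ p ∈ irr (leads f N), min (mult (leads f N) p) 2 * m p := by
  rcases hN.detection hf0 hf hg h2 hdisc with ⟨p, hp, ho⟩ | ⟨p, hp, hpf, ho, hr⟩ | ⟨h, hL⟩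
  · have hpL := hN.mem_irr_leads_of_mem_sdiff hp
    have hpf := ((mem_irr hf0).mp (Finset.mem_sdiff.mp hp).1).2.2
    have hk := (hN.two_le_count hf0 hpL hpf).2
    have h1 := hm₁ p hpL hpf ho
    refine le_trans ?_ (Finset.single_le_sum (fun _ _ => Nat.zero_le _) hpL)
    rw [min_eq_right hk]
    omega
  · have h1 := hm₃ p hp hpf ho hr
    refine le_trans ?_ (Finset.single_le_sum (fun _ _ => Nat.zero_le _) hp)
    have hk : 1 ≤ mult (leads f N) p :=
      one_le_mult hp
    have hk' : 1 ≤ min (mult (leads f N) p) 2 := by omega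
    nlinarith
  · refine min_two_le_sum _ _ (ordV v g) m (fun p hp ho => hm₂ p hp (h p hp ho)) ?_
    rw [← factorSum_ordV hg hN.leads_ne_zero, factorSum_eq_sum] at hL
    simpa using hL

/-- The discriminant estimate for a block. -/
theorem IsInitial.block_estimate (hN : IsInitial f N) (hf0 : f ≠ 0) (hf : Squarefree f) (r : σ)
    (A : Finset (HeightOneSpectrum (𝓞 K)))
    (hA : ∀ v ∈ A, MvPolynomial.degreeOf r (block N r) ≠ 0 ∧
      disc r (MvPolynomial.degreeOf r (block N r)) (red v (block N r)) = 0) :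
    ∑ v ∈ A, Real.log (normV v) + ∑ p ∈ (irr (leads f N)).filter fun p => r < mainVar p,
        ((MvPolynomial.degreeOf r (block N r) : ℝ) - degMod p r (block N r)) * hgt p
      ≤ (2 * MvPolynomial.degreeOf r (block N r) - 1) * hgt (block N r)
        + Fintype.card (K →+* ℂ) * (MvPolynomial.degreeOf r (block N r)
          * Real.log (MvPolynomial.degreeOf r (block N r))) := by
  set d := MvPolynomial.degreeOf r (block N r) with hd
  have hcast : ∀ p, (d : ℝ) - degMod p r (block N r) = ((d - degMod p r (block N r) : ℕ) : ℝ) :=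
    fun p => (Nat.cast_sub (degMod_le p r _)).symm
  simp only [hcast]
  rcases Nat.eq_zero_or_pos d with h0 | h0
  · have hA' : A = ∅ := Finset.eq_empty_of_forall_notMem fun v hv => (hA v hv).1 h0
    rw [hA', h0, hN.block_eq_one h0, hgt_one]
    simp
  · exact discriminant_estimate r h0 rfl (hN.disc_block_ne_zero hf0 hf r) A
      (fun v hv => (hA v hv).2) _ (fun p => p) _
      (fun p hp => (irreducible_of_mem_irr (Finset.mem_filter.mp hp).1).ne_zero)
      (fun p hp q hq hne => isRelPrime_of_mem_irr (Finset.mem_filter.mp hp).1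
        (Finset.mem_filter.mp hq).1 hne)
      (fun p _ => pow_dvd_disc r fun k hk => dvd_coeff_phi_of_degMod_lt hk)

end SquareFactors

/-! ### The bound in terms of heights -/

section Bound

open IsDedekindDomain UniqueFactorizationMonoid
open scoped Classical

variable {K : Type*} [Field K] [NumberField K] {σ : Type*}
  [NormalizationMonoid (MvPolynomial σ K)] [LinearOrder σ] [Fintype σ] [Nonempty σ]
  {f : MvPolynomial σ K} {N : Finset (MvPolynomial σ K)}

/-- Every place in `S₀` is seen either by the discriminant of a block or by the contact with a
factor of the leading coefficients. -/
theorem IsInitial.sum_log_normV_le (hN : IsInitial f N) (hf0 : f ≠ 0) (hf : Squarefree f)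
    (S₀ : Finset (HeightOneSpectrum (𝓞 K)))
    (hS₀ : ∀ v ∈ S₀, ∃ g : MvPolynomial σ (ResV v), Irreducible g ∧ g ^ 2 ∣ red v f) :
    ∃ A : σ → Finset (HeightOneSpectrum (𝓞 K)),
      (∀ r, ∀ v ∈ A r, MvPolynomial.degreeOf r (block N r) ≠ 0 ∧
        disc r (MvPolynomial.degreeOf r (block N r)) (red v (block N r)) = 0) ∧
      ∑ v ∈ S₀, Real.log (normV v) ≤ ∑ r, ∑ v ∈ A r, Real.log (normV v)
        + ∑ p ∈ irr (leads f N), (min (mult (leads f N) p) 2 : ℕ) / 2 *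
          (((f.totalDegree : ℝ) - ∑ r ∈ Finset.univ.filter (· < mainVar p),
            (degMod p r (block N r) : ℝ)) * hgt p
          + p.totalDegree * (hgtL f + Fintype.card (K →+* ℂ) * Real.log f.totalDegree)) := by
  let A : σ → Finset (HeightOneSpectrum (𝓞 K)) := fun r => S₀.filter fun v =>
    MvPolynomial.degreeOf r (block N r) ≠ 0 ∧
      disc r (MvPolynomial.degreeOf r (block N r)) (red v (block N r)) = 0
  refine ⟨A, fun r v hv => (Finset.mem_filter.mp hv).2, ?_⟩
  let S₁ := S₀.filter fun v => ∀ r, v ∉ A r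
  have hgex : ∀ v, ∃ g : MvPolynomial σ (ResV v), v ∈ S₀ → Irreducible g ∧ g ^ 2 ∣ red v f := by
    intro v
    by_cases hv : v ∈ S₀
    · obtain ⟨g, hg⟩ := hS₀ v hv
      exact ⟨g, fun _ => hg⟩
    · exact ⟨0, fun h => absurd h hv⟩
  choose g hg using hgex
  have hg' : ∀ v ∈ S₁, Irreducible (g v) ∧ 2 ≤ ordV v (g v) f := fun v hv => by
    obtain ⟨h1, h2⟩ := hg v (Finset.mem_filter.mp hv).1
    exact ⟨h1, (pow_dvd_iff_le_ordV h1 hf0).mp h2⟩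
  have hmex : ∀ p, ∃ m : HeightOneSpectrum (𝓞 K) → ℕ, p ∈ irr (leads f N) →
      (p ∣ f → ∀ v ∈ S₁, 1 ≤ ordV v (g v) p → 1 ≤ m v) ∧
      (¬ p ∣ f → ∀ v ∈ S₁, min (ordV v (g v) p) 2 ≤ m v) ∧
      (¬ p ∣ f → ∀ v ∈ S₁, 1 ≤ ordV v (g v) p → (∃ r r', r < mainVar p ∧ mainVar p ≤ r' ∧
        1 ≤ ordV v (g v) (block N r) ∧ 1 ≤ ordV v (g v) (block N r')) → 2 ≤ m v) ∧
      ∑ v ∈ S₁, (m v : ℝ) * Real.log (normV v) ≤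
        ((f.totalDegree : ℝ) - ∑ r ∈ Finset.univ.filter (· < mainVar p),
          (degMod p r (block N r) : ℝ)) * hgt p
        + p.totalDegree * (hgtL f + Fintype.card (K →+* ℂ) * Real.log f.totalDegree) := by
    intro p
    by_cases hp : p ∈ irr (leads f N)
    · obtain ⟨m, hm⟩ := hN.exists_contact hf0 hf hp S₁ g hg'
      exact ⟨m, fun _ => hm⟩
    · exact ⟨0, fun h => absurd h hp⟩
  choose m hm using hmex
  have hlog : ∀ v : HeightOneSpectrum (𝓞 K), 0 ≤ Real.log (normV v) := fun v =>
    (Real.log_pos (one_lt_normV v)).le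
  have h1 : ∑ v ∈ S₀, Real.log (normV v)
      ≤ ∑ r, ∑ v ∈ A r, Real.log (normV v) + ∑ v ∈ S₁, Real.log (normV v) := by
    have hA' : ∀ r, ∑ v ∈ A r, Real.log (normV v)
        = ∑ v ∈ S₀, if v ∈ A r then Real.log (normV v) else 0 := fun r => by
      rw [Finset.sum_ite_mem, Finset.inter_eq_right.mpr (Finset.filter_subset _ _)]
    have hS₁ : ∑ v ∈ S₁, Real.log (normV v)
        = ∑ v ∈ S₀, if v ∈ S₁ then Real.log (normV v) else 0 := by
      rw [Finset.sum_ite_mem, Finset.inter_eq_right.mpr (Finset.filter_subset _ _)]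
    rw [hS₁, Finset.sum_congr rfl fun r _ => hA' r, Finset.sum_comm, ← Finset.sum_add_distrib]
    refine Finset.sum_le_sum fun v hv => ?_
    have hnn : ∀ r, 0 ≤ if v ∈ A r then Real.log (normV v) else 0 := fun r => by
      split_ifs
      exacts [hlog v, le_rfl]
    by_cases h : ∃ r, v ∈ A r
    · obtain ⟨r, hr⟩ := h
      have h3 := Finset.single_le_sum (fun r _ => hnn r) (Finset.mem_univ r)
      simp only [if_pos hr] at h3
      refine h3.trans (le_add_of_nonneg_right ?_)
      split_ifs
      exacts [hlog v, le_rfl]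
    · push Not at h
      rw [if_pos (Finset.mem_filter.mpr ⟨hv, h⟩)]
      exact le_add_of_nonneg_left (Finset.sum_nonneg fun r _ => hnn r)
  have h2 : ∑ v ∈ S₁, Real.log (normV v) ≤ ∑ p ∈ irr (leads f N),
      ((min (mult (leads f N) p) 2 : ℕ) : ℝ) / 2 * ∑ v ∈ S₁, (m p v : ℝ) * Real.log (normV v) := by
    simp only [Finset.mul_sum]
    rw [Finset.sum_comm]
    refine Finset.sum_le_sum fun v hv => ?_
    obtain ⟨hv0, hvA⟩ := Finset.mem_filter.mp hv
    obtain ⟨h3, h4⟩ := hg' v hv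
    have h5 := hN.two_le_contact hf0 hf h3 h4
      (fun r hr h0 => hvA r (Finset.mem_filter.mpr ⟨hv0, hr, h0⟩)) (fun p => m p v)
      (fun p hp hpf => (hm p hp).1 hpf v hv) (fun p hp hpf => (hm p hp).2.1 hpf v hv)
      (fun p hp hpf => (hm p hp).2.2.1 hpf v hv)
    have h6 : (2 : ℝ) ≤ ∑ p ∈ irr (leads f N),
        ((min (mult (leads f N) p) 2 : ℕ) : ℝ) * (m p v : ℝ) := by
      exact_mod_cast h5
    have h7 : ∑ p ∈ irr (leads f N), ((min (mult (leads f N) p) 2 : ℕ) : ℝ) / 2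
        * ((m p v : ℝ) * Real.log (normV v))
        = (∑ p ∈ irr (leads f N), ((min (mult (leads f N) p) 2 : ℕ) : ℝ) * (m p v : ℝ)) / 2
          * Real.log (normV v) := by
      rw [Finset.sum_div, Finset.sum_mul]
      exact Finset.sum_congr rfl fun p _ => by ring
    rw [h7]
    nlinarith [hlog v]
  refine h1.trans (add_le_add le_rfl (h2.trans (Finset.sum_le_sum fun p hp => ?_)))
  exact mul_le_mul_of_nonneg_left (hm p hp).2.2.2 (by positivity)

omit [NumberField K] in
theorem IsInitial.nonempty (hN : IsInitial f N) (hf0 : f ≠ 0) (hf : ¬ IsUnit f) : N.Nonempty := by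
  have hne : (irr f).Nonempty := by
    obtain ⟨q, hq, hqf⟩ := WfDvdMonoid.exists_irreducible_factor hf hf0
    exact ⟨normalize q, (mem_irr hf0).mpr ⟨(normalize_associated q).symm.irreducible hq,
      normalize_idem q, (normalize_associated q).dvd.trans hqf⟩⟩
  obtain ⟨q, hq, hmin⟩ := Finset.exists_min_image (irr f) mainVar hne
  refine ⟨q, ?_⟩
  by_contra h
  obtain ⟨q', hq', hlt, -⟩ := (hN.notMem_iff q hq).mp h
  exact absurd (hmin q' (hN.subset hq')) (not_le.mpr hlt)

omit [NumberField K] [NormalizationMonoid (MvPolynomial σ K)] [LinearOrder σ] [Fintype σ]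
  [Nonempty σ] in
theorem totalDegree_prod {ι : Type*} (I : Finset ι) {p : ι → MvPolynomial σ K}
    (hp : ∀ i ∈ I, p i ≠ 0) : (∏ i ∈ I, p i).totalDegree = ∑ i ∈ I, (p i).totalDegree := by
  induction I using Finset.induction_on with
  | empty => simp
  | insert i I hi ih =>
    have h := fun j hj => hp j (Finset.mem_insert_of_mem hj)
    rw [Finset.prod_insert hi, Finset.sum_insert hi, MvPolynomial.totalDegree_mul_of_isDomain
      (hp i (Finset.mem_insert_self i I)) (Finset.prod_ne_zero_iff.mpr h), ih h]

omit [NumberField K] in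
theorem IsInitial.totalDegree_leads_add_le (hN : IsInitial f N) (hf0 : f ≠ 0) (hf : Squarefree f) :
    (leads f N).totalDegree + ∑ r, MvPolynomial.degreeOf r (block N r) ≤ f.totalDegree := by
  rw [← totalDegree_eq_of_associated hf0 (hN.rest_mul_prod_block hf0 hf), leads,
    MvPolynomial.totalDegree_mul_of_isDomain rest_ne_zero
      (Finset.prod_ne_zero_iff.mpr fun r _ => hN.lead_block_ne_zero r),
    MvPolynomial.totalDegree_mul_of_isDomain rest_ne_zero
      (Finset.prod_ne_zero_iff.mpr fun r _ => hN.block_ne_zero r),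
    totalDegree_prod _ fun r _ => hN.lead_block_ne_zero r,
    totalDegree_prod _ fun r _ => hN.block_ne_zero r, add_assoc, ← Finset.sum_add_distrib]
  refine Nat.add_le_add_left (Finset.sum_le_sum fun r _ => ?_) _
  rw [← natDegree_phi]
  exact totalDegree_coeff_phi_add_le r (hN.lead_block_ne_zero r)

omit [NormalizationMonoid (MvPolynomial σ K)] [LinearOrder σ] [Nonempty σ] in
theorem hgt_le_hgtL (hf0 : f ≠ 0) : hgt f ≤ hgtL f := by
  refine add_le_add (Finset.sum_le_sum fun φ _ => ?_) le_rfl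
  have hφ := map_embedding_ne_zero φ hf0
  refine (logMahler_le_log_l2 hφ).trans (Real.log_le_log (Real.sqrt_pos.mpr ?_) ?_)
  · exact Finset.sum_pos (fun d hd => by
      have := norm_pos_iff.mpr (MvPolynomial.mem_support_iff.mp hd)
      positivity) (MvPolynomial.support_nonempty.mpr hφ)
  · rw [Real.sqrt_le_left (l1_pos hφ).le]
    exact Finset.sum_sq_le_sq_sum_of_nonneg fun _ _ => norm_nonneg _

/-- The bound for squarefree polynomials in terms of heights. The gain in the discriminant estimates
from the drop of the degrees of the blocks modulo `p` compensates the loss in the multiplicity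
estimates. -/
theorem sum_log_normV_le (hf0 : f ≠ 0) (hf : Squarefree f)
    (hdeg : 1 ≤ f.totalDegree) {H : ℝ} (hH₁ : hgt f ≤ H) (hH₂ : hgtL f ≤ 2 * H)
    (S₀ : Finset (HeightOneSpectrum (𝓞 K)))
    (hS₀ : ∀ v ∈ S₀, ∃ g : MvPolynomial σ (ResV v), Irreducible g ∧ g ^ 2 ∣ red v f) :
    ∑ v ∈ S₀, Real.log (normV v) ≤ (2 * f.totalDegree - 1) * H
      + Fintype.card (K →+* ℂ) * (f.totalDegree * Real.log f.totalDegree) := by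
  obtain ⟨N, hN⟩ := exists_isInitial f
  obtain ⟨A, hA, hsum⟩ := hN.sum_log_normV_le hf0 hf S₀ hS₀
  set L := leads f N with hL
  have hL0 : L ≠ 0 := hN.leads_ne_zero
  set W := hgtL f + Fintype.card (K →+* ℂ) * Real.log f.totalDegree with hW
  set δ : ℝ := (f.totalDegree : ℝ) with hδ
  set κ : ℝ := (Fintype.card (K →+* ℂ) : ℝ) with hκ
  set d : σ → ℝ := fun r => MvPolynomial.degreeOf r (block N r) with hd
  set e : MvPolynomial σ K → σ → ℝ := fun p r => degMod p r (block N r) with he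
  have hκ0 : 0 ≤ κ := Nat.cast_nonneg _
  have hδ1 : 1 ≤ δ := by rw [hδ]; exact_mod_cast hdeg
  have hlogδ : 0 ≤ Real.log δ := Real.log_nonneg hδ1
  have hh0 : ∀ p ∈ irr L, 0 ≤ hgt p := fun p hp => hgt_nonneg (irreducible_of_mem_irr hp).ne_zero
  have hd0 : ∀ r, 0 ≤ d r := fun r => Nat.cast_nonneg _
  have hed : ∀ p r, e p r ≤ d r := fun p r => Nat.cast_le.mpr (degMod_le p r _)
  have hf0' : 0 ≤ hgt f := hgt_nonneg hf0
  have hb0 : ∀ r, 0 ≤ hgt (block N r) := fun r => hgt_nonneg (hN.block_ne_zero r)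
  -- The blocks and their leading coefficients share the degree of `f`.
  have hdegL : (L.totalDegree : ℝ) + ∑ r, d r ≤ δ := by
    rw [hδ, hd]
    simp only
    exact_mod_cast hN.totalDegree_leads_add_le hf0 hf
  have hdsum1 : 1 ≤ ∑ r, d r := by
    have hfu : ¬ IsUnit f := fun h => by
      have := totalDegree_eq_of_associated one_ne_zero (associated_one_iff_isUnit.mpr h)
      rw [MvPolynomial.totalDegree_one] at this
      omega
    obtain ⟨q, hq⟩ := hN.nonempty hf0 hfu
    have h1 : d (mainVar q) ≤ ∑ r, d r :=
      Finset.single_le_sum (fun r _ => hd0 r) (Finset.mem_univ _)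
    refine le_trans ?_ h1
    have hqb : q ∣ block N (mainVar q) := Finset.dvd_prod_of_mem _ (by simp [hq])
    have : MvPolynomial.degreeOf (mainVar q) (block N (mainVar q)) ≠ 0 := fun h0 =>
      hN.degreeOf_ne_zero_of_dvd_block (hN.irreducible hq) hqb
        (degreeOf_eq_zero_of_dvd (hN.block_ne_zero _) hqb h0)
    rw [hd]
    simp only
    exact_mod_cast Nat.one_le_iff_ne_zero.mpr this
  -- Passing to leading coefficients does not increase the height.
  have hhf : hgt f = hgt (rest f N) + ∑ r, hgt (block N r) := by
    rw [← hgt_eq_of_associated hf0 (hN.rest_mul_prod_block hf0 hf), hgt_mul rest_ne_zero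
      (Finset.prod_ne_zero_iff.mpr fun r _ => hN.block_ne_zero r),
      hgt_prod _ _ fun r _ => hN.block_ne_zero r]
  have hhL : hgt L ≤ hgt f := by
    rw [hL, leads, hhf, hgt_mul rest_ne_zero
      (Finset.prod_ne_zero_iff.mpr fun r _ => hN.lead_block_ne_zero r),
      hgt_prod _ _ fun r _ => hN.lead_block_ne_zero r]
    exact add_le_add le_rfl (Finset.sum_le_sum fun r _ => hgt_lead_le r (hN.block_ne_zero r))
  have hrest0 : 0 ≤ hgt (rest f N) := hgt_nonneg rest_ne_zero
  -- the discriminant estimates for all blocks, with the gain from the factors of `L`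
  have hblocks : ∑ r, ∑ v ∈ A r, Real.log (normV v)
      + ∑ p ∈ irr L, ∑ r ∈ Finset.univ.filter (· < mainVar p), (d r - e p r) * hgt p
      ≤ ∑ r, ((2 * d r - 1) * hgt (block N r) + κ * (d r * Real.log (d r))) := by
    have hcomm : ∑ p ∈ irr L, ∑ r ∈ Finset.univ.filter (· < mainVar p), (d r - e p r) * hgt p
        = ∑ r, ∑ p ∈ (irr L).filter (fun p => r < mainVar p), (d r - e p r) * hgt p :=
      Finset.sum_comm' fun p r => by simp
    rw [hcomm, ← Finset.sum_add_distrib]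
    exact Finset.sum_le_sum fun r _ => hN.block_estimate hf0 hf r (A r) (hA r)
  -- In the multiplicity estimate for `p`, the weight `min (mult L p) 2 / 2` is at most `1` on the part
  -- which the gain compensates, and at most half the multiplicity on the remaining part.
  set D : MvPolynomial σ K → ℝ := fun p => ∑ r ∈ Finset.univ.filter (fun r => ¬ r < mainVar p), d r
    with hD
  have hDsplit : ∀ p, ∑ r ∈ Finset.univ.filter (· < mainVar p), d r + D p = ∑ r, d r := fun p =>
    Finset.sum_filter_add_sum_filter_not _ _ _
  have hD0 : ∀ p, 0 ≤ D p := fun p => Finset.sum_nonneg fun r _ => hd0 r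
  have hW0 : 0 ≤ W :=
    add_nonneg (hf0'.trans (hgt_le_hgtL hf0)) (mul_nonneg hκ0 hlogδ)
  set b : ℝ := δ - ∑ r, d r with hb
  have hb1 : (L.totalDegree : ℝ) ≤ b := by rw [hb]; linarith
  have hbnn : 0 ≤ b := (Nat.cast_nonneg _).trans hb1
  have hterm : ∀ p ∈ irr L, ((min (mult L p) 2 : ℕ) : ℝ) / 2 *
      ((δ - ∑ r ∈ Finset.univ.filter (· < mainVar p), e p r) * hgt p + p.totalDegree * W)
      ≤ ∑ r ∈ Finset.univ.filter (· < mainVar p), (d r - e p r) * hgt p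
        + (mult L p : ℝ) * ((b * hgt p + D p * hgt p + p.totalDegree * W) / 2) := by
    intro p hp
    set l : ℝ := ((min (mult L p) 2 : ℕ) : ℝ) / 2 with hl
    have hl0 : 0 ≤ l := by positivity
    have hl1 : l ≤ 1 := by
      have : ((min (mult L p) 2 : ℕ) : ℝ) ≤ 2 := by exact_mod_cast min_le_right _ _
      rw [hl]; linarith
    have hlk : l ≤ (mult L p : ℝ) / 2 := by
      have : ((min (mult L p) 2 : ℕ) : ℝ) ≤ mult L p := by exact_mod_cast min_le_left _ _
      rw [hl]; linarith
    set z := ∑ r ∈ Finset.univ.filter (· < mainVar p), (d r - e p r) * hgt p with hz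
    have hz0 : 0 ≤ z := Finset.sum_nonneg fun r _ =>
      mul_nonneg (sub_nonneg.mpr (hed p r)) (hh0 p hp)
    have hzz : z = (∑ r ∈ Finset.univ.filter (· < mainVar p), d r) * hgt p
        - (∑ r ∈ Finset.univ.filter (· < mainVar p), e p r) * hgt p := by
      rw [hz, ← Finset.sum_mul, Finset.sum_sub_distrib, sub_mul]
    have hrw : (δ - ∑ r ∈ Finset.univ.filter (· < mainVar p), e p r) * hgt p + p.totalDegree * W
        = z + (b * hgt p + D p * hgt p + p.totalDegree * W) := by
      rw [hzz, hb]
      have := hDsplit p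
      have h2 : ∑ r ∈ Finset.univ.filter (· < mainVar p), d r = ∑ r, d r - D p := by linarith
      rw [h2]
      ring
    have hnn : 0 ≤ b * hgt p + D p * hgt p + p.totalDegree * W :=
      add_nonneg (add_nonneg (mul_nonneg hbnn (hh0 p hp)) (mul_nonneg (hD0 p) (hh0 p hp)))
        (mul_nonneg (Nat.cast_nonneg _) hW0)
    rw [hrw, mul_add]
    refine add_le_add (mul_le_of_le_one_left hz0 hl1) ?_
    calc l * (b * hgt p + D p * hgt p + p.totalDegree * W)
        ≤ (mult L p : ℝ) / 2 * (b * hgt p + D p * hgt p + p.totalDegree * W) :=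
          mul_le_mul_of_nonneg_right hlk hnn
      _ = _ := by ring
  -- Summed with multiplicities over the factors of `L`, the remaining part is additive.
  have hmult : ∀ w : MvPolynomial σ K → ℝ, ∑ p ∈ irr L, (mult L p : ℝ) * w p = factorSum w L :=
    fun w => by rw [factorSum_eq_sum]; simp only [nsmul_eq_mul]
  have hDL : factorSum (fun p => D p * hgt p) L
      ≤ (∑ r, d r) * hgt (rest f N) + ∑ r, (∑ i, d i - d r) * hgt (block N r) := by
    have hscale : ∀ (c : ℝ) {Q : MvPolynomial σ K}, Q ≠ 0 →
        factorSum (fun p => c * hgt p) Q = c * hgt Q := fun c Q hQ => by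
      rw [← factorSum_hgt hQ, factorSum_eq_sum, factorSum_eq_sum, Finset.mul_sum]
      exact Finset.sum_congr rfl fun p _ => by rw [nsmul_eq_mul, nsmul_eq_mul]; ring
    rw [hL, leads, factorSum_mul _ rest_ne_zero
      (Finset.prod_ne_zero_iff.mpr fun r _ => hN.lead_block_ne_zero r),
      factorSum_prod _ _ fun r _ => hN.lead_block_ne_zero r]
    refine add_le_add ?_ (Finset.sum_le_sum fun r _ => ?_)
    · rw [← hscale _ rest_ne_zero]
      refine factorSum_le fun p hp => mul_le_mul_of_nonneg_right ?_
        (hgt_nonneg (irreducible_of_mem_irr hp).ne_zero)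
      rw [← hDsplit p]
      exact le_add_of_nonneg_left (Finset.sum_nonneg fun r _ => hd0 r)
    · have hle : d r ≤ ∑ i, d i := Finset.single_le_sum (fun i _ => hd0 i) (Finset.mem_univ r)
      refine le_trans ?_ (mul_le_mul_of_nonneg_left (hgt_lead_le r (hN.block_ne_zero r))
        (sub_nonneg.mpr hle))
      rw [← hscale _ (hN.lead_block_ne_zero r)]
      refine factorSum_le fun p hp => mul_le_mul_of_nonneg_right ?_
        (hgt_nonneg (irreducible_of_mem_irr hp).ne_zero)
      have hlt := hN.lt_mainVar (irreducible_of_mem_irr hp)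
        ((mem_irr (hN.lead_block_ne_zero r)).mp hp).2.2
      have h1 : d r ≤ ∑ i ∈ Finset.univ.filter (· < mainVar p), d i :=
        Finset.single_le_sum (fun i _ => hd0 i) (Finset.mem_filter.mpr ⟨Finset.mem_univ r, hlt⟩)
      have := hDsplit p
      linarith
  have htotal : ∑ p ∈ irr L, (mult L p : ℝ)
      * ((b * hgt p + D p * hgt p + p.totalDegree * W) / 2)
      = (b * hgt L + factorSum (fun p => D p * hgt p) L + L.totalDegree * W) / 2 := by
    have h1 : (L.totalDegree : ℝ) = ∑ p ∈ irr L, (mult L p : ℝ) * p.totalDegree := by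
      rw [← factorSum_totalDegree hL0, factorSum_eq_sum]
      push_cast [smul_eq_mul]
      rfl
    have h2 : hgt L = ∑ p ∈ irr L, (mult L p : ℝ) * hgt p := by
      rw [hmult, factorSum_hgt hL0]
    rw [h1, h2, ← hmult, Finset.mul_sum, Finset.sum_mul, ← Finset.sum_add_distrib,
      ← Finset.sum_add_distrib, Finset.sum_div]
    exact Finset.sum_congr rfl fun p _ => by ring
  have hEsum := Finset.sum_le_sum hterm
  rw [Finset.sum_add_distrib, htotal] at hEsum
  have hdlog : ∑ r, d r * Real.log (d r) ≤ (∑ r, d r) * Real.log δ := by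
    rw [Finset.sum_mul]
    refine Finset.sum_le_sum fun r _ => mul_le_mul_of_nonneg_left ?_ (hd0 r)
    rcases (hd0 r).eq_or_lt with h0 | h0
    · rw [← h0, Real.log_zero]; exact hlogδ
    · refine Real.log_le_log h0 ?_
      have : d r ≤ ∑ i, d i := Finset.single_le_sum (fun i _ => hd0 i) (Finset.mem_univ r)
      linarith
  have hblk : ∑ r, (2 * d r - 1) * hgt (block N r)
      + ((∑ r, d r) * hgt (rest f N) + ∑ r, (∑ i, d i - d r) * hgt (block N r)) / 2
      ≤ (2 * ∑ r, d r - 1) * hgt f := by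
    have h1 : ∑ r, (2 * d r - 1) * hgt (block N r) + (∑ r, (∑ i, d i - d r) * hgt (block N r)) / 2
        ≤ ∑ r, (2 * ∑ i, d i - 1) * hgt (block N r) := by
      rw [Finset.sum_div, ← Finset.sum_add_distrib]
      refine Finset.sum_le_sum fun r _ => ?_
      have hle : d r ≤ ∑ i, d i := Finset.single_le_sum (fun i _ => hd0 i) (Finset.mem_univ r)
      have := mul_nonneg (sub_nonneg.mpr hle) (hb0 r)
      linarith
    have h2 : (∑ r, d r) * hgt (rest f N) / 2 ≤ (2 * ∑ r, d r - 1) * hgt (rest f N) := by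
      have := mul_le_mul_of_nonneg_right hdsum1 hrest0
      nlinarith
    rw [← Finset.mul_sum] at h1
    rw [hhf, mul_add]
    linarith
  rw [Finset.sum_add_distrib, ← Finset.mul_sum] at hblocks
  have hκlog := mul_le_mul_of_nonneg_left hdlog hκ0
  have hx1 : b * hgt L ≤ b * H := mul_le_mul_of_nonneg_left (hhL.trans hH₁) hbnn
  have hx2 : (L.totalDegree : ℝ) * W ≤ b * (2 * H + κ * Real.log δ) :=
    mul_le_mul hb1 (by rw [hW]; linarith) hW0 hbnn
  have hx3 : (2 * ∑ r, d r - 1) * hgt f ≤ (2 * ∑ r, d r - 1) * H :=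
    mul_le_mul_of_nonneg_left hH₁ (by linarith)
  have hH0 : 0 ≤ H := hf0'.trans hH₁
  have hbH := mul_nonneg hbnn hH0
  have hbκ := mul_nonneg hbnn (mul_nonneg hκ0 hlogδ)
  have hδb : δ = b + ∑ r, d r := by rw [hb]; ring
  calc ∑ v ∈ S₀, Real.log (normV v)
      ≤ (2 * ∑ r, d r - 1) * H + κ * ((∑ r, d r) * Real.log δ)
        + (b * H + b * (2 * H + κ * Real.log δ)) / 2 := by linarith
    _ ≤ (2 * (b + ∑ r, d r) - 1) * H + κ * ((b + ∑ r, d r) * Real.log δ) := by nlinarith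
    _ = _ := by rw [← hδb]

end Bound

/-! ### The classical height -/

section ClassicalHeight

open IsDedekindDomain

variable {K : Type*} [Field K] [NumberField K] {σ : Type*}

/-- The largest absolute value of a coefficient of a complex polynomial. -/
def linf (F : MvPolynomial σ ℂ) : ℝ := ⨆ d : F.support, ‖F.coeff d‖

theorem norm_coeff_le_linf (F : MvPolynomial σ ℂ) {d : σ →₀ ℕ} (hd : d ∈ F.support) :
    ‖F.coeff d‖ ≤ linf F :=
  le_ciSup (f := fun d : F.support => ‖F.coeff d‖) (Set.finite_range _).bddAbove ⟨d, hd⟩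

theorem linf_pos {F : MvPolynomial σ ℂ} (hF : F ≠ 0) : 0 < linf F := by
  obtain ⟨d, hd⟩ := MvPolynomial.support_nonempty.2 hF
  exact (norm_pos_iff.2 (MvPolynomial.mem_support_iff.1 hd)).trans_le (norm_coeff_le_linf F hd)

theorem log_l1_le {F : MvPolynomial σ ℂ} (hF : F ≠ 0) {C : ℕ} (hC : F.support.card ≤ C) :
    Real.log (l1 F) ≤ Real.log C + Real.log (linf F) := by
  have hcard : 0 < F.support.card := Finset.card_pos.2 (MvPolynomial.support_nonempty.2 hF)
  have hC0 : (0 : ℝ) < C := by exact_mod_cast hcard.trans_le hC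
  rw [← Real.log_mul hC0.ne' (linf_pos hF).ne']
  refine Real.log_le_log (l1_pos hF) ?_
  calc l1 F ≤ ∑ d ∈ F.support, linf F := Finset.sum_le_sum fun d hd => norm_coeff_le_linf F hd
    _ = F.support.card * linf F := by rw [Finset.sum_const, nsmul_eq_mul]
    _ ≤ C * linf F := by
      refine mul_le_mul_of_nonneg_right ?_ (linf_pos hF).le
      exact_mod_cast hC

theorem logMahler_le_linf [Fintype σ] {F : MvPolynomial σ ℂ} (hF : F ≠ 0) {C : ℕ}
    (hC : F.support.card ≤ C) :
    logMahler F ≤ Real.log C / 2 + Real.log (linf F) := by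
  have hcard : 0 < F.support.card := Finset.card_pos.2 (MvPolynomial.support_nonempty.2 hF)
  have hC0 : (0 : ℝ) < C := by exact_mod_cast hcard.trans_le hC
  have hle : ∑ d ∈ F.support, ‖F.coeff d‖ ^ 2 ≤ C * linf F ^ 2 :=
    calc ∑ d ∈ F.support, ‖F.coeff d‖ ^ 2 ≤ ∑ d ∈ F.support, linf F ^ 2 :=
          Finset.sum_le_sum fun d hd =>
            pow_le_pow_left₀ (norm_nonneg _) (norm_coeff_le_linf F hd) 2
      _ = F.support.card * linf F ^ 2 := by rw [Finset.sum_const, nsmul_eq_mul]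
      _ ≤ C * linf F ^ 2 := by
        refine mul_le_mul_of_nonneg_right ?_ (sq_nonneg _)
        exact_mod_cast hC
  have hpos : 0 < ∑ d ∈ F.support, ‖F.coeff d‖ ^ 2 := by
    obtain ⟨d, hd⟩ := MvPolynomial.support_nonempty.2 hF
    exact Finset.sum_pos (fun d hd => pow_pos
      (norm_pos_iff.2 (MvPolynomial.mem_support_iff.1 hd)) 2) ⟨d, hd⟩
  refine (logMahler_le_log_l2 hF).trans ?_
  rw [Real.log_sqrt hpos.le]
  have h := Real.log_le_log hpos hle
  rw [Real.log_mul hC0.ne' (pow_pos (linf_pos hF) 2).ne', Real.log_pow] at h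
  push_cast at h
  linarith

/-- A product over the archimedean places with multiplicities is a product over the complex
embeddings. -/
theorem prod_infinitePlace_pow_mult (g : InfinitePlace K → ℝ) :
    ∏ w : InfinitePlace K, g w ^ w.mult = ∏ φ : K →+* ℂ, g (InfinitePlace.mk φ) := by
  classical
  rw [← Finset.prod_fiberwise (s := (Finset.univ : Finset (K →+* ℂ)))
    (g := fun φ => InfinitePlace.mk φ)]
  refine Finset.prod_congr rfl fun w _ => ?_
  rw [Finset.prod_congr rfl (g := fun _ => g w) fun φ hφ => by rw [(Finset.mem_filter.1 hφ).2],
    Finset.prod_const, InfinitePlace.card_filter_mk_eq]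

theorem logHeight_eq {f : MvPolynomial σ K} (hf : f ≠ 0) :
    Height.logHeight (fun d : f.support => f.coeff d)
      = (∑ φ : K →+* ℂ, Real.log (linf (MvPolynomial.map φ f)))
        + ∑ᶠ v : HeightOneSpectrum (𝓞 K), Real.log (gaussV v f) := by
  classical
  obtain ⟨d₀, hd₀⟩ := MvPolynomial.support_nonempty.2 hf
  have hx : (fun d : f.support => f.coeff d) ≠ 0 := fun h =>
    MvPolynomial.mem_support_iff.1 hd₀ (congrFun h ⟨d₀, hd₀⟩)
  have hfin := finite_gaussV_ne_one hf
  have h1 : ∏ w : InfinitePlace K, (⨆ d : f.support, w (f.coeff d)) ^ w.mult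
      = ∏ φ : K →+* ℂ, linf (MvPolynomial.map φ f) := by
    rw [prod_infinitePlace_pow_mult fun w => ⨆ d : f.support, w (f.coeff d)]
    refine Finset.prod_congr rfl fun φ _ => ?_
    have hs : (MvPolynomial.map φ f).support = f.support :=
      MvPolynomial.support_map_of_injective _ φ.injective
    rw [linf]
    simp only [InfinitePlace.apply, MvPolynomial.coeff_map]
    rw [hs]
  have h2 : ∏ᶠ w : FinitePlace K, ⨆ d : f.support, w (f.coeff d)
      = ∏ᶠ v : HeightOneSpectrum (𝓞 K), gaussV v f := by
    rw [← finprod_comp_equiv FinitePlace.equivHeightOneSpectrum.symm]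
    refine finprod_congr fun v => iSup_congr fun d => ?_
    rw [FinitePlace.equivHeightOneSpectrum_symm_apply, FinitePlace.norm_embedding]
    rfl
  rw [Height.logHeight, NumberField.mulHeight_eq hx, h1, h2,
    finprod_eq_prod_of_mulSupport_subset (s := hfin.toFinset) _ (fun v hv => by simpa using hv),
    finsum_eq_sum_of_support_subset (s := hfin.toFinset) _ (fun v hv => by
      rw [Set.Finite.coe_toFinset]
      intro h1
      exact hv (by simp only [h1, Real.log_one]))]
  have hφ : ∀ φ : K →+* ℂ, linf (MvPolynomial.map φ f) ≠ 0 := fun φ =>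
    (linf_pos (map_embedding_ne_zero φ hf)).ne'
  have hv : ∀ v : HeightOneSpectrum (𝓞 K), gaussV v f ≠ 0 := fun v => (gaussV_pos v hf).ne'
  rw [Real.log_mul (Finset.prod_ne_zero_iff.2 fun φ _ => hφ φ)
    (Finset.prod_ne_zero_iff.2 fun v _ => hv v), Real.log_prod fun φ _ => hφ φ,
    Real.log_prod fun v _ => hv v]

omit [NumberField K] in
theorem card_support_map_le {f : MvPolynomial σ K} {C : ℕ} (hC : f.support.card ≤ C)
    (φ : K →+* ℂ) : (MvPolynomial.map φ f).support.card ≤ C := by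
  classical
  rwa [MvPolynomial.support_map_of_injective _ φ.injective]

theorem hgt_le_logHeight [Fintype σ] {f : MvPolynomial σ K} (hf : f ≠ 0) {C : ℕ}
    (hC : f.support.card ≤ C) :
    hgt f ≤ Height.logHeight (fun d : f.support => f.coeff d)
      + Fintype.card (K →+* ℂ) * Real.log C / 2 := by
  rw [logHeight_eq hf, hgt]
  have h := Finset.sum_le_sum fun (φ : K →+* ℂ) (_ : φ ∈ Finset.univ) =>
    logMahler_le_linf (map_embedding_ne_zero φ hf) (card_support_map_le hC φ)
  rw [Finset.sum_add_distrib, Finset.sum_const, Finset.card_univ, nsmul_eq_mul] at h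
  linarith

theorem hgtL_le_logHeight {f : MvPolynomial σ K} (hf : f ≠ 0) {C : ℕ}
    (hC : f.support.card ≤ C) :
    hgtL f ≤ Height.logHeight (fun d : f.support => f.coeff d)
      + Fintype.card (K →+* ℂ) * Real.log C := by
  rw [logHeight_eq hf, hgtL]
  have h := Finset.sum_le_sum fun (φ : K →+* ℂ) (_ : φ ∈ Finset.univ) =>
    log_l1_le (map_embedding_ne_zero φ hf) (card_support_map_le hC φ)
  rw [Finset.sum_add_distrib, Finset.sum_const, Finset.card_univ, nsmul_eq_mul] at h
  linarith

omit [NumberField K] in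
/-- The number of monomials of degree `δ` in `n + 1` variables bounds the number of terms of a
form. -/
theorem card_support_le_choose {n δ : ℕ} {f : MvPolynomial (Fin (n + 1)) K}
    (hf : f.IsHomogeneous δ) : f.support.card ≤ (δ + n).choose n := by
  classical
  have h : f.support ⊆ Finset.finsuppAntidiag Finset.univ δ := fun d hd => by
    rw [Finset.mem_finsuppAntidiag]
    refine ⟨?_, Finset.subset_univ _⟩
    have := hf (MvPolynomial.mem_support_iff.1 hd)
    rw [← Finsupp.degree_eq_sum, Finsupp.degree_eq_weight_one (R := ℕ)]
    exact this
  refine (Finset.card_le_card h).trans_eq ?_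
  rw [Finset.card_finsuppAntidiag_nat_eq_choose, Finset.card_univ, Fintype.card_fin,
    show n + 1 + δ - 1 = δ + n by omega, Nat.choose_symm_add]

end ClassicalHeight

/-! ### The places where the reduction has a square factor -/

section SquareFactor

open IsDedekindDomain

variable {n δ : ℕ} {K : Type u} [Field K] [NumberField K]

/-- A maximal ideal of `𝓞 K` as a nonzero prime ideal. -/
def toPlace (𝔭 : MaximalSpectrum (𝓞 K)) : HeightOneSpectrum (𝓞 K) where
  asIdeal := 𝔭.asIdeal
  isPrime := 𝔭.isMaximal.isPrime
  ne_bot := Ring.ne_bot_of_isMaximal_of_not_isField 𝔭.isMaximal (RingOfIntegers.not_isField K)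

theorem toPlace_injective : Function.Injective (toPlace (K := K)) := fun _ _ h =>
  MaximalSpectrum.ext (congrArg HeightOneSpectrum.asIdeal h)

theorem placeNorm_eq (𝔭 : MaximalSpectrum (𝓞 K)) : (placeNorm 𝔭 : ℝ) = normV (toPlace 𝔭) := rfl

theorem one_lt_placeNorm (𝔭 : MaximalSpectrum (𝓞 K)) : 1 < placeNorm 𝔭 := by
  have := one_lt_normV (toPlace 𝔭)
  rw [← placeNorm_eq] at this
  exact_mod_cast this

omit [NumberField K] in
theorem mem_formModule {f : MvPolynomial (Fin (n + 1)) K}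
    {Q : MvPolynomial (Fin (n + 1)) (𝓞 K)} :
    Q ∈ formModule f ↔ ∃ a, intMap Q = MvPolynomial.C a * f := by
  have h : (MvPolynomial.mapAlgHom (Algebra.ofId (𝓞 K) K)).toLinearMap Q = intMap Q := rfl
  rw [formModule, Submodule.mem_comap, h, Submodule.restrictScalars_mem,
    Submodule.mem_span_singleton]
  exact exists_congr fun a => by rw [MvPolynomial.smul_eq_C_mul, eq_comm]

/-- The primitive reduction of `f` modulo a maximal ideal. -/
def redAt (𝔭 : MaximalSpectrum (𝓞 K)) (f : MvPolynomial (Fin (n + 1)) K) :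
    MvPolynomial (Fin (n + 1)) (𝓞 K ⧸ 𝔭.asIdeal) :=
  red (toPlace 𝔭) f

/-- The reduction of `K f ∩ 𝓞 K[T₀, …, Tₙ]` is the line spanned by the primitive reduction of
`f`. -/
theorem reductionMod_formModule (f : MvPolynomial (Fin (n + 1)) K) (𝔭 : MaximalSpectrum (𝓞 K)) :
    reductionMod (formModule f) 𝔭
      = Submodule.span (𝓞 K ⧸ 𝔭.asIdeal) {redAt 𝔭 f} := by
  refine le_antisymm (Submodule.span_le.2 ?_) (Submodule.span_le.2 ?_)
  · rintro _ ⟨Q, hQ, rfl⟩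
    obtain ⟨a, ha⟩ := mem_formModule.1 hQ
    obtain ⟨c, hc⟩ : ∃ c : 𝓞 K ⧸ 𝔭.asIdeal, MvPolynomial.map (Ideal.Quotient.mk 𝔭.asIdeal) Q
        = MvPolynomial.C c * redAt 𝔭 f := exists_redMap_eq (toPlace 𝔭) ha
    refine Submodule.mem_span_singleton.2 ⟨c, ?_⟩
    rw [MvPolynomial.smul_eq_C_mul]
    exact hc.symm
  · rw [Set.singleton_subset_iff]
    exact Submodule.subset_span ⟨primLift (toPlace 𝔭) f,
      mem_formModule.2 ⟨_, intMap_primLift (toPlace 𝔭) f⟩, rfl⟩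

theorem mem_squareFactorPlaces {f : MvPolynomial (Fin (n + 1)) K} (𝔭 : MaximalSpectrum (𝓞 K)) :
    𝔭 ∈ squareFactorPlaces (formModule f) ↔ ¬ Squarefree (redAt 𝔭 f) := by
  constructor
  · rintro ⟨g, hg, hsq⟩ h
    rw [reductionMod_formModule] at hg
    have hmem : redAt 𝔭 f ∈ Submodule.span (𝓞 K ⧸ 𝔭.asIdeal) {g} :=
      hg ▸ Submodule.mem_span_singleton_self _
    have hmem' : g ∈ Submodule.span (𝓞 K ⧸ 𝔭.asIdeal) {redAt 𝔭 f} :=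
      hg ▸ Submodule.mem_span_singleton_self _
    obtain ⟨c, hc⟩ := Submodule.mem_span_singleton.1 hmem'
    refine hsq (h.squarefree_of_dvd ?_)
    obtain ⟨c', hc'⟩ := Submodule.mem_span_singleton.1 hmem
    rw [MvPolynomial.smul_eq_C_mul] at hc'
    exact ⟨MvPolynomial.C c', by rw [← hc', mul_comm]⟩
  · exact fun h => ⟨_, reductionMod_formModule f 𝔭, h⟩

/-- The logarithmic bound for finite sets of places with a square factor. -/
theorem sum_log_placeNorm_le (hδ : 1 ≤ δ) {f : MvPolynomial (Fin (n + 1)) K} (hf0 : f ≠ 0)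
    (hf : f.IsHomogeneous δ) (hsq : Squarefree f) (T : Finset (MaximalSpectrum (𝓞 K)))
    (hT : ∀ 𝔭 ∈ T, 𝔭 ∈ squareFactorPlaces (formModule f)) :
    ∑ 𝔭 ∈ T, Real.log (placeNorm 𝔭)
      ≤ (2 * δ - 1) * (Height.logHeight (fun d : f.support => f.coeff d)
          + Module.finrank ℚ K * Real.log ((δ + n).choose n) / 2)
        + Module.finrank ℚ K * (δ * Real.log δ) := by
  classical
  let : NormalizationMonoid (MvPolynomial (Fin (n + 1)) K) :=
    (UniqueFactorizationMonoid.strongNormalizationMonoid).toNormalizationMonoid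
  have hdeg : f.totalDegree = δ := hf.totalDegree hf0
  have hC := card_support_le_choose hf
  have hκ : Fintype.card (K →+* ℂ) = Module.finrank ℚ K := NumberField.Embeddings.card K ℂ
  have hh := Height.logHeight_nonneg (fun d : f.support => f.coeff d)
  have h1 := hgt_le_logHeight hf0 hC
  have h2 := hgtL_le_logHeight hf0 hC
  rw [hκ] at h1 h2
  have main := sum_log_normV_le hf0 hsq (hdeg ▸ hδ) h1 (by linarith)
    (T.map ⟨toPlace, toPlace_injective⟩) (by
      intro v hv
      obtain ⟨𝔭, h𝔭, rfl⟩ := Finset.mem_map.1 hv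
      have h : ¬ Squarefree (red (toPlace 𝔭) f) := (mem_squareFactorPlaces 𝔭).1 (hT 𝔭 h𝔭)
      rw [squarefree_iff_irreducible_sq_not_dvd_of_ne_zero (red_ne_zero _ hf0)] at h
      push Not at h
      obtain ⟨g, hg, hg2⟩ := h
      exact ⟨g, hg, by rw [pow_two]; exact hg2⟩)
  rw [Finset.sum_map, hdeg, hκ] at main
  exact main

/-- Each place contributes at least `log 2` to a bounded sum. -/
theorem finite_squareFactorPlaces (hδ : 1 ≤ δ) {f : MvPolynomial (Fin (n + 1)) K} (hf0 : f ≠ 0)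
    (hf : f.IsHomogeneous δ) (hsq : Squarefree f) :
    (squareFactorPlaces (formModule f)).Finite := by
  by_contra hinf
  set B := (2 * δ - 1 : ℝ) * (Height.logHeight (fun d : f.support => f.coeff d)
          + Module.finrank ℚ K * Real.log ((δ + n).choose n) / 2)
        + Module.finrank ℚ K * (δ * Real.log δ) with hB
  obtain ⟨N, hN⟩ := exists_nat_gt (B / Real.log 2)
  have hlog2 : 0 < Real.log 2 := Real.log_pos one_lt_two
  obtain ⟨T, hT, hcard⟩ := Set.Infinite.exists_subset_card_eq hinf N
  have h := sum_log_placeNorm_le hδ hf0 hf hsq T fun 𝔭 h𝔭 => hT h𝔭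
  have h' : T.card * Real.log 2 ≤ ∑ 𝔭 ∈ T, Real.log (placeNorm 𝔭) := by
    rw [← nsmul_eq_mul]
    refine Finset.card_nsmul_le_sum _ _ _ fun 𝔭 _ => Real.log_le_log two_pos ?_
    exact_mod_cast one_lt_placeNorm 𝔭
  rw [hcard] at h'
  rw [div_lt_iff₀ hlog2] at hN
  linarith

theorem finprod_placeNorm_le (hδ : 1 ≤ δ) {f : MvPolynomial (Fin (n + 1)) K} (hf0 : f ≠ 0)
    (hf : f.IsHomogeneous δ) (hsq : Squarefree f) :
    ((∏ᶠ 𝔭 ∈ squareFactorPlaces (formModule f), placeNorm 𝔭 : ℕ) : ℝ)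
      ≤ ((δ + n).choose n : ℝ) ^ (((2 * δ - 1) * Module.finrank ℚ K : ℝ) / 2) *
        (δ : ℝ) ^ (Module.finrank ℚ K * δ) * expHeight f ^ (2 * δ - 1) := by
  have hfin := finite_squareFactorPlaces hδ hf0 hf hsq
  have hκ : (Module.finrank ℚ K : ℝ) ≠ 0 := by
    exact_mod_cast (Module.finrank_pos (R := ℚ) (M := K)).ne'
  have hC : (0 : ℝ) < (δ + n).choose n := by
    exact_mod_cast Nat.choose_pos (Nat.le_add_left n δ)
  have hδ0 : (0 : ℝ) < δ := by exact_mod_cast hδ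
  have h := sum_log_placeNorm_le hδ hf0 hf hsq hfin.toFinset fun 𝔭 h𝔭 => hfin.mem_toFinset.1 h𝔭
  have hpos : ∀ 𝔭 : MaximalSpectrum (𝓞 K), (0 : ℝ) < placeNorm 𝔭 := fun 𝔭 => by
    exact_mod_cast (zero_lt_one.trans (one_lt_placeNorm 𝔭))
  rw [finprod_mem_eq_finite_toFinset_prod _ hfin, Nat.cast_prod,
    ← Real.exp_log (Finset.prod_pos fun 𝔭 _ => hpos 𝔭), Real.log_prod fun 𝔭 _ => (hpos 𝔭).ne']
  refine (Real.exp_le_exp.2 h).trans_eq ?_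
  have hexp : expHeight f = Real.exp (Height.logHeight (fun d : f.support => f.coeff d)) := by
    rw [expHeight, classicalHeight, mul_div_cancel₀ _ hκ]
  have hcast : ((2 * δ - 1 : ℕ) : ℝ) = 2 * δ - 1 := by
    rw [Nat.cast_sub (by omega)]; push_cast; ring
  rw [hexp, ← Real.exp_nat_mul, hcast, Real.rpow_def_of_pos hC,
    show (δ : ℝ) ^ (Module.finrank ℚ K * δ)
      = Real.exp ((Module.finrank ℚ K * δ : ℕ) * Real.log δ) by
        rw [Real.exp_nat_mul, Real.exp_log hδ0], ← Real.exp_add, ← Real.exp_add]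
  congr 1
  push_cast
  ring

end SquareFactor

/-! ### Degree zero localizations of the coordinate rings -/

section AwayQuotient

open HomogeneousLocalization

attribute [local instance] MvPolynomial.gradedAlgebra

theorem awayMk_eq_zero_iff {A τ : Type*} [CommRing A] [SetLike τ A] [AddSubgroupClass τ A]
    (𝒜 : ℕ → τ) [GradedRing 𝒜] {s : A} {d : ℕ} (hs : s ∈ 𝒜 d) (m : ℕ) (a : A)
    (ha : a ∈ 𝒜 (m • d)) : Away.mk 𝒜 hs m a ha = 0 ↔ ∃ N, s ^ N * a = 0 := by
  rw [← (val_injective _).eq_iff, Away.val_mk, val_zero, Localization.mk_eq_mk',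
    IsLocalization.mk'_eq_zero_iff]
  constructor
  · rintro ⟨⟨_, N, rfl⟩, h⟩
    exact ⟨N, h⟩
  · rintro ⟨N, h⟩
    exact ⟨⟨s ^ N, N, rfl⟩, h⟩

theorem awayMk_pow {A τ : Type*} [CommRing A] [SetLike τ A] [AddSubgroupClass τ A]
    (𝒜 : ℕ → τ) [GradedRing 𝒜] {s : A} {d : ℕ} (hs : s ∈ 𝒜 d) (m : ℕ) (a : A)
    (ha : a ∈ 𝒜 (m • d)) (r : ℕ) : Away.mk 𝒜 hs m a ha ^ r
      = Away.mk 𝒜 hs (r * m) (a ^ r)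
        (by rw [mul_smul]; exact SetLike.pow_mem_graded r ha) := by
  apply val_injective
  rw [val_pow, Away.val_mk, Away.val_mk, Localization.mk_pow]
  congr 1
  exact Subtype.ext (by rw [SubmonoidClass.coe_pow, ← pow_mul, mul_comm])

variable {n δ : ℕ} {K : Type u} [Field K]

/-- The homomorphism of graded rings `R[T₀, …, Tₙ] → K[T₀, …, Tₙ] / (f)`. -/
def toQuot (R : Type u) [CommRing R] [Algebra R K] (f : MvPolynomial (Fin (n + 1)) K)
    (hf : f.IsHomogeneous δ) :
    GradedRingHom (polyGrading n R) (quotGrading (formIdeal f hf)) :=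
  (quotGradedHom (formIdeal f hf)).comp (polyBaseChange n R K)

theorem quotGradedHom_eq_zero_iff {f : MvPolynomial (Fin (n + 1)) K} (hf : f.IsHomogeneous δ)
    (a : MvPolynomial (Fin (n + 1)) K) : quotGradedHom (formIdeal f hf) a = 0 ↔ f ∣ a := by
  change Ideal.Quotient.mk (formIdeal f hf).toIdeal a = 0 ↔ _
  rw [Ideal.Quotient.eq_zero_iff_mem]
  exact Ideal.mem_span_singleton

/-- The kernel of a localization of `K[T₀, …, Tₙ] → K[T₀, …, Tₙ] / (f)`. -/
theorem awayMk_quot_eq_zero_iff {f : MvPolynomial (Fin (n + 1)) K} (hf : f.IsHomogeneous δ)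
    {s : MvPolynomial (Fin (n + 1)) K} {d : ℕ}
    (hs : quotGradedHom (formIdeal f hf) s ∈ quotGrading (formIdeal f hf) d)
    (m : ℕ) (a : MvPolynomial (Fin (n + 1)) K)
    (ha : quotGradedHom (formIdeal f hf) a ∈ quotGrading (formIdeal f hf) (m • d)) :
    Away.mk (quotGrading (formIdeal f hf)) hs m (quotGradedHom (formIdeal f hf) a) ha = 0
      ↔ ∃ N, f ∣ s ^ N * a := by
  rw [awayMk_eq_zero_iff]
  refine exists_congr fun N => ?_
  rw [← map_pow, ← map_mul, quotGradedHom_eq_zero_iff]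

theorem away_map_toQuot_eq_zero_iff {R : Type u} [CommRing R] [Algebra R K]
    {f : MvPolynomial (Fin (n + 1)) K} (hf : f.IsHomogeneous δ)
    {s : MvPolynomial (Fin (n + 1)) R} {d : ℕ} (hs : s ∈ polyGrading n R d)
    (m : ℕ) (a : MvPolynomial (Fin (n + 1)) R) (ha : a ∈ polyGrading n R (m • d)) :
    Away.map (toQuot R f hf) s (Away.mk (polyGrading n R) hs m a ha) = 0
      ↔ ∃ N, f ∣ MvPolynomial.map (algebraMap R K) (s ^ N * a) := by
  rw [Away.map_mk]
  refine (awayMk_eq_zero_iff _ _ _ _ _).trans (exists_congr fun N => ?_)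
  rw [← map_pow, ← map_mul]
  exact quotGradedHom_eq_zero_iff hf (MvPolynomial.map (algebraMap R K) (s ^ N * a))

/-- The coefficient ring `R` in the degree zero localization of `R[T₀, …, Tₙ]` at `s`. -/
def coeffHom {R : Type u} [CommRing R] (s : MvPolynomial (Fin (n + 1)) R) :
    R →+* Away (polyGrading n R) s :=
  (fromZeroRingHom (polyGrading n R) (Submonoid.powers s)).comp
    (algebraMap R (polyGrading n R 0))

theorem val_coeffHom {R : Type u} [CommRing R] (s : MvPolynomial (Fin (n + 1)) R) (r : R) :
    (coeffHom s r).val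
      = algebraMap (MvPolynomial (Fin (n + 1)) R) (Localization (Submonoid.powers s))
        (MvPolynomial.C r) := by
  rw [← Localization.mk_one_eq_algebraMap]
  rfl

theorem val_awayMk {R : Type u} [CommRing R] {s : MvPolynomial (Fin (n + 1)) R} {d : ℕ}
    (hs : s ∈ polyGrading n R d) (m : ℕ) (a : MvPolynomial (Fin (n + 1)) R)
    (ha : a ∈ polyGrading n R (m • d)) :
    (Away.mk (polyGrading n R) hs m a ha).val
      = algebraMap (MvPolynomial (Fin (n + 1)) R) (Localization (Submonoid.powers s)) a
        * Localization.mk 1 (⟨s ^ m, m, rfl⟩ : Submonoid.powers s) := by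
  rw [Away.val_mk, ← Localization.mk_one_eq_algebraMap, Localization.mk_mul, mul_one, one_mul]

/-- A fraction whose numerator has all its coefficients in the ideal `𝔭` lies in the extension
of `𝔭`. -/
theorem awayMk_mem_map {R : Type u} [CommRing R] {𝔭 : Ideal R}
    {s : MvPolynomial (Fin (n + 1)) R} (hs : s ∈ polyGrading n R 1) (m : ℕ)
    (w : MvPolynomial (Fin (n + 1)) R) (hw : w ∈ polyGrading n R (m • 1))
    (hcoeff : ∀ d, w.coeff d ∈ 𝔭) :
    Away.mk (polyGrading n R) hs m w hw ∈ 𝔭.map (coeffHom s) := by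
  have hd : ∀ d ∈ w.support,
      MvPolynomial.monomial d (1 : R) ∈ polyGrading n R (m • 1) := fun d hd => by
    refine MvPolynomial.isHomogeneous_monomial _ ?_
    rw [Finsupp.degree_eq_weight_one (R := ℕ)]
    exact hw (MvPolynomial.mem_support_iff.1 hd)
  have h : Away.mk (polyGrading n R) hs m w hw = ∑ d ∈ w.support.attach,
      coeffHom s (w.coeff d) * Away.mk (polyGrading n R) hs m _ (hd d d.2) := by
    apply val_injective
    rw [← HomogeneousLocalization.algebraMap_apply, ← HomogeneousLocalization.algebraMap_apply,
      map_sum]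
    simp only [map_mul, HomogeneousLocalization.algebraMap_apply, val_coeffHom, val_awayMk]
    simp only [← mul_assoc, ← map_mul]
    rw [← Finset.sum_mul, ← map_sum]
    congr 2
    simp only [MvPolynomial.C_mul_monomial, mul_one]
    rw [Finset.sum_attach w.support fun d => MvPolynomial.monomial d (w.coeff d)]
    exact w.as_sum
  rw [h]
  exact Ideal.sum_mem _ fun d _ => Ideal.mul_mem_right _ _ (Ideal.mem_map_of_mem _ (hcoeff d))

theorem homogeneousComponent_mul_of_mem {R : Type u} [CommRing R] {a : ℕ}
    {p : MvPolynomial (Fin (n + 1)) R} (hp : p ∈ polyGrading n R a)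
    (q : MvPolynomial (Fin (n + 1)) R) (b : ℕ) :
    MvPolynomial.homogeneousComponent (a + b) (p * q)
      = p * MvPolynomial.homogeneousComponent b q := by
  rw [← MvPolynomial.decomposition.decompose'_apply, ← MvPolynomial.decomposition.decompose'_apply]
  exact DirectSum.coe_decompose_mul_add_of_left_mem (polyGrading n R) (b := q) (j := b) hp

variable {k : Type u} [Field k] {R : Type u} [CommRing R] [Algebra R K] [Algebra R k]
  {f : MvPolynomial (Fin (n + 1)) K} {f' : MvPolynomial (Fin (n + 1)) k}

/-- Fractions that vanish on the closure of the hypersurface, or are divisible by the ideal of the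
residue field `k`, vanish on the reduced hypersurface `f' = 0` over `k`. -/
theorem ker_sup_map_le (hf : f.IsHomogeneous δ) (hf' : f'.IsHomogeneous δ) {𝔭 : Ideal R}
    (h𝔭 : ∀ r ∈ 𝔭, algebraMap R k r = 0)
    (hG : ∀ b : MvPolynomial (Fin (n + 1)) R, f ∣ MvPolynomial.map (algebraMap R K) b →
      f' ∣ MvPolynomial.map (algebraMap R k) b)
    {s : MvPolynomial (Fin (n + 1)) R} (hs : s ∈ polyGrading n R 1) :
    RingHom.ker (Away.map (toQuot R f hf) s) ⊔ 𝔭.map (coeffHom s)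
      ≤ RingHom.ker (Away.map (toQuot R f' hf') s) := by
  refine sup_le (fun x hx => ?_) (Ideal.map_le_iff_le_comap.2 fun r hr => ?_)
  · obtain ⟨m, a, ha, rfl⟩ := Away.mk_surjective _ hs x
    obtain ⟨N, hN⟩ := (away_map_toQuot_eq_zero_iff hf hs m a ha).1 hx
    exact (away_map_toQuot_eq_zero_iff hf' hs m a ha).2 ⟨N, hG _ hN⟩
  · have hC : MvPolynomial.C r ∈ polyGrading n R (0 • 1) := MvPolynomial.isHomogeneous_C _ _
    have h : coeffHom s r = Away.mk (polyGrading n R) hs 0 (MvPolynomial.C r) hC := by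
      apply val_injective
      rw [val_coeffHom, Away.val_mk, ← Localization.mk_one_eq_algebraMap]
      congr 1
    rw [Ideal.mem_comap, RingHom.mem_ker, h, away_map_toQuot_eq_zero_iff]
    refine ⟨0, ?_⟩
    rw [pow_zero, one_mul, MvPolynomial.map_C, h𝔭 r hr, map_zero]
    exact dvd_zero _

/-- Conversely, a fraction that vanishes on `f' = 0` is a multiple of the integral equation `F` up to
a fraction with coefficients in `𝔭`: lift the cofactor of `f'`. -/
theorem awayMk_mem_ker_sup_map (hf : f.IsHomogeneous δ) {𝔭 : Ideal R}
    (hsurj : Function.Surjective (algebraMap R k)) (h𝔭 : ∀ r, algebraMap R k r = 0 → r ∈ 𝔭)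
    {F : MvPolynomial (Fin (n + 1)) R} (hF : F ∈ polyGrading n R δ)
    (hFK : f ∣ MvPolynomial.map (algebraMap R K) F)
    (hFk : MvPolynomial.map (algebraMap R k) F = f')
    {s : MvPolynomial (Fin (n + 1)) R} (hs : s ∈ polyGrading n R 1)
    (m : ℕ) (a : MvPolynomial (Fin (n + 1)) R) (ha : a ∈ polyGrading n R (m • 1)) {N : ℕ}
    (h : f' ∣ MvPolynomial.map (algebraMap R k) (s ^ N * a)) :
    Away.mk (polyGrading n R) hs m a ha
      ∈ RingHom.ker (Away.map (toQuot R f hf) s) ⊔ 𝔭.map (coeffHom s) := by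
  -- The exponent is raised by `δ`, so that the cofactor has nonnegative degree `N + m`.
  obtain ⟨q, hq⟩ : f' ∣ MvPolynomial.map (algebraMap R k) (s ^ (N + δ) * a) := by
    rw [pow_add, mul_right_comm, map_mul _ (s ^ N * a)]
    exact h.mul_right _
  obtain ⟨b, rfl⟩ := MvPolynomial.map_surjective _ hsurj q
  set M := δ + (N + m)
  have hm : m • 1 = m := by simp
  have hM : M • 1 = M := by simp
  rw [hm] at ha
  set c : MvPolynomial (Fin (n + 1)) R := MvPolynomial.homogeneousComponent (N + m) b
  have hc : c ∈ polyGrading n R (N + m) := MvPolynomial.homogeneousComponent_isHomogeneous _ _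
  have hsa : s ^ (N + δ) * a ∈ polyGrading n R M := by
    have h1 := SetLike.mul_mem_graded (SetLike.pow_mem_graded (N + δ) hs) ha
    have h2 : (N + δ) • 1 + m = M := by simp [M]; ring
    rwa [h2] at h1
  have hFc : F * c ∈ polyGrading n R M := SetLike.mul_mem_graded hF hc
  set w := s ^ (N + δ) * a - F * c
  have hw : w ∈ polyGrading n R M := Submodule.sub_mem _ hsa hFc
  have hwc : w = MvPolynomial.homogeneousComponent M (s ^ (N + δ) * a - F * b) := by
    have h1 : MvPolynomial.homogeneousComponent M (F * b) = F * c :=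
      homogeneousComponent_mul_of_mem hF b (N + m)
    rw [map_sub, h1, MvPolynomial.homogeneousComponent_of_mem hsa, if_pos rfl]
  have hcoeff : ∀ d, w.coeff d ∈ 𝔭 := fun d => by
    apply h𝔭
    have h1 : MvPolynomial.map (algebraMap R k) (s ^ (N + δ) * a - F * b) = 0 := by
      rw [map_sub, hq, map_mul, hFk, sub_self]
    rw [hwc, MvPolynomial.coeff_homogeneousComponent]
    split_ifs
    · rw [← MvPolynomial.coeff_map, h1, MvPolynomial.coeff_zero]
    · exact map_zero _
  have hsum : Away.mk (polyGrading n R) hs m a (hm.symm ▸ ha)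
      = Away.mk (polyGrading n R) hs M (F * c) (hM.symm ▸ hFc)
        + Away.mk (polyGrading n R) hs M w (hM.symm ▸ hw) := by
    apply val_injective
    rw [val_add, Away.val_mk, Away.val_mk, Away.val_mk, Localization.add_mk_self,
      Localization.mk_eq_mk_iff, Localization.r_iff_exists]
    refine ⟨1, ?_⟩
    simp only [OneMemClass.coe_one, one_mul, w, M]
    ring
  rw [hsum]
  refine add_mem (Ideal.mem_sup_left ?_) (Ideal.mem_sup_right (awayMk_mem_map hs M w _ hcoeff))
  rw [RingHom.mem_ker, away_map_toQuot_eq_zero_iff]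
  exact ⟨0, by rw [pow_zero, one_mul, map_mul]; exact hFK.mul_right _⟩

/-- The affine charts of the special fibre of the closure are reduced when the reduction `f'` of
the equation is squarefree: `f'` divides a power of a polynomial only if it divides that
polynomial. -/
theorem isRadical_ker_sup_map (hf : f.IsHomogeneous δ) (hf' : f'.IsHomogeneous δ)
    (hsq : Squarefree f') {𝔭 : Ideal R} (hsurj : Function.Surjective (algebraMap R k))
    (h𝔭 : ∀ r, algebraMap R k r = 0 ↔ r ∈ 𝔭)
    (hG : ∀ b : MvPolynomial (Fin (n + 1)) R, f ∣ MvPolynomial.map (algebraMap R K) b →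
      f' ∣ MvPolynomial.map (algebraMap R k) b)
    {F : MvPolynomial (Fin (n + 1)) R} (hF : F ∈ polyGrading n R δ)
    (hFK : f ∣ MvPolynomial.map (algebraMap R K) F)
    (hFk : MvPolynomial.map (algebraMap R k) F = f')
    {s : MvPolynomial (Fin (n + 1)) R} (hs : s ∈ polyGrading n R 1) :
    (RingHom.ker (Away.map (toQuot R f hf) s) ⊔ 𝔭.map (coeffHom s)).IsRadical := by
  rintro x ⟨r, hr⟩
  obtain ⟨m, a, ha, rfl⟩ := Away.mk_surjective _ hs x
  have h1 := ker_sup_map_le hf hf' (fun r hr => (h𝔭 r).2 hr) hG hs hr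
  rw [awayMk_pow, RingHom.mem_ker, away_map_toQuot_eq_zero_iff] at h1
  obtain ⟨N, hN⟩ := h1
  refine awayMk_mem_ker_sup_map hf hsurj (fun r hr => (h𝔭 r).1 hr) hF hFK hFk hs m a ha (N := N) ?_
  rcases r.eq_zero_or_pos with rfl | hr0
  · rw [pow_zero, mul_one] at hN
    rw [map_mul]
    exact hN.mul_right _
  · rw [← hsq.dvd_pow_iff_dvd hr0.ne', ← map_pow]
    refine hN.trans (map_dvd _ ?_)
    rw [mul_pow]
    exact mul_dvd_mul (dvd_pow_self _ hr0.ne') dvd_rfl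

end AwayQuotient

/-! ### A reduced hypersurface has a squarefree equation -/

section ReducedSquarefree

open HomogeneousLocalization

attribute [local instance] MvPolynomial.gradedAlgebra

variable {n δ : ℕ} {K : Type u} [Field K]

/-- The top degree component of a product is the product of the top degree components. -/
theorem homogeneousComponent_add_mul {p q : MvPolynomial (Fin (n + 1)) K} {a b : ℕ}
    (hp : p.totalDegree ≤ a) (hq : q.totalDegree ≤ b) :
    MvPolynomial.homogeneousComponent (a + b) (p * q)
      = MvPolynomial.homogeneousComponent a p * MvPolynomial.homogeneousComponent b q := by
  set r := p - MvPolynomial.homogeneousComponent a p with hr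
  have hpr : p = MvPolynomial.homogeneousComponent a p + r := by rw [hr]; ring
  have hmem : MvPolynomial.homogeneousComponent a p ∈ polyGrading n K a :=
    MvPolynomial.homogeneousComponent_isHomogeneous _ _
  have h1 : MvPolynomial.homogeneousComponent (a + b)
      (MvPolynomial.homogeneousComponent a p * q)
      = MvPolynomial.homogeneousComponent a p * MvPolynomial.homogeneousComponent b q :=
    homogeneousComponent_mul_of_mem hmem q b
  have h2 : MvPolynomial.homogeneousComponent (a + b) (r * q) = 0 := by
    by_cases hr0 : r = 0
    · rw [hr0, zero_mul, map_zero]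
    have hdeg : ∀ d ∈ r.support, d.degree < a := fun d hd => by
      have hne := MvPolynomial.mem_support_iff.1 hd
      rw [hr, MvPolynomial.coeff_sub, MvPolynomial.coeff_homogeneousComponent] at hne
      have hda : d.degree ≠ a := fun h => hne (by rw [if_pos h, sub_self])
      rw [if_neg hda, sub_zero] at hne
      refine lt_of_le_of_ne (le_trans ?_ hp) hda
      exact MvPolynomial.le_totalDegree (MvPolynomial.mem_support_iff.2 hne)
    have ha : 0 < a := by
      obtain ⟨d, hd⟩ := MvPolynomial.support_nonempty.2 hr0
      exact (Nat.zero_le _).trans_lt (hdeg d hd)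
    have hlt : r.totalDegree < a := (Finset.sup_lt_iff ha).2 fun d hd => hdeg d hd
    refine MvPolynomial.homogeneousComponent_eq_zero _ _ ?_
    exact (MvPolynomial.totalDegree_mul _ _).trans_lt (by omega)
  conv_lhs => rw [hpr, add_mul, map_add, h1, h2, add_zero]

/-- If the coordinate rings of the affine charts of `f = 0` are reduced, then `f` is squarefree:
for a form `g` with `f = g² h`, reducedness of the chart `Tᵢ ≠ 0` shows that `g` divides a power
of `Tᵢ`, and a nonconstant `g` cannot do so for two different variables. -/
theorem squarefree_of_isReduced_away (hn : 1 ≤ n) {f : MvPolynomial (Fin (n + 1)) K}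
    (hf0 : f ≠ 0) (hf : f.IsHomogeneous δ)
    (hred : ∀ i, _root_.IsReduced (Away (quotGrading (formIdeal f hf))
      (quotGradedHom (formIdeal f hf) (MvPolynomial.X i)))) : Squarefree f := by
  rintro g ⟨h, hgh⟩
  have hg0 : g ≠ 0 := fun h0 => hf0 (by rw [hgh, h0]; ring)
  have hh0 : h ≠ 0 := fun h0 => hf0 (by rw [hgh, h0]; ring)
  set a := g.totalDegree with ha
  set c := h.totalDegree
  set G := MvPolynomial.homogeneousComponent a g
  set H := MvPolynomial.homogeneousComponent c h
  have hdeg : δ = a + (a + c) := by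
    rw [← hf.totalDegree hf0, hgh, MvPolynomial.totalDegree_mul_of_isDomain (mul_ne_zero hg0 hg0)
      hh0, MvPolynomial.totalDegree_mul_of_isDomain hg0 hg0, add_assoc]
  have hfG : f = G * (G * H) := by
    have h1 := homogeneousComponent_add_mul (p := g) (q := g * h) (a := a) (b := a + c) le_rfl
      (MvPolynomial.totalDegree_mul _ _)
    rw [homogeneousComponent_add_mul le_rfl le_rfl, ← mul_assoc g, ← hgh, ← hdeg,
      MvPolynomial.homogeneousComponent_of_mem hf, if_pos rfl] at h1
    exact h1
  have hG : G.IsHomogeneous a := MvPolynomial.homogeneousComponent_isHomogeneous _ _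
  have hH : H.IsHomogeneous c := MvPolynomial.homogeneousComponent_isHomogeneous _ _
  have hGH0 : G * H ≠ 0 := fun h0 => hf0 (by rw [hfG, h0, mul_zero])
  have hG0 : G ≠ 0 := left_ne_zero_of_mul hGH0
  have hdvd : ∀ i, ∃ N, G ∣ (MvPolynomial.X i : MvPolynomial (Fin (n + 1)) K) ^ N := fun i => by
    have hX : quotGradedHom (formIdeal f hf) (MvPolynomial.X i) ∈ quotGrading (formIdeal f hf) 1 :=
      mk_mem_quotGrading (formIdeal f hf) (MvPolynomial.isHomogeneous_X K i)
    have hGHm : quotGradedHom (formIdeal f hf) (G * H)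
        ∈ quotGrading (formIdeal f hf) ((a + c) • 1) :=
      mk_mem_quotGrading (formIdeal f hf) (by
        rw [smul_eq_mul, mul_one]; exact hG.mul hH)
    have h2 : Away.mk (quotGrading (formIdeal f hf)) hX (a + c)
        (quotGradedHom (formIdeal f hf) (G * H)) hGHm ^ 2 = 0 := by
      rw [awayMk_pow, awayMk_eq_zero_iff]
      refine ⟨0, ?_⟩
      rw [pow_zero, one_mul, ← map_pow, quotGradedHom_eq_zero_iff]
      exact ⟨H, by rw [hfG]; ring⟩
    have h3 := (hred i).eq_zero _ ⟨2, h2⟩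
    obtain ⟨N, q, hN⟩ := (awayMk_quot_eq_zero_iff hf hX _ _ hGHm).1 h3
    refine ⟨N, q, mul_right_cancel₀ hGH0 ?_⟩
    rw [hN, hfG]
    ring
  have hGu : IsUnit G := by
    by_contra hGu
    obtain ⟨p, hp, hpG⟩ := WfDvdMonoid.exists_irreducible_factor hGu hG0
    have hpX : ∀ i, p ∣ (MvPolynomial.X i : MvPolynomial (Fin (n + 1)) K) := fun i => by
      obtain ⟨N, hN⟩ := hdvd i
      exact hp.prime.dvd_of_dvd_pow (hpG.trans hN)
    have h1 := hp.dvd_symm (MvPolynomial.X_prime (i := (0 : Fin (n + 1)))).irreducible (hpX 0)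
    have h2 := MvPolynomial.X_dvd_X.1 (h1.trans (hpX (Fin.last n)))
    simp only [Fin.ext_iff, Fin.val_zero, Fin.val_last] at h2
    omega
  have ha0 : a = 0 := by
    rw [← hG.totalDegree hG0]
    exact (MvPolynomial.isUnit_iff_totalDegree_of_isReduced.1 hGu).2
  rw [(MvPolynomial.totalDegree_eq_zero_iff_eq_C (p := g)).1 (ha ▸ ha0)] at hg0 ⊢
  refine IsUnit.map MvPolynomial.C (isUnit_iff_ne_zero.2 fun h0 => hg0 (by rw [h0, map_zero]))

end ReducedSquarefree

/-! ### Affine charts of the closure and of its special fibres -/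

section Charts

open HomogeneousLocalization

attribute [local instance] MvPolynomial.gradedAlgebra

/-- The fibre of an affine scheme over a closed point is reduced when the extension of the ideal
of the point is radical. -/
theorem isReduced_pullback_SpecMap {O S : Type u} [CommRing O] [CommRing S] (θ : O →+* S)
    (𝔭 : Ideal O) (h : (𝔭.map θ).IsRadical) :
    AlgebraicGeometry.IsReduced (pullback (Spec.map (CommRingCat.ofHom θ))
      (Spec.map (CommRingCat.ofHom (Ideal.Quotient.mk 𝔭)))) := by
  algebraize [θ]
  have h1 : _root_.IsReduced (S ⧸ 𝔭.map (algebraMap O S)) :=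
    (Ideal.isRadical_iff_quotient_reduced _).1 h
  have h2 : _root_.IsReduced (TensorProduct O S (O ⧸ 𝔭)) :=
    isReduced_of_injective (Algebra.TensorProduct.quotIdealMapEquivTensorQuot S 𝔭).symm
      (Algebra.TensorProduct.quotIdealMapEquivTensorQuot S 𝔭).symm.injective
  have h3 : AlgebraicGeometry.IsReduced (Spec (.of (TensorProduct O S (O ⧸ 𝔭)))) :=
    (affine_isReduced_iff _).2 h2
  exact isReduced_of_isOpenImmersion (pullbackSpecIso O S (O ⧸ 𝔭)).hom

theorem isReduced_pullback_of_openCover {Y B B' : Scheme.{u}} (π : Y ⟶ B) (q : B' ⟶ B)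
    (𝒰 : Y.OpenCover) (h : ∀ i, AlgebraicGeometry.IsReduced (pullback (𝒰.f i ≫ π) q)) :
    AlgebraicGeometry.IsReduced (pullback π q) := by
  have (i : (𝒰.pullback₁ (pullback.fst π q)).I₀) :
      AlgebraicGeometry.IsReduced ((𝒰.pullback₁ (pullback.fst π q)).X i) := by
    have := h i
    let e : (𝒰.pullback₁ (pullback.fst π q)).X i ≅ pullback (𝒰.f i ≫ π) q :=
      pullbackSymmetry _ _ ≪≫ pullbackRightPullbackFstIso π q (𝒰.f i)
    exact isReduced_of_isOpenImmersion e.hom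
  exact IsReduced.of_openCover _ (𝒰.pullback₁ (pullback.fst π q))

/-- The cover of a scheme-theoretic image by the closed subschemes of the members of an affine
open cover of the target. -/
def imageCover {X P : Scheme.{u}} (g : X ⟶ P) {ι : Type u} (U : ι → P.affineOpens)
    (hU : ⨆ i, (U i).1 = ⊤) : g.image.AffineOpenCover where
  I₀ := ι
  X i := .of (Γ(P, (U i).1) ⧸ g.ker.ideal (U i))
  f i := g.ker.subschemeCover.f (U i)
  idx x := (TopologicalSpace.Opens.mem_iSup.1
    (hU.ge (TopologicalSpace.Opens.mem_top (g.imageι x)))).choose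
  covers x := by
    have h := (TopologicalSpace.Opens.mem_iSup.1
      (hU.ge (TopologicalSpace.Opens.mem_top (g.imageι x)))).choose_spec
    have h2 := (g.ker.opensRange_subschemeCover_map _).ge h
    exact h2
  map_prop i := g.ker.subschemeCover.map_prop (U i)

theorem imageCover_f {X P : Scheme.{u}} (g : X ⟶ P) {ι : Type u} (U : ι → P.affineOpens)
    (hU : ⨆ i, (U i).1 = ⊤) (i : ι) : (imageCover g U hU).f i ≫ g.imageι
      = Spec.map (CommRingCat.ofHom (Ideal.Quotient.mk (g.ker.ideal (U i))))
        ≫ (U i).2.fromSpec :=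
  (g.ker.subschemeCover_map_subschemeι (U i)).trans (g.ker.glueDataObjι_ι (U i))

/-- A fibre of a scheme-theoretic image is reduced if this holds on the members of an affine open
cover of the target. -/
theorem isReduced_pullback_image {O : Type u} [CommRing O] {X P : Scheme.{u}} (g : X ⟶ P)
    (str : P ⟶ Spec (.of O)) (𝔭 : Ideal O) {ι : Type u} (U : ι → P.affineOpens)
    (hU : ⨆ i, (U i).1 = ⊤) (θ : ∀ i, O →+* Γ(P, (U i).1))
    (hθ : ∀ i, (U i).2.fromSpec ≫ str = Spec.map (CommRingCat.ofHom (θ i)))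
    (h : ∀ i, (g.ker.ideal (U i) ⊔ 𝔭.map (θ i)).IsRadical) :
    AlgebraicGeometry.IsReduced (pullback (g.imageι ≫ str)
      (Spec.map (CommRingCat.ofHom (Ideal.Quotient.mk 𝔭)))) := by
  refine isReduced_pullback_of_openCover _ _ (imageCover g U hU).openCover fun i => ?_
  have h1 : (imageCover g U hU).openCover.f i ≫ g.imageι ≫ str
      = Spec.map (CommRingCat.ofHom ((Ideal.Quotient.mk (g.ker.ideal (U i))).comp (θ i))) := by
    have h2 := imageCover_f g U hU i
    rw [CommRingCat.ofHom_comp, Spec.map_comp, ← hθ i, ← Category.assoc, ← Category.assoc]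
    exact congrArg (· ≫ str) h2
  rw [h1]
  refine isReduced_pullback_SpecMap _ _ ?_
  rintro x ⟨r, hr⟩
  obtain ⟨a, rfl⟩ := Ideal.Quotient.mk_surjective x
  rw [← Ideal.map_map, ← map_pow, ← Ideal.mem_comap,
    Ideal.comap_map_of_surjective _ Ideal.Quotient.mk_surjective, ← RingHom.ker_eq_comap_bot,
    Ideal.mk_ker, sup_comm] at hr
  rw [← Ideal.map_map, ← Ideal.mem_comap,
    Ideal.comap_map_of_surjective _ Ideal.Quotient.mk_surjective, ← RingHom.ker_eq_comap_bot,
    Ideal.mk_ker, sup_comm]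
  exact h i ⟨r, hr⟩

theorem fromSpec_basicOpen {A τ : Type u} [CommRing A] [SetLike τ A] [AddSubgroupClass τ A]
    (𝒜 : ℕ → τ) [GradedRing 𝒜] {s : A} {d : ℕ} (hs : s ∈ 𝒜 d) (hd : 0 < d) :
    (Proj.isAffineOpen_basicOpen 𝒜 s hs hd).fromSpec
      = Spec.map (Proj.awayToSection 𝒜 s) ≫ Proj.awayι 𝒜 s hs hd := by
  rw [Proj.awayι, ← IsAffineOpen.isoSpec_inv_ι, ← Category.assoc]
  congr 1
  rw [Iso.eq_comp_inv, Proj.basicOpenIsoSpec_hom, Proj.basicOpenToSpec, Iso.inv_comp_eq,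
    IsAffineOpen.isoSpec_hom]

variable {n δ : ℕ}

theorem awayι_projSpaceStr (O : Type u) [CommRing O] {s : MvPolynomial (Fin (n + 1)) O}
    (hs : s ∈ polyGrading n O 1) :
    Proj.awayι (polyGrading n O) s hs one_pos ≫ projSpaceStr n O
      = Spec.map (CommRingCat.ofHom (coeffHom s)) := by
  have h := Proj.awayι_toSpecZero (polyGrading n O) s hs one_pos
  exact (Category.assoc _ _ _).symm.trans ((congrArg (· ≫ Spec.map (CommRingCat.ofHom
    (algebraMap O (polyGrading n O 0)))) h).trans (Spec.map_comp _ _).symm)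

theorem iSup_basicOpen_X (O : Type u) [CommRing O] :
    ⨆ i : Fin (n + 1), Proj.basicOpen (polyGrading n O) (MvPolynomial.X i) = ⊤ := by
  refine Proj.iSup_basicOpen_eq_top' _ _ (fun i => ⟨1, MvPolynomial.isHomogeneous_X O i⟩) ?_
  refine top_le_iff.1 fun p _ => ?_
  induction p using MvPolynomial.induction_on with
  | C r =>
    exact Subalgebra.algebraMap_mem (Algebra.adjoin (polyGrading n O 0) (Set.range MvPolynomial.X))
      (⟨MvPolynomial.C r, MvPolynomial.isHomogeneous_C _ _⟩ : polyGrading n O 0)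
  | add p q hp hq => exact add_mem (hp trivial) (hq trivial)
  | mul_X p i hp => exact mul_mem (hp trivial) (Algebra.subset_adjoin ⟨i, rfl⟩)

variable {A τ : Type u} [CommRing A] [SetLike τ A] [AddSubgroupClass τ A]
    {𝒜 : ℕ → τ} [GradedRing 𝒜] {B τ' : Type u} [CommRing B] [SetLike τ' B]
    [AddSubgroupClass τ' B] {ℬ : ℕ → τ'} [GradedRing ℬ]

theorem injective_awayToSection {s : A} {d : ℕ} (hs : s ∈ 𝒜 d) (hd : 0 < d) :
    Function.Injective (Proj.awayToSection 𝒜 s).hom :=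
  (Proj.basicOpenIsoAway 𝒜 s hs hd).commRingCatIsoToRingEquiv.injective

theorem surjective_awayToSection {s : A} {d : ℕ} (hs : s ∈ 𝒜 d) (hd : 0 < d) :
    Function.Surjective (Proj.awayToSection 𝒜 s).hom :=
  (Proj.basicOpenIsoAway 𝒜 s hs hd).commRingCatIsoToRingEquiv.surjective

/-- On the chart `s ≠ 0`, the kernel of `Proj ℬ → Proj 𝒜` on functions is the kernel of the map of
degree zero localizations. -/
theorem comap_ker_app (G : GradedRingHom 𝒜 ℬ)
    (hG : HomogeneousIdeal.irrelevant ℬ ≤ (HomogeneousIdeal.irrelevant 𝒜).map G)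
    {s : A} {d : ℕ} (hs : s ∈ 𝒜 d) (hd : 0 < d) :
    (RingHom.ker ((Proj.map G hG).app (Proj.basicOpen 𝒜 s)).hom).comap
      (Proj.awayToSection 𝒜 s).hom = RingHom.ker (Away.map G s) := by
  ext x
  have h := congrArg (fun φ => φ.hom x) (Proj.awayToSection_comp_appLE G hG hs)
  rw [Ideal.mem_comap, RingHom.mem_ker, RingHom.mem_ker, Scheme.Hom.app_eq_appLE]
  have hs' : G s ∈ ℬ d := G.map_mem hs
  rw [← map_eq_zero_iff (Proj.awayToSection ℬ (G s)).hom (injective_awayToSection hs' hd)]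
  exact Eq.congr_left h

theorem quasiCompact_proj_map (G : GradedRingHom 𝒜 ℬ)
    (hG : HomogeneousIdeal.irrelevant ℬ ≤ (HomogeneousIdeal.irrelevant 𝒜).map G)
    {ι : Type*} (s : ι → A) (hs : ∀ i, s i ∈ 𝒜 1)
    (hU : ⨆ i, Proj.basicOpen 𝒜 (s i) = ⊤) : QuasiCompact (Proj.map G hG) := by
  have : IsAffineHom (Proj.map G hG) := by
    refine isAffineHom_of_forall_exists_isAffineOpen _ fun x => ?_
    obtain ⟨i, hi⟩ := TopologicalSpace.Opens.mem_iSup.1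
      (hU.ge (TopologicalSpace.Opens.mem_top x))
    exact ⟨_, hi, Proj.isAffineOpen_basicOpen 𝒜 (s i) (hs i) one_pos,
      Proj.isAffineOpen_basicOpen ℬ (G (s i)) (G.map_mem (hs i)) one_pos⟩
  infer_instance

/-- The fibre over `𝔭` of the closure of `Proj ℬ` in projective space over `O` is reduced if this
holds on the standard charts. -/
theorem isReduced_fibre_closure {O : Type u} [CommRing O] (𝔭 : Ideal O)
    (G : GradedRingHom (polyGrading n O) ℬ)
    (hG : HomogeneousIdeal.irrelevant ℬ
      ≤ (HomogeneousIdeal.irrelevant (polyGrading n O)).map G)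
    (h : ∀ i, (RingHom.ker (Away.map G (MvPolynomial.X i))
      ⊔ 𝔭.map (coeffHom (MvPolynomial.X i))).IsRadical) :
    AlgebraicGeometry.IsReduced (pullback
      ((show Proj ℬ ⟶ projSpace n O from Proj.map G hG).imageι ≫ projSpaceStr n O)
      (Spec.map (CommRingCat.ofHom (Ideal.Quotient.mk 𝔭)))) := by
  have hX : ∀ i, MvPolynomial.X i ∈ polyGrading n O 1 := fun i =>
    MvPolynomial.isHomogeneous_X O i
  have hU : ⨆ i : ULift.{u} (Fin (n + 1)),
      Proj.basicOpen (polyGrading n O) (MvPolynomial.X i.down) = ⊤ := by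
    rw [← iSup_basicOpen_X O]
    exact Equiv.ulift.iSup_congr fun _ => rfl
  have hqc := quasiCompact_proj_map G hG _ hX (iSup_basicOpen_X O)
  refine isReduced_pullback_image (Proj.map G hG) (projSpaceStr n O) 𝔭
    (fun i : ULift.{u} (Fin (n + 1)) => ⟨Proj.basicOpen (polyGrading n O) (MvPolynomial.X i.down),
      Proj.isAffineOpen_basicOpen _ _ (hX i.down) one_pos⟩) hU
    (fun i => (Proj.awayToSection (polyGrading n O) (MvPolynomial.X i.down)).hom.comp
      (coeffHom (MvPolynomial.X i.down))) (fun i => ?_) (fun i => ?_)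
  · rw [CommRingCat.ofHom_comp, Spec.map_comp, ← awayι_projSpaceStr O (hX i.down)]
    exact (congrArg (· ≫ projSpaceStr n O) (fromSpec_basicOpen _ (hX i.down) one_pos)).trans
      (Category.assoc _ _ _)
  · have hsurj := surjective_awayToSection (𝒜 := polyGrading n O) (hX i.down) one_pos
    rw [Scheme.Hom.ker_apply]
    rintro x ⟨r, hr⟩
    obtain ⟨a, rfl⟩ := hsurj x
    have hcomap : ∀ b, (Proj.awayToSection (polyGrading n O) (MvPolynomial.X i.down)).hom b
        ∈ RingHom.ker ((Proj.map G hG).app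
            (Proj.basicOpen (polyGrading n O) (MvPolynomial.X i.down))).hom
          ⊔ 𝔭.map ((Proj.awayToSection (polyGrading n O) (MvPolynomial.X i.down)).hom.comp
            (coeffHom (MvPolynomial.X i.down)))
        ↔ b ∈ RingHom.ker (Away.map G (MvPolynomial.X i.down))
          ⊔ 𝔭.map (coeffHom (MvPolynomial.X i.down)) := fun b => by
      rw [← comap_ker_app G hG (hX i.down) one_pos, ← Ideal.map_map, ← Ideal.mem_comap,
        ← Ideal.map_comap_of_surjective _ hsurj (RingHom.ker _), ← Ideal.map_sup,
        Ideal.comap_map_of_surjective _ hsurj, ← RingHom.ker_eq_comap_bot,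
        (RingHom.injective_iff_ker_eq_bot _).1
          (injective_awayToSection (𝒜 := polyGrading n O) (hX i.down) one_pos), sup_bot_eq,
        Ideal.map_comap_of_surjective _ hsurj]
    refine (hcomap a).2 (h i.down ⟨r, (hcomap _).1 ?_⟩)
    rw [map_pow]
    exact hr

end Charts

/-! ### Reducedness of the hypersurface and of its special fibres -/

section Reducedness

open HomogeneousLocalization IsDedekindDomain

attribute [local instance] MvPolynomial.gradedAlgebra

variable {n δ : ℕ} {K : Type u} [Field K]

theorem squarefree_of_isReduced_hypersurface (hn : 1 ≤ n) {f : MvPolynomial (Fin (n + 1)) K}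
    (hf0 : f ≠ 0) (hf : f.IsHomogeneous δ)
    (hX : AlgebraicGeometry.IsReduced (hypersurface f hf)) : Squarefree f := by
  refine squarefree_of_isReduced_away hn hf0 hf fun i => ?_
  have hXi : quotGradedHom (formIdeal f hf) (MvPolynomial.X i) ∈ quotGrading (formIdeal f hf) 1 :=
    mk_mem_quotGrading (formIdeal f hf) (MvPolynomial.isHomogeneous_X K i)
  have h : _root_.IsReduced Γ(Proj (quotGrading (formIdeal f hf)),
      Proj.basicOpen _ (quotGradedHom (formIdeal f hf) (MvPolynomial.X i))) :=
    hX.component_reduced _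
  exact isReduced_of_injective _ (injective_awayToSection hXi one_pos)

variable [NumberField K]

/-- Gauss's lemma: a polynomial with integral coefficients that is divisible by `f` over `K`
reduces to a multiple of the primitive reduction of `f`. -/
theorem red_dvd_redMap (v : HeightOneSpectrum (𝓞 K)) {σ : Type*} {f : MvPolynomial σ K}
    {b : MvPolynomial σ (𝓞 K)} (h : f ∣ intMap b) : red v f ∣ redMap v b := by
  obtain ⟨q, hq⟩ := h
  obtain ⟨c, hc⟩ := exists_redMap_eq v (Q := f * q) (a := 1) (Q' := b)
    (by rw [MvPolynomial.C_1, one_mul, hq])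
  rw [hc]
  exact (((red_mul_associated v f q).dvd_iff_dvd_right).2 (dvd_mul_right _ _)).mul_left _

theorem isHomogeneous_primLift (v : HeightOneSpectrum (𝓞 K)) {f : MvPolynomial (Fin (n + 1)) K}
    (hf : f.IsHomogeneous δ) : (primLift v f).IsHomogeneous δ := fun d hd => by
  refine hf fun h0 => hd ?_
  have h := congrArg (MvPolynomial.coeff d) (intMap_primLift v f)
  rw [MvPolynomial.coeff_C_mul, MvPolynomial.coeff_map, h0, mul_zero] at h
  exact (FaithfulSMul.algebraMap_eq_zero_iff _ _).1 h

/-- The special fibre at a place where the primitive reduction of `f` is squarefree is reduced. -/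
theorem isReduced_specialFibre {f : MvPolynomial (Fin (n + 1)) K} (hf : f.IsHomogeneous δ)
    (𝔭 : MaximalSpectrum (𝓞 K)) (hsq : Squarefree (red (toPlace 𝔭) f)) :
    AlgebraicGeometry.IsReduced (specialFibre (zariskiClosureStr f hf) 𝔭) := by
  have hg : toIntegralProjSpace f hf = Proj.map (toQuot (𝓞 K) f hf)
      (HomogeneousIdeal.irrelevant_le_map_comp (irrelevant_le_map_polyBaseChange n (𝓞 K) K)
        (irrelevant_le_map_quot (formIdeal f hf))) :=
    (Proj.map_comp _ _ _ _).symm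
  have hfib : specialFibre (zariskiClosureStr f hf) 𝔭
      = pullback ((toIntegralProjSpace f hf).imageι ≫ projSpaceStr n (𝓞 K))
        (Spec.map (CommRingCat.ofHom (Ideal.Quotient.mk 𝔭.asIdeal))) := rfl
  rw [hfib, hg]
  refine isReduced_fibre_closure 𝔭.asIdeal (toQuot (𝓞 K) f hf) _ fun i => ?_
  let := (Ideal.Quotient.mk (toPlace 𝔭).asIdeal).toAlgebra
  exact isRadical_ker_sup_map (k := ResV (toPlace 𝔭)) (f' := red (toPlace 𝔭) f) hf
    ((isHomogeneous_primLift (toPlace 𝔭) hf).map _) hsq Ideal.Quotient.mk_surjective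
    (fun r => Ideal.Quotient.eq_zero_iff_mem) (fun b hb => red_dvd_redMap (toPlace 𝔭) hb)
    (isHomogeneous_primLift (toPlace 𝔭) hf)
    ((Dvd.intro_left _ rfl).trans (intMap_primLift (toPlace 𝔭) f).symm.dvd) rfl
    (MvPolynomial.isHomogeneous_X (𝓞 K) i)

/-- A special fibre that is not reduced comes from a square factor of the primitive reduction. -/
theorem nonReducedPlaces_subset {f : MvPolynomial (Fin (n + 1)) K} (hf : f.IsHomogeneous δ) :
    nonReducedPlaces (zariskiClosureStr f hf) ⊆ squareFactorPlaces (formModule f) :=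
  fun 𝔭 h𝔭 => (mem_squareFactorPlaces 𝔭).2 fun hsq => h𝔭 (isReduced_specialFibre hf 𝔭 hsq)

end Reducedness

end ReducedHypersurface

end

theorem mainTheorem2 {K : Type*} [Field K] [NumberField K] (n δ : ℕ) (hn : 1 ≤ n) (hδ : 1 ≤ δ)
    (f : MvPolynomial (Fin (n + 1)) K) (hf0 : f ≠ 0) (hf : f.IsHomogeneous δ)
    (hX : AlgebraicGeometry.IsReduced (ReducedHypersurface.hypersurface f hf)) :
    (ReducedHypersurface.nonReducedPlaces
        (ReducedHypersurface.zariskiClosureStr f hf)).Finite ∧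
    (ReducedHypersurface.squareFactorPlaces (ReducedHypersurface.formModule f)).Finite ∧
    (∏ᶠ 𝔭 ∈ ReducedHypersurface.nonReducedPlaces (ReducedHypersurface.zariskiClosureStr f hf),
        ReducedHypersurface.placeNorm 𝔭) ≤
      (∏ᶠ 𝔭 ∈ ReducedHypersurface.squareFactorPlaces (ReducedHypersurface.formModule f),
        ReducedHypersurface.placeNorm 𝔭) ∧
    ((∏ᶠ 𝔭 ∈ ReducedHypersurface.squareFactorPlaces (ReducedHypersurface.formModule f),
        ReducedHypersurface.placeNorm 𝔭 : ℕ) : ℝ) ≤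
      ((δ + n).choose n : ℝ) ^ (((2 * δ - 1) * Module.finrank ℚ K : ℝ) / 2) *
        (δ : ℝ) ^ (Module.finrank ℚ K * δ) *
        ReducedHypersurface.expHeight f ^ (2 * δ - 1) := by
  have hsq := ReducedHypersurface.squarefree_of_isReduced_hypersurface hn hf0 hf hX
  have hfin := ReducedHypersurface.finite_squareFactorPlaces hδ hf0 hf hsq
  have hsub := ReducedHypersurface.nonReducedPlaces_subset hf
  have hfin' := hfin.subset hsub
  refine ⟨hfin', hfin, ?_, ReducedHypersurface.finprod_placeNorm_le hδ hf0 hf hsq⟩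
  rw [finprod_mem_eq_finite_toFinset_prod _ hfin, finprod_mem_eq_finite_toFinset_prod _ hfin']
  exact Finset.prod_le_prod_of_subset_of_one_le' (Set.Finite.toFinset_subset_toFinset.2 hsub)
    fun 𝔭 _ _ => (ReducedHypersurface.one_lt_placeNorm 𝔭).le
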